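/- Conventions. Everything is holomorphic; Greek indices run over $1,\dots,n$, $n\ge 1$, repeated indices are summed, and $\partial_\alpha=\partial/\partial v^\alpha$. **Frobenius manifold.** Let $M\subset\mathbb C^n$ be open with coordinates $v^1,\dots,v^n$, and let $F$ be holomorphic on $M$ such that $\partial_1\partial_\alpha\partial_\beta F=\eta_{\alpha\beta}$ is constant, symmetric and invertible ($\eta^{\alpha\beta}$ is the inverse matrix, and indices are raised and lowered by $\eta$), $c^\gamma_{\alpha\beta}=\eta^{\gamma\epsilon}\partial_\epsilon\partial_\alpha\partial_\beta F$ are the structure constants of associative algebras with product "$\cdot$" and unit $e=\partial_1$, and $E^\epsilon\partial_\epsilon F=(3-d)F+$ (polynomial of degree $\le 2$) for an affine vector field $E=E^\epsilon\partial_\epsilon$ with $[e,E]=e$. Assume that it is semisimple: for generic $v\in M$ the algebra $T_vM$ has no nilpotents. Put $\mathcal U=E\,\cdot$, $\mathcal V=\frac{2-d}{2}-\nabla E$, $g^{\alpha\beta}=E^\epsilon c_\epsilon^{\alpha\beta}$, $\Gamma^{\alpha\beta}_\gamma=c^{\alpha\epsilon}_\gamma(\tfrac12-\mathcal V)^\beta_\epsilon$.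 The dispersionless pencil of $M$ is $$\{v^\alpha(x),v^\beta(y)\}_1=\eta^{\alpha\beta}\delta'(x-y),\qquad \{v^\alpha(x),v^\beta(y)\}_2=g^{\alpha\beta}(v(x))\delta'(x-y)+\Gamma^{\alpha\beta}_\gamma(v(x))\,v^\gamma_x\,\delta(x-y).\tag{0}$$ Fix a calibration, i.e. write $\mathcal V=\mu+R_0$ with $\mu$ semisimple, $R_0$ nilpotent and choose matrices $R_k$ with $[\mu,R_k]=kR_k$, $R_k^*=(-1)^{k+1}R_k$ ($k\ge0$; $\mu^*=-\mu$; $^*$ is the $\eta$-adjoint) and holomorphic functions $(\Theta_p)^\alpha_\beta=\eta^{\alpha\epsilon}\partial_\epsilon\theta_{\beta,p}$ on $M$ with $\Theta_0=1$, $\partial_\gamma\Theta_{p+1}=c_\gamma\Theta_p$ (where $c_\gamma=(c^\alpha_{\gamma\beta})$), $(p+1)\Theta_{p+1}+[\Theta_{p+1},\mathcal V]=\mathcal U\Theta_p-\sum_{k=1}^{p+1}\Theta_{p+1-k}R_k$ and $\sum_{i+j=p}(-1)^i\Theta_i^*\Theta_j=0$ for $p>0$. The principal hierarchy is $\partial v^\gamma/\partial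 t^{\beta,p}=\partial_x(\Theta_{p+1})^\gamma_\beta$; its tau-cover has the additional dependent variables $f$, $f_{\alpha,p}$ with $\partial f/\partial t^{\alpha,p}=f_{\alpha,p}$, $\partial f_{\alpha,p}/\partial t^{\beta,q}=\Omega_{\alpha,p;\beta,q}(v)=\sum_{k=0}^q(-1)^k(\Theta_{p+1+k}^{T}\,\eta\,\Theta_{q-k})_{\alpha\beta}$, and $x=t^{1,0}$. **Pencil.** A $(0,n)$ Poisson pencil is a pair of brackets $$\{w^i(x),w^j(y)\}_{1,2}=\sum_{k\ge0}\epsilon^k\sum_{s=0}^{k+1}A^{ij}_{k,s;1,2}(w;w_x,\dots)\,\delta^{(k+1-s)}(x-y)$$ all of whose linear combinations are Poisson brackets, with $A_{k,s}$ differential polynomials of degree $s$ ($\deg w^{(r)}=r$) with coefficients holomorphic on $M$. A tau-structure (compatible with spatial translations) is a system of densities $h_{i,p}=\sum_k\epsilon^kh_{i,p}^{[k]}$, $p\ge-1$, with $h_{i,p}^{[k]}$ differential polynomials of degree $k$, of the form $h_{i,p}=\sum_{q=-1}^p a_{ij,pq}f^j_q+$ (total derivative), $\det(a_{ij,pp})\ne0$,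 where $\int f^j_{-1}dx$ are independent Casimirs of $\{\,,\}_1$ and $\{\cdot,\int f^j_{q+1}dx\}_1=\{\cdot,\int f^j_qdx\}_2$, such that for the flows $\partial/\partial t^{i,p}=\{\cdot,\int h_{i,p}dx\}_1$ one has $\partial h_{i,p-1}/\partial t^{j,q}=\partial h_{j,q-1}/\partial t^{i,p}$ and $\partial/\partial t^{1,0}=\partial_x$. The functions $h_{\alpha,-1}$ are the normal coordinates. Consider a tau-symmetric $(0,n)$ Poisson pencil, written in normal coordinates $w_\alpha=\eta_{\alpha\beta}w^\beta=h_{\alpha,-1}$, with leading term (0). **Quasitriviality.** Assume that, near a jet $j_0$ over a point of $M$, the pencil is obtained from (0) by a quasi-Miura transformation $w^\gamma=v^\gamma+\sum_{k\ge1}\epsilon^kW_k^\gamma(v;v_x,\dots)$, where $W_k^\gamma$ is regular at $j_0$ and rational in the derivatives, homogeneous of degree $k$. **Linearization axiom.** Assume that $W_{k}^{\gamma}=\eta^{\gamma\alpha}\partial_x\partial_{t^{\alpha,0}}\mathcal F^{[k]}$ with functions $\mathcal F^{[k]}$ analytic in finitely many jet variables near $j_0$, and that the Virasoro symmetries are linearized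 in the following sense. For $m\ge-1$ let $$\frac{\partial f}{\partial s_m}=\sum a_m^{\alpha,k;\gamma,l}f_{\alpha,k}f_{\gamma,l}+\sum b_{m;\gamma,l}^{\alpha,k}\,t^{\gamma,l}f_{\alpha,k}+\sum c^m_{\beta,k;\gamma,l}\,t^{\beta,k}t^{\gamma,l},\qquad \frac{\partial v_\gamma}{\partial s_m}=\partial_x\partial_{t^{\gamma,0}}\frac{\partial f}{\partial s_m}$$ be the Virasoro symmetries of the tau-cover of the principal hierarchy. Here, if $N_m(q,r)$ denotes the part of $\sum_{i\ge0}\frac1{i!}R^i\,P_{m,q}^{(i)}(\mu)$, $P_{m,q}(y)=\prod_{j=0}^{m}(y-q+j)$, $R=\sum_kR_k$, consisting of the products of matrices $R_{k}$ of total degree $r$ (and $N_m(q,r)=0$ for $r<0$), $$a_m^{\alpha,k;\gamma,l}=\tfrac{(-1)^{l+1}}2\big(N_m(l+\tfrac12,m-k-l-1)\eta^{-1}\big)^{\alpha\gamma},\quad b_{m;\gamma,l}^{\alpha,k}=N_m(-l-\tfrac12,m+l-k)^\alpha_\gamma,\quad c^m_{\beta,k;\gamma,l}=\tfrac{(-1)^k}2\big(\eta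 N_m(-l-\tfrac12,m+k+l+1)\big)_{\beta\gamma}.$$ Put $\log\tau=\epsilon^{-2}f+\sum_{k\ge1}\epsilon^{k-2}\mathcal F^{[k]}$ and $\frac{\partial\log\tau}{\partial\hat s_m}=\epsilon^{-2}\frac{\partial f}{\partial s_m}+\sum_{k\ge1}\epsilon^{k-2}\sum_r\frac{\partial\mathcal F^{[k]}}{\partial v^{\alpha,r}}\partial_x^r\frac{\partial v^\alpha}{\partial s_m}$. The axiom requires linear differential operators $\hat L_m=\hat L_m(\epsilon^{-1}\mathbf t,\epsilon\,\partial/\partial\mathbf t)$, $m\ge-1$, of finite order and with coefficients polynomial in $\epsilon^{-1}\mathbf t$, such that $\partial\tau/\partial\hat s_m=\hat L_m\tau$ identically on the tau-cover. **Conclusion.** Under these assumptions there are functions $\mathcal F_g=\mathcal F_g(v;v_x,\dots,v^{(3g-2)})$, $g\ge1$, analytic near $j_0$, such that, with $\Delta\mathcal F=\sum_{g\ge1}\epsilon^{2g-2}\mathcal F_g$, the quasitriviality is $$w_\alpha=v_\alpha+\epsilon^2\,\partial_x\partial_{t^{\alpha,0}}\Delta\mathcal F(v;v_x,v_{xx},\dots;\epsilon^2),\qquad\alpha=1,\dots,n,$$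 so the pencil is obtained from (0) by this transformation. Let $\lambda_0$ not be an eigenvalue of $\mathcal U$ at the base point $v_0$ of $j_0$, and let $p_\alpha(v;\lambda)$ be any basis of independent periods near $(v_0,\lambda_0)$, i.e. $(g^{\beta\epsilon}-\lambda\eta^{\beta\epsilon})\partial_\epsilon\partial_\gamma p_\alpha+\Gamma^{\beta\epsilon}_\gamma\partial_\epsilon p_\alpha=0$, $\partial_\lambda p_\alpha=-\partial_1p_\alpha$, $\det(\partial_\sigma p_\alpha)\ne0$, with constant Gram matrix $(G^{\alpha\beta})=\big(\partial_\sigma p_\alpha(g^{\sigma\epsilon}-\lambda\eta^{\sigma\epsilon})\partial_\epsilon p_\beta\big)^{-1}$. Then $\Delta\mathcal F$ satisfies, near $(j_0,\lambda_0)$ and in every order in $\epsilon$, the loop equation $$\sum_{r\ge0}\frac{\partial\Delta\mathcal F}{\partial v^{\gamma,r}}\partial_x^r\Big(\frac1{E-\lambda}\Big)^\gamma+\sum_{r\ge1}\frac{\partial\Delta\mathcal F}{\partial v^{\gamma,r}}\sum_{k=1}^r\binom rk\partial_x^{k-1}\partial_1p_\alpha\,G^{\alpha\beta}\,\partial_x^{r-k+1}\partial^\gamma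 p_\beta$$ $$=-\tfrac1{16}\operatorname{tr}(\mathcal U-\lambda)^{-2}+\tfrac14\operatorname{tr}\big[(\mathcal U-\lambda)^{-1}\mathcal V\big]^2$$ $$+\frac{\epsilon^2}2\sum\Big(\frac{\partial^2\Delta\mathcal F}{\partial v^{\gamma,k}\partial v^{\rho,l}}+\frac{\partial\Delta\mathcal F}{\partial v^{\gamma,k}}\frac{\partial\Delta\mathcal F}{\partial v^{\rho,l}}\Big)\partial_x^{k+1}\partial^\gamma p_\alpha\,G^{\alpha\beta}\,\partial_x^{l+1}\partial^\rho p_\beta+\frac{\epsilon^2}2\sum\frac{\partial\Delta\mathcal F}{\partial v^{\gamma,k}}\partial_x^{k+1}\Big[\nabla\frac{\partial p_\alpha}{\partial\lambda}\cdot\nabla\frac{\partial p_\beta}{\partial\lambda}\cdot v_x\Big]^\gamma G^{\alpha\beta},$$ where $v^{\gamma,r}=\partial_x^rv^\gamma$, $\partial^\gamma=\eta^{\gamma\epsilon}\partial_\epsilon$ and $\frac1{E-\lambda}=(\mathcal U-\lambda)^{-1}e$. Moreover $\Delta\mathcal F$ is uniquely determined by this equation: any other family $(\mathcal F'_g)_{g\ge1}$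 of functions, each analytic in finitely many jet variables near $j_0$, for which $\sum_g\epsilon^{2g-2}\mathcal F'_g$ satisfies it differs from $(\mathcal F_g)$ only by additive constants. -/

import Mathlib

open Filter Topology

noncomputable section

namespace LoopEq

/-! ### Frobenius manifolds in flat coordinates -/

/-- The partial derivative `∂f/∂v^α` of a function on (an open subset of) `ℂⁿ`. -/
def pd {n : ℕ} (α : Fin n) (f : (Fin n → ℂ) → ℂ) (v : Fin n → ℂ) : ℂ :=
  fderiv ℂ f v (Pi.single α 1)

/-- A Frobenius manifold of dimension `n ≥ 1`, given on a domain `M` of its flat coordinates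
`v^0, …, v^(n-1)` by a holomorphic potential `F`. The unit field is `e = ∂/∂v^0`, the flat metric
is the constant matrix `η`, and the Euler field is `E^α = ∑ Q^α_β v^β + r^α`. -/
structure FrobeniusManifold (n : ℕ) [NeZero n] where
  M : Set (Fin n → ℂ)
  F : (Fin n → ℂ) → ℂ
  η : Matrix (Fin n) (Fin n) ℂ
  Q : Matrix (Fin n) (Fin n) ℂ
  r : Fin n → ℂ
  d : ℂ
  isOpen : IsOpen M
  analytic : AnalyticOnNhd ℂ F M
  symm : η.IsSymm
  nondeg : IsUnit η.det
  unit : ∀ v ∈ M, ∀ α β, pd 0 (pd α (pd β F)) v = η α β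
  assoc : ∀ v ∈ M, ∀ α β γ δ,
    ∑ ε, ∑ ζ, pd α (pd β (pd ε F)) v * η⁻¹ ε ζ * pd ζ (pd γ (pd δ F)) v =
      ∑ ε, ∑ ζ, pd δ (pd β (pd ε F)) v * η⁻¹ ε ζ * pd ζ (pd γ (pd α F)) v
  euler_unit : ∀ α, Q α 0 = if α = 0 then 1 else 0
  euler : ∃ (a : Matrix (Fin n) (Fin n) ℂ) (b : Fin n → ℂ) (c : ℂ), ∀ v ∈ M,
    ∑ α, (∑ β, Q α β * v β + r α) * pd α F v =
      (3 - d) * F v + ((∑ α, ∑ β, a α β * v α * v β) + (∑ α, b α * v α) + c)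

namespace FrobeniusManifold

variable {n : ℕ} [NeZero n] (X : FrobeniusManifold n)

/-- The Euler vector field. -/
def E (v : Fin n → ℂ) (α : Fin n) : ℂ := ∑ β, X.Q α β * v β + X.r α

/-- The matrix `(C_γ)^α_β = c^α_{γβ}` of multiplication by `∂/∂v^γ`. -/
def C (γ : Fin n) (v : Fin n → ℂ) : Matrix (Fin n) (Fin n) ℂ :=
  fun α β => ∑ ε, X.η⁻¹ α ε * pd ε (pd γ (pd β X.F)) v

/-- The matrix of multiplication by the tangent vector `x`. -/
def mulBy (x : Fin n → ℂ) (v : Fin n → ℂ) : Matrix (Fin n) (Fin n) ℂ := ∑ γ, x γ • X.C γ v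

/-- `𝒰`, the multiplication by the Euler vector field. -/
def U (v : Fin n → ℂ) : Matrix (Fin n) (Fin n) ℂ := X.mulBy (X.E v) v

/-- `𝒱 = (2 - d)/2 - ∇E`. -/
def V : Matrix (Fin n) (Fin n) ℂ := ((2 - X.d) / 2) • 1 - X.Q

/-- The intersection form `g^{αβ} = E^ε c_ε^{αβ}`. -/
def g (v : Fin n → ℂ) : Matrix (Fin n) (Fin n) ℂ := X.U v * X.η⁻¹

/-- The contravariant Christoffel coefficients `Γ^{αβ}_γ = c^{αε}_γ (1/2 - 𝒱)^β_ε`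
of the intersection form. -/
def Γ (γ : Fin n) (v : Fin n → ℂ) : Matrix (Fin n) (Fin n) ℂ :=
  X.C γ v * X.η⁻¹ * ((1 / 2 : ℂ) • (1 : Matrix (Fin n) (Fin n) ℂ) - X.V).transpose

/-- Raising an index with `η`. -/
def raise (x : Fin n → ℂ) (γ : Fin n) : ℂ := ∑ ε, X.η⁻¹ γ ε * x ε

/-- The adjoint of an operator with respect to `η`. -/
def adj (A : Matrix (Fin n) (Fin n) ℂ) : Matrix (Fin n) (Fin n) ℂ :=
  X.η⁻¹ * A.transpose * X.η

/-- The algebra on the tangent space at `v` is semisimple: it has no nilpotent elements. -/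
def SemisimpleAt (v : Fin n → ℂ) : Prop :=
  ∀ x : Fin n → ℂ, IsNilpotent (X.mulBy x v) → x = 0

/-- The Frobenius manifold is semisimple: the algebra is semisimple at generic points. -/
def Semisimple : Prop := X.M ⊆ closure {v | v ∈ X.M ∧ X.SemisimpleAt v}

end FrobeniusManifold

/-- A calibration: the spectrum `(μ, R)` of the Frobenius manifold together with the coefficients
`Θ_p`, `(Θ_p)^α_β = ∇^α θ_{β,p}`, of a Levelt system of deformed flat coordinates
`(∑ θ_p z^p) z^μ z^R`, where `R = R_0 + R_1 + …`, and `μ`, `R_0` are the semisimple and the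
nilpotent part of `𝒱`. -/
structure Calibration {n : ℕ} [NeZero n] (X : FrobeniusManifold n) where
  μ : Matrix (Fin n) (Fin n) ℂ
  R : ℕ → Matrix (Fin n) (Fin n) ℂ
  Θ : ℕ → (Fin n → ℂ) → Matrix (Fin n) (Fin n) ℂ
  semisimple : Module.End.IsSemisimple (Matrix.toLin' μ)
  nilpotent : IsNilpotent (R 0)
  splitting : X.V = μ + R 0
  grading : ∀ k : ℕ, μ * R k - R k * μ = (k : ℂ) • R k
  adj_μ : X.adj μ = -μ
  adj_R : ∀ k : ℕ, X.adj (R k) = (-1 : ℂ) ^ (k + 1) • R k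
  analytic : ∀ p α β, AnalyticOnNhd ℂ (fun v => Θ p v α β) X.M
  zero : ∀ v ∈ X.M, Θ 0 v = 1
  flat : ∀ v ∈ X.M, ∀ p γ α β,
    pd γ (fun u => Θ (p + 1) u α β) v = (X.C γ v * Θ p v) α β
  homogeneous : ∀ v ∈ X.M, ∀ p : ℕ,
    ((p : ℂ) + 1) • Θ (p + 1) v + (Θ (p + 1) v * X.V - X.V * Θ (p + 1) v) =
      X.U v * Θ p v - ∑ k ∈ Finset.range (p + 1), Θ (p - k) v * R (k + 1)
  orthogonal : ∀ v ∈ X.M, ∀ p : ℕ, 0 < p →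
    ∑ i ∈ Finset.range (p + 1), (-1 : ℂ) ^ i • (X.adj (Θ i v) * Θ (p - i) v) = 0

/-! ### Calculus on the jet space -/

/-- A jet: `j r γ` is the coordinate `v^{γ,r} = ∂_x^r v^γ`. -/
abbrev Jet (n : ℕ) : Type := ℕ → Fin n → ℂ

/-- The index set of the times `t^{α,p}`. -/
abbrev Time (n : ℕ) : Type := Fin n × ℕ

section Jets

variable {n : ℕ}

/-- The partial derivative `∂Φ/∂v^{γ,r}`. -/
def jd (γ : Fin n) (r : ℕ) (Φ : Jet n → ℂ) (j : Jet n) : ℂ :=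
  deriv (fun z => Φ (Function.update j r (Function.update (j r) γ z))) (j r γ)

/-- The total `x`-derivative. -/
def Dx (Φ : Jet n → ℂ) (j : Jet n) : ℂ :=
  ∑ᶠ r : ℕ, ∑ γ, jd γ r Φ j * j (r + 1) γ

/-- The derivative along the evolutionary vector field `∂v^γ/∂t = a^γ`. -/
def evD (a : Fin n → Jet n → ℂ) (Φ : Jet n → ℂ) (j : Jet n) : ℂ :=
  ∑ᶠ r : ℕ, ∑ γ, jd γ r Φ j * Dx^[r] (a γ) j

/-- The variational derivative `δ/δv^γ` of the functional with density `Φ`. -/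
def varD (γ : Fin n) (Φ : Jet n → ℂ) (j : Jet n) : ℂ :=
  ∑ᶠ r : ℕ, (-1 : ℂ) ^ r * Dx^[r] (jd γ r Φ) j

/-- Near `j₀` the function `Φ` is an analytic function of `v, v_x, …, v^{(N)}`. -/
def JetAnalyticAt (N : ℕ) (Φ : Jet n → ℂ) (j₀ : Jet n) : Prop :=
  ∃ G : (Fin (N + 1) → Fin n → ℂ) → ℂ, AnalyticAt ℂ G (fun i => j₀ i) ∧
    ∀ᶠ j in 𝓝 j₀, Φ j = G (fun i => j i)

/-- On the jets over `M`, the function `Φ` is a differential polynomial of degree `w`: a polynomial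
in the `v^{γ,s+1}` (the variable with index `(γ, s)`, of degree `s + 1`), whose coefficients are
analytic functions of `v ∈ M`. -/
def IsDiffPoly (M : Set (Fin n → ℂ)) (w : ℕ) (Φ : Jet n → ℂ) : Prop :=
  ∃ P : MvPolynomial (Fin n × ℕ) ((Fin n → ℂ) → ℂ),
    (∀ m, AnalyticOnNhd ℂ (P.coeff m) M) ∧
    P.IsWeightedHomogeneous (fun x : Fin n × ℕ => x.2 + 1) w ∧
    ∀ j : Jet n, j 0 ∈ M →
      Φ j = P.eval₂ (Pi.evalRingHom (fun _ : Fin n → ℂ => ℂ) (j 0)) (fun x => j (x.2 + 1) x.1)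

/-- Near `j₀`, the function `Φ` is a rational function of the derivatives, homogeneous of
degree `k`. -/
def IsRationalAt (M : Set (Fin n → ℂ)) (k : ℕ) (Φ : Jet n → ℂ) (j₀ : Jet n) : Prop :=
  ∃ (a : ℕ) (P Q : Jet n → ℂ), IsDiffPoly M (a + k) P ∧ IsDiffPoly M a Q ∧ Q j₀ ≠ 0 ∧
    ∀ᶠ j in 𝓝 j₀, Q j * Φ j = P j

/-! ### Poisson pencils on the loop space -/

/-- A bracket `{w^i(x), w^l(y)} = ∑_k ε^k ∑_{s ≤ k+1} A_{k,s}^{il} δ^{(k+1-s)}(x - y)`; the value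
`A k s i l` is the function `A_{k,s}^{il}` (irrelevant when `s > k + 1`). -/
abbrev Bracket (n : ℕ) : Type := ℕ → ℕ → Fin n → Fin n → Jet n → ℂ

/-- The differential operator that is the `ε^k`-coefficient of the bracket. -/
def op (A : Bracket n) (k : ℕ) (i l : Fin n) (f : Jet n → ℂ) (j : Jet n) : ℂ :=
  ∑ s ∈ Finset.range (k + 2), A k s i l j * Dx^[k + 1 - s] f j

/-- The `ε^k`-coefficient of the density of the bracket of two local functionals. -/
def brk (A : Bracket n) (k : ℕ) (f h : Jet n → ℂ) (j : Jet n) : ℂ :=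
  ∑ i, ∑ l, varD i f j * op A k i l (varD l h) j

/-- The `ε^k`-coefficient of the Hamiltonian vector field `{w^i, H}` of the functional `H` with
density `∑_k ε^k f_k`. -/
def hamFlow (A : Bracket n) (f : ℕ → Jet n → ℂ) (k : ℕ) (i : Fin n) (j : Jet n) : ℂ :=
  ∑ ab ∈ Finset.HasAntidiagonal.antidiagonal k, ∑ l, op A ab.1 i l (varD l (f ab.2)) j

/-- The bracket of local functionals (densities modulo total derivatives, i.e. modulo densities
with vanishing variational derivatives) is skew symmetric and satisfies the Jacobi identity. -/
def IsPoisson (M : Set (Fin n → ℂ)) (A : Bracket n) : Prop :=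
  (∀ f h : Jet n → ℂ, (∃ w, IsDiffPoly M w f) → (∃ w, IsDiffPoly M w h) →
    ∀ (k : ℕ) (γ : Fin n) (j : Jet n), j 0 ∈ M →
      varD γ (fun j' => brk A k f h j' + brk A k h f j') j = 0) ∧
  (∀ f h q : Jet n → ℂ, (∃ w, IsDiffPoly M w f) → (∃ w, IsDiffPoly M w h) →
    (∃ w, IsDiffPoly M w q) → ∀ (k : ℕ) (γ : Fin n) (j : Jet n), j 0 ∈ M →
      varD γ (fun j' => ∑ ab ∈ Finset.HasAntidiagonal.antidiagonal k,
        (brk A ab.1 (brk A ab.2 f h) q j' + brk A ab.1 (brk A ab.2 h q) f j' +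
          brk A ab.1 (brk A ab.2 q f) h j')) j = 0)

/-- A `(0,n)` Poisson pencil over `M`. -/
structure IsPoissonPencil (M : Set (Fin n → ℂ)) (A₁ A₂ : Bracket n) : Prop where
  poly₁ : ∀ k s i l, s ≤ k + 1 → IsDiffPoly M s (A₁ k s i l)
  poly₂ : ∀ k s i l, s ≤ k + 1 → IsDiffPoly M s (A₂ k s i l)
  poisson : ∀ a₁ a₂ : ℂ, IsPoisson M (a₁ • A₁ + a₂ • A₂)

end Jets

section Pencil

variable {n : ℕ} [NeZero n] (X : FrobeniusManifold n)

/-- The first bracket `η^{αβ} δ'(x - y)` of the dispersionless pencil. -/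
def bracket₁ : Bracket n := fun k s i l _ =>
  if k = 0 ∧ s = 0 then X.η⁻¹ i l else 0

/-- The second bracket `g^{αβ}(v) δ'(x - y) + Γ^{αβ}_γ(v) v_x^γ δ(x - y)` of the dispersionless
pencil. -/
def bracket₂ : Bracket n := fun k s i l j =>
  if k = 0 ∧ s = 0 then X.g (j 0) i l
  else if k = 0 ∧ s = 1 then ∑ γ, X.Γ γ (j 0) i l * j 1 γ
  else 0

/-- The leading term of the pencil is the dispersionless pencil of the Frobenius manifold. -/
def HasLeadingTerm (A₁ A₂ : Bracket n) : Prop :=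
  ∀ s ≤ 1, ∀ i l, ∀ j : Jet n, j 0 ∈ X.M →
    A₁ 0 s i l j = bracket₁ X 0 s i l j ∧ A₂ 0 s i l j = bracket₂ X 0 s i l j

/-- `h i P = ∑_k ε^k h i P k` are the densities `h_{i,P-1}` of a tau-structure of the pencil,
compatible with spatial translations. The densities `f i P` stand for `f^i_{P-1}`: the `f^i_{-1}`
are independent Casimirs of the first bracket, and the further ones are obtained by the
bihamiltonian recursion. -/
structure IsTauStructure (A₁ A₂ : Bracket n) (h : Fin n → ℕ → ℕ → Jet n → ℂ) : Prop where
  densities : ∃ (f q : Fin n → ℕ → ℕ → Jet n → ℂ) (a : ℕ → ℕ → Matrix (Fin n) (Fin n) ℂ),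
    (∀ i P k, IsDiffPoly X.M k (f i P k)) ∧
    (∀ i P k, IsDiffPoly X.M k (q i P k)) ∧
    (∀ P, (a P P).det ≠ 0) ∧
    (∀ j : Jet n, j 0 ∈ X.M →
      (Matrix.of fun i l => jd l 0 (f i 0 0) j).det ≠ 0 ∧
      (∀ i k α, hamFlow A₁ (f i 0) k α j = 0) ∧
      (∀ i P k α, hamFlow A₁ (f i (P + 1)) k α j = hamFlow A₂ (f i P) k α j) ∧
      (∀ i P, h i P 0 j = ∑ S ∈ Finset.range (P + 1), ∑ l, a P S i l * f l S 0 j) ∧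
      (∀ i P k, h i P (k + 1) j =
        ∑ S ∈ Finset.range (P + 1), ∑ l, a P S i l * f l S (k + 1) j + Dx (q i P k) j))
  closed : ∀ i p l s k, ∀ j : Jet n, j 0 ∈ X.M →
    ∑ ab ∈ Finset.HasAntidiagonal.antidiagonal k, evD (hamFlow A₁ (h l (s + 1)) ab.1) (h i p ab.2) j =
      ∑ ab ∈ Finset.HasAntidiagonal.antidiagonal k, evD (hamFlow A₁ (h i (p + 1)) ab.1) (h l s ab.2) j
  translation : ∀ k α, ∀ j : Jet n, j 0 ∈ X.M →
    hamFlow A₁ (h 0 1) k α j = if k = 0 then j 1 α else 0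

/-- The dependent variables, with indices lowered by `η`, are the normal coordinates of the
tau-structure. -/
def IsNormal (h : Fin n → ℕ → ℕ → Jet n → ℂ) : Prop :=
  ∀ i k, ∀ j : Jet n, j 0 ∈ X.M → h i 0 k j = if k = 0 then ∑ l, X.η i l * j 0 l else 0

variable {X}

/-- A quasi-Miura transformation `w^γ = v^γ + ∑_{k ≥ 1} ε^k W_k^γ` near the jet `j₀`. -/
structure IsQuasiMiura (M : Set (Fin n → ℂ)) (W : ℕ → Fin n → Jet n → ℂ) (j₀ : Jet n) : Prop where
  zero : ∀ γ, ∀ᶠ j in 𝓝 j₀, W 0 γ j = j 0 γ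
  rational : ∀ k γ, 0 < k → IsRationalAt M k (W k γ) j₀

/-- The `ε^b`-coefficient of `Φ(w; w_x, …)`, where `w = ∑ ε^k W_k`, as a function of the jet of
`v`. -/
def compCoeff (W : ℕ → Fin n → Jet n → ℂ) (Φ : Jet n → ℂ) (b : ℕ) (j : Jet n) : ℂ :=
  iteratedDeriv b
    (fun ε : ℂ => Φ fun r γ => ∑ k ∈ Finset.range (b + 1), ε ^ k * Dx^[r] (W k γ) j) 0 /
    (Nat.factorial b : ℂ)

/-- The series `w = ∑ ε^k W_k` transforms the bracket `B` (without `ε`-corrections) into `A`: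
`∑ (∂w^i/∂v^{k,s}) ∂_x^s ∘ B^{kl} ∘ (-∂_x)^t ∘ (∂w^{i'}/∂v^{l,t})` is the operator of `A`, with
coefficients evaluated on `w`; the operators are compared, in each order in `ε`, by their action on
functions `f` on the jet space. -/
def Transforms (W : ℕ → Fin n → Jet n → ℂ) (B A : Bracket n) (j₀ : Jet n) : Prop :=
  ∀ (m : ℕ) (i i' : Fin n) (N : ℕ) (f : Jet n → ℂ), JetAnalyticAt N f j₀ → ∀ᶠ j in 𝓝 j₀,
    ∑ ab ∈ Finset.HasAntidiagonal.antidiagonal m, ∑ᶠ s : ℕ, ∑ k, ∑ l, jd k s (W ab.1 i) j *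
        Dx^[s] (op B 0 k l (fun y => ∑ᶠ t : ℕ,
          (-1 : ℂ) ^ t * Dx^[t] (fun z => jd l t (W ab.2 i') z * f z) y)) j =
      ∑ ab ∈ Finset.HasAntidiagonal.antidiagonal m, ∑ s ∈ Finset.range (ab.1 + 2),
        compCoeff W (A ab.1 s i i') ab.2 j * Dx^[ab.1 + 1 - s] f j

end Pencil

/-! ### The principal hierarchy, its tau-cover and the Virasoro symmetries -/

namespace Calibration

variable {n : ℕ} [NeZero n] {X : FrobeniusManifold n} (c : Calibration X)

/-- The functions `Ω_{α,p;β,q}(v)`. -/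
def Ω (a b : Time n) (v : Fin n → ℂ) : ℂ :=
  ∑ k ∈ Finset.range (b.2 + 1),
    (-1 : ℂ) ^ k * ((c.Θ (a.2 + 1 + k) v).transpose * X.η * c.Θ (b.2 - k) v) a.1 b.1

/-- The principal hierarchy `∂v^γ/∂t^{β,p} = ∂_x ∇^γ θ_{β,p+1}`. -/
def flow (a : Time n) (γ : Fin n) : Jet n → ℂ := Dx fun j => c.Θ (a.2 + 1) (j 0) γ a.1

/-- The derivative `∂/∂t^{β,p}` of functions on the jet space. -/
def Dt (a : Time n) (Φ : Jet n → ℂ) : Jet n → ℂ := evD (c.flow a) Φ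

/-- The series `v^γ + ε² ∂_x ∂_{t_{γ,0}} ∑ ε^{2g-2} F_g`, with `∂_{t_{γ,0}} = η^{γβ} ∂_{t^{β,0}}`. -/
def genusExpansion (F : ℕ → Jet n → ℂ) (k : ℕ) (γ : Fin n) (j : Jet n) : ℂ :=
  if k = 0 then j 0 γ
  else if Even k then X.raise (fun β => Dx (c.Dt (β, 0) (F (k / 2))) j) γ
  else 0

/-- The derivative `∂/∂t^a` of functions `G(t, φ, j)` on the tau-cover of the principal hierarchy,
on which `t` are the times and `φ_b = ∂f/∂t^b`: it acts by `∂φ_b/∂t^a = Ω_{ab}(v)` and by the flow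
of the hierarchy. The variable `x` is identified with `t^{0,0}`. -/
def coverD (a : Time n) (G : (Time n →₀ ℂ) → (Time n → ℂ) → Jet n → ℂ)
    (t : Time n →₀ ℂ) (φ : Time n → ℂ) (j : Jet n) : ℂ :=
  deriv (fun z => G (t + Finsupp.single a z) φ j) 0 +
    (∑ᶠ b : Time n, deriv (fun z => G t (Function.update φ b z) j) (φ b) * c.Ω a b (j 0)) +
    c.Dt a (G t φ) j

/-- The degree-`r` part, with respect to `ad μ`, of
`(exp (R ∂_y) ∏_{i < m'} (y - q + i))` at `y = μ`, powers of `R` standing to the left. -/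
def virN (m' : ℕ) (q : ℂ) (r : ℕ) : Matrix (Fin n) (Fin n) ℂ :=
  ∑ i ∈ Finset.range (m' + 1),
    PowerSeries.coeff r ((PowerSeries.mk c.R) ^ i) *
      Polynomial.aeval c.μ (Polynomial.hasseDeriv i
        (∏ l ∈ Finset.range m', (Polynomial.X - Polynomial.C q + Polynomial.C (l : ℂ))))

/-- The coefficients of the Virasoro operator
`L_m = ∑ ε² a^{ab} ∂_a ∂_b + ∑ b^a_b t^b ∂_a + ∑ ε⁻² c_{ab} t^a t^b`, `m = m' - 1 ≥ -1`,
without its additive constant. -/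
def virA (m' : ℕ) (a b : Time n) : ℂ :=
  if a.2 + b.2 + 2 ≤ m' then
    (1 / 2) * (-1) ^ (b.2 + 1) *
      (c.virN m' ((b.2 : ℂ) + 1 / 2) (m' - 2 - a.2 - b.2) * X.η⁻¹) a.1 b.1
  else 0

/-- The coefficient of `t^b ∂_a`. -/
def virB (m' : ℕ) (a b : Time n) : ℂ :=
  if a.2 + 1 ≤ b.2 + m' then
    c.virN m' (-(b.2 : ℂ) - 1 / 2) (b.2 + m' - 1 - a.2) a.1 b.1
  else 0

/-- The coefficient of `t^a t^b`. -/
def virC (m' : ℕ) (a b : Time n) : ℂ :=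
  (1 / 2) * (-1) ^ a.2 * (X.η * c.virN m' (-(b.2 : ℂ) - 1 / 2) (m' + a.2 + b.2)) a.1 b.1

/-- The Virasoro symmetry `∂f/∂s_m`, `m = m' - 1`, of the tau-cover of the principal hierarchy. -/
def virF (m' : ℕ) (t : Time n →₀ ℂ) (φ : Time n → ℂ) (_j : Jet n) : ℂ :=
  (∑ k ∈ Finset.range m', ∑ l ∈ Finset.range m', ∑ α, ∑ β,
      c.virA m' (α, k) (β, l) * φ (α, k) * φ (β, l)) +
    (t.sum fun b tb => ∑ k ∈ Finset.range (b.2 + m'), ∑ α,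
      c.virB m' (α, k) b * tb * φ (α, k)) +
    (t.sum fun a ta => t.sum fun b tb => c.virC m' a b * ta * tb)

/-- The Virasoro symmetry `∂v^γ/∂s_m = η^{γβ} ∂_x ∂_{t^{β,0}} (∂f/∂s_m)`. -/
def virV (m' : ℕ) (γ : Fin n) (t : Time n →₀ ℂ) (φ : Time n → ℂ) (j : Jet n) : ℂ :=
  X.raise (fun β => c.coverD (0, 0) (c.coverD (β, 0) (c.virF m')) t φ j) γ

/-- For `τ = exp (ε⁻² f + ∑_{k ≥ 1} ε^{k-2} F_k)`, the `ε^k`-coefficient of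
`ε^{2|J|} τ⁻¹ ∂_J τ` on the tau-cover. -/
def tauMon (F : ℕ → Jet n → ℂ) :
    List (Time n) → ℕ → (Time n →₀ ℂ) → (Time n → ℂ) → Jet n → ℂ
  | [], k => fun _ _ _ => if k = 0 then 1 else 0
  | a :: J, k => fun t φ j =>
      (if 2 ≤ k then c.coverD a (tauMon F J (k - 2)) t φ j else 0) +
        φ a * tauMon F J k t φ j +
        ∑ i ∈ Finset.Icc 1 k, c.Dt a (F i) j * tauMon F J (k - i) t φ j

/-- The `ε^e`-coefficient of `∂ log τ/∂ŝ_m`, the image of the Virasoro symmetry under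
`log τ = ε⁻² f + ∑_{k ≥ 1} ε^{k-2} F_k`. -/
def virTau (F : ℕ → Jet n → ℂ) (m' : ℕ) (e : ℤ)
    (t : Time n →₀ ℂ) (φ : Time n → ℂ) (j : Jet n) : ℂ :=
  if e = -2 then c.virF m' t φ j
  else if -1 ≤ e then
    ∑ᶠ r : ℕ, ∑ γ, jd γ r (F (e + 2).toNat) j * (c.coverD (0, 0))^[r] (c.virV m' γ) t φ j
  else 0

/-- There are linear differential operators
`L̂_m = ∑ ℓ_{I,J} (ε⁻¹ t)^I (ε ∂_t)^J`, `m = m' - 1 ≥ -1`, with coefficients polynomial in `ε⁻¹ t`,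
such that `∂τ/∂ŝ_m = L̂_m τ` on the tau-cover (over a neighbourhood of `j₀`, depending on the order
in `ε`). -/
def LinearizesVirasoro (F : ℕ → Jet n → ℂ) (j₀ : Jet n) : Prop :=
  ∀ m' : ℕ, ∃ ℓ : (Time n →₀ ℕ) → List (Time n) → ℂ,
    (∃ N : ℕ, ∀ I J, ℓ I J ≠ 0 → (I.sum fun _ p => p) + J.length ≤ N) ∧
    (∀ I, {J | ℓ I J ≠ 0}.Finite) ∧
    ∀ e : ℤ, ∀ᶠ j in 𝓝 j₀, ∀ (t : Time n →₀ ℂ) (φ : Time n → ℂ),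
      ∑ᶠ x : (Time n →₀ ℕ) × List (Time n),
          ℓ x.1 x.2 * (x.1.prod fun a p => t a ^ p) *
            (if 0 ≤ e + (x.1.sum fun _ p => p : ℕ) + x.2.length then
              c.tauMon F x.2 (e + (x.1.sum fun _ p => p : ℕ) + x.2.length).toNat t φ j
            else 0) =
        c.virTau F m' e t φ j

/-- The axiom of linearization of the Virasoro symmetries for the quasitriviality `W`: it has the
form `w_α = v_α + ∂_x ∂_{t^{α,0}} ∑_{k ≥ 1} ε^k F_k`, and it linearizes the Virasoro symmetries. -/
def LinearizationAxiom (W : ℕ → Fin n → Jet n → ℂ) (j₀ : Jet n) : Prop :=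
  ∃ F : ℕ → Jet n → ℂ,
    (∀ k, 0 < k → ∃ N, JetAnalyticAt N (F k) j₀) ∧
    (∀ k γ, 0 < k → ∀ᶠ j in 𝓝 j₀,
      W k γ j = X.raise (fun β => Dx (c.Dt (β, 0) (F k)) j) γ) ∧
    c.LinearizesVirasoro F j₀

end Calibration

/-! ### Periods and the loop equation -/

section Loop

variable {n : ℕ} [NeZero n] (X : FrobeniusManifold n)

/-- The Jacobi matrix `∂_σ p_α(v; lam)`. -/
def periodJac (p : Fin n → (Fin n → ℂ) → ℂ → ℂ) (v : Fin n → ℂ) (lam : ℂ) :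
    Matrix (Fin n) (Fin n) ℂ :=
  Matrix.of fun α σ => pd σ (fun u => p α u lam) v

/-- A basis of independent periods near `(v₀, lam₀)`: flat coordinates `p_α(v; lam)` of the metric
inverse to `g^{αβ} - lam η^{αβ}`, normalized by `∂p/∂lam = -∂_e p`. -/
structure IsPeriodSystem (p : Fin n → (Fin n → ℂ) → ℂ → ℂ) (v₀ : Fin n → ℂ) (lam₀ : ℂ) :
    Prop where
  regular : (X.U v₀ - lam₀ • (1 : Matrix (Fin n) (Fin n) ℂ)).det ≠ 0
  analytic : ∀ α, AnalyticAt ℂ (fun x : (Fin n → ℂ) × ℂ => p α x.1 x.2) (v₀, lam₀)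
  flat : ∀ᶠ x : (Fin n → ℂ) × ℂ in 𝓝 (v₀, lam₀), ∀ α β γ,
    ∑ ε, ((X.g x.1 β ε - x.2 * X.η⁻¹ β ε) * pd ε (pd γ (fun u => p α u x.2)) x.1 +
      X.Γ γ x.1 β ε * pd ε (fun u => p α u x.2) x.1) = 0
  normalized : ∀ᶠ x : (Fin n → ℂ) × ℂ in 𝓝 (v₀, lam₀), ∀ α,
    deriv (fun l => p α x.1 l) x.2 = -pd 0 (fun u => p α u x.2) x.1
  independent : (periodJac p v₀ lam₀).det ≠ 0

variable (p : Fin n → (Fin n → ℂ) → ℂ → ℂ)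

/-- The (constant) Gram matrix `G^{αβ}`. -/
def gram (v : Fin n → ℂ) (lam : ℂ) : Matrix (Fin n) (Fin n) ℂ :=
  (periodJac p v lam * (X.g v - lam • X.η⁻¹) * (periodJac p v lam).transpose)⁻¹

/-- `∂^γ p_α = η^{γε} ∂_ε p_α`, as a function on the jet space. -/
def gradP (lam : ℂ) (α γ : Fin n) (j : Jet n) : ℂ :=
  X.raise (fun ε => pd ε (fun u => p α u lam) (j 0)) γ

/-- The vector `∇(∂p_α/∂lam)`. -/
def gradDP (lam : ℂ) (α : Fin n) (v : Fin n → ℂ) : Fin n → ℂ :=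
  X.raise fun ε => pd ε (fun u => deriv (fun l => p α u l) lam) v

/-- The left hand side of the loop equation, applied to one function `Φ`. -/
def loopLHS (lam : ℂ) (Φ : Jet n → ℂ) (j : Jet n) : ℂ :=
  ∑ᶠ r : ℕ, ∑ γ, jd γ r Φ j *
    (Dx^[r] (fun y => (X.U (y 0) - lam • (1 : Matrix (Fin n) (Fin n) ℂ))⁻¹ γ 0) j +
      ∑ k ∈ Finset.Icc 1 r, (Nat.choose r k : ℂ) * ∑ α, ∑ β,
        Dx^[k - 1] (fun y => pd 0 (fun u => p α u lam) (y 0)) j * gram X p (j 0) lam α β *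
          Dx^[r - k + 1] (gradP X p lam β γ) j)

/-- `∑ Ψ_{γ,k;ρ,l} ∂_x^{k+1}∂^γ p_α G^{αβ} ∂_x^{l+1}∂^ρ p_β`. -/
def loopQuad (lam : ℂ) (Ψ : Fin n → ℕ → Fin n → ℕ → ℂ) (j : Jet n) : ℂ :=
  ∑ᶠ x : ℕ × ℕ, ∑ γ, ∑ ρ, Ψ γ x.1 ρ x.2 * ∑ α, ∑ β,
    Dx^[x.1 + 1] (gradP X p lam α γ) j * gram X p (j 0) lam α β *
      Dx^[x.2 + 1] (gradP X p lam β ρ) j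

/-- `∑ ∂Φ/∂v^{γ,k} ∂_x^{k+1} [∇(∂p_α/∂lam) · ∇(∂p_β/∂lam) · v_x]^γ G^{αβ}`. -/
def loopLin (lam : ℂ) (Φ : Jet n → ℂ) (j : Jet n) : ℂ :=
  ∑ᶠ k : ℕ, ∑ γ, jd γ k Φ j * ∑ α, ∑ β,
    Dx^[k + 1] (fun y => ((X.mulBy (gradDP X p lam α (y 0)) (y 0) *
      X.mulBy (gradDP X p lam β (y 0)) (y 0)).mulVec (y 1)) γ) j * gram X p (j 0) lam α β

/-- The genus-one inhomogeneity `-(1/16) tr (𝒰 - lam)⁻² + (1/4) tr [(𝒰 - lam)⁻¹ 𝒱]²`. -/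
def loopConst (lam : ℂ) (v : Fin n → ℂ) : ℂ :=
  (1 / 4) * (((X.U v - lam • (1 : Matrix (Fin n) (Fin n) ℂ))⁻¹ * X.V) ^ 2).trace -
    (1 / 16) * ((X.U v - lam • (1 : Matrix (Fin n) (Fin n) ℂ))⁻¹ ^ 2).trace

/-- The loop equation for `ΔF = ∑_{g ≥ 1} ε^{2g-2} F_g` near the jet `j₀` and near `lam₀`, written
as the equality of the coefficients of `ε^{2g-2}` for all `g ≥ 1` (`F_0` does not occur). -/
def LoopEquation (lam₀ : ℂ) (j₀ : Jet n) (F : ℕ → Jet n → ℂ) : Prop :=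
  ∀ g : ℕ, 0 < g → ∀ᶠ x : Jet n × ℂ in 𝓝 (j₀, lam₀),
    loopLHS X p x.2 (F g) x.1 =
      (if g = 1 then loopConst X x.2 (x.1 0)
      else
        (1 / 2) * loopQuad X p x.2 (fun γ k ρ l => jd γ k (jd ρ l (F (g - 1))) x.1 +
          ∑ h ∈ Finset.Icc 1 (g - 1), jd γ k (F h) x.1 * jd ρ l (F (g - h)) x.1) x.1 +
        (1 / 2) * loopLin X p x.2 (F (g - 1)) x.1)

end Loop

end LoopEq

end

open LoopEq

noncomputable section

namespace LoopEq

open Finset (sum_congr sum_add_distrib mul_sum sum_comm mem_range sum_eq_zero sum_mul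
  analyticAt_fun_sum mem_Icc sum_neg_distrib sum_range_succ' sum_range_succ smul_sum)
open Finset.HasAntidiagonal (antidiagonal mem_antidiagonal)

/-! ### Analytic functions on open sets of jets -/

section JetCalculus

variable {n : ℕ}

/-- The jet `j` with the coordinate `v^{γ,r}` replaced by `z`. -/
def jetUpdate (j : Jet n) (r : ℕ) (γ : Fin n) (z : ℂ) : Jet n :=
  Function.update j r (Function.update (j r) γ z)

lemma jetUpdate_self (j : Jet n) (r : ℕ) (γ : Fin n) : jetUpdate j r γ (j r γ) = j := by
  simp [jetUpdate]

lemma continuous_jetUpdate (j : Jet n) (r : ℕ) (γ : Fin n) : Continuous (jetUpdate j r γ) :=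
  continuous_const.update r (continuous_const.update γ continuous_id)

lemma tendsto_jetUpdate (j : Jet n) (r : ℕ) (γ : Fin n) :
    Tendsto (jetUpdate j r γ) (𝓝 (j r γ)) (𝓝 j) := by
  have := (continuous_jetUpdate j r γ).tendsto (j r γ)
  rwa [jetUpdate_self] at this

lemma jetUpdate_of_ne (j : Jet n) {r s : ℕ} (h : s ≠ r) (γ : Fin n) (z : ℂ) :
    jetUpdate j r γ z s = j s := by
  simp [jetUpdate, h]

/-- The first `N + 1` entries of a jet. -/
def jetTrunc (N : ℕ) (j : Jet n) : Fin (N + 1) → Fin n → ℂ := fun i => j i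

lemma continuous_jetTrunc (N : ℕ) : Continuous (jetTrunc N : Jet n → _) :=
  continuous_pi fun i => continuous_apply (i : ℕ)

/-- The coordinate vector of `v^{γ,r}` in the space of truncated jets (zero if `r > N`). -/
def truncBasis (N : ℕ) (γ : Fin n) (r : ℕ) : Fin (N + 1) → Fin n → ℂ :=
  fun i => if (i : ℕ) = r then Pi.single γ 1 else 0

lemma jetTrunc_jetUpdate (N : ℕ) (j : Jet n) (r : ℕ) (γ : Fin n) (z : ℂ) :
    jetTrunc N (jetUpdate j r γ z) = jetTrunc N j + (z - j r γ) • truncBasis N γ r := by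
  funext i δ
  by_cases h : (i : ℕ) = r
  · subst h
    by_cases hδ : δ = γ
    · subst hδ
      simp [jetTrunc, jetUpdate, truncBasis]
    · simp [jetTrunc, jetUpdate, truncBasis, hδ]
  · simp [jetTrunc, jetUpdate, truncBasis, h]

lemma truncBasis_eq_zero {N r : ℕ} (h : N < r) (γ : Fin n) : truncBasis N γ r = 0 := by
  funext i
  have : (i : ℕ) ≠ r := by omega
  simp [truncBasis, this]

/-- Near `j₀`, the function `Φ` is the analytic function `G` of the truncated jet. -/
def JetRep (N : ℕ) (Φ : Jet n → ℂ) (G : (Fin (N + 1) → Fin n → ℂ) → ℂ) (j₀ : Jet n) : Prop :=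
  AnalyticAt ℂ G (jetTrunc N j₀) ∧ ∀ᶠ j in 𝓝 j₀, Φ j = G (jetTrunc N j)

lemma JetRep.eventually {N : ℕ} {Φ : Jet n → ℂ} {G} {j₀ : Jet n} (h : JetRep N Φ G j₀) :
    ∀ᶠ j in 𝓝 j₀, JetRep N Φ G j :=
  (((continuous_jetTrunc N).tendsto j₀).eventually h.1.eventually_analyticAt).and
    h.2.eventually_nhds

lemma JetRep.hasDerivAt {N : ℕ} {Φ : Jet n → ℂ} {G} {j : Jet n} (h : JetRep N Φ G j)
    (γ : Fin n) (r : ℕ) :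
    HasDerivAt (fun z => Φ (jetUpdate j r γ z))
      (fderiv ℂ G (jetTrunc N j) (truncBasis N γ r)) (j r γ) := by
  have h1 : HasDerivAt (fun z : ℂ => jetTrunc N j + (z - j r γ) • truncBasis N γ r)
      (truncBasis N γ r) (j r γ) := by
    have := (((hasDerivAt_id (j r γ)).sub_const (j r γ)).smul_const
      (truncBasis N γ r)).const_add (jetTrunc N j)
    simpa using this
  have h2 : HasFDerivAt G (fderiv ℂ G (jetTrunc N j))
      (jetTrunc N j + (j r γ - j r γ) • truncBasis N γ r) := by
    simpa using h.1.differentiableAt.hasFDerivAt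
  refine (h2.comp_hasDerivAt (j r γ) h1).congr_of_eventuallyEq ?_
  filter_upwards [(tendsto_jetUpdate j r γ).eventually h.2] with z hz
  rw [hz, jetTrunc_jetUpdate]
  rfl

lemma JetRep.jd_eq {N : ℕ} {Φ : Jet n → ℂ} {G} {j : Jet n} (h : JetRep N Φ G j)
    (γ : Fin n) (r : ℕ) : jd γ r Φ j = fderiv ℂ G (jetTrunc N j) (truncBasis N γ r) :=
  (h.hasDerivAt γ r).deriv

lemma JetRep.jd {N : ℕ} {Φ : Jet n → ℂ} {G} {j : Jet n} (h : JetRep N Φ G j)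
    (γ : Fin n) (r : ℕ) :
    JetRep N (jd γ r Φ) (fun x => fderiv ℂ G x (truncBasis N γ r)) j :=
  ⟨((ContinuousLinearMap.apply ℂ ℂ (truncBasis N γ r)).analyticAt _).comp h.1.fderiv, h.eventually.mono fun _ hj => hj.jd_eq γ r⟩

lemma JetRep.jd_comm {N : ℕ} {Φ : Jet n → ℂ} {G} {j : Jet n} (h : JetRep N Φ G j)
    (γ δ : Fin n) (r s : ℕ) : LoopEq.jd δ s (LoopEq.jd γ r Φ) j =
      LoopEq.jd γ r (LoopEq.jd δ s Φ) j := by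
  rw [(h.jd γ r).jd_eq, (h.jd δ s).jd_eq]
  have hd := h.1.fderiv.differentiableAt
  rw [fderiv_clm_apply hd (differentiableAt_const _), fderiv_clm_apply hd (differentiableAt_const _)]
  have hs := ContDiffAt.isSymmSndFDerivAt (𝕜 := ℂ) (n := ⊤) h.1.contDiffAt (by simp)
  simpa using hs.eq (truncBasis N δ s) (truncBasis N γ r)

lemma eventually_of_isOpen {α : Type*} [TopologicalSpace α] {O : Set α} (hO : IsOpen O) {j : α}
    (hj : j ∈ O) {P : α → Prop} (h : ∀ j ∈ O, P j) : ∀ᶠ j' in 𝓝 j, P j' :=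
  Filter.mem_of_superset (hO.mem_nhds hj) h

/-- `Φ` is, near each point of `O`, an analytic function of finitely many jet variables. -/
def JetAnalyticOn (O : Set (Jet n)) (Φ : Jet n → ℂ) : Prop :=
  ∀ j ∈ O, ∃ N, JetAnalyticAt N Φ j

lemma JetAnalyticAt.mono {N N' : ℕ} (hN : N ≤ N') {Φ : Jet n → ℂ} {j : Jet n}
    (h : JetAnalyticAt N Φ j) : JetAnalyticAt N' Φ j := by
  obtain ⟨G, hG, hΦ⟩ := h
  let L : (Fin (N' + 1) → Fin n → ℂ) →L[ℂ] (Fin (N + 1) → Fin n → ℂ) :=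
    ContinuousLinearMap.pi fun i => ContinuousLinearMap.proj (Fin.castLE (by omega) i)
  refine ⟨fun x => G (L x), ?_, ?_⟩
  · exact AnalyticAt.comp (g := G) (f := L) (by exact hG) (L.analyticAt _)
  · exact hΦ

lemma JetAnalyticAt.eventually {N : ℕ} {Φ : Jet n → ℂ} {j : Jet n} (h : JetAnalyticAt N Φ j) :
    ∀ᶠ j' in 𝓝 j, JetAnalyticAt N Φ j' := by
  obtain ⟨G, hG⟩ := h
  exact (JetRep.eventually hG).mono fun j' hj' => ⟨G, hj'⟩

lemma JetAnalyticAt.jd_eq_zero {N : ℕ} {Φ : Jet n → ℂ} {j : Jet n} (h : JetAnalyticAt N Φ j)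
    (γ : Fin n) {r : ℕ} (hr : N < r) : jd γ r Φ j = 0 := by
  obtain ⟨G, hG⟩ := h
  rw [JetRep.jd_eq hG, truncBasis_eq_zero hr, map_zero]

lemma JetAnalyticAt.jd {N : ℕ} {Φ : Jet n → ℂ} {j : Jet n} (h : JetAnalyticAt N Φ j)
    (γ : Fin n) (r : ℕ) : JetAnalyticAt N (jd γ r Φ) j := by
  obtain ⟨G, hG⟩ := h
  exact ⟨_, JetRep.jd hG γ r⟩

lemma JetAnalyticAt.differentiableAt {N : ℕ} {Φ : Jet n → ℂ} {j : Jet n}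
    (h : JetAnalyticAt N Φ j) (γ : Fin n) (r : ℕ) :
    DifferentiableAt ℂ (fun z => Φ (jetUpdate j r γ z)) (j r γ) := by
  obtain ⟨G, hG⟩ := h
  exact (JetRep.hasDerivAt hG γ r).differentiableAt

lemma JetAnalyticAt.congr {N : ℕ} {Φ Ψ : Jet n → ℂ} {j : Jet n} (h : JetAnalyticAt N Φ j)
    (he : ∀ᶠ j' in 𝓝 j, Ψ j' = Φ j') : JetAnalyticAt N Ψ j := by
  obtain ⟨G, hG, hΦ⟩ := h
  exact ⟨G, hG, by filter_upwards [hΦ, he] with j' h1 h2; rw [h2, h1]⟩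

lemma JetAnalyticAt.add {N : ℕ} {Φ Ψ : Jet n → ℂ} {j : Jet n} (h : JetAnalyticAt N Φ j)
    (h' : JetAnalyticAt N Ψ j) : JetAnalyticAt N (fun j => Φ j + Ψ j) j := by
  obtain ⟨G, hG, hΦ⟩ := h
  obtain ⟨G', hG', hΨ⟩ := h'
  exact ⟨fun x => G x + G' x, hG.fun_add hG',
    by filter_upwards [hΦ, hΨ] with j' h1 h2; rw [h2, h1]⟩

lemma JetAnalyticAt.mul {N : ℕ} {Φ Ψ : Jet n → ℂ} {j : Jet n} (h : JetAnalyticAt N Φ j)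
    (h' : JetAnalyticAt N Ψ j) : JetAnalyticAt N (fun j => Φ j * Ψ j) j := by
  obtain ⟨G, hG, hΦ⟩ := h
  obtain ⟨G', hG', hΨ⟩ := h'
  exact ⟨fun x => G x * G' x, hG.fun_mul hG',
    by filter_upwards [hΦ, hΨ] with j' h1 h2; rw [h2, h1]⟩

lemma JetAnalyticAt.const (N : ℕ) (a : ℂ) (j : Jet n) : JetAnalyticAt N (fun _ => a) j :=
  ⟨fun _ => a, analyticAt_const, by simp⟩

lemma JetAnalyticAt.coord (r : ℕ) (γ : Fin n) (j : Jet n) :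
    JetAnalyticAt r (fun j => j r γ) j := by
  let L : (Fin (r + 1) → Fin n → ℂ) →L[ℂ] ℂ :=
    (ContinuousLinearMap.proj (R := ℂ) (φ := fun _ : Fin n => ℂ) γ).comp
      (ContinuousLinearMap.proj (Fin.last r))
  exact ⟨L, L.analyticAt _, by simp [L]⟩

lemma JetAnalyticAt.comp_base {f : (Fin n → ℂ) → ℂ} {j : Jet n} (h : AnalyticAt ℂ f (j 0)) :
    JetAnalyticAt 0 (fun j => f (j 0)) j := by
  let L : (Fin (0 + 1) → Fin n → ℂ) →L[ℂ] (Fin n → ℂ) := ContinuousLinearMap.proj 0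
  exact ⟨fun x => f (L x), AnalyticAt.comp (g := f) (f := L) h (L.analyticAt _), by simp [L]⟩

lemma exists_common_order {Φ Ψ : Jet n → ℂ} {j : Jet n} (h : ∃ N, JetAnalyticAt N Φ j)
    (h' : ∃ N, JetAnalyticAt N Ψ j) : ∃ N, JetAnalyticAt N Φ j ∧ JetAnalyticAt N Ψ j := by
  obtain ⟨N, h⟩ := h
  obtain ⟨N', h'⟩ := h'
  exact ⟨max N N', h.mono (le_max_left _ _), h'.mono (le_max_right _ _)⟩

namespace JetAnalyticOn

variable {O : Set (Jet n)} {Φ Ψ : Jet n → ℂ}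

lemma add (h : JetAnalyticOn O Φ) (h' : JetAnalyticOn O Ψ) :
    JetAnalyticOn O (fun j => Φ j + Ψ j) := fun j hj => by
  obtain ⟨N, h1, h2⟩ := exists_common_order (h j hj) (h' j hj)
  exact ⟨N, h1.add h2⟩

lemma mul (h : JetAnalyticOn O Φ) (h' : JetAnalyticOn O Ψ) :
    JetAnalyticOn O (fun j => Φ j * Ψ j) := fun j hj => by
  obtain ⟨N, h1, h2⟩ := exists_common_order (h j hj) (h' j hj)
  exact ⟨N, h1.mul h2⟩

lemma const (a : ℂ) : JetAnalyticOn O (fun _ => a) := fun j _ => ⟨0, .const 0 a j⟩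

lemma sum {ι : Type*} (s : Finset ι) {Φ : ι → Jet n → ℂ} (h : ∀ i ∈ s, JetAnalyticOn O (Φ i)) :
    JetAnalyticOn O (fun j => ∑ i ∈ s, Φ i j) := by
  classical
  induction s using Finset.induction_on with
  | empty => simpa using const 0
  | insert a s ha ih =>
    simp only [Finset.sum_insert ha]
    exact (h a (by simp)).add (ih fun i hi => h i (by simp [hi]))

lemma coord (r : ℕ) (γ : Fin n) : JetAnalyticOn O (fun j => j r γ) :=
  fun j _ => ⟨r, .coord r γ j⟩

lemma comp_base {f : (Fin n → ℂ) → ℂ} (h : ∀ j ∈ O, AnalyticAt ℂ f (j 0)) :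
    JetAnalyticOn O (fun j => f (j 0)) := fun j hj => ⟨0, .comp_base (h j hj)⟩

lemma congr (hO : IsOpen O) (h : JetAnalyticOn O Φ) (he : ∀ j ∈ O, Ψ j = Φ j) :
    JetAnalyticOn O Ψ := fun j hj => by
  obtain ⟨N, h1⟩ := h j hj
  exact ⟨N, h1.congr (eventually_of_isOpen hO hj he)⟩

lemma jd (h : JetAnalyticOn O Φ) (γ : Fin n) (r : ℕ) : JetAnalyticOn O (jd γ r Φ) := fun j hj => by
  obtain ⟨N, h1⟩ := h j hj
  exact ⟨N, h1.jd γ r⟩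

end JetAnalyticOn

section jdRules

variable {O : Set (Jet n)} {Φ Ψ : Jet n → ℂ} {j : Jet n}

lemma jd_congr_nhds (h : ∀ᶠ j' in 𝓝 j, Φ j' = Ψ j') (γ : Fin n) (r : ℕ) :
    jd γ r Φ j = jd γ r Ψ j :=
  Filter.EventuallyEq.deriv_eq ((tendsto_jetUpdate j r γ).eventually h)

lemma jd_congr (hO : IsOpen O) (h : ∀ j ∈ O, Φ j = Ψ j) (γ : Fin n) (r : ℕ) :
    ∀ j ∈ O, jd γ r Φ j = jd γ r Ψ j :=
  fun _ hj => jd_congr_nhds (eventually_of_isOpen hO hj h) γ r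

lemma jd_add (hΦ : ∃ N, JetAnalyticAt N Φ j) (hΨ : ∃ N, JetAnalyticAt N Ψ j) (γ : Fin n) (r : ℕ) :
    jd γ r (fun j => Φ j + Ψ j) j = jd γ r Φ j + jd γ r Ψ j := by
  obtain ⟨N, h1, h2⟩ := exists_common_order hΦ hΨ
  exact deriv_fun_add (h1.differentiableAt γ r) (h2.differentiableAt γ r)

lemma jd_mul (hΦ : ∃ N, JetAnalyticAt N Φ j) (hΨ : ∃ N, JetAnalyticAt N Ψ j) (γ : Fin n) (r : ℕ) :
    jd γ r (fun j => Φ j * Ψ j) j = jd γ r Φ j * Ψ j + Φ j * jd γ r Ψ j := by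
  obtain ⟨N, h1, h2⟩ := exists_common_order hΦ hΨ
  have := deriv_fun_mul (h1.differentiableAt γ r) (h2.differentiableAt γ r)
  rw [jetUpdate_self] at this
  exact this

lemma jd_const (a : ℂ) (γ : Fin n) (r : ℕ) : jd γ r (fun _ => a) j = 0 := by
  simp [jd]

lemma jd_coord (s : ℕ) (δ γ : Fin n) (r : ℕ) :
    jd γ r (fun j => j s δ) j = if r = s ∧ γ = δ then 1 else 0 := by
  unfold jd
  by_cases h : r = s
  · subst h
    by_cases hδ : γ = δ
    · subst hδ; simp
    · simp [hδ, Ne.symm hδ]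
  · simp [h, Function.update_of_ne (Ne.symm h)]

lemma jd_comp_base (f : (Fin n → ℂ) → ℂ) (hf : DifferentiableAt ℂ f (j 0)) (γ : Fin n) :
    jd γ 0 (fun j => f (j 0)) j = pd γ f (j 0) := by
  unfold jd pd
  simp only [Function.update_self]
  have h1 : HasDerivAt (fun z => Function.update (j 0) γ z) (Pi.single γ (1 : ℂ)) (j 0 γ) :=
    hasDerivAt_update (j 0) γ (j 0 γ)
  have h2 : HasFDerivAt f (fderiv ℂ f (j 0)) (Function.update (j 0) γ (j 0 γ)) := by
    simpa using hf.hasFDerivAt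
  exact (h2.comp_hasDerivAt (j 0 γ) h1).deriv

lemma jd_eq_zero_of_forall_update (γ : Fin n) (r : ℕ) (h : ∀ z, Φ (jetUpdate j r γ z) = Φ j) :
    jd γ r Φ j = 0 := by
  have : (fun z => Φ (Function.update j r (Function.update (j r) γ z))) = fun _ => Φ j :=
    funext h
  rw [jd, this, deriv_const]

lemma jd_comp_base_pos (f : (Fin n → ℂ) → ℂ) (γ : Fin n) {r : ℕ} (hr : r ≠ 0) :
    jd γ r (fun j => f (j 0)) j = 0 :=
  jd_eq_zero_of_forall_update γ r fun z => by rw [jetUpdate_of_ne _ (Ne.symm hr)]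

lemma jd_comm (h : ∃ N, JetAnalyticAt N Φ j) (γ δ : Fin n) (r s : ℕ) :
    jd δ s (jd γ r Φ) j = jd γ r (jd δ s Φ) j := by
  obtain ⟨N, G, hG⟩ := h
  exact JetRep.jd_comm hG γ δ r s

end jdRules

/-! ### Vector fields on the jet space -/

/-- The derivative of `Φ` along the vector field `∑ b_{r,γ} ∂/∂v^{γ,r}`. -/
def vecD (b : ℕ → Fin n → Jet n → ℂ) (Φ : Jet n → ℂ) (j : Jet n) : ℂ :=
  ∑ᶠ r : ℕ, ∑ γ, jd γ r Φ j * b r γ j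

lemma Dx_eq_vecD : (Dx : (Jet n → ℂ) → Jet n → ℂ) = vecD fun r γ j => j (r + 1) γ := rfl

section vecD

variable {O : Set (Jet n)} {Φ Ψ : Jet n → ℂ} {j : Jet n} {b b' : ℕ → Fin n → Jet n → ℂ}

lemma JetAnalyticAt.finsum_eq {N : ℕ} (h : JetAnalyticAt N Φ j) (c : ℕ → Fin n → ℂ) :
    ∑ᶠ r : ℕ, ∑ γ, LoopEq.jd γ r Φ j * c r γ = ∑ r ∈ Finset.range (N + 1), ∑ γ, LoopEq.jd γ r Φ j * c r γ := by
  refine finsum_eq_sum_of_support_subset _ fun r hr => ?_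
  by_contra hN
  refine hr (sum_eq_zero fun γ _ => ?_)
  rw [h.jd_eq_zero γ (by simpa using hN), zero_mul]

lemma JetAnalyticAt.vecD_eq {N : ℕ} (h : JetAnalyticAt N Φ j) (b : ℕ → Fin n → Jet n → ℂ) :
    vecD b Φ j = ∑ r ∈ Finset.range (N + 1), ∑ γ, LoopEq.jd γ r Φ j * b r γ j :=
  h.finsum_eq fun r γ => b r γ j

lemma vecD_congr_nhds (h : ∀ᶠ j' in 𝓝 j, Φ j' = Ψ j') : vecD b Φ j = vecD b Ψ j := by
  simp only [vecD, jd_congr_nhds h]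

lemma vecD_congr (hO : IsOpen O) (h : ∀ j ∈ O, Φ j = Ψ j) : ∀ j ∈ O, vecD b Φ j = vecD b Ψ j :=
  fun _ hj => vecD_congr_nhds (eventually_of_isOpen hO hj h)

lemma vecD_congr_field (h : ∀ r γ, b r γ j = b' r γ j) : vecD b Φ j = vecD b' Φ j := by
  simp only [vecD, h]

lemma vecD_add (hΦ : ∃ N, JetAnalyticAt N Φ j) (hΨ : ∃ N, JetAnalyticAt N Ψ j) :
    vecD b (fun j => Φ j + Ψ j) j = vecD b Φ j + vecD b Ψ j := by
  obtain ⟨N, h1, h2⟩ := exists_common_order hΦ hΨ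
  rw [(h1.add h2).vecD_eq, h1.vecD_eq, h2.vecD_eq]
  simp only [jd_add hΦ hΨ, add_mul, sum_add_distrib]

lemma vecD_mul (hΦ : ∃ N, JetAnalyticAt N Φ j) (hΨ : ∃ N, JetAnalyticAt N Ψ j) :
    vecD b (fun j => Φ j * Ψ j) j = vecD b Φ j * Ψ j + Φ j * vecD b Ψ j := by
  obtain ⟨N, h1, h2⟩ := exists_common_order hΦ hΨ
  rw [(h1.mul h2).vecD_eq, h1.vecD_eq, h2.vecD_eq]
  simp only [jd_mul hΦ hΨ, sum_mul, mul_sum, ← sum_add_distrib]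
  exact sum_congr rfl fun r _ => sum_congr rfl fun γ _ => by ring

lemma vecD_const (a : ℂ) : vecD b (fun _ => a) j = 0 := by
  simp [vecD, jd_const]

lemma vecD_const_mul (a : ℂ) (hΦ : ∃ N, JetAnalyticAt N Φ j) :
    vecD b (fun j => a * Φ j) j = a * vecD b Φ j := by
  rw [vecD_mul ⟨0, .const 0 a j⟩ hΦ, vecD_const, zero_mul, zero_add]

lemma vecD_sum {ι : Type*} (s : Finset ι) {Φ : ι → Jet n → ℂ}
    (h : ∀ i ∈ s, ∃ N, JetAnalyticAt N (Φ i) j) :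
    vecD b (fun j => ∑ i ∈ s, Φ i j) j = ∑ i ∈ s, vecD b (Φ i) j := by
  classical
  induction s using Finset.induction_on with
  | empty => simpa using vecD_const 0
  | insert a s ha ih =>
    simp only [Finset.sum_insert ha]
    have hs : JetAnalyticOn {j} (fun j => ∑ i ∈ s, Φ i j) :=
      JetAnalyticOn.sum s fun i hi j' hj' => by rw [hj']; exact h i (by simp [hi])
    rw [vecD_add (h a (by simp)) (hs j rfl), ih fun i hi => h i (by simp [hi])]

lemma vecD_coord (s : ℕ) (δ : Fin n) : vecD b (fun j => j s δ) j = b s δ j := by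
  rw [(JetAnalyticAt.coord s δ j).vecD_eq]
  simp only [jd_coord, ite_mul, one_mul, zero_mul]
  rw [Finset.sum_eq_single s (fun r _ hr => by simp [hr]) (by simp)]
  simp

lemma vecD_comp_base (f : (Fin n → ℂ) → ℂ) (hf : AnalyticAt ℂ f (j 0)) :
    vecD b (fun j => f (j 0)) j = ∑ γ, pd γ f (j 0) * b 0 γ j := by
  rw [(JetAnalyticAt.comp_base hf).vecD_eq]
  simp [jd_comp_base f hf.differentiableAt]

lemma JetAnalyticOn.vecD (h : JetAnalyticOn O Φ) (hb : ∀ r γ, JetAnalyticOn O (b r γ)) :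
    JetAnalyticOn O (vecD b Φ) := fun j hj => by
  obtain ⟨N, h1⟩ := h j hj
  have h2 : JetAnalyticOn {j} fun j => ∑ r ∈ Finset.range (N + 1), ∑ γ, LoopEq.jd γ r Φ j * b r γ j :=
    .sum _ fun r _ => .sum _ fun γ _ => .mul (fun j' hj' => by rw [hj']; exact ⟨N, h1.jd γ r⟩)
      (fun j' hj' => by rw [hj']; exact hb r γ j hj)
  obtain ⟨N', h3⟩ := h2 j rfl
  exact ⟨N', h3.congr (h1.eventually.mono fun j' hj' => hj'.vecD_eq b)⟩

/-- The commutator of two vector fields. -/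
lemma vecD_commutator (h : JetAnalyticOn O Φ) (hb : ∀ r γ, JetAnalyticOn O (b r γ))
    (hb' : ∀ r γ, JetAnalyticOn O (b' r γ)) (hj : j ∈ O) :
    vecD b (vecD b' Φ) j - vecD b' (vecD b Φ) j =
      vecD (fun r γ j => vecD b (b' r γ) j - vecD b' (b r γ) j) Φ j := by
  obtain ⟨N, h1⟩ := h j hj
  have key : ∀ c c' : ℕ → Fin n → Jet n → ℂ, (∀ r γ, JetAnalyticOn O (c' r γ)) →
      vecD c (vecD c' Φ) j = ∑ r ∈ Finset.range (N + 1), ∑ γ,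
        ((∑ s ∈ Finset.range (N + 1), ∑ δ, jd δ s (jd γ r Φ) j * c s δ j) * c' r γ j +
          jd γ r Φ j * vecD c (c' r γ) j) := by
    intro c c' hc'
    rw [vecD_congr_nhds (h1.eventually.mono fun j' hj' => hj'.vecD_eq c')]
    rw [vecD_sum _ fun r _ => (JetAnalyticOn.sum _ fun γ _ => (h.jd γ r).mul (hc' r γ)) j hj]
    refine sum_congr rfl fun r _ => ?_
    rw [vecD_sum _ fun γ _ => ((h.jd γ r).mul (hc' r γ)) j hj]
    refine sum_congr rfl fun γ _ => ?_
    rw [vecD_mul (h.jd γ r j hj) (hc' r γ j hj), (h1.jd γ r).vecD_eq]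
  rw [key b b' hb', key b' b hb, h1.vecD_eq]
  simp only [mul_sub, Finset.sum_sub_distrib, sum_add_distrib]
  have : ∑ r ∈ Finset.range (N + 1), ∑ γ,
      (∑ s ∈ Finset.range (N + 1), ∑ δ, jd δ s (jd γ r Φ) j * b s δ j) * b' r γ j =
      ∑ r ∈ Finset.range (N + 1), ∑ γ,
      (∑ s ∈ Finset.range (N + 1), ∑ δ, jd δ s (jd γ r Φ) j * b' s δ j) * b r γ j := by
    simp only [sum_mul, sum_comm (s := Finset.univ) (t := Finset.range (N + 1))]
    rw [sum_comm]
    refine sum_congr rfl fun s _ => sum_congr rfl fun r _ => ?_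
    rw [sum_comm]
    refine sum_congr rfl fun δ _ => sum_congr rfl fun γ _ => ?_
    rw [jd_comm (h j hj)]; ring
  rw [this]; ring

lemma vecD_comm (h : JetAnalyticOn O Φ) (hb : ∀ r γ, JetAnalyticOn O (b r γ))
    (hb' : ∀ r γ, JetAnalyticOn O (b' r γ))
    (hbb' : ∀ r γ, ∀ j ∈ O, vecD b (b' r γ) j = vecD b' (b r γ) j) (hj : j ∈ O) :
    vecD b (vecD b' Φ) j = vecD b' (vecD b Φ) j := by
  have := vecD_commutator h hb hb' hj
  rw [vecD_congr_field (b := fun r γ j => vecD b (b' r γ) j - vecD b' (b r γ) j)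
    (b' := fun _ _ _ => 0) fun r γ => sub_eq_zero.2 (hbb' r γ j hj)] at this
  simp only [vecD, mul_zero, Finset.sum_const_zero, finsum_zero] at this
  exact sub_eq_zero.1 this

end vecD

section Dx

variable {O : Set (Jet n)} {Φ Ψ : Jet n → ℂ} {j : Jet n}

lemma JetAnalyticOn.Dx (h : JetAnalyticOn O Φ) : JetAnalyticOn O (Dx Φ) :=
  h.vecD fun r γ => .coord (r + 1) γ

lemma JetAnalyticOn.iterate_Dx (h : JetAnalyticOn O Φ) (k : ℕ) :
    JetAnalyticOn O (LoopEq.Dx^[k] Φ) := by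
  induction k generalizing Φ with
  | zero => exact h
  | succ k ih => exact ih h.Dx

lemma Dx_congr (hO : IsOpen O) (h : ∀ j ∈ O, Φ j = Ψ j) : ∀ j ∈ O, Dx Φ j = Dx Ψ j :=
  vecD_congr hO h

lemma iterate_Dx_congr (hO : IsOpen O) (h : ∀ j ∈ O, Φ j = Ψ j) (k : ℕ) :
    ∀ j ∈ O, Dx^[k] Φ j = Dx^[k] Ψ j := by
  induction k generalizing Φ Ψ with
  | zero => exact h
  | succ k ih => exact ih (Dx_congr hO h)

lemma Dx_mul (hΦ : ∃ N, JetAnalyticAt N Φ j) (hΨ : ∃ N, JetAnalyticAt N Ψ j) :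
    Dx (fun j => Φ j * Ψ j) j = Dx Φ j * Ψ j + Φ j * Dx Ψ j :=
  vecD_mul (b := fun r γ j => j (r + 1) γ) hΦ hΨ

lemma Dx_const_mul (a : ℂ) (hΦ : ∃ N, JetAnalyticAt N Φ j) :
    Dx (fun j => a * Φ j) j = a * Dx Φ j :=
  vecD_const_mul (b := fun r γ j => j (r + 1) γ) a hΦ

lemma Dx_const (a : ℂ) : Dx (fun _ : Jet n => a) = fun _ => 0 := funext fun _ =>
  vecD_const (b := fun r γ j => j (r + 1) γ) a

lemma Dx_sum {ι : Type*} (s : Finset ι) {Φ : ι → Jet n → ℂ}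
    (h : ∀ i ∈ s, ∃ N, JetAnalyticAt N (Φ i) j) :
    Dx (fun j => ∑ i ∈ s, Φ i j) j = ∑ i ∈ s, Dx (Φ i) j :=
  vecD_sum (b := fun r γ j => j (r + 1) γ) s h

lemma Dx_coord (s : ℕ) (δ : Fin n) : Dx (fun j => j s δ) j = j (s + 1) δ :=
  vecD_coord (b := fun r γ j => j (r + 1) γ) s δ

lemma iterate_Dx_coord (s k : ℕ) (δ : Fin n) :
    Dx^[k] (fun j => j s δ) = fun j => j (s + k) δ := by
  induction k generalizing s with
  | zero => rfl
  | succ k ih =>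
    rw [Function.iterate_succ_apply, show Dx (fun j : Jet n => j s δ) = fun j => j (s + 1) δ from
      funext fun j => Dx_coord s δ, ih]
    funext j; congr 1; omega

lemma Dx_comp_base (f : (Fin n → ℂ) → ℂ) (hf : AnalyticAt ℂ f (j 0)) :
    Dx (fun j => f (j 0)) j = ∑ γ, pd γ f (j 0) * j 1 γ :=
  vecD_comp_base (b := fun r γ j => j (r + 1) γ) f hf

lemma iterate_Dx_const_mul (hO : IsOpen O) (a : ℂ) (hΦ : JetAnalyticOn O Φ) (k : ℕ) :
    ∀ j ∈ O, Dx^[k] (fun j => a * Φ j) j = a * Dx^[k] Φ j := by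
  induction k generalizing Φ with
  | zero => intro j _; rfl
  | succ k ih =>
    intro j hj
    rw [Function.iterate_succ_apply, Function.iterate_succ_apply,
      iterate_Dx_congr hO (fun j hj => Dx_const_mul a (hΦ j hj)) k j hj, ih hΦ.Dx j hj]

lemma iterate_Dx_sum (hO : IsOpen O) {ι : Type*} (s : Finset ι) {Φ : ι → Jet n → ℂ}
    (h : ∀ i ∈ s, JetAnalyticOn O (Φ i)) (k : ℕ) :
    ∀ j ∈ O, Dx^[k] (fun j => ∑ i ∈ s, Φ i j) j = ∑ i ∈ s, Dx^[k] (Φ i) j := by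
  induction k generalizing Φ with
  | zero => intro j _; rfl
  | succ k ih =>
    intro j hj
    simp only [Function.iterate_succ_apply]
    rw [iterate_Dx_congr hO (fun j hj => Dx_sum s fun i hi => h i hi j hj) k j hj,
      ih (fun i hi => (h i hi).Dx) j hj]

/-- The Leibniz rule for iterated total derivatives. -/
lemma iterate_Dx_mul (hO : IsOpen O) (hΦ : JetAnalyticOn O Φ) (hΨ : JetAnalyticOn O Ψ) (k : ℕ) :
    ∀ j ∈ O, Dx^[k] (fun j => Φ j * Ψ j) j = ∑ ab ∈ antidiagonal k,
      (Nat.choose k ab.1 : ℂ) * (Dx^[ab.1] Φ j * Dx^[ab.2] Ψ j) := by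
  induction k with
  | zero => intro j _; simp
  | succ k ih =>
    intro j hj
    rw [Function.iterate_succ_apply', Dx_congr hO ih j hj]
    have hterm : ∀ ab : ℕ × ℕ, JetAnalyticOn O fun j => Dx^[ab.1] Φ j * Dx^[ab.2] Ψ j :=
      fun ab => (hΦ.iterate_Dx _).mul (hΨ.iterate_Dx _)
    rw [Dx_sum _ fun ab _ => ((JetAnalyticOn.const _).mul (hterm ab)) j hj]
    rw [Finset.sum_antidiagonal_choose_succ_mul
      (fun a b => Dx^[a] Φ j * Dx^[b] Ψ j) k]
    rw [add_comm, ← sum_add_distrib]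
    refine sum_congr rfl fun ab hab => ?_
    rw [Dx_const_mul _ (hterm ab j hj), Dx_mul (hΦ.iterate_Dx _ j hj) (hΨ.iterate_Dx _ j hj)]
    rw [Function.iterate_succ_apply', Function.iterate_succ_apply']
    have := mem_antidiagonal.1 hab
    rw [show k.choose ab.2 = k.choose ab.1 by
      rw [← this]; exact (Nat.choose_symm_add).symm]
    ring

/-- The commutator of `∂/∂v^{γ,r}` with the total derivative. -/
lemma jd_Dx (hO : IsOpen O) (h : JetAnalyticOn O Φ) (γ : Fin n) (r : ℕ) (hj : j ∈ O) :
    jd γ r (Dx Φ) j = Dx (jd γ r Φ) j + if r = 0 then 0 else jd γ (r - 1) Φ j := by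
  let b : ℕ → Fin n → Jet n → ℂ := fun s δ _ => if s = r ∧ δ = γ then 1 else 0
  have hb : ∀ Ψ : Jet n → ℂ, JetAnalyticOn O Ψ → ∀ j ∈ O, vecD b Ψ j = jd γ r Ψ j := by
    intro Ψ hΨ j hj
    obtain ⟨N, h1⟩ := hΨ j hj
    have h2 := h1.mono (le_max_left N r)
    rw [h2.vecD_eq]
    simp only [b, mul_ite, mul_one, mul_zero]
    rw [Finset.sum_eq_single r (fun s _ hs => by simp [hs])
      (fun hr => absurd (mem_range.2 (by omega)) hr)]
    simp
  have hc := vecD_commutator h (b := b) (b' := fun r γ j => j (r + 1) γ)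
    (fun s δ => .const _) (fun s δ => .coord _ _) hj
  rw [← Dx_eq_vecD, hb _ h.Dx j hj, Dx_congr hO (hb Φ h) j hj] at hc
  rw [← sub_eq_iff_eq_add', hc]
  obtain ⟨N, h1⟩ := h j hj
  have h2 := h1.mono (le_max_left N r)
  rw [h2.vecD_eq]
  simp only [vecD_coord, b, Dx_const, sub_zero]
  split_ifs with hr
  · subst hr; simp
  · rw [Finset.sum_eq_single (r - 1)]
    · have : r - 1 + 1 = r := by omega
      simp [this]
    · intro s _ hs
      have : s + 1 ≠ r := by omega
      simp [this]
    · intro hr'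
      exact absurd (mem_range.2 (by omega)) hr'

end Dx

end JetCalculus

/-! ### Algebraic identities on a Frobenius manifold -/

section pd

variable {n : ℕ}

lemma analyticAt_pd {f : (Fin n → ℂ) → ℂ} {v : Fin n → ℂ} (h : AnalyticAt ℂ f v) (γ : Fin n) :
    AnalyticAt ℂ (pd γ f) v :=
  ((ContinuousLinearMap.apply ℂ ℂ (Pi.single γ (1 : ℂ) : Fin n → ℂ)).analyticAt _).comp h.fderiv

lemma pd_comm {f : (Fin n → ℂ) → ℂ} {v : Fin n → ℂ} (h : AnalyticAt ℂ f v) (γ δ : Fin n) :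
    pd γ (pd δ f) v = pd δ (pd γ f) v := by
  have hd := h.fderiv.differentiableAt
  have hs := ContDiffAt.isSymmSndFDerivAt (𝕜 := ℂ) (n := ⊤) h.contDiffAt (by simp)
  have key : ∀ α β : Fin n, pd α (pd β f) v =
      fderiv ℂ (fderiv ℂ f) v (Pi.single α 1) (Pi.single β 1) := by
    intro α β
    have : pd β f = fun u => fderiv ℂ f u (Pi.single β 1) := rfl
    rw [this, pd, fderiv_clm_apply hd (differentiableAt_const _)]
    simp
  rw [key, key]
  exact hs.eq _ _

lemma pd_congr_nhds {f g : (Fin n → ℂ) → ℂ} {v : Fin n → ℂ} (h : f =ᶠ[𝓝 v] g) (γ : Fin n) :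
    pd γ f v = pd γ g v := by
  rw [pd, pd, h.fderiv_eq]

lemma pd_congr {M : Set (Fin n → ℂ)} (hM : IsOpen M) {f g : (Fin n → ℂ) → ℂ}
    (h : ∀ v ∈ M, f v = g v) (γ : Fin n) : ∀ v ∈ M, pd γ f v = pd γ g v :=
  fun _ hv => pd_congr_nhds (eventually_of_isOpen hM hv h) γ

lemma pd_add {f g : (Fin n → ℂ) → ℂ} {v : Fin n → ℂ} (hf : AnalyticAt ℂ f v)
    (hg : AnalyticAt ℂ g v) (γ : Fin n) : pd γ (fun u => f u + g u) v = pd γ f v + pd γ g v := by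
  simp [pd, fderiv_fun_add hf.differentiableAt hg.differentiableAt]

lemma pd_mul {f g : (Fin n → ℂ) → ℂ} {v : Fin n → ℂ} (hf : AnalyticAt ℂ f v)
    (hg : AnalyticAt ℂ g v) (γ : Fin n) :
    pd γ (fun u => f u * g u) v = pd γ f v * g v + f v * pd γ g v := by
  simp [pd, fderiv_fun_mul hf.differentiableAt hg.differentiableAt]; ring

lemma pd_const (a : ℂ) (v : Fin n → ℂ) (γ : Fin n) : pd γ (fun _ => a) v = 0 := by
  simp [pd]

lemma pd_const_mul {f : (Fin n → ℂ) → ℂ} {v : Fin n → ℂ} (a : ℂ) (hf : AnalyticAt ℂ f v)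
    (γ : Fin n) : pd γ (fun u => a * f u) v = a * pd γ f v := by
  rw [pd_mul analyticAt_const hf, pd_const, zero_mul, zero_add]

lemma pd_sum {ι : Type*} (s : Finset ι) {f : ι → (Fin n → ℂ) → ℂ} {v : Fin n → ℂ}
    (hf : ∀ i ∈ s, AnalyticAt ℂ (f i) v) (γ : Fin n) :
    pd γ (fun u => ∑ i ∈ s, f i u) v = ∑ i ∈ s, pd γ (f i) v := by
  simp [pd, fderiv_fun_sum fun i hi => (hf i hi).differentiableAt]

end pd

namespace FrobeniusManifold

variable {n : ℕ} [NeZero n] (X : FrobeniusManifold n) {v : Fin n → ℂ}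

lemma third_swap_inner (hv : v ∈ X.M) (α β γ : Fin n) :
    pd α (pd β (pd γ X.F)) v = pd α (pd γ (pd β X.F)) v :=
  pd_congr X.isOpen (fun u hu => pd_comm (X.analytic u hu) β γ) α v hv

lemma third_swap_outer (hv : v ∈ X.M) (α β γ : Fin n) :
    pd α (pd β (pd γ X.F)) v = pd β (pd α (pd γ X.F)) v :=
  pd_comm (analyticAt_pd (X.analytic v hv) γ) α β

lemma eta_mul_inv : X.η * X.η⁻¹ = 1 := Matrix.mul_nonsing_inv _ X.nondeg

lemma inv_mul_eta : X.η⁻¹ * X.η = 1 := Matrix.nonsing_inv_mul _ X.nondeg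

lemma inv_symm : X.η⁻¹.transpose = X.η⁻¹ := by
  rw [Matrix.transpose_nonsing_inv, X.symm.eq]

lemma eta_mul_inv_assoc (A : Matrix (Fin n) (Fin n) ℂ) : X.η * (X.η⁻¹ * A) = A := by
  rw [← Matrix.mul_assoc, X.eta_mul_inv, Matrix.one_mul]

lemma inv_mul_eta_assoc (A : Matrix (Fin n) (Fin n) ℂ) : X.η⁻¹ * (X.η * A) = A := by
  rw [← Matrix.mul_assoc, X.inv_mul_eta, Matrix.one_mul]

lemma eta_mul_C (γ : Fin n) (v : Fin n → ℂ) :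
    X.η * X.C γ v = Matrix.of fun α β => pd α (pd γ (pd β X.F)) v := by
  have : X.C γ v = X.η⁻¹ * Matrix.of fun α β => pd α (pd γ (pd β X.F)) v := by
    ext α β; simp [C, Matrix.mul_apply]
  rw [this, X.eta_mul_inv_assoc]

lemma C_symm (hv : v ∈ X.M) (γ α β : Fin n) : X.C γ v α β = X.C β v α γ := by
  simp only [C, X.third_swap_inner hv _ γ β]

lemma C_zero (hv : v ∈ X.M) : X.C 0 v = 1 := by
  rw [← X.inv_mul_eta_assoc (X.C 0 v), eta_mul_C]
  have : (Matrix.of fun α β => pd α (pd 0 (pd β X.F)) v) = X.η := by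
    ext α β
    simp only [Matrix.of_apply]
    rw [X.third_swap_outer hv, X.unit v hv]
  rw [this, X.inv_mul_eta]

lemma C_comm (hv : v ∈ X.M) (γ δ : Fin n) : X.C γ v * X.C δ v = X.C δ v * X.C γ v := by
  have h : ∀ γ δ α β, (X.η * X.C γ v * X.C δ v) α β = ∑ ε, ∑ ζ, pd α (pd γ (pd ε X.F)) v *
      X.η⁻¹ ε ζ * pd ζ (pd δ (pd β X.F)) v := by
    intro γ δ α β
    rw [eta_mul_C, Matrix.mul_apply]
    refine sum_congr rfl fun ε _ => ?_
    simp only [Matrix.of_apply, C, mul_sum, mul_assoc]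
  suffices hs : X.η * X.C γ v * X.C δ v = X.η * X.C δ v * X.C γ v by
    rw [← X.inv_mul_eta_assoc (X.C γ v * X.C δ v), ← X.inv_mul_eta_assoc (X.C δ v * X.C γ v),
      ← Matrix.mul_assoc X.η, hs, ← Matrix.mul_assoc X.η]
  ext α β
  rw [h, h, X.assoc v hv, sum_comm]
  refine sum_congr rfl fun ε _ => sum_congr rfl fun ζ _ => ?_
  have h1 : X.η⁻¹ ζ ε = X.η⁻¹ ε ζ := congrFun (congrFun X.inv_symm ε) ζ
  rw [h1, X.third_swap_outer hv β γ ζ, X.third_swap_inner hv γ β ζ, X.third_swap_outer hv γ ζ β,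
    X.third_swap_inner hv ε δ α, X.third_swap_outer hv ε α δ, X.third_swap_inner hv α ε δ]
  ring

lemma adj_mul (A B : Matrix (Fin n) (Fin n) ℂ) : X.adj (A * B) = X.adj B * X.adj A := by
  simp only [adj, Matrix.transpose_mul, Matrix.mul_assoc, X.eta_mul_inv_assoc]

lemma adj_add (A B : Matrix (Fin n) (Fin n) ℂ) : X.adj (A + B) = X.adj A + X.adj B := by
  simp [adj, Matrix.mul_add, Matrix.add_mul]

lemma adj_smul (a : ℂ) (A : Matrix (Fin n) (Fin n) ℂ) : X.adj (a • A) = a • X.adj A := by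
  simp [adj]

lemma adj_one : X.adj 1 = 1 := by simp [adj, X.inv_mul_eta]

lemma adj_zero : X.adj 0 = 0 := by simp [adj]

lemma adj_sub (A B : Matrix (Fin n) (Fin n) ℂ) : X.adj (A - B) = X.adj A - X.adj B := by
  simp [adj, Matrix.mul_sub, Matrix.sub_mul]

lemma adj_sum {ι : Type*} (s : Finset ι) (A : ι → Matrix (Fin n) (Fin n) ℂ) :
    X.adj (∑ i ∈ s, A i) = ∑ i ∈ s, X.adj (A i) := by
  simp [adj, Matrix.transpose_sum, mul_sum, sum_mul]

/-- `Aᵀ = η A^* η⁻¹`. -/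
lemma transpose_eq (A : Matrix (Fin n) (Fin n) ℂ) : A.transpose = X.η * X.adj A * X.η⁻¹ := by
  simp only [adj, Matrix.mul_assoc, X.eta_mul_inv, X.eta_mul_inv_assoc, Matrix.mul_one]

lemma adj_C (hv : v ∈ X.M) (γ : Fin n) : X.adj (X.C γ v) = X.C γ v := by
  have h : (X.C γ v).transpose * X.η = X.η * X.C γ v := by
    have h1 : (X.η * X.C γ v).transpose = X.η * X.C γ v := by
      rw [eta_mul_C]
      ext α β
      simp only [Matrix.transpose_apply, Matrix.of_apply]
      rw [X.third_swap_inner hv, X.third_swap_outer hv, X.third_swap_inner hv]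
    rw [Matrix.transpose_mul, X.symm.eq] at h1
    exact h1
  rw [adj, Matrix.mul_assoc, h, X.inv_mul_eta_assoc]

lemma adj_mulBy (hv : v ∈ X.M) (x : Fin n → ℂ) : X.adj (X.mulBy x v) = X.mulBy x v := by
  simp only [mulBy, adj_sum, adj_smul, X.adj_C hv]

lemma mulBy_comm (hv : v ∈ X.M) (x y : Fin n → ℂ) :
    X.mulBy x v * X.mulBy y v = X.mulBy y v * X.mulBy x v := by
  simp only [mulBy, sum_mul, mul_sum, Matrix.smul_mul, Matrix.mul_smul]
  rw [sum_comm]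
  refine sum_congr rfl fun γ _ => sum_congr rfl fun δ _ => ?_
  rw [X.C_comm hv, smul_comm]

lemma mulBy_single (γ : Fin n) (v : Fin n → ℂ) : X.mulBy (Pi.single γ 1) v = X.C γ v := by
  simp [mulBy, Pi.single_apply]

lemma mulBy_mulVec (hv : v ∈ X.M) (x y : Fin n → ℂ) :
    (X.mulBy x v).mulVec y = (X.mulBy y v).mulVec x := by
  ext α
  simp only [mulBy, Matrix.mulVec, dotProduct, Matrix.sum_apply, Matrix.smul_apply, smul_eq_mul,
    sum_mul]
  rw [sum_comm]
  refine sum_congr rfl fun β _ => sum_congr rfl fun γ _ => ?_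
  rw [X.C_symm hv]; ring

lemma mulBy_add (x y : Fin n → ℂ) (v : Fin n → ℂ) :
    X.mulBy (x + y) v = X.mulBy x v + X.mulBy y v := by
  simp [mulBy, add_smul, sum_add_distrib]

lemma mulBy_smul (a : ℂ) (x : Fin n → ℂ) (v : Fin n → ℂ) :
    X.mulBy (a • x) v = a • X.mulBy x v := by
  simp [mulBy, smul_sum, smul_smul]

/-- The unit vector `e`. -/
def e : Fin n → ℂ := Pi.single 0 1

lemma mulBy_e (hv : v ∈ X.M) : X.mulBy e v = 1 := by
  rw [e, mulBy_single, X.C_zero hv]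

lemma mulBy_mulVec_e (hv : v ∈ X.M) (x : Fin n → ℂ) : (X.mulBy x v).mulVec e = x := by
  rw [X.mulBy_mulVec hv, X.mulBy_e hv, Matrix.one_mulVec]

/-- The operators of multiplication are closed under products. -/
lemma mulBy_mul_mulBy (hv : v ∈ X.M) (x y : Fin n → ℂ) :
    X.mulBy x v * X.mulBy y v = X.mulBy ((X.mulBy x v).mulVec y) v := by
  have h : ∀ z, (X.mulBy x v * X.mulBy y v).mulVec z =
      (X.mulBy ((X.mulBy x v).mulVec y) v).mulVec z := by
    intro z
    rw [X.mulBy_mulVec hv _ z, Matrix.mulVec_mulVec, ← X.mulBy_comm hv x z, ← Matrix.mulVec_mulVec,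
      ← Matrix.mulVec_mulVec, X.mulBy_mulVec hv y z]
  exact Matrix.ext_of_mulVec_single fun i => h _

lemma analyticAt_C (hv : v ∈ X.M) (γ α β : Fin n) : AnalyticAt ℂ (fun u => X.C γ u α β) v := by
  unfold C
  exact analyticAt_fun_sum _ fun ε _ => analyticAt_const.fun_mul
    (analyticAt_pd (analyticAt_pd (analyticAt_pd (X.analytic v hv) β) γ) ε)

lemma U_comm_C (hv : v ∈ X.M) (γ : Fin n) : X.U v * X.C γ v = X.C γ v * X.U v := by
  rw [← mulBy_single, U, X.mulBy_comm hv]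

lemma adj_U (hv : v ∈ X.M) : X.adj (X.U v) = X.U v := X.adj_mulBy hv _

lemma analyticAt_U (hv : v ∈ X.M) (α β : Fin n) : AnalyticAt ℂ (fun u => X.U u α β) v := by
  have : (fun u => X.U u α β) = fun u => ∑ γ, X.E u γ * X.C γ u α β := by
    funext u; simp [U, mulBy, Matrix.sum_apply]
  rw [this]
  refine analyticAt_fun_sum _ fun γ _ => AnalyticAt.fun_mul ?_ (X.analyticAt_C hv γ α β)
  unfold E
  refine AnalyticAt.fun_add (analyticAt_fun_sum _ fun δ _ => analyticAt_const.fun_mul ?_)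
    analyticAt_const
  exact (ContinuousLinearMap.proj (R := ℂ) (φ := fun _ : Fin n => ℂ) δ).analyticAt _

end FrobeniusManifold

namespace Calibration

variable {n : ℕ} [NeZero n] {X : FrobeniusManifold n} {v : Fin n → ℂ}

lemma adj_V (c : Calibration X) : X.adj X.V = -X.V := by
  have h := c.adj_R 0
  simp only [zero_add, pow_one, neg_smul, one_smul] at h
  rw [c.splitting, X.adj_add, c.adj_μ, h, neg_add]

lemma pd_U (c : Calibration X) (hv : v ∈ X.M) (γ α β : Fin n) :
    pd γ (fun u => X.U u α β) v = (X.C γ v + (X.C γ v * X.V - X.V * X.C γ v)) α β := by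
  have h0 : ∀ u ∈ X.M, X.U u α β = c.Θ 1 u α β +
      ((∑ σ, c.Θ 1 u α σ * X.V σ β) + ∑ σ, (-X.V α σ) * c.Θ 1 u σ β) + c.R 1 α β := by
    intro u hu
    have h := congrFun (congrFun (c.homogeneous u hu 0) α) β
    simp only [Nat.cast_zero, zero_add, one_smul, Finset.range_one, Finset.sum_singleton,
      c.zero u hu, Matrix.mul_one, Matrix.one_mul, Matrix.add_apply,
      Matrix.sub_apply, Matrix.mul_apply] at h
    simp only [neg_mul, sum_neg_distrib]
    linear_combination -h
  have hA : ∀ α β, AnalyticAt ℂ (fun u => c.Θ 1 u α β) v := fun α β => c.analytic 1 α β v hv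
  have hp : ∀ α β, pd γ (fun u => c.Θ 1 u α β) v = X.C γ v α β := fun α β => by
    rw [c.flat v hv 0, c.zero v hv, Matrix.mul_one]
  rw [pd_congr X.isOpen h0 γ v hv]
  have h1 : AnalyticAt ℂ (fun u => ∑ σ, c.Θ 1 u α σ * X.V σ β) v :=
    analyticAt_fun_sum _ fun σ _ => (hA α σ).fun_mul analyticAt_const
  have h2 : AnalyticAt ℂ (fun u => ∑ σ, (-X.V α σ) * c.Θ 1 u σ β) v :=
    analyticAt_fun_sum _ fun σ _ => analyticAt_const.fun_mul (hA σ β)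
  rw [pd_add ((hA α β).fun_add (h1.fun_add h2)) analyticAt_const, pd_const,
    pd_add (hA α β) (h1.fun_add h2), pd_add h1 h2,
    pd_sum _ fun σ _ => (hA α σ).fun_mul analyticAt_const,
    pd_sum _ fun σ _ => analyticAt_const.fun_mul (hA σ β), hp]
  simp only [pd_mul (hA _ _) analyticAt_const, pd_const_mul _ (hA _ _), pd_const, hp,
    Matrix.add_apply, Matrix.sub_apply, Matrix.mul_apply, mul_zero, add_zero]
  simp only [neg_mul, sum_neg_distrib]
  ring

end Calibration

/-! ### Waves -/

section Waves

variable {n : ℕ} [NeZero n] (X : FrobeniusManifold n)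

/-- A sequence of vector fields `w_i` on `D` with `∂_γ w_i = ∂_γ · w_{i+1}`. -/
structure IsWave (D : Set (Fin n → ℂ)) (w : ℕ → (Fin n → ℂ) → Fin n → ℂ) : Prop where
  analytic : ∀ i σ, ∀ v ∈ D, AnalyticAt ℂ (fun u => w i u σ) v
  deriv : ∀ i γ σ, ∀ v ∈ D, pd γ (fun u => w i u σ) v = (X.C γ v).mulVec (w (i + 1) v) σ

variable {X} in
lemma IsWave.shift {D : Set (Fin n → ℂ)} {w : ℕ → (Fin n → ℂ) → Fin n → ℂ} (h : IsWave X D w) :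
    IsWave X D fun i => w (i + 1) :=
  ⟨fun i => h.analytic (i + 1), fun i => h.deriv (i + 1)⟩

/-- The coefficients in `∂_x^k w_0 = ∑_i M_{k,i} w_i` for waves `w`. -/
def waveCoeff : ℕ → ℕ → Fin n → Fin n → Jet n → ℂ
  | 0, i, γ, σ => fun _ => if i = 0 ∧ γ = σ then 1 else 0
  | k + 1, 0, γ, σ => Dx (waveCoeff k 0 γ σ)
  | k + 1, i + 1, γ, σ => fun j => Dx (waveCoeff k (i + 1) γ σ) j +
      ∑ τ, waveCoeff k i γ τ j * X.mulBy (j 1) (j 0) τ σ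

lemma waveCoeff_eq_zero {k i : ℕ} (h : k < i) (γ σ : Fin n) :
    waveCoeff X k i γ σ = fun _ => 0 := by
  induction k generalizing i γ σ with
  | zero => simp [waveCoeff, show i ≠ 0 by omega]
  | succ k ih =>
    obtain ⟨i, rfl⟩ : ∃ l, i = l + 1 := ⟨i - 1, by omega⟩
    simp only [waveCoeff]
    rw [ih (by omega), Dx_const]
    funext j
    simp [ih (show k < i by omega)]

variable {O : Set (Jet n)}

lemma jetAnalyticOn_mulBy (hM : ∀ j ∈ O, j 0 ∈ X.M) (τ σ : Fin n) :
    JetAnalyticOn O fun j => X.mulBy (j 1) (j 0) τ σ := by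
  have : (fun j : Jet n => X.mulBy (j 1) (j 0) τ σ) = fun j => ∑ γ, j 1 γ * X.C γ (j 0) τ σ := by
    funext j; simp [FrobeniusManifold.mulBy, Matrix.sum_apply]
  rw [this]
  exact .sum _ fun γ _ => .mul (.coord 1 γ) (.comp_base (f := fun v => X.C γ v τ σ)
    fun j hj => X.analyticAt_C (hM j hj) γ τ σ)

lemma jetAnalyticOn_waveCoeff (hM : ∀ j ∈ O, j 0 ∈ X.M) (k i : ℕ) (γ σ : Fin n) :
    JetAnalyticOn O (waveCoeff X k i γ σ) := by
  induction k generalizing i γ σ with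
  | zero => exact .const _
  | succ k ih =>
    cases i with
    | zero => exact (ih 0 γ σ).Dx
    | succ i => exact (ih _ γ σ).Dx.add (.sum _ fun τ _ => (ih i γ τ).mul
        (jetAnalyticOn_mulBy X hM τ σ))

variable {X} in
lemma IsWave.jetAnalyticOn {D : Set (Fin n → ℂ)} {w : ℕ → (Fin n → ℂ) → Fin n → ℂ}
    (h : IsWave X D w) (hD : ∀ j ∈ O, j 0 ∈ D) (i : ℕ) (σ : Fin n) :
    JetAnalyticOn O fun j => w i (j 0) σ :=
  .comp_base (f := fun v => w i v σ) fun j hj => h.analytic i σ _ (hD j hj)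

variable {X} in
lemma IsWave.Dx {D : Set (Fin n → ℂ)} {w : ℕ → (Fin n → ℂ) → Fin n → ℂ}
    (h : IsWave X D w) {j : Jet n} (hD : j 0 ∈ D) (i : ℕ) (σ : Fin n) :
    Dx (fun j => w i (j 0) σ) j = ∑ τ, X.mulBy (j 1) (j 0) σ τ * w (i + 1) (j 0) τ := by
  rw [Dx_comp_base (fun v => w i v σ) (h.analytic i σ _ hD)]
  simp only [h.deriv i _ σ _ hD, Matrix.mulVec, dotProduct, FrobeniusManifold.mulBy,
    Matrix.sum_apply, Matrix.smul_apply, smul_eq_mul, sum_mul]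
  rw [sum_comm]
  exact sum_congr rfl fun _ _ => sum_congr rfl fun _ _ => by ring

variable {X} in
/-- The total derivatives of a wave. -/
lemma IsWave.iterate_Dx {D : Set (Fin n → ℂ)} {w : ℕ → (Fin n → ℂ) → Fin n → ℂ}
    (h : IsWave X D w) (hO : IsOpen O) (hM : ∀ j ∈ O, j 0 ∈ X.M) (hD : ∀ j ∈ O, j 0 ∈ D)
    (k : ℕ) (γ : Fin n) : ∀ j ∈ O, LoopEq.Dx^[k] (fun j => w 0 (j 0) γ) j =
      ∑ i ∈ Finset.range (k + 1), ∑ σ, waveCoeff X k i γ σ j * w i (j 0) σ := by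
  induction k with
  | zero => intro j _; simp [waveCoeff]
  | succ k ih =>
    intro j hj
    have hw := fun i σ => h.jetAnalyticOn hD i σ
    have hc := fun i σ => jetAnalyticOn_waveCoeff X hM k i γ σ
    rw [Function.iterate_succ_apply', Dx_congr hO ih j hj,
      Dx_sum _ fun i _ => (JetAnalyticOn.sum _ fun σ _ => (hc i σ).mul (hw i σ)) j hj]
    have h1 : ∀ i, LoopEq.Dx (fun j => ∑ σ, waveCoeff X k i γ σ j * w i (j 0) σ) j =
        ∑ σ, LoopEq.Dx (waveCoeff X k i γ σ) j * w i (j 0) σ +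
        ∑ σ, (∑ τ, waveCoeff X k i γ τ j * X.mulBy (j 1) (j 0) τ σ) * w (i + 1) (j 0) σ := by
      intro i
      rw [Dx_sum _ fun σ _ => ((hc i σ).mul (hw i σ)) j hj]
      simp only [Dx_mul (hc i _ j hj) (hw i _ j hj), h.Dx (hD j hj), sum_add_distrib]
      congr 1
      simp only [mul_sum, sum_mul]
      rw [sum_comm]
      exact sum_congr rfl fun _ _ => sum_congr rfl fun _ _ => by ring
    simp only [h1, sum_add_distrib]
    rw [sum_range_succ' (fun i => ∑ σ, waveCoeff X (k + 1) i γ σ j * w i (j 0) σ)]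
    simp only [waveCoeff, add_mul, sum_add_distrib]
    have h2 : ∑ i ∈ Finset.range (k + 1), ∑ σ, LoopEq.Dx (waveCoeff X k (i + 1) γ σ) j *
        w (i + 1) (j 0) σ + ∑ σ, LoopEq.Dx (waveCoeff X k 0 γ σ) j * w 0 (j 0) σ =
        ∑ i ∈ Finset.range (k + 1), ∑ σ, LoopEq.Dx (waveCoeff X k i γ σ) j * w i (j 0) σ := by
      rw [← sum_range_succ' (fun i => ∑ σ, LoopEq.Dx (waveCoeff X k i γ σ) j *
        w i (j 0) σ), sum_range_succ _ (k + 1)]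
      simp [waveCoeff_eq_zero X (show k < k + 1 by omega), Dx_const]
    rw [← h2]; ring

/-- The waves `(Θ_p, Θ_{p-1}, …, Θ_0, 0, …)`. -/
def thetaWave (c : Calibration X) (a : Time n) (i : ℕ) (v : Fin n → ℂ) (σ : Fin n) : ℂ :=
  if i ≤ a.2 then c.Θ (a.2 - i) v σ a.1 else 0

lemma isWave_thetaWave (c : Calibration X) (a : Time n) : IsWave X X.M (thetaWave X c a) := by
  constructor
  · intro i σ v hv
    by_cases h : i ≤ a.2
    · simpa only [thetaWave, h, if_true] using c.analytic _ σ a.1 v hv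
    · simp only [thetaWave, h, if_false]; exact analyticAt_const
  · intro i γ σ v hv
    by_cases h : i + 1 ≤ a.2
    · have h1 : i ≤ a.2 := by omega
      have h2 : a.2 - i = a.2 - (i + 1) + 1 := by omega
      have h3 : (fun u => thetaWave X c a i u σ) = fun u => c.Θ (a.2 - (i + 1) + 1) u σ a.1 := by
        funext u; simp only [thetaWave, h1, if_true, h2]
      rw [h3, c.flat v hv, Matrix.mul_apply]
      simp only [Matrix.mulVec, dotProduct, thetaWave, h, if_true]
    · have h3 : (X.C γ v).mulVec (thetaWave X c a (i + 1) v) σ = 0 := by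
        simp [Matrix.mulVec, dotProduct, thetaWave, h]
      rw [h3]
      by_cases h1 : i ≤ a.2
      · have h2 : a.2 - i = 0 := by omega
        simp only [thetaWave, h1, if_true, h2]
        rw [pd_congr X.isOpen (g := fun _ => (1 : Matrix (Fin n) (Fin n) ℂ) σ a.1)
          (fun u hu => by rw [c.zero u hu]) γ v hv, pd_const]
      · simp only [thetaWave, h1, if_false, pd_const]

end Waves

/-! ### The Virasoro coefficients -/

section Antidiagonal

variable {A : Type*} [AddCommMonoid A]

lemma sum_antidiagonal_assoc (f : ℕ → ℕ → ℕ → A) (N : ℕ) :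
    ∑ x ∈ antidiagonal N, ∑ y ∈ antidiagonal x.2, f x.1 y.1 y.2 =
      ∑ x ∈ antidiagonal N, ∑ y ∈ antidiagonal x.1, f y.1 y.2 x.2 := by
  rw [Finset.sum_sigma', Finset.sum_sigma']
  refine Finset.sum_nbij' (fun x => ⟨(x.1.1 + x.2.1, x.2.2), (x.1.1, x.2.1)⟩)
    (fun x => ⟨(x.2.1, x.2.2 + x.1.2), (x.2.2, x.1.2)⟩) ?_ ?_ ?_ ?_ ?_
  · rintro ⟨⟨a, b⟩, ⟨s, t⟩⟩ h
    simp only [Finset.mem_sigma, mem_antidiagonal] at h ⊢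
    obtain ⟨h1, h2⟩ := h
    exact ⟨by omega, trivial⟩
  · rintro ⟨⟨a, b⟩, ⟨s, t⟩⟩ h
    simp only [Finset.mem_sigma, mem_antidiagonal] at h ⊢
    obtain ⟨h1, h2⟩ := h
    exact ⟨by omega, trivial⟩
  · rintro ⟨⟨a, b⟩, ⟨s, t⟩⟩ h
    simp only [Finset.mem_sigma, mem_antidiagonal] at h
    obtain ⟨h1, rfl⟩ := h
    rfl
  · rintro ⟨⟨a, b⟩, ⟨s, t⟩⟩ h
    simp only [Finset.mem_sigma, mem_antidiagonal] at h
    obtain ⟨h1, rfl⟩ := h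
    rfl
  · rintro ⟨⟨a, b⟩, ⟨s, t⟩⟩ _
    rfl

lemma sum_antidiagonal_swap (f : ℕ → ℕ → ℕ → A) (N : ℕ) :
    ∑ x ∈ antidiagonal N, ∑ y ∈ antidiagonal x.2, f x.1 y.1 y.2 =
      ∑ x ∈ antidiagonal N, ∑ y ∈ antidiagonal x.2, f y.1 x.1 y.2 := by
  rw [sum_antidiagonal_assoc, sum_antidiagonal_assoc (fun a b c => f b a c)]
  refine sum_congr rfl fun x _ => ?_
  exact (Finset.Nat.sum_antidiagonal_swap (f := fun y => f y.1 y.2 x.2)).symm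

end Antidiagonal

namespace Calibration

variable {n : ℕ} [NeZero n] {X : FrobeniusManifold n} (c : Calibration X)

/-- The part of degree `r` of `R^i`. -/
def Rpow (i r : ℕ) : Matrix (Fin n) (Fin n) ℂ := PowerSeries.coeff r ((PowerSeries.mk c.R) ^ i)

lemma Rpow_zero (r : ℕ) : c.Rpow 0 r = if r = 0 then 1 else 0 := by
  simp [Rpow, PowerSeries.coeff_one]

lemma Rpow_succ (i r : ℕ) :
    c.Rpow (i + 1) r = ∑ x ∈ antidiagonal r, c.R x.1 * c.Rpow i x.2 := by
  simp [Rpow, pow_succ', PowerSeries.coeff_mul]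

lemma Rpow_mul_mu (i r : ℕ) : c.Rpow i r * c.μ = c.μ * c.Rpow i r - (r : ℂ) • c.Rpow i r := by
  induction i generalizing r with
  | zero =>
    rw [Rpow_zero]
    split_ifs with h <;> simp [h]
  | succ i ih =>
    rw [Rpow_succ, sum_mul, mul_sum, smul_sum, ← Finset.sum_sub_distrib]
    refine sum_congr rfl fun x hx => ?_
    have hg : c.μ * c.R x.1 = c.R x.1 * c.μ + (x.1 : ℂ) • c.R x.1 := by
      rw [← c.grading x.1]; abel
    rw [Matrix.mul_assoc, ih, ← Matrix.mul_assoc c.μ, hg,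
      ← mem_antidiagonal.1 hx]
    simp only [Matrix.mul_sub, Matrix.add_mul, Matrix.smul_mul, Matrix.mul_smul, Nat.cast_add,
      add_smul, Matrix.mul_assoc]
    abel

/-- The polynomial `∏_{l < m} (y - q + l)`. -/
def virPoly (m : ℕ) (q : ℂ) : Polynomial ℂ :=
  ∏ l ∈ Finset.range m, (Polynomial.X - Polynomial.C q + Polynomial.C (l : ℂ))

lemma natDegree_virPoly (m : ℕ) (q : ℂ) : (virPoly m q).natDegree ≤ m := by
  refine (Polynomial.natDegree_prod_le _ _).trans ?_
  refine (Finset.sum_le_card_nsmul _ _ 1 fun l _ => ?_).trans (by simp)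
  have : Polynomial.X - Polynomial.C q + Polynomial.C (l : ℂ) =
      Polynomial.X - Polynomial.C (q - l) := by
    rw [Polynomial.C_sub]; ring
  rw [this, Polynomial.natDegree_X_sub_C]

lemma virN_eq (m : ℕ) (q : ℂ) (r : ℕ) : c.virN m q r = ∑ i ∈ Finset.range (m + 1),
    c.Rpow i r * Polynomial.aeval c.μ (Polynomial.hasseDeriv i (virPoly m q)) := rfl

lemma virN_zero (q : ℂ) (r : ℕ) : c.virN 0 q r = if r = 0 then 1 else 0 := by
  rw [virN_eq]
  simp [virPoly, Rpow_zero]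

lemma hasseDeriv_mul_linear (P : Polynomial ℂ) (a : ℂ) (i : ℕ) :
    Polynomial.hasseDeriv (i + 1) (P * (Polynomial.X + Polynomial.C a)) =
      Polynomial.hasseDeriv (i + 1) P * (Polynomial.X + Polynomial.C a) +
        Polynomial.hasseDeriv i P := by
  rw [Polynomial.hasseDeriv_mul, Finset.Nat.sum_antidiagonal_succ', Finset.sum_eq_single (i, 0)]
  · simp
  · rintro ⟨a, b⟩ h1 h2
    have h1 := mem_antidiagonal.1 h1
    have : b ≠ 0 := by rintro rfl; simp_all
    rw [Polynomial.hasseDeriv_eq_zero_of_lt_natDegree (Polynomial.X + Polynomial.C _), mul_zero]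
    simp only [Polynomial.natDegree_X_add_C]; omega
  · simp

/-- Appending a factor on the left. -/
lemma virN_succ (m : ℕ) (q : ℂ) (r : ℕ) : c.virN (m + 1) q r =
    c.μ * c.virN m q r + ((m : ℂ) - q - r) • c.virN m q r +
      ∑ x ∈ antidiagonal r, c.R x.1 * c.virN m q x.2 := by
  have hP : virPoly (m + 1) q = virPoly m q * (Polynomial.X + Polynomial.C ((m : ℂ) - q)) := by
    rw [virPoly, Finset.prod_range_succ, virPoly, Polynomial.C_sub]; ring
  have h2 : ∑ x ∈ antidiagonal r, c.R x.1 * c.virN m q x.2 =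
      ∑ i ∈ Finset.range (m + 1), c.Rpow (i + 1) r *
        Polynomial.aeval c.μ (Polynomial.hasseDeriv i (virPoly m q)) := by
    simp only [virN_eq, Rpow_succ, mul_sum, sum_mul, Matrix.mul_assoc]
    rw [sum_comm]
  have h1 : c.μ * c.virN m q r + ((m : ℂ) - q - r) • c.virN m q r =
      ∑ i ∈ Finset.range (m + 2), c.Rpow i r *
        Polynomial.aeval c.μ (Polynomial.hasseDeriv i (virPoly m q) *
          (Polynomial.X + Polynomial.C ((m : ℂ) - q))) := by
    rw [sum_range_succ, Polynomial.hasseDeriv_eq_zero_of_lt_natDegree _ _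
      (Nat.lt_succ_of_le (natDegree_virPoly m q)), zero_mul, map_zero, mul_zero, add_zero, virN_eq,
      mul_sum, smul_sum, ← sum_add_distrib]
    refine sum_congr rfl fun i _ => ?_
    rw [mul_comm (Polynomial.hasseDeriv i _), map_mul, ← Matrix.mul_assoc (c.Rpow i r)]
    simp only [map_add, Polynomial.aeval_X, Polynomial.aeval_C, Matrix.mul_add,
      Algebra.algebraMap_eq_smul_one, Matrix.mul_smul, Matrix.one_mul, Matrix.add_mul,
      Matrix.smul_mul, Rpow_mul_mu, Matrix.sub_mul, Matrix.mul_sub, Matrix.mul_assoc, sub_smul]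
    abel
  rw [h1, h2, virN_eq, sum_range_succ' _ (m + 1), sum_range_succ' _ (m + 1)]
  simp only [hP, hasseDeriv_mul_linear, map_add, Matrix.mul_add, sum_add_distrib,
    Polynomial.hasseDeriv_zero, LinearMap.id_apply]
  abel

/-- Appending a factor on the right. -/
lemma virN_succ' (m : ℕ) (q : ℂ) (r : ℕ) : c.virN (m + 1) q r =
    c.virN m (q - 1) r * c.μ - q • c.virN m (q - 1) r +
      ∑ x ∈ antidiagonal r, c.virN m (q - 1 + x.1) x.2 * c.R x.1 := by
  induction m generalizing q r with
  | zero =>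
    rw [virN_succ]
    simp only [virN_zero]
    have h1 : ∀ x ∈ antidiagonal r, c.R x.1 * (if x.2 = 0 then (1 : Matrix (Fin n) (Fin n) ℂ)
        else 0) = (if x.2 = 0 then 1 else 0) * c.R x.1 := by
      intro x _; split_ifs <;> simp
    rw [sum_congr rfl h1]
    split_ifs with h
    · simp [h, sub_eq_add_neg]
    · simp
  | succ m ih =>
    rw [virN_succ, ih q r, sum_congr (g := fun x : ℕ × ℕ => c.R x.1 * _) rfl
      fun x _ => congrArg (c.R x.1 * ·) (ih q x.2)]
    have e1 : ∀ q r, c.virN (m + 1) q r = c.μ * c.virN m q r + ((m : ℂ) - q - r) • c.virN m q r +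
      ∑ x ∈ antidiagonal r, c.R x.1 * c.virN m q x.2 := fun q r => c.virN_succ m q r
    have e2 : ∑ x ∈ antidiagonal r, c.virN (m + 1) (q - 1 + x.1) x.2 * c.R x.1 =
        c.μ * (∑ x ∈ antidiagonal r, c.virN m (q - 1 + x.1) x.2 * c.R x.1) +
        ((m : ℂ) + 1 - q - r) • (∑ x ∈ antidiagonal r, c.virN m (q - 1 + x.1) x.2 * c.R x.1) +
        ∑ x ∈ antidiagonal r, ∑ y ∈ antidiagonal x.2,
          c.R y.1 * (c.virN m (q - 1 + x.1) y.2 * c.R x.1) := by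
      rw [mul_sum, smul_sum, ← sum_add_distrib, ← sum_add_distrib]
      refine sum_congr rfl fun x hx => ?_
      rw [e1, Matrix.add_mul, Matrix.add_mul, sum_mul, Matrix.mul_assoc, Matrix.smul_mul]
      congr 2
      · congr 1
        rw [← mem_antidiagonal.1 hx]
        push_cast; ring
      · funext y; rw [Matrix.mul_assoc]
    have e3 : ∑ x ∈ antidiagonal r, c.R x.1 * (c.virN m (q - 1) x.2 * c.μ -
        q • c.virN m (q - 1) x.2 + ∑ y ∈ antidiagonal x.2, c.virN m (q - 1 + y.1) y.2 * c.R y.1) =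
        (∑ x ∈ antidiagonal r, c.R x.1 * c.virN m (q - 1) x.2) * c.μ -
        q • (∑ x ∈ antidiagonal r, c.R x.1 * c.virN m (q - 1) x.2) +
        ∑ x ∈ antidiagonal r, ∑ y ∈ antidiagonal x.2,
          c.R y.1 * (c.virN m (q - 1 + x.1) y.2 * c.R x.1) := by
      rw [sum_antidiagonal_swap (fun a b d => c.R b * (c.virN m (q - 1 + a) d * c.R a))]
      simp only [Matrix.mul_add, Matrix.mul_sub, sum_add_distrib, Finset.sum_sub_distrib,
        sum_mul, smul_sum, mul_sum, Matrix.mul_assoc, Matrix.mul_smul]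
    rw [e2, e3, e1 (q - 1) r]
    set N := c.virN m (q - 1) r
    set A := ∑ x ∈ antidiagonal r, c.R x.1 * c.virN m (q - 1) x.2
    set B := ∑ x ∈ antidiagonal r, c.virN m (q - 1 + x.1) x.2 * c.R x.1
    have hs : ((m + 1 : ℕ) : ℂ) - q - r = (m : ℂ) + 1 - q - r := by push_cast; ring
    have hs' : (m : ℂ) - (q - 1) - r = (m : ℂ) + 1 - q - r := by ring
    rw [hs, hs']
    simp only [Matrix.mul_add, Matrix.add_mul, Matrix.mul_sub, Matrix.mul_assoc, Matrix.smul_mul,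
      Matrix.mul_smul, smul_add, smul_sub, smul_comm q]
    abel

lemma adj_virN (m : ℕ) (q : ℂ) (r : ℕ) :
    X.adj (c.virN m q r) = (-1 : ℂ) ^ (r + m) • c.virN m ((m : ℂ) - 1 - r - q) r := by
  induction m generalizing q r with
  | zero =>
    rw [virN_zero, virN_zero]
    split_ifs with h
    · simp [h, X.adj_one]
    · simp [X.adj_zero]
  | succ m ih =>
    rw [virN_succ, virN_succ', X.adj_add, X.adj_add, X.adj_mul, X.adj_smul, X.adj_sum, c.adj_μ, ih]
    simp only [X.adj_mul, ih, c.adj_R]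
    have hQ : ((m + 1 : ℕ) : ℂ) - 1 - r - q - 1 = (m : ℂ) - 1 - r - q := by push_cast; ring
    rw [hQ, smul_add, smul_sub, smul_sum, Matrix.smul_mul, Matrix.mul_neg]
    have h1 : ∀ x ∈ antidiagonal r,
        (-1 : ℂ) ^ (x.2 + m) • c.virN m ((m : ℂ) - 1 - x.2 - q) x.2 *
          (-1 : ℂ) ^ (x.1 + 1) • c.R x.1 =
        (-1 : ℂ) ^ (r + (m + 1)) • (c.virN m ((m : ℂ) - 1 - r - q + x.1) x.2 * c.R x.1) := by
      intro x hx
      have hx := mem_antidiagonal.1 hx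
      have h2 : (-1 : ℂ) ^ (x.2 + m) * (-1 : ℂ) ^ (x.1 + 1) = (-1 : ℂ) ^ (r + (m + 1)) := by
        rw [← hx]; ring
      have h3 : (m : ℂ) - 1 - x.2 - q = (m : ℂ) - 1 - r - q + x.1 := by
        rw [← hx]; push_cast; ring
      rw [Matrix.smul_mul, Matrix.mul_smul, smul_smul, h2, h3]
    rw [sum_congr rfl h1]
    have h4 : (-1 : ℂ) ^ (r + (m + 1)) = -(-1) ^ (r + m) := by ring
    have h5 : -(-1 : ℂ) ^ (r + m) * (((m + 1 : ℕ) : ℂ) - 1 - r - q) =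
        -((m - q - r) * (-1) ^ (r + m)) := by push_cast; ring
    rw [h4, smul_smul, smul_smul, h5, smul_neg, neg_smul, neg_smul, sub_neg_eq_add]

/-- The Levelt equation, including the term of degree zero. -/
lemma homogeneous_sum {v : Fin n → ℂ} (hv : v ∈ X.M) (k : ℕ) :
    (k : ℂ) • c.Θ k v + c.Θ k v * c.μ + ∑ x ∈ antidiagonal k, c.Θ x.1 v * c.R x.2 =
      (if k = 0 then 0 else X.U v * c.Θ (k - 1) v) + X.V * c.Θ k v := by
  cases k with
  | zero => simp [c.zero v hv, c.splitting]
  | succ p =>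
    have h := c.homogeneous v hv p
    have h2 : ∑ x ∈ antidiagonal (p + 1), c.Θ x.1 v * c.R x.2 = c.Θ (p + 1) v * c.R 0 +
        ∑ k ∈ Finset.range (p + 1), c.Θ (p - k) v * c.R (k + 1) := by
      rw [← Finset.Nat.sum_antidiagonal_swap, Finset.Nat.sum_antidiagonal_eq_sum_range_succ_mk,
        sum_range_succ']
      simp only [Prod.fst_swap, Prod.snd_swap, Nat.sub_zero, Nat.add_sub_add_right]
      abel
    rw [h2]
    simp only [Nat.succ_ne_zero, if_false, Nat.add_sub_cancel]
    have h3 : c.Θ (p + 1) v * X.V = c.Θ (p + 1) v * c.μ + c.Θ (p + 1) v * c.R 0 := by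
      rw [c.splitting, Matrix.mul_add]
    rw [h3] at h
    push_cast
    rw [eq_sub_iff_add_eq] at h
    rw [← h]
    abel

lemma orthogonal_sum {v : Fin n → ℂ} (hv : v ∈ X.M) (d : ℕ) :
    ∑ x ∈ antidiagonal d, (-1 : ℂ) ^ x.2 • (c.Θ x.1 v * X.adj (c.Θ x.2 v)) =
      if d = 0 then 1 else 0 := by
  let A : PowerSeries (Matrix (Fin n) (Fin n) ℂ) :=
    PowerSeries.mk fun i => (-1 : ℂ) ^ i • X.adj (c.Θ i v)
  let B : PowerSeries (Matrix (Fin n) (Fin n) ℂ) := PowerSeries.mk fun i => c.Θ i v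
  have hAB : A * B = 1 := by
    ext1 d
    rw [PowerSeries.coeff_mul, PowerSeries.coeff_one]
    simp only [A, B, PowerSeries.coeff_mk]
    split_ifs with h
    · subst h; simp [c.zero v hv, X.adj_one]
    · rw [Finset.Nat.sum_antidiagonal_eq_sum_range_succ_mk]
      simpa only [Matrix.smul_mul] using c.orthogonal v hv d (Nat.pos_of_ne_zero h)
  have hB : IsUnit B := by
    rw [PowerSeries.isUnit_iff_constantCoeff]
    simp [B, c.zero v hv]
  have hBA : B * A = 1 := by
    obtain ⟨u, hu⟩ := hB
    rw [← hu] at hAB ⊢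
    rw [show A = ↑u⁻¹ from Units.eq_inv_of_mul_eq_one_right hAB]
    exact u.mul_inv
  have := congrArg (PowerSeries.coeff d) hBA
  rw [PowerSeries.coeff_mul, PowerSeries.coeff_one] at this
  simpa only [A, B, PowerSeries.coeff_mk, Matrix.mul_smul] using this

/-- The coefficient of `z^{q+e}` in `∏_{l<m} (μ + R(z) - z∂_z + l)` applied to
`z^q (∑ (-1)^l Θ_l^* z^l)`. -/
def virInner (m : ℕ) (q : ℂ) (e : ℕ) (v : Fin n → ℂ) : Matrix (Fin n) (Fin n) ℂ :=
  ∑ x ∈ antidiagonal e, (-1 : ℂ) ^ x.1 • (c.virN m (x.1 + q) x.2 * X.adj (c.Θ x.1 v))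

lemma virInner_succ (m : ℕ) (q : ℂ) (e : ℕ) (v : Fin n → ℂ) : c.virInner (m + 1) q e v =
    c.μ * c.virInner m q e v + ((m : ℂ) - q - e) • c.virInner m q e v +
      ∑ x ∈ antidiagonal e, c.R x.1 * c.virInner m q x.2 v := by
  have h3 : ∑ x ∈ antidiagonal e, c.R x.1 * c.virInner m q x.2 v = ∑ x ∈ antidiagonal e,
      ∑ y ∈ antidiagonal x.2, (-1 : ℂ) ^ x.1 • (c.R y.1 * c.virN m (x.1 + q) y.2 *
        X.adj (c.Θ x.1 v)) := by
    rw [sum_antidiagonal_swap (fun a b d => (-1 : ℂ) ^ a • (c.R b * c.virN m (a + q) d *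
        X.adj (c.Θ a v)))]
    simp only [virInner, mul_sum, Matrix.mul_smul, Matrix.mul_assoc]
  rw [h3]
  simp only [virInner, mul_sum, smul_sum]
  rw [← sum_add_distrib, ← sum_add_distrib]
  refine sum_congr rfl fun x hx => ?_
  rw [virN_succ, Matrix.add_mul, Matrix.add_mul, sum_mul, smul_add, smul_add,
    smul_sum, Matrix.mul_smul, Matrix.mul_assoc, Matrix.smul_mul,
    smul_comm ((-1 : ℂ) ^ x.1) (_ : ℂ)]
  congr 3
  rw [← mem_antidiagonal.1 hx]
  push_cast; ring

/-- The coefficient of `z^{q+d}` in `Θ(z) ∏_{l<m} (μ + R(z) - z∂_z + l) z^q Θ(z)⁻¹`. -/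
def virXi (m : ℕ) (q : ℂ) (d : ℕ) (v : Fin n → ℂ) : Matrix (Fin n) (Fin n) ℂ :=
  ∑ x ∈ antidiagonal d, c.Θ x.1 v * c.virInner m q x.2 v

lemma virXi_zero {v : Fin n → ℂ} (hv : v ∈ X.M) (q : ℂ) (d : ℕ) :
    c.virXi 0 q d v = if d = 0 then 1 else 0 := by
  rw [← c.orthogonal_sum hv d, virXi]
  refine sum_congr rfl fun x _ => ?_
  have : c.virInner 0 q x.2 v = (-1 : ℂ) ^ x.2 • X.adj (c.Θ x.2 v) := by
    rw [virInner, Finset.sum_eq_single (x.2, 0)]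
    · simp [virN_zero]
    · rintro ⟨a, b⟩ h1 h2
      have h1 := mem_antidiagonal.1 h1
      have : b ≠ 0 := by rintro rfl; simp_all
      simp [virN_zero, this]
    · simp
  rw [this, Matrix.mul_smul]

lemma virXi_succ {v : Fin n → ℂ} (hv : v ∈ X.M) (m : ℕ) (q : ℂ) (d : ℕ) :
    c.virXi (m + 1) q d v = X.V * c.virXi m q d v + ((m : ℂ) - q - d) • c.virXi m q d v +
      if d = 0 then 0 else X.U v * c.virXi m q (d - 1) v := by
  have h1 : c.virXi (m + 1) q d v = ∑ x ∈ antidiagonal d,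
      (((x.1 : ℂ) • c.Θ x.1 v + c.Θ x.1 v * c.μ + ∑ y ∈ antidiagonal x.1, c.Θ y.1 v * c.R y.2) *
        c.virInner m q x.2 v + ((m : ℂ) - q - d) • (c.Θ x.1 v * c.virInner m q x.2 v)) := by
    have h2 : ∑ x ∈ antidiagonal d, (∑ y ∈ antidiagonal x.1, c.Θ y.1 v * c.R y.2) *
        c.virInner m q x.2 v = ∑ x ∈ antidiagonal d, c.Θ x.1 v *
          ∑ y ∈ antidiagonal x.2, c.R y.1 * c.virInner m q y.2 v := by
      simp only [sum_mul, mul_sum]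
      rw [sum_antidiagonal_assoc (fun a b e => c.Θ a v * (c.R b * c.virInner m q e v))]
      simp only [Matrix.mul_assoc]
    simp only [Matrix.add_mul, sum_add_distrib, h2]
    rw [virXi, ← sum_add_distrib, ← sum_add_distrib, ← sum_add_distrib]
    refine sum_congr rfl fun x hx => ?_
    have hd : (d : ℂ) = x.1 + x.2 := by
      rw [← mem_antidiagonal.1 hx]; push_cast; ring
    rw [virInner_succ, Matrix.mul_add, Matrix.mul_add, Matrix.mul_smul, Matrix.smul_mul,
      Matrix.mul_assoc, hd, show (m : ℂ) - q - (x.1 + x.2) = (m - q - x.2) - x.1 by ring,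
      sub_smul _ (x.1 : ℂ)]
    abel
  rw [h1, sum_add_distrib, ← smul_sum]
  simp only [c.homogeneous_sum hv, Matrix.add_mul, sum_add_distrib, Matrix.mul_assoc,
    ← mul_sum]
  have h3 : ∑ x ∈ antidiagonal d, (if x.1 = 0 then 0 else X.U v * c.Θ (x.1 - 1) v) *
      c.virInner m q x.2 v = if d = 0 then 0 else X.U v * c.virXi m q (d - 1) v := by
    cases d with
    | zero => simp
    | succ d =>
      rw [Finset.Nat.sum_antidiagonal_succ]
      simp [virXi, mul_sum, Matrix.mul_assoc]
  rw [h3]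
  simp only [virXi]
  abel

lemma virXi_eq_zero {v : Fin n → ℂ} (hv : v ∈ X.M) {m d : ℕ} (h : m < d) (q : ℂ) :
    c.virXi m q d v = 0 := by
  induction m generalizing d with
  | zero => rw [c.virXi_zero hv]; simp [show d ≠ 0 by omega]
  | succ m ih =>
    rw [c.virXi_succ hv, ih (by omega), ih (d := d - 1) (by omega)]
    simp

end Calibration

/-! ### Tensors, resolvents and the transfer principle -/

section Transfer

variable {n : ℕ}

/-- Families of matrices `X_{ik}`. -/
abbrev Tensor (n : ℕ) : Type := ℕ → ℕ → Matrix (Fin n) (Fin n) ℂ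

/-- The operator `U + V z⁻¹ - ∂_z` on the coefficients of `z^{k - 1/2 - a}`. -/
def blockOp (U V : Matrix (Fin n) (Fin n) ℂ) : Tensor n →ₗ[ℂ] Tensor n where
  toFun f a k := U * f a k +
    if a = 0 then 0 else (V + ((a : ℂ) - k - 1 / 2) • (1 : Matrix (Fin n) (Fin n) ℂ)) * f (a - 1) k
  map_add' f g := by
    funext a k
    simp only [Pi.add_apply, Matrix.mul_add]
    split_ifs <;> abel
  map_smul' r f := by
    funext a k
    simp only [Pi.smul_apply, Matrix.mul_smul, RingHom.id_apply, smul_add]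
    split_ifs <;> simp

lemma blockOp_apply_zero (U V : Matrix (Fin n) (Fin n) ℂ) (f : Tensor n) (k : ℕ) :
    blockOp U V f 0 k = U * f 0 k := by simp [blockOp]

lemma blockOp_apply_succ (U V : Matrix (Fin n) (Fin n) ℂ) (f : Tensor n) (a k : ℕ) :
    blockOp U V f (a + 1) k = U * f (a + 1) k +
      (V + ((a : ℂ) + 1 - k - 1 / 2) • (1 : Matrix (Fin n) (Fin n) ℂ)) * f a k := by
  simp [blockOp]

/-- The tensor `δ_{a,0}`. -/
def tensorDelta : Tensor n := fun a _ => if a = 0 then 1 else 0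

/-- The coefficients of `(lam - U - V z⁻¹ + ∂_z)⁻¹ z^{k - 1/2}`. -/
def resTensor (U V : Matrix (Fin n) (Fin n) ℂ) (lam : ℂ) : Tensor n
  | 0, _ => (lam • 1 - U)⁻¹
  | a + 1, k => (lam • 1 - U)⁻¹ *
      ((V + ((a : ℂ) + 1 - k - 1 / 2) • (1 : Matrix (Fin n) (Fin n) ℂ)) * resTensor U V lam a k)

lemma aeval_blockOp (U V : Matrix (Fin n) (Fin n) ℂ) (q : Polynomial ℂ) {s : ℕ} {f : Tensor n}
    (hf : ∀ a < s, ∀ k, f a k = 0) :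
    (∀ a < s, ∀ k, Polynomial.aeval (blockOp U V) q f a k = 0) ∧
      ∀ k, Polynomial.aeval (blockOp U V) q f s k = Polynomial.aeval U q * f s k := by
  have hpow : ∀ m : ℕ, (∀ a < s, ∀ k, (blockOp U V ^ m) f a k = 0) ∧
      ∀ k, (blockOp U V ^ m) f s k = U ^ m * f s k := by
    intro m
    induction m with
    | zero => simpa using hf
    | succ m ih =>
      rw [pow_succ']
      simp only [Module.End.mul_apply]
      constructor
      · intro a ha k
        cases a with
        | zero => rw [blockOp_apply_zero, ih.1 0 ha, mul_zero]
        | succ a => rw [blockOp_apply_succ, ih.1 _ ha, ih.1 a (by omega), mul_zero, mul_zero,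
            add_zero]
      · intro k
        cases s with
        | zero => rw [blockOp_apply_zero, ih.2, pow_succ', Matrix.mul_assoc]
        | succ s => rw [blockOp_apply_succ, ih.1 s (by omega), mul_zero, add_zero, ih.2, pow_succ',
            Matrix.mul_assoc]
  induction q using Polynomial.induction_on' with
  | add p q hp hq =>
    simp only [map_add, LinearMap.add_apply, Pi.add_apply, Matrix.add_mul]
    exact ⟨fun a ha k => by rw [hp.1 a ha, hq.1 a ha, add_zero], fun k => by rw [hp.2, hq.2]⟩
  | monomial m a =>
    simp only [Polynomial.aeval_monomial, Algebra.algebraMap_eq_smul_one, smul_mul_assoc, one_mul,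
      LinearMap.smul_apply, Pi.smul_apply]
    exact ⟨fun b hb k => by rw [(hpow m).1 b hb, smul_zero], fun k => by
      rw [(hpow m).2]⟩

lemma aeval_blockOp_charpoly_pow (U V : Matrix (Fin n) (Fin n) ℂ) (q : Polynomial ℂ) (K : ℕ)
    (f : Tensor n) :
    ∀ a < K, ∀ k, Polynomial.aeval (blockOp U V) (U.charpoly ^ K * q) f a k = 0 := by
  induction K with
  | zero => simp
  | succ K ih =>
    intro a ha k
    have h := aeval_blockOp U V U.charpoly ih
    rw [pow_succ', mul_assoc, map_mul, Module.End.mul_apply]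
    rcases Nat.lt_succ_iff_lt_or_eq.1 ha with h1 | rfl
    · exact h.1 a h1 k
    · rw [h.2, Matrix.aeval_self_charpoly, zero_mul]

/-- A functional depending on finitely many entries that vanishes on sufficiently many powers
vanishes on the resolvent. -/
lemma transfer (U V : Matrix (Fin n) (Fin n) ℂ) (Λ : Tensor n →ₗ[ℂ] ℂ) (K : ℕ)
    (hΛ : ∀ f : Tensor n, (∀ a < K, ∀ k, f a k = 0) → Λ f = 0)
    (hm : ∀ m < n * K, Λ ((blockOp U V ^ m) tensorDelta) = 0) (lam : ℂ)
    (hlam : (lam • 1 - U).det ≠ 0) : Λ (resTensor U V lam) = 0 := by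
  set χ := U.charpoly ^ K
  have hχ : χ.Monic := (Matrix.charpoly_monic U).pow K
  have hdeg : χ.natDegree = n * K := by
    rw [(Matrix.charpoly_monic U).natDegree_pow, Matrix.charpoly_natDegree_eq_dim]
    simp [mul_comm]
  have hcop : IsCoprime χ (Polynomial.X - Polynomial.C lam) := by
    refine IsCoprime.pow_left (IsCoprime.symm ?_)
    refine (Polynomial.irreducible_X_sub_C lam).coprime_iff_not_dvd.2 fun hd => ?_
    rw [Polynomial.dvd_iff_isRoot, Polynomial.IsRoot, Matrix.eval_charpoly] at hd
    refine hlam ?_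
    rwa [Matrix.smul_one_eq_diagonal]
  obtain ⟨a, b, hab⟩ := hcop
  set q := b %ₘ χ
  have hq : (Polynomial.X - Polynomial.C lam) * q =
      1 - χ * (a + (b /ₘ χ) * (Polynomial.X - Polynomial.C lam)) := by
    have := Polynomial.modByMonic_add_div b χ
    linear_combination (Polynomial.X - Polynomial.C lam) * this + hab
  have hΛq : Λ (Polynomial.aeval (blockOp U V) q tensorDelta) = 0 := by
    by_cases h0 : n * K = 0
    · have : q = 0 := by
        have h1 : χ = 1 := hχ.natDegree_eq_zero.1 (by rw [hdeg, h0])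
        simp [q, h1]
      rw [this]; simp
    · have hd : q.natDegree < n * K := by
        rw [← hdeg]
        exact Polynomial.natDegree_modByMonic_lt _ hχ fun h1 => h0 (by rw [← hdeg, h1]; simp)
      rw [Polynomial.aeval_eq_sum_range' hd, LinearMap.sum_apply, map_sum]
      refine sum_eq_zero fun m hmem => ?_
      rw [LinearMap.smul_apply, map_smul, hm m (mem_range.1 hmem), smul_zero]
  set Y := Polynomial.aeval (blockOp U V) q tensorDelta
  have hY : ∀ a < K, ∀ k, blockOp U V Y a k - lam • Y a k = tensorDelta a k := by
    intro a' ha k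
    have h1 := congrArg (fun p => Polynomial.aeval (blockOp U V) p tensorDelta a' k) hq
    simp only [map_mul, map_sub, map_one, Polynomial.aeval_X, Polynomial.aeval_C,
      LinearMap.sub_apply, Pi.sub_apply, Module.End.mul_apply,
      Module.End.one_apply, Module.algebraMap_end_apply, Pi.smul_apply] at h1
    rw [h1]
    have h2 := aeval_blockOp_charpoly_pow U V
      (a + (b /ₘ χ) * (Polynomial.X - Polynomial.C lam)) K tensorDelta a' ha k
    rw [map_mul, Module.End.mul_apply] at h2
    simp only [map_mul, map_sub, Polynomial.aeval_X,
      Polynomial.aeval_C, map_add] at h2 ⊢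
    erw [h2, sub_zero]
  have hS : (lam • 1 - U)⁻¹ * (lam • 1 - U) = 1 :=
    Matrix.nonsing_inv_mul _ (isUnit_iff_ne_zero.2 hlam)
  have hsol : ∀ Z W : Matrix (Fin n) (Fin n) ℂ, U * Z - lam • Z = -W →
      Z = (lam • 1 - U)⁻¹ * W := by
    intro Z W h
    have : (lam • 1 - U) * Z = W := by
      rw [Matrix.sub_mul, Matrix.smul_mul, Matrix.one_mul, ← neg_sub, h, neg_neg]
    rw [← this, ← Matrix.mul_assoc, hS, Matrix.one_mul]
  have key : ∀ a < K, ∀ k, (Y + resTensor U V lam) a k = 0 := by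
    intro a ha
    induction a with
    | zero =>
      intro k
      have h1 := hY 0 ha k
      rw [blockOp_apply_zero] at h1
      have h2 := hsol (Y 0 k) (-1) (by rw [h1]; simp [tensorDelta])
      simp only [Pi.add_apply, resTensor]
      rw [h2]; simp
    | succ a ih =>
      intro k
      have h1 := hY (a + 1) ha k
      rw [blockOp_apply_succ] at h1
      have h3 : Y a k = -resTensor U V lam a k := eq_neg_of_add_eq_zero_left (ih (by omega) k)
      have h2 := hsol (Y (a + 1) k) ((V + ((a : ℂ) + 1 - k - 1 / 2) •
        (1 : Matrix (Fin n) (Fin n) ℂ)) * Y a k) (by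
          have h4 : (tensorDelta (n := n)) (a + 1) k = 0 := by simp [tensorDelta]
          rw [h4] at h1
          rw [eq_neg_iff_add_eq_zero, ← h1]; abel)
      simp only [Pi.add_apply, resTensor]
      rw [h2, h3, Matrix.mul_neg, Matrix.mul_neg, neg_add_cancel]
  have h := hΛ _ key
  rw [map_add, hΛq, zero_add] at h
  exact h

end Transfer

namespace Calibration

variable {n : ℕ} [NeZero n] {X : FrobeniusManifold n} (c : Calibration X)

lemma blockOp_pow_tensorDelta {v : Fin n → ℂ} (hv : v ∈ X.M) (m a k : ℕ) :
    (blockOp (X.U v) X.V ^ m) tensorDelta a k =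
      if a ≤ m then c.virXi m ((k : ℂ) - 1 / 2) (m - a) v else 0 := by
  induction m generalizing a with
  | zero =>
    simp only [pow_zero, Module.End.one_apply, tensorDelta, c.virXi_zero hv]
    rcases Nat.eq_zero_or_pos a with h | h
    · simp [h]
    · simp [show a ≠ 0 by omega]
  | succ m ih =>
    rw [pow_succ', Module.End.mul_apply]
    cases a with
    | zero =>
      rw [blockOp_apply_zero, ih]
      simp only [Nat.zero_le, if_true, Nat.sub_zero]
      rw [c.virXi_succ hv, c.virXi_eq_zero hv (Nat.lt_succ_self m)]
      simp
    | succ a =>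
      rw [blockOp_apply_succ, ih, ih]
      by_cases h : a + 1 ≤ m + 1
      · have h1 : a ≤ m := by omega
        have h2 : m + 1 - (a + 1) = m - a := by omega
        have h3 : (m : ℂ) - ((k : ℂ) - 1 / 2) - ((m - a : ℕ) : ℂ) = (a : ℂ) + 1 - k - 1 / 2 := by
          rw [Nat.cast_sub h1]; ring
        simp only [h, h1, if_true, h2]
        rw [c.virXi_succ hv, h3, Matrix.add_mul, Matrix.smul_mul, Matrix.one_mul, add_comm]
        congr 1
        by_cases h4 : a + 1 ≤ m
        · simp only [h4, if_true, show m - a ≠ 0 by omega, if_false,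
            show m - a - 1 = m - (a + 1) by omega]
        · simp [h4, show m - a = 0 by omega]
      · simp [h, show ¬ a ≤ m by omega, show ¬ a + 1 ≤ m by omega]

/-- The coefficients of the Virasoro operators, extended to the index `-1` of the times
(the second component of an index is the time index plus one). -/
def virHat (m : ℕ) (a b : Time n) : ℂ :=
  if a.2 + b.2 ≤ m then
    (-1) ^ b.2 * (c.virN m ((b.2 : ℂ) - 1 / 2) (m - a.2 - b.2) * X.η⁻¹) a.1 b.1
  else 0

lemma virHat_symm (m : ℕ) (a b : Time n) : c.virHat m a b = c.virHat m b a := by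
  unfold virHat
  by_cases h : a.2 + b.2 ≤ m
  · have h' : b.2 + a.2 ≤ m := by omega
    simp only [h, h', if_true]
    have h1 : (c.virN m ((b.2 : ℂ) - 1 / 2) (m - a.2 - b.2) * X.η⁻¹).transpose =
        X.adj (c.virN m ((b.2 : ℂ) - 1 / 2) (m - a.2 - b.2)) * X.η⁻¹ := by
      rw [Matrix.transpose_mul, X.inv_symm, FrobeniusManifold.adj, Matrix.mul_assoc, X.eta_mul_inv,
        Matrix.mul_one]
    rw [c.adj_virN, Matrix.smul_mul] at h1
    have h2 := congrFun (congrFun h1 b.1) a.1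
    have h3 : m - b.2 - a.2 = m - a.2 - b.2 := by omega
    have h4 : (m : ℂ) - 1 - ((m - a.2 - b.2 : ℕ) : ℂ) - ((b.2 : ℂ) - 1 / 2) = (a.2 : ℂ) - 1 / 2 := by
      rw [Nat.sub_sub, Nat.cast_sub h]; push_cast; ring
    rw [Matrix.transpose_apply, Matrix.smul_apply, smul_eq_mul, h4] at h2
    rw [h2, h3, ← mul_assoc]
    congr 1
    rw [← pow_add]
    have h5 : b.2 + (m - a.2 - b.2 + m) = a.2 + 2 * (m - a.2) := by omega
    rw [h5, pow_add, pow_mul]; simp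
  · simp [h, show ¬ b.2 + a.2 ≤ m by omega]

/-- `X^m_{ik} = ∑ w_i^a â_{ab} w_k^b` for the waves `w^a` of the calibration. -/
def virTensor (m : ℕ) (v : Fin n → ℂ) : Tensor n := fun i k => Matrix.of fun σ ρ =>
  ∑ p ∈ Finset.range (m + 1), ∑ q ∈ Finset.range (m + 1), ∑ α, ∑ β,
    c.virHat m (α, p) (β, q) * (thetaWave X c (α, p) i v σ * thetaWave X c (β, q) k v ρ)

end Calibration

/-- The passage from the resolvent normalization to tensors with two upper indices. -/
def toTensor {n : ℕ} [NeZero n] (X : FrobeniusManifold n) : Tensor n →ₗ[ℂ] Tensor n where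
  toFun f i k := (-1 : ℂ) ^ k • (f (i + k) k * X.η⁻¹)
  map_add' f g := by funext i k; simp [Matrix.add_mul]
  map_smul' r f := by funext i k; simp [smul_comm r]

lemma sum_range_shift {A : Type*} [AddCommMonoid A] {N i : ℕ} (hi : i ≤ N) (g : ℕ → A)
    (h0 : ∀ p < i, g p = 0) :
    ∑ p ∈ Finset.range N, g p = ∑ k ∈ Finset.range (N - i), g (i + k) := by
  obtain ⟨M, rfl⟩ := Nat.exists_eq_add_of_le hi
  rw [Finset.sum_range_add, sum_eq_zero fun p hp => h0 p (mem_range.1 hp), zero_add,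
    Nat.add_sub_cancel_left]

lemma sum_range_truncate {A : Type*} [AddCommMonoid A] {N M : ℕ} (hM : M ≤ N) (g : ℕ → A)
    (h0 : ∀ p, M ≤ p → g p = 0) :
    ∑ p ∈ Finset.range N, g p = ∑ p ∈ Finset.range M, g p := by
  symm
  refine Finset.sum_subset (Finset.range_subset_range.2 hM) fun p _ hp => h0 p (by simpa using hp)

namespace Calibration

variable {n : ℕ} [NeZero n] {X : FrobeniusManifold n} (c : Calibration X)

lemma virTensor_eq {v : Fin n → ℂ} (hv : v ∈ X.M) (m : ℕ) :
    c.virTensor m v = toTensor X ((blockOp (X.U v) X.V ^ m) tensorDelta) := by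
  funext i k
  let Tm : ℕ → ℕ → Matrix (Fin n) (Fin n) ℂ := fun p i => if i ≤ p then c.Θ (p - i) v else 0
  let Nm : ℕ → ℕ → Matrix (Fin n) (Fin n) ℂ := fun p q =>
    if p + q ≤ m then (-1 : ℂ) ^ q • (c.virN m ((q : ℂ) - 1 / 2) (m - p - q) * X.η⁻¹) else 0
  have hL : c.virTensor m v i k = ∑ p ∈ Finset.range (m + 1), ∑ q ∈ Finset.range (m + 1),
      Tm p i * Nm p q * (Tm q k).transpose := by
    ext σ ρ
    simp only [virTensor, Matrix.of_apply, Matrix.sum_apply]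
    refine sum_congr rfl fun p _ => sum_congr rfl fun q _ => ?_
    rw [Matrix.mul_apply]
    simp only [Matrix.mul_apply, sum_mul, Matrix.transpose_apply]
    rw [sum_comm]
    refine sum_congr rfl fun β _ => sum_congr rfl fun α _ => ?_
    have h1 : ∀ α p i σ, thetaWave X c (α, p) i v σ = Tm p i σ α := by
      intro α p i σ; simp only [thetaWave, Tm]; split_ifs <;> rfl
    have h2 : c.virHat m (α, p) (β, q) = Nm p q α β := by
      simp only [virHat, Nm]; split_ifs <;> simp
    rw [h1, h1, h2]; ring
  rw [hL]
  change _ = (-1 : ℂ) ^ k • (_ * X.η⁻¹)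
  rw [c.blockOp_pow_tensorDelta hv]
  by_cases hik : i + k ≤ m
  swap
  · rw [if_neg hik, Matrix.zero_mul, smul_zero]
    refine sum_eq_zero fun p _ => sum_eq_zero fun q _ => ?_
    by_cases h1 : i ≤ p
    · by_cases h2 : k ≤ q
      · simp [Nm, show ¬ p + q ≤ m by omega]
      · simp [Tm, h2]
    · simp [Tm, h1]
  rw [if_pos hik, sum_range_shift (show i ≤ m + 1 by omega) _ fun p hp => by
    refine sum_eq_zero fun q _ => ?_
    simp [Tm, show ¬ i ≤ p by omega]]
  rw [sum_range_truncate (show m - (i + k) + 1 ≤ m + 1 - i by omega) _ fun p hp => by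
    refine sum_eq_zero fun q _ => ?_
    by_cases h2 : k ≤ q
    · simp [Nm, show ¬ i + p + q ≤ m by omega]
    · simp [Tm, h2]]
  rw [virXi, Finset.Nat.sum_antidiagonal_eq_sum_range_succ_mk, sum_mul, smul_sum]
  refine sum_congr rfl fun p hp => ?_
  have hp := mem_range.1 hp
  rw [sum_range_shift (show k ≤ m + 1 by omega) _ fun q hq => by
    simp [Tm, show ¬ k ≤ q by omega]]
  rw [sum_range_truncate (show m - (i + k) - p + 1 ≤ m + 1 - k by omega) _ fun q hq => by
    simp [Nm, show ¬ i + p + (k + q) ≤ m by omega]]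
  rw [virInner, Finset.Nat.sum_antidiagonal_eq_sum_range_succ_mk, mul_sum, sum_mul,
    smul_sum]
  refine sum_congr rfl fun q hq => ?_
  have hq := mem_range.1 hq
  have h1 : i + p + (k + q) ≤ m := by omega
  have h2 : m - (i + p) - (k + q) = m - (i + k) - p - q := by omega
  have h3 : ((k + q : ℕ) : ℂ) - 1 / 2 = (q : ℂ) + ((k : ℂ) - 1 / 2) := by push_cast; ring
  have h4 : X.η⁻¹ * (c.Θ q v).transpose = X.adj (c.Θ q v) * X.η⁻¹ := by
    rw [FrobeniusManifold.adj, Matrix.mul_assoc, X.eta_mul_inv, Matrix.mul_one]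
  simp only [Tm, Nm, Nat.le_add_right, if_true, Nat.add_sub_cancel_left, h1, h2, h3,
    Matrix.mul_smul, Matrix.smul_mul, Matrix.mul_assoc, h4, pow_add, smul_smul]

end Calibration

/-! ### The weight filtration on jet functions -/

section Filtration

variable {n : ℕ} {O : Set (Jet n)} {Φ Ψ : Jet n → ℂ}

/-- Iterated partial derivatives on the jet space. -/
def jdL : List (Fin n × ℕ) → (Jet n → ℂ) → Jet n → ℂ
  | [], Φ => Φ
  | x :: L, Φ => jdL L (jd x.1 x.2 Φ)

/-- The weight of an iterated derivative: `v^{γ,k}` has weight `k - 1`. -/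
def jetWeight (L : List (Fin n × ℕ)) : ℤ := (L.map fun x => (x.2 : ℤ) - 1).sum

lemma jetWeight_cons (x : Fin n × ℕ) (L : List (Fin n × ℕ)) :
    jetWeight (x :: L) = (x.2 : ℤ) - 1 + jetWeight L := by simp [jetWeight]

lemma jdL_congr (hO : IsOpen O) (L : List (Fin n × ℕ)) (h : ∀ j ∈ O, Φ j = Ψ j) :
    ∀ j ∈ O, jdL L Φ j = jdL L Ψ j := by
  induction L generalizing Φ Ψ with
  | nil => exact h
  | cons x L ih => exact ih (jd_congr hO h x.1 x.2)

lemma JetAnalyticOn.jdL (h : JetAnalyticOn O Φ) (L : List (Fin n × ℕ)) :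
    JetAnalyticOn O (jdL L Φ) := by
  induction L generalizing Φ with
  | nil => exact h
  | cons x L ih => exact ih (h.jd x.1 x.2)

lemma jdL_add (hO : IsOpen O) (L : List (Fin n × ℕ)) (hΦ : JetAnalyticOn O Φ)
    (hΨ : JetAnalyticOn O Ψ) :
    ∀ j ∈ O, jdL L (fun j => Φ j + Ψ j) j = jdL L Φ j + jdL L Ψ j := by
  induction L generalizing Φ Ψ with
  | nil => exact fun _ _ => rfl
  | cons x L ih =>
    intro j hj
    simp only [jdL]
    rw [jdL_congr hO L (fun j hj => jd_add (hΦ j hj) (hΨ j hj) x.1 x.2) j hj]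
    exact ih (hΦ.jd _ _) (hΨ.jd _ _) j hj

lemma jdL_zero (L : List (Fin n × ℕ)) : jdL L (fun _ : Jet n => 0) = fun _ => 0 := by
  induction L with
  | nil => rfl
  | cons x L ih =>
    simp only [jdL]
    rw [show jd x.1 x.2 (fun _ : Jet n => (0 : ℂ)) = fun _ => 0 from
      funext fun j => jd_const 0 x.1 x.2, ih]

lemma jdL_sum (hO : IsOpen O) (L : List (Fin n × ℕ)) {ι : Type*} (s : Finset ι)
    {Φ : ι → Jet n → ℂ} (h : ∀ i ∈ s, JetAnalyticOn O (Φ i)) :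
    ∀ j ∈ O, jdL L (fun j => ∑ i ∈ s, Φ i j) j = ∑ i ∈ s, jdL L (Φ i) j := by
  classical
  induction s using Finset.induction_on with
  | empty => intro j _; simp [jdL_zero]
  | insert a s ha ih =>
    intro j hj
    simp only [Finset.sum_insert ha]
    rw [jdL_add hO L (h a (Finset.mem_insert_self a s))
      (.sum _ fun i hi => h i (Finset.mem_insert_of_mem hi)) j hj,
      ih (fun i hi => h i (Finset.mem_insert_of_mem hi)) j hj]

lemma jdL_mul_base (hO : IsOpen O) (L : List (Fin n × ℕ)) (hL : ∀ x ∈ L, 2 ≤ x.2)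
    (hΦ : JetAnalyticOn O Φ) {f : (Fin n → ℂ) → ℂ} (hf : ∀ j ∈ O, AnalyticAt ℂ f (j 0)) :
    ∀ j ∈ O, jdL L (fun j => Φ j * f (j 0)) j = jdL L Φ j * f (j 0) := by
  induction L generalizing Φ with
  | nil => exact fun _ _ => rfl
  | cons x L ih =>
    intro j hj
    simp only [jdL]
    have h2 : x.2 ≠ 0 := by have := hL x (by simp); omega
    rw [jdL_congr hO L (Ψ := fun j => jd x.1 x.2 Φ j * f (j 0)) (fun j hj => by
      rw [jd_mul (hΦ j hj) (JetAnalyticOn.comp_base hf j hj), jd_comp_base_pos f x.1 h2, mul_zero,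
        add_zero]) j hj]
    exact ih (fun y hy => hL y (List.mem_cons_of_mem _ hy)) (hΦ.jd _ _) j hj

lemma jdL_base (L : List (Fin n × ℕ)) (hL : ∀ x ∈ L, 2 ≤ x.2) (h0 : L ≠ [])
    (f : (Fin n → ℂ) → ℂ) : jdL L (fun j => f (j 0)) = fun _ => 0 := by
  cases L with
  | nil => exact absurd rfl h0
  | cons x L =>
    have h2 : x.2 ≠ 0 := by have := hL x (by simp); omega
    simp only [jdL]
    rw [show jd x.1 x.2 (fun j : Jet n => f (j 0)) = fun _ => 0 from
      funext fun j => jd_comp_base_pos f x.1 h2, jdL_zero]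

/-- On `O`, the iterated derivatives of `Φ` of weight greater than `d`, with respect to fewer than
`l` of the variables `v^{γ,k}`, `k ≥ 2`, vanish. -/
def Filt (O : Set (Jet n)) (l : ℕ) (d : ℤ) (Φ : Jet n → ℂ) : Prop :=
  ∀ L : List (Fin n × ℕ), (∀ x ∈ L, 2 ≤ x.2) → L.length < l → d < jetWeight L →
    ∀ j ∈ O, jdL L Φ j = 0

lemma filt_zero (d : ℤ) : Filt O 0 d Φ := fun _ _ h => absurd h (Nat.not_lt_zero _)

lemma filt_succ {l : ℕ} {d : ℤ} : Filt O (l + 1) d Φ ↔ (d < 0 → ∀ j ∈ O, Φ j = 0) ∧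
    ∀ γ (k : ℕ), 2 ≤ k → Filt O l (d - ((k : ℤ) - 1)) (jd γ k Φ) := by
  constructor
  · intro h
    refine ⟨fun hd => h [] (by simp) (by simp) (by simpa [jetWeight] using hd), ?_⟩
    intro γ k hk L hL hl hd
    refine h ((γ, k) :: L) ?_ (by simpa using hl) (by rw [jetWeight_cons]; linarith)
    intro x hx
    rcases List.mem_cons.1 hx with rfl | hx
    · exact hk
    · exact hL x hx
  · rintro ⟨h0, h1⟩ L hL hl hd
    cases L with
    | nil => exact h0 (by simpa [jetWeight] using hd)
    | cons x L =>
      rw [jetWeight_cons] at hd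
      exact h1 x.1 x.2 (hL x (by simp)) L (fun y hy => hL y (List.mem_cons_of_mem _ hy))
        (by simpa using hl) (by linarith)

namespace Filt

variable {l l' : ℕ} {d d' : ℤ}

lemma mono (h : Filt O l d Φ) (hl : l' ≤ l) (hd : d ≤ d') : Filt O l' d' Φ :=
  fun L hL hlen hw => h L hL (by omega) (by omega)

lemma congr (hO : IsOpen O) (h : Filt O l d Φ) (he : ∀ j ∈ O, Ψ j = Φ j) : Filt O l d Ψ :=
  fun L hL hlen hw j hj => by rw [jdL_congr hO L he j hj, h L hL hlen hw j hj]

lemma zero : Filt O l d fun _ => 0 := fun L _ _ _ j _ => by rw [jdL_zero]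

lemma base (f : (Fin n → ℂ) → ℂ) : Filt O l 0 fun j => f (j 0) := fun L hL _ hw j _ => by
  rw [jdL_base L hL (by rintro rfl; simp [jetWeight] at hw)]

lemma const (a : ℂ) : Filt O l 0 fun _ => a := base fun _ => a

lemma coord_one (γ : Fin n) : Filt O l 0 fun j => j 1 γ := by
  cases l with
  | zero => exact filt_zero _
  | succ l =>
    refine filt_succ.2 ⟨fun h => absurd h (lt_irrefl _), fun δ k hk => ?_⟩
    rw [show jd δ k (fun j : Jet n => j 1 γ) = fun _ => 0 from funext fun j => by
      rw [jd_coord]; simp [show k ≠ 1 by omega]]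
    exact zero

lemma add (hO : IsOpen O) (hA : JetAnalyticOn O Φ) (hB : JetAnalyticOn O Ψ) (h : Filt O l d Φ)
    (h' : Filt O l d Ψ) : Filt O l d fun j => Φ j + Ψ j := fun L hL hlen hw j hj => by
  rw [jdL_add hO L hA hB j hj, h L hL hlen hw j hj, h' L hL hlen hw j hj, add_zero]

lemma sum (hO : IsOpen O) {ι : Type*} (s : Finset ι) {Φ : ι → Jet n → ℂ}
    (hA : ∀ i ∈ s, JetAnalyticOn O (Φ i)) (h : ∀ i ∈ s, Filt O l d (Φ i)) :
    Filt O l d fun j => ∑ i ∈ s, Φ i j := fun L hL hlen hw j hj => by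
  rw [jdL_sum hO L s hA j hj]
  exact sum_eq_zero fun i hi => h i hi L hL hlen hw j hj

lemma mul (hO : IsOpen O) (hA : JetAnalyticOn O Φ) (hB : JetAnalyticOn O Ψ) (h : Filt O l d Φ)
    (h' : Filt O l d' Ψ) : Filt O l (d + d') fun j => Φ j * Ψ j := by
  induction l generalizing Φ Ψ d d' with
  | zero => exact filt_zero _
  | succ l ih =>
    obtain ⟨h1, h2⟩ := filt_succ.1 h
    obtain ⟨h1', h2'⟩ := filt_succ.1 h'
    refine filt_succ.2 ⟨fun hd j hj => ?_, fun γ k hk => ?_⟩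
    · rcases lt_or_ge d 0 with hd0 | hd0
      · rw [h1 hd0 j hj, zero_mul]
      · rw [h1' (by omega) j hj, mul_zero]
    · refine congr hO (Φ := fun j => jd γ k Φ j * Ψ j + Φ j * jd γ k Ψ j) ?_
        fun j hj => jd_mul (hA j hj) (hB j hj) γ k
      refine add hO ((hA.jd _ _).mul hB) (hA.mul (hB.jd _ _)) ?_ ?_
      · exact (ih (hA.jd γ k) hB (h2 γ k hk) (h'.mono (Nat.le_succ l) le_rfl)).mono le_rfl
          (by omega)
      · exact (ih hA (hB.jd γ k) (h.mono (Nat.le_succ l) le_rfl) (h2' γ k hk)).mono le_rfl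
          (by omega)

lemma const_mul (hO : IsOpen O) (hA : JetAnalyticOn O Φ) (a : ℂ) (h : Filt O l d Φ) :
    Filt O l d fun j => a * Φ j := by
  simpa using mul hO (.const a) hA (const a) h

lemma jd_low (hO : IsOpen O) (hA : JetAnalyticOn O Φ) (h : Filt O l d Φ) (γ : Fin n) (s : ℕ) :
    Filt O l d (jd γ s Φ) := by
  induction l generalizing Φ d with
  | zero => exact filt_zero _
  | succ l ih =>
    obtain ⟨h1, h2⟩ := filt_succ.1 h
    refine filt_succ.2 ⟨fun hd j hj => ?_, fun δ k hk => ?_⟩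
    · rw [jd_congr hO (Ψ := fun _ => 0) (h1 hd) γ s j hj, jd_const]
    · exact congr hO (ih (hA.jd δ k) (h2 δ k hk)) fun j hj => jd_comm (hA j hj) γ δ s k

lemma jd (hO : IsOpen O) (hA : JetAnalyticOn O Φ) (h : Filt O (l + 1) d Φ) (γ : Fin n) (s : ℕ) :
    Filt O l (d + 1 - s) (jd γ s Φ) := by
  by_cases hs : 2 ≤ s
  · exact ((filt_succ.1 h).2 γ s hs).mono le_rfl (by omega)
  · exact (h.jd_low hO hA γ s).mono (Nat.le_succ l) (by omega)

lemma Dx (hO : IsOpen O) (hA : JetAnalyticOn O Φ) (h : Filt O l d Φ) :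
    Filt O l (d + 1) (Dx Φ) := by
  induction l generalizing Φ d with
  | zero => exact filt_zero _
  | succ l ih =>
    obtain ⟨h1, h2⟩ := filt_succ.1 h
    refine filt_succ.2 ⟨fun hd j hj => ?_, fun γ k hk => ?_⟩
    · rw [Dx_congr hO (Ψ := fun _ => 0) (h1 (by omega)) j hj, Dx_const]
    · refine congr hO (Φ := fun j => LoopEq.Dx (LoopEq.jd γ k Φ) j + LoopEq.jd γ (k - 1) Φ j) ?_
        fun j hj => by rw [jd_Dx hO hA γ k hj, if_neg (by omega)]
      refine add hO (hA.jd γ k).Dx (hA.jd _ _) ?_ ?_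
      · exact (ih (hA.jd γ k) (h2 γ k hk)).mono le_rfl (by omega)
      · exact (h.jd hO hA γ (k - 1)).mono le_rfl (by omega)

lemma iterate_Dx (hO : IsOpen O) (hA : JetAnalyticOn O Φ) (h : Filt O l d Φ) (k : ℕ) :
    Filt O l (d + k) (LoopEq.Dx^[k] Φ) := by
  induction k with
  | zero => simpa using h
  | succ k ih =>
    rw [Function.iterate_succ_apply']
    exact (ih.Dx hO (hA.iterate_Dx k)).mono le_rfl (by push_cast; omega)

lemma jdL_mul_eq (hO : IsOpen O) (L : List (Fin n × ℕ)) (hL : ∀ x ∈ L, 2 ≤ x.2)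
    (hA : JetAnalyticOn O Φ) (hB : JetAnalyticOn O Ψ) (h : Filt O L.length d Φ)
    (h' : ∀ l, Filt O l d' Ψ) (hw : d + d' < jetWeight L) :
    ∀ j ∈ O, jdL L (fun j => Φ j * Ψ j) j = jdL L Φ j * Ψ j := by
  induction L generalizing Φ d with
  | nil => exact fun _ _ => rfl
  | cons x L ih =>
    intro j hj
    have hx := hL x (by simp)
    have hL' : ∀ y ∈ L, 2 ≤ y.2 := fun y hy => hL y (List.mem_cons_of_mem _ hy)
    rw [jetWeight_cons] at hw
    simp only [jdL]
    rw [jdL_congr hO L (fun j hj => jd_mul (hA j hj) (hB j hj) x.1 x.2) j hj,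
      jdL_add hO L ((hA.jd _ _).mul hB) (hA.mul (hB.jd _ _)) j hj,
      ih hL' (hA.jd x.1 x.2) ((filt_succ.1 h).2 x.1 x.2 hx) (by linarith) j hj,
      mul hO hA (hB.jd x.1 x.2) h ((filt_succ.1 (h' _)).2 x.1 x.2 hx) L hL' (Nat.lt_succ_self _)
        (by linarith) j hj, add_zero]

end Filt

end Filtration

/-! ### Forms: linear functionals of tensors with jet functions as coefficients -/

section Forms

/-- The coefficients of a linear functional on tensors. -/
abbrev Form (n : ℕ) : Type := ℕ → ℕ → Fin n → Fin n → Jet n → ℂ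

variable {n : ℕ}

/-- The value of a form, whose coefficients with an index `≥ K` are disregarded, at a tensor. -/
def Form.ev (K : ℕ) (f : Form n) (T : Tensor n) (j : Jet n) : ℂ :=
  ∑ i ∈ Finset.range K, ∑ k ∈ Finset.range K, ∑ σ, ∑ ρ, f i k σ ρ j * T i k σ ρ

lemma Form.ev_eq_zero {K : ℕ} (f : Form n) {T : Tensor n} (j : Jet n)
    (hT : ∀ i < K, ∀ k < K, T i k = 0) : Form.ev K f T j = 0 :=
  sum_eq_zero fun i hi => sum_eq_zero fun k hk => by
    simp [hT i (mem_range.1 hi) k (mem_range.1 hk)]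

lemma Form.ev_sum_left (K : ℕ) {ι : Type*} (s : Finset ι) (f : ι → Form n) (T : Tensor n)
    (j : Jet n) : Form.ev K (fun i k σ ρ j => ∑ x ∈ s, f x i k σ ρ j) T j =
      ∑ x ∈ s, Form.ev K (f x) T j := by
  classical
  induction s using Finset.induction_on with
  | empty => simp [Form.ev]
  | insert a s ha ih =>
    rw [Finset.sum_insert ha, ← ih]
    simp only [Form.ev, Finset.sum_insert ha, add_mul, sum_add_distrib]

lemma Form.ev_mul_left (K : ℕ) (z : Jet n → ℂ) (f : Form n) (T : Tensor n) (j : Jet n) :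
    Form.ev K (fun i k σ ρ j => z j * f i k σ ρ j) T j = z j * Form.ev K f T j := by
  simp only [Form.ev, mul_sum, mul_assoc]

lemma Form.ev_add_left (K : ℕ) (f g : Form n) (T : Tensor n) (j : Jet n) :
    Form.ev K (fun i k σ ρ j => f i k σ ρ j + g i k σ ρ j) T j =
      Form.ev K f T j + Form.ev K g T j := by
  simp only [Form.ev, add_mul, sum_add_distrib]

/-- The value of a form, as a linear functional. -/
def Form.evL (K : ℕ) (f : Form n) (j : Jet n) : Tensor n →ₗ[ℂ] ℂ where
  toFun T := f.ev K T j
  map_add' T T' := by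
    simp only [Form.ev, Pi.add_apply, Matrix.add_apply, mul_add, sum_add_distrib]
  map_smul' r T := by
    simp only [Form.ev, Pi.smul_apply, Matrix.smul_apply, smul_eq_mul, RingHom.id_apply,
      mul_sum]
    refine sum_congr rfl fun _ _ => sum_congr rfl fun _ _ =>
      sum_congr rfl fun _ _ => sum_congr rfl fun _ _ => by ring

lemma Form.evL_apply (K : ℕ) (f : Form n) (j : Jet n) (T : Tensor n) :
    Form.evL K f j T = f.ev K T j := rfl

variable [NeZero n] (X : FrobeniusManifold n)

/-- The form `∂_x^a w_0^γ ∂_x^b w'_0^ρ`. -/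
def bForm (a b : ℕ) (γ ρ : Fin n) : Form n := fun i k σ τ j =>
  waveCoeff X a i γ σ j * waveCoeff X b k ρ τ j

/-- The coefficient of `∂_x^a w_0 ∂_x^b (w'_0, e)`, `a + b = r`, in the left hand side of the loop
equation. -/
def yCoeff (r : ℕ) (ab : ℕ × ℕ) : ℂ := (Nat.choose r ab.1 : ℂ) + Nat.choose r (ab.2 + 1)

/-- The form `∑ yCoeff r (a, b) ∂_x^a w_0^γ ∂_x^b (w'_0, e)`. -/
def yForm (r : ℕ) (γ : Fin n) : Form n := fun i k σ τ j =>
  ∑ ab ∈ antidiagonal r, yCoeff r ab *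
    ∑ ρ, X.η ρ 0 * bForm X ab.1 ab.2 γ ρ i k σ τ j

/-- `(∂_σ · ∂_ρ · v_x)^γ`. -/
def triple (σ ρ γ : Fin n) (j : Jet n) : ℂ :=
  ((X.C σ (j 0) * X.C ρ (j 0)).mulVec (j 1)) γ

/-- The form `∂_x^{k+1} (w_1 · w'_1 · v_x)^γ`. -/
def lForm (k : ℕ) (γ : Fin n) : Form n := fun i l σ τ j =>
  if i = 0 ∨ l = 0 then 0 else
    ∑ ab ∈ antidiagonal (k + 1), ∑ cd ∈ antidiagonal ab.1,
      ((Nat.choose (k + 1) ab.1 : ℂ) * Nat.choose ab.1 cd.1) * ∑ σ', ∑ ρ',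
        bForm X cd.1 cd.2 σ' ρ' (i - 1) (l - 1) σ τ j * Dx^[ab.2] (triple X σ' ρ' γ) j

/-- The tensor `w_i ⊗ w'_k` of a pair of waves. -/
def pairTensor (w w' : ℕ → (Fin n → ℂ) → Fin n → ℂ) (v : Fin n → ℂ) : Tensor n :=
  fun i k => Matrix.of fun σ τ => w i v σ * w' k v τ

variable {O : Set (Jet n)} {X} {D : Set (Fin n → ℂ)} {w w' : ℕ → (Fin n → ℂ) → Fin n → ℂ}

lemma IsWave.iterate_Dx_range (h : IsWave X D w) (hO : IsOpen O) (hM : ∀ j ∈ O, j 0 ∈ X.M)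
    (hD : ∀ j ∈ O, j 0 ∈ D) {a K : ℕ} (hK : a < K) (γ : Fin n) {j : Jet n} (hj : j ∈ O) :
    LoopEq.Dx^[a] (fun j => w 0 (j 0) γ) j =
      ∑ i ∈ Finset.range K, ∑ σ, waveCoeff X a i γ σ j * w i (j 0) σ := by
  rw [h.iterate_Dx hO hM hD a γ j hj]
  symm
  exact sum_range_truncate (by omega) _ fun p hp => by
    simp [waveCoeff_eq_zero X (show a < p by omega)]

lemma ev_bForm (h : IsWave X D w) (h' : IsWave X D w') (hO : IsOpen O)
    (hM : ∀ j ∈ O, j 0 ∈ X.M) (hD : ∀ j ∈ O, j 0 ∈ D) {a b K : ℕ} (ha : a < K) (hb : b < K)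
    (γ ρ : Fin n) {j : Jet n} (hj : j ∈ O) :
    Form.ev K (bForm X a b γ ρ) (pairTensor w w' (j 0)) j =
      Dx^[a] (fun j => w 0 (j 0) γ) j * Dx^[b] (fun j => w' 0 (j 0) ρ) j := by
  rw [h.iterate_Dx_range hO hM hD ha γ hj, h'.iterate_Dx_range hO hM hD hb ρ hj,
    Finset.sum_mul_sum]
  refine sum_congr rfl fun i _ => sum_congr rfl fun k _ => ?_
  rw [Finset.sum_mul_sum]
  refine sum_congr rfl fun σ _ => sum_congr rfl fun τ _ => ?_
  simp only [bForm, pairTensor, Matrix.of_apply]; ring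

lemma ev_yForm (h : IsWave X D w) (h' : IsWave X D w') (hO : IsOpen O)
    (hM : ∀ j ∈ O, j 0 ∈ X.M) (hD : ∀ j ∈ O, j 0 ∈ D) {r K : ℕ} (hr : r < K)
    (γ : Fin n) {j : Jet n} (hj : j ∈ O) :
    Form.ev K (yForm X r γ) (pairTensor w w' (j 0)) j =
      ∑ ab ∈ antidiagonal r, yCoeff r ab *
        (Dx^[ab.1] (fun j => w 0 (j 0) γ) j *
          ∑ ρ, X.η ρ 0 * Dx^[ab.2] (fun j => w' 0 (j 0) ρ) j) := by
  unfold yForm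
  rw [Form.ev_sum_left]
  refine sum_congr rfl fun ab hab => ?_
  have hab := mem_antidiagonal.1 hab
  rw [Form.ev_mul_left K (fun _ => yCoeff r ab), Form.ev_sum_left]
  simp only [mul_sum]
  refine sum_congr rfl fun ρ _ => ?_
  rw [Form.ev_mul_left K (fun _ => X.η ρ 0), ev_bForm h h' hO hM hD (by omega) (by omega) γ ρ hj]
  ring

lemma jetAnalyticOn_triple (hM : ∀ j ∈ O, j 0 ∈ X.M) (σ ρ γ : Fin n) :
    JetAnalyticOn O (triple X σ ρ γ) := by
  unfold triple
  simp only [Matrix.mulVec, dotProduct, Matrix.mul_apply]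
  exact .sum _ fun δ _ => .mul (.sum _ fun κ _ => .mul
    (.comp_base (f := fun v => X.C σ v γ κ) fun j hj => X.analyticAt_C (hM j hj) σ γ κ)
    (.comp_base (f := fun v => X.C ρ v κ δ) fun j hj => X.analyticAt_C (hM j hj) ρ κ δ))
    (.coord 1 δ)

lemma mulBy_mul_mulBy_mulVec (x y : Fin n → ℂ) (j : Jet n) (γ : Fin n) :
    ((X.mulBy x (j 0) * X.mulBy y (j 0)).mulVec (j 1)) γ =
      ∑ σ, ∑ ρ, (x σ * y ρ) * triple X σ ρ γ j := by
  simp only [FrobeniusManifold.mulBy, triple, Finset.sum_mul_sum, Matrix.sum_mulVec,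
    Finset.sum_apply, smul_mul_smul_comm, Matrix.smul_mulVec, Pi.smul_apply, smul_eq_mul]

lemma ev_lForm (h : IsWave X D w) (h' : IsWave X D w') (hO : IsOpen O)
    (hM : ∀ j ∈ O, j 0 ∈ X.M) (hD : ∀ j ∈ O, j 0 ∈ D) {k K : ℕ} (hk : k + 2 < K)
    (γ : Fin n) {j : Jet n} (hj : j ∈ O) :
    Form.ev K (lForm X k γ) (pairTensor w w' (j 0)) j =
      Dx^[k + 1] (fun y => ((X.mulBy (w 1 (y 0)) (y 0) *
        X.mulBy (w' 1 (y 0)) (y 0)).mulVec (y 1)) γ) j := by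
  obtain ⟨K, rfl⟩ : ∃ K', K = K' + 1 := ⟨K - 1, by omega⟩
  have hw := fun σ => h.jetAnalyticOn hD 1 σ
  have hw' := fun σ => h'.jetAnalyticOn hD 1 σ
  have ht := fun σ ρ => jetAnalyticOn_triple hM σ ρ γ
  have h1 : Form.ev (K + 1) (lForm X k γ) (pairTensor w w' (j 0)) j =
      Form.ev K (fun i l σ τ => lForm X k γ (i + 1) (l + 1) σ τ)
        (pairTensor (fun i => w (i + 1)) (fun i => w' (i + 1)) (j 0)) j := by
    have e : ∀ g : ℕ → ℂ, ∑ i ∈ Finset.range (K + 1), g i =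
        ∑ i ∈ Finset.range K, g (i + 1) + g 0 := fun g => sum_range_succ' g K
    simp only [Form.ev, e]
    simp [lForm, pairTensor]
  have h2 : (fun i l σ τ => lForm X k γ (i + 1) (l + 1) σ τ) = (fun i l σ τ j =>
      ∑ ab ∈ antidiagonal (k + 1), ∑ cd ∈ antidiagonal ab.1,
      ((Nat.choose (k + 1) ab.1 : ℂ) * Nat.choose ab.1 cd.1) * ∑ σ', ∑ ρ',
        Dx^[ab.2] (triple X σ' ρ' γ) j * bForm X cd.1 cd.2 σ' ρ' i l σ τ j) := by
    funext i l σ τ j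
    simp only [lForm, Nat.succ_ne_zero, or_self, if_false, Nat.add_sub_cancel, mul_comm]
  rw [h1, h2, Form.ev_sum_left, iterate_Dx_congr hO (fun y _ => mulBy_mul_mulBy_mulVec _ _ y γ) _ j hj,
    iterate_Dx_sum hO _ (fun σ _ => .sum _ fun ρ _ => ((hw σ).mul (hw' ρ)).mul (ht σ ρ)) _ j hj]
  have h3 : ∀ σ, Dx^[k + 1] (fun y => ∑ ρ, w 1 (y 0) σ * w' 1 (y 0) ρ * triple X σ ρ γ y) j =
      ∑ ρ, ∑ ab ∈ antidiagonal (k + 1), (Nat.choose (k + 1) ab.1 : ℂ) *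
        ((∑ cd ∈ antidiagonal ab.1, (Nat.choose ab.1 cd.1 : ℂ) *
          (Dx^[cd.1] (fun y => w 1 (y 0) σ) j * Dx^[cd.2] (fun y => w' 1 (y 0) ρ) j)) *
          Dx^[ab.2] (triple X σ ρ γ) j) := by
    intro σ
    rw [iterate_Dx_sum hO _ (fun ρ _ => ((hw σ).mul (hw' ρ)).mul (ht σ ρ)) _ j hj]
    refine sum_congr rfl fun ρ _ => ?_
    rw [iterate_Dx_mul hO ((hw σ).mul (hw' ρ)) (ht σ ρ) _ j hj]
    refine sum_congr rfl fun ab _ => ?_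
    rw [iterate_Dx_mul hO (hw σ) (hw' ρ) _ j hj]
  simp only [h3]
  simp only [sum_comm (s := (Finset.univ : Finset (Fin n)))
    (t := antidiagonal (k + 1))]
  refine sum_congr rfl fun ab hab => ?_
  have hab := mem_antidiagonal.1 hab
  rw [Form.ev_sum_left]
  simp only [sum_mul, mul_sum]
  simp only [sum_comm (s := (Finset.univ : Finset (Fin n)))
    (t := antidiagonal ab.1)]
  refine sum_congr rfl fun cd hcd => ?_
  have hcd := mem_antidiagonal.1 hcd
  rw [Form.ev_sum_left]
  refine sum_congr rfl fun σ _ => ?_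
  rw [Form.ev_sum_left]
  refine sum_congr rfl fun ρ _ => ?_
  rw [Form.ev_mul_left K (fun _ => ((Nat.choose (k + 1) ab.1 : ℂ) * Nat.choose ab.1 cd.1)),
    Form.ev_mul_left K (fun j => Dx^[ab.2] (triple X σ ρ γ) j),
    ev_bForm h.shift h'.shift hO hM hD (by omega) (by omega) σ ρ hj]
  ring

end Forms

/-! ### The flows of the principal hierarchy -/

namespace Calibration

variable {n : ℕ} [NeZero n] {X : FrobeniusManifold n} (c : Calibration X)

/-- The vector `∇θ_{α,p}`. -/
def col (a : Time n) (v : Fin n → ℂ) (σ : Fin n) : ℂ := c.Θ a.2 v σ a.1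

/-- The index following `a`. -/
def up (a : Time n) : Time n := (a.1, a.2 + 1)

lemma thetaWave_up_zero (a : Time n) (v : Fin n → ℂ) (σ : Fin n) :
    thetaWave X c (up a) 0 v σ = c.Θ (a.2 + 1) v σ a.1 := by simp [up, thetaWave]

lemma thetaWave_up_one (a : Time n) (v : Fin n → ℂ) : thetaWave X c (up a) 1 v = c.col a v := by
  funext σ; simp [up, thetaWave, col]

lemma flow_eq_Dx (a : Time n) (γ : Fin n) :
    c.flow a γ = Dx fun j => thetaWave X c (up a) 0 (j 0) γ := by
  unfold flow; simp only [thetaWave_up_zero]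

lemma flow_eq (a : Time n) (γ : Fin n) {j : Jet n} (hj : j 0 ∈ X.M) :
    c.flow a γ j = (X.mulBy (j 1) (j 0)).mulVec (c.col a (j 0)) γ := by
  rw [flow_eq_Dx, (isWave_thetaWave X c (up a)).Dx hj, zero_add, thetaWave_up_one]
  rfl

lemma flow_zero {j : Jet n} (hj : j 0 ∈ X.M) (γ : Fin n) : c.flow (0, 0) γ j = j 1 γ := by
  rw [c.flow_eq _ _ hj]
  have : c.col (0, 0) (j 0) = FrobeniusManifold.e := by
    funext σ
    simp [col, c.zero _ hj, FrobeniusManifold.e, Matrix.one_apply, Pi.single_apply]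
  rw [this, X.mulBy_mulVec_e hj]

lemma Omega_zero (a : Time n) (β : Fin n) {v : Fin n → ℂ} (hv : v ∈ X.M) :
    c.Ω a (β, 0) v = ((c.Θ (a.2 + 1) v).transpose * X.η) a.1 β := by
  simp [Ω, c.zero v hv]

lemma Omega_succ (a : Time n) (β : Fin n) (q : ℕ) (v : Fin n → ℂ) :
    c.Ω a (β, q + 1) v = ((c.Θ (a.2 + 1) v).transpose * X.η * c.Θ (q + 1) v) a.1 β -
      c.Ω (up a) (β, q) v := by
  simp only [Ω, up]
  rw [sum_range_succ', add_comm]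
  simp only [pow_zero, one_mul, Nat.sub_zero, add_zero, pow_succ, mul_neg, mul_one, neg_mul,
    sum_neg_distrib, Nat.add_sub_add_right, ← sub_eq_add_neg]
  congr 1
  refine sum_congr rfl fun k _ => ?_
  rw [show a.2 + 1 + (k + 1) = a.2 + 1 + 1 + k by ring]

lemma analyticAt_Omega (a b : Time n) {v : Fin n → ℂ} (hv : v ∈ X.M) :
    AnalyticAt ℂ (c.Ω a b) v := by
  unfold Ω
  refine analyticAt_fun_sum _ fun k _ => analyticAt_const.fun_mul ?_
  simp only [Matrix.mul_apply, Matrix.transpose_apply]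
  exact analyticAt_fun_sum _ fun σ _ => (analyticAt_fun_sum _ fun ρ _ =>
    (c.analytic _ _ _ v hv).fun_mul analyticAt_const).fun_mul (c.analytic _ _ _ v hv)

lemma pd_Omega (a b : Time n) (γ : Fin n) {v : Fin n → ℂ} (hv : v ∈ X.M) :
    pd γ (c.Ω a b) v = ((c.Θ a.2 v).transpose * X.η * X.C γ v * c.Θ b.2 v) a.1 b.1 := by
  have hC : (X.C γ v).transpose * X.η = X.η * X.C γ v := by
    rw [X.transpose_eq, X.adj_C hv, Matrix.mul_assoc, X.inv_mul_eta, Matrix.mul_one]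
  have hmul : ∀ (p q : ℕ) (α β : Fin n),
      pd γ (fun u => ((c.Θ (p + 1) u).transpose * X.η * c.Θ (q + 1) u) α β) v =
      ((c.Θ p v).transpose * X.η * X.C γ v * c.Θ (q + 1) v +
        (c.Θ (p + 1) v).transpose * X.η * X.C γ v * c.Θ q v) α β := by
    intro p q α β
    have h1 : ∀ ρ, AnalyticAt ℂ (fun u => ∑ σ, c.Θ (p + 1) u σ α * X.η σ ρ) v := fun ρ =>
      analyticAt_fun_sum _ fun σ _ => (c.analytic _ _ _ v hv).fun_mul analyticAt_const
    have h2 : ∀ p γ' ρ, pd γ (fun u => c.Θ (p + 1) u γ' ρ) v = (X.C γ v * c.Θ p v) γ' ρ :=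
      fun p γ' ρ => c.flat v hv p γ γ' ρ
    have hm : (c.Θ p v).transpose * X.η * X.C γ v * c.Θ (q + 1) v +
        (c.Θ (p + 1) v).transpose * X.η * X.C γ v * c.Θ q v =
        (X.C γ v * c.Θ p v).transpose * X.η * c.Θ (q + 1) v +
        (c.Θ (p + 1) v).transpose * X.η * (X.C γ v * c.Θ q v) := by
      rw [Matrix.transpose_mul, Matrix.mul_assoc (c.Θ p v).transpose (X.C γ v).transpose, hC]
      simp only [Matrix.mul_assoc]
    rw [show (fun u => ((c.Θ (p + 1) u).transpose * X.η * c.Θ (q + 1) u) α β) = fun u =>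
      ∑ ρ, (∑ σ, c.Θ (p + 1) u σ α * X.η σ ρ) * c.Θ (q + 1) u ρ β from funext fun u => by
        simp only [Matrix.mul_apply, Matrix.transpose_apply]]
    rw [pd_sum _ fun ρ _ => (h1 ρ).fun_mul (c.analytic _ _ _ v hv)]
    simp only [pd_mul (h1 _) (c.analytic _ _ _ v hv), h2]
    simp only [pd_sum _ fun σ _ => (c.analytic _ _ _ v hv).fun_mul analyticAt_const,
      pd_mul (c.analytic _ _ _ v hv) analyticAt_const, pd_const, mul_zero, add_zero, h2]
    rw [hm, sum_add_distrib]
    simp only [Matrix.add_apply, Matrix.mul_apply, Matrix.transpose_apply]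
  obtain ⟨α, p⟩ := a
  obtain ⟨β, q⟩ := b
  induction q generalizing p with
  | zero =>
    have h1 : ∀ u ∈ X.M, c.Ω (α, p) (β, 0) u = ∑ σ, c.Θ (p + 1) u σ α * X.η σ β := fun u hu => by
      rw [c.Omega_zero _ _ hu]; simp [Matrix.mul_apply]
    rw [pd_congr X.isOpen h1 γ v hv,
      pd_sum _ fun σ _ => (c.analytic _ _ _ v hv).fun_mul analyticAt_const]
    simp only [pd_mul (c.analytic _ _ _ v hv) analyticAt_const, pd_const, mul_zero, add_zero,
      c.flat v hv, c.zero v hv, Matrix.mul_one]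
    rw [Matrix.mul_assoc, ← hC, ← Matrix.mul_assoc, ← Matrix.transpose_mul, Matrix.mul_apply]
    simp only [Matrix.transpose_apply]
  | succ q ih =>
    have h1 : ∀ u, c.Ω (α, p) (β, q + 1) u =
        ((c.Θ (p + 1) u).transpose * X.η * c.Θ (q + 1) u) α β +
          (-1) * c.Ω (α, p + 1) (β, q) u := fun u => by
      rw [Omega_succ]; simp only [up]; ring
    have h2 : AnalyticAt ℂ (fun u => ((c.Θ (p + 1) u).transpose * X.η * c.Θ (q + 1) u) α β) v := by
      simp only [Matrix.mul_apply, Matrix.transpose_apply]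
      exact analyticAt_fun_sum _ fun σ _ => (analyticAt_fun_sum _ fun ρ _ =>
        (c.analytic _ _ _ v hv).fun_mul analyticAt_const).fun_mul (c.analytic _ _ _ v hv)
    have h3 := c.analyticAt_Omega (α, p + 1) (β, q) hv
    rw [show c.Ω (α, p) (β, q + 1) = _ from funext h1,
      pd_add h2 (analyticAt_const.fun_mul h3), pd_const_mul _ h3, ih, hmul]
    simp only [Matrix.add_apply]
    ring

lemma Omega_symm (a b : Time n) {v : Fin n → ℂ} (hv : v ∈ X.M) : c.Ω a b v = c.Ω b a v := by
  obtain ⟨α, p⟩ := a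
  obtain ⟨β, q⟩ := b
  have h := c.orthogonal v hv (p + q + 1) (by omega)
  have h1 : ∑ i ∈ Finset.range (p + 1 + (q + 1)), (-1 : ℂ) ^ i *
      ((c.Θ i v).transpose * X.η * c.Θ (p + q + 1 - i) v) α β = 0 := by
    have h2 := congrArg (fun A => (X.η * A) α β) h
    simp only [Matrix.mul_zero, Matrix.zero_apply, mul_sum, Matrix.mul_smul,
      Matrix.sum_apply, Matrix.smul_apply, smul_eq_mul] at h2
    rw [show p + 1 + (q + 1) = p + q + 1 + 1 by ring, ← h2]
    refine sum_congr rfl fun i _ => ?_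
    rw [FrobeniusManifold.adj, Matrix.mul_assoc X.η⁻¹, Matrix.mul_assoc X.η⁻¹, X.eta_mul_inv_assoc]
  rw [Finset.sum_range_add] at h1
  have h2 : ∑ k ∈ Finset.range (q + 1), (-1 : ℂ) ^ (p + 1 + k) *
      ((c.Θ (p + 1 + k) v).transpose * X.η * c.Θ (p + q + 1 - (p + 1 + k)) v) α β =
      (-1) ^ (p + 1) * c.Ω (α, p) (β, q) v := by
    simp only [Ω, mul_sum]
    refine sum_congr rfl fun k _ => ?_
    rw [show p + q + 1 - (p + 1 + k) = q - k by omega, pow_add, mul_assoc]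
  have h3 : ∑ i ∈ Finset.range (p + 1), (-1 : ℂ) ^ i *
      ((c.Θ i v).transpose * X.η * c.Θ (p + q + 1 - i) v) α β =
      (-1) ^ p * c.Ω (β, q) (α, p) v := by
    rw [← Finset.sum_range_reflect]
    simp only [Ω, mul_sum]
    refine sum_congr rfl fun k hk => ?_
    have hk := mem_range.1 hk
    have h4 : ((c.Θ (q + 1 + k) v).transpose * X.η * c.Θ (p - k) v) β α =
        ((c.Θ (p - k) v).transpose * X.η * c.Θ (q + 1 + k) v) α β := by
      rw [← Matrix.transpose_apply (((c.Θ (q + 1 + k) v).transpose * X.η * c.Θ (p - k) v)),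
        Matrix.transpose_mul, Matrix.transpose_mul, Matrix.transpose_transpose, X.symm.eq,
        Matrix.mul_assoc]
    rw [h4, show p + 1 - 1 - k = p - k by omega, show p + q + 1 - (p - k) = q + 1 + k by omega,
      ← mul_assoc]
    congr 1
    obtain ⟨r, rfl⟩ := Nat.exists_eq_add_of_le (Nat.lt_succ_iff.1 hk)
    rw [show k + r - k = r by omega, ← pow_add, show k + r + k = r + 2 * k by ring, pow_add,
      pow_mul]
    simp
  rw [h2, h3, pow_succ] at h1
  have h5 : (-1 : ℂ) ^ p ≠ 0 := by simp
  have h6 : (-1 : ℂ) ^ p * (c.Ω (β, q) (α, p) v - c.Ω (α, p) (β, q) v) = 0 := by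
    linear_combination h1
  exact (sub_eq_zero.1 ((mul_eq_zero.1 h6).resolve_left h5)).symm

lemma Dt_base (a : Time n) {f : (Fin n → ℂ) → ℂ} {j : Jet n} (hf : AnalyticAt ℂ f (j 0)) :
    c.Dt a (fun j => f (j 0)) j = ∑ γ, pd γ f (j 0) * c.flow a γ j :=
  vecD_comp_base f hf

lemma Dt_theta (a b : Time n) (γ : Fin n) {j : Jet n} (hj : j 0 ∈ X.M) :
    c.Dt a (fun j => c.Θ (b.2 + 1) (j 0) γ b.1) j =
      ((X.mulBy (c.col a (j 0)) (j 0) * X.mulBy (c.col b (j 0)) (j 0)).mulVec (j 1)) γ := by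
  rw [c.Dt_base a (c.analytic _ _ _ _ hj)]
  simp only [c.flat _ hj, c.flow_eq _ _ hj]
  have h1 : ∑ σ, (X.C σ (j 0) * c.Θ b.2 (j 0)) γ b.1 *
      (X.mulBy (j 1) (j 0)).mulVec (c.col a (j 0)) σ =
      (X.mulBy ((X.mulBy (j 1) (j 0)).mulVec (c.col a (j 0))) (j 0)).mulVec (c.col b (j 0)) γ := by
    simp only [FrobeniusManifold.mulBy, Matrix.sum_mulVec, Matrix.smul_mulVec, Finset.sum_apply,
      Pi.smul_apply, smul_eq_mul, Matrix.mul_apply]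
    refine sum_congr rfl fun σ _ => ?_
    rw [mul_comm]; rfl
  rw [h1, X.mulBy_mulVec hj, X.mulBy_mulVec hj (j 1), Matrix.mulVec_mulVec,
    X.mulBy_comm hj (c.col b (j 0))]

lemma Dt_Omega (a b d : Time n) {j : Jet n} (hj : j 0 ∈ X.M) :
    c.Dt a (fun j => c.Ω b d (j 0)) j = c.Dt b (fun j => c.Ω a d (j 0)) j := by
  have h : ∀ a b d, c.Dt a (fun j => c.Ω b d (j 0)) j = dotProduct (c.col b (j 0))
      ((X.η * (X.mulBy (j 1) (j 0) * X.mulBy (c.col d (j 0)) (j 0))).mulVec (c.col a (j 0))) := by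
    intro a b d
    rw [c.Dt_base a (c.analyticAt_Omega _ _ hj)]
    simp only [c.pd_Omega _ _ _ hj, c.flow_eq _ _ hj]
    rw [← Matrix.mulVec_mulVec, ← Matrix.mulVec_mulVec, X.mulBy_mulVec hj (c.col d (j 0)),
      Matrix.mulVec_mulVec _ (X.mulBy (j 1) (j 0)), X.mulBy_mul_mulBy hj]
    simp only [FrobeniusManifold.mulBy, Matrix.sum_mulVec, Matrix.smul_mulVec, Matrix.mulVec_sum,
      Matrix.mulVec_smul, dotProduct_sum, dotProduct_smul, smul_eq_mul]
    refine sum_congr rfl fun σ _ => ?_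
    rw [mul_comm]
    congr 1
    rw [Matrix.mulVec_mulVec, Matrix.mul_assoc, Matrix.mul_assoc]
    simp only [Matrix.mul_apply (M := (c.Θ b.2 (j 0)).transpose), Matrix.transpose_apply,
      dotProduct, col]
    refine sum_congr rfl fun ρ _ => ?_
    rw [← Matrix.mul_assoc]; rfl
  rw [h, h, Matrix.dotProduct_mulVec, ← Matrix.mulVec_transpose, dotProduct_comm]
  congr 2
  rw [X.transpose_eq]
  have h2 : X.adj (X.η * (X.mulBy (j 1) (j 0) * X.mulBy (c.col d (j 0)) (j 0))) =
      (X.mulBy (j 1) (j 0) * X.mulBy (c.col d (j 0)) (j 0)) * X.η := by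
    rw [X.adj_mul, X.adj_mul, X.adj_mulBy hj, X.adj_mulBy hj, X.mulBy_comm hj,
      FrobeniusManifold.adj, X.symm.eq, X.inv_mul_eta, Matrix.one_mul]
  rw [h2, Matrix.mul_assoc, Matrix.mul_assoc, X.eta_mul_inv, Matrix.mul_one]

section Commute

variable {O : Set (Jet n)} {Φ : Jet n → ℂ}

lemma jetAnalyticOn_flow (hM : ∀ j ∈ O, j 0 ∈ X.M) (a : Time n) (γ : Fin n) :
    JetAnalyticOn O (c.flow a γ) :=
  (JetAnalyticOn.comp_base (f := fun v => c.Θ (a.2 + 1) v γ a.1)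
    fun j hj => c.analytic _ _ _ _ (hM j hj)).Dx

lemma jetAnalyticOn_Dt (hM : ∀ j ∈ O, j 0 ∈ X.M) (h : JetAnalyticOn O Φ) (a : Time n) :
    JetAnalyticOn O (c.Dt a Φ) :=
  h.vecD fun r γ => (c.jetAnalyticOn_flow hM a γ).iterate_Dx r

lemma Dt_congr (hO : IsOpen O) {Ψ : Jet n → ℂ} (h : ∀ j ∈ O, Φ j = Ψ j) (a : Time n) :
    ∀ j ∈ O, c.Dt a Φ j = c.Dt a Ψ j := vecD_congr hO h

lemma Dt_zero_eq (hO : IsOpen O) (hM : ∀ j ∈ O, j 0 ∈ X.M) {j : Jet n} (hj : j ∈ O) :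
    c.Dt (0, 0) Φ j = Dx Φ j := by
  refine vecD_congr_field (b := fun r γ => Dx^[r] (c.flow (0, 0) γ))
    (b' := fun r γ j => j (r + 1) γ) fun r γ => ?_
  rw [iterate_Dx_congr hO (fun j hj => c.flow_zero (hM j hj) γ) r j hj, iterate_Dx_coord, add_comm]

lemma Dt_Dx (hM : ∀ j ∈ O, j 0 ∈ X.M) (h : JetAnalyticOn O Φ) (a : Time n) :
    ∀ j ∈ O, c.Dt a (Dx Φ) j = Dx (c.Dt a Φ) j := fun j hj => by
  refine vecD_comm h (fun r γ => (c.jetAnalyticOn_flow hM a γ).iterate_Dx r)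
    (fun r γ => .coord (r + 1) γ) (fun r γ j hj => ?_) hj
  rw [vecD_coord, Function.iterate_succ_apply']; rfl

lemma Dt_iterate_Dx (hO : IsOpen O) (hM : ∀ j ∈ O, j 0 ∈ X.M) (h : JetAnalyticOn O Φ)
    (a : Time n) (r : ℕ) : ∀ j ∈ O, c.Dt a (Dx^[r] Φ) j = Dx^[r] (c.Dt a Φ) j := by
  induction r with
  | zero => exact fun _ _ => rfl
  | succ r ih =>
    intro j hj
    rw [Function.iterate_succ_apply', Function.iterate_succ_apply',
      c.Dt_Dx hM (h.iterate_Dx r) a j hj, Dx_congr hO ih j hj]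

lemma Dt_flow (hO : IsOpen O) (hM : ∀ j ∈ O, j 0 ∈ X.M) (a b : Time n) (γ : Fin n) :
    ∀ j ∈ O, c.Dt a (c.flow b γ) j = Dx (fun j => ((X.mulBy (c.col a (j 0)) (j 0) *
      X.mulBy (c.col b (j 0)) (j 0)).mulVec (j 1)) γ) j := fun j hj => by
  unfold flow
  rw [c.Dt_Dx hM (.comp_base (f := fun v => c.Θ (b.2 + 1) v γ b.1)
    fun j hj => c.analytic _ _ _ _ (hM j hj)) a j hj]
  exact Dx_congr hO (fun j hj => c.Dt_theta a b γ (hM j hj)) j hj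

lemma Dt_comm (hO : IsOpen O) (hM : ∀ j ∈ O, j 0 ∈ X.M) (h : JetAnalyticOn O Φ) (a b : Time n) :
    ∀ j ∈ O, c.Dt a (c.Dt b Φ) j = c.Dt b (c.Dt a Φ) j := fun j hj => by
  refine vecD_comm h (fun r γ => (c.jetAnalyticOn_flow hM a γ).iterate_Dx r)
    (fun r γ => (c.jetAnalyticOn_flow hM b γ).iterate_Dx r) (fun r γ j hj => ?_) hj
  change c.Dt a _ j = c.Dt b _ j
  rw [c.Dt_iterate_Dx hO hM (c.jetAnalyticOn_flow hM b γ) a r j hj,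
    c.Dt_iterate_Dx hO hM (c.jetAnalyticOn_flow hM a γ) b r j hj]
  refine iterate_Dx_congr hO (fun j hj => ?_) r j hj
  rw [c.Dt_flow hO hM a b γ j hj, c.Dt_flow hO hM b a γ j hj]
  refine Dx_congr hO (fun j hj => ?_) j hj
  rw [X.mulBy_comm (hM j hj)]

end Commute

end Calibration

/-! ### Functions on the tau-cover -/

section Cover

variable {n : ℕ}

/-- The derivative with respect to `φ_b`. -/
def phiD (b : Time n) (g : (Time n → ℂ) → Jet n → ℂ) (φ : Time n → ℂ) (j : Jet n) : ℂ :=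
  deriv (fun z => g (Function.update φ b z) j) (φ b)

/-- Polynomials in the variables `φ` whose coefficients are analytic on `O`. -/
inductive CoverPoly (O : Set (Jet n)) : ((Time n → ℂ) → Jet n → ℂ) → Prop
  | jet {f : Jet n → ℂ} (hf : JetAnalyticOn O f) : CoverPoly O fun _ j => f j
  | phi (a : Time n) : CoverPoly O fun φ _ => φ a
  | add {g h} (hg : CoverPoly O g) (hh : CoverPoly O h) : CoverPoly O fun φ j => g φ j + h φ j
  | mul {g h} (hg : CoverPoly O g) (hh : CoverPoly O h) : CoverPoly O fun φ j => g φ j * h φ j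
  | congr {g h} (hg : CoverPoly O g) (he : ∀ φ, ∀ j ∈ O, h φ j = g φ j) : CoverPoly O h

variable {O : Set (Jet n)} {g h : (Time n → ℂ) → Jet n → ℂ}

lemma CoverPoly.sum {ι : Type*} (s : Finset ι) {g : ι → (Time n → ℂ) → Jet n → ℂ}
    (hg : ∀ i ∈ s, CoverPoly O (g i)) : CoverPoly O fun φ j => ∑ i ∈ s, g i φ j := by
  classical
  induction s using Finset.induction_on with
  | empty => simpa using CoverPoly.jet (.const 0)
  | insert a s ha ih =>
    simp only [Finset.sum_insert ha]
    exact .add (hg a (Finset.mem_insert_self a s))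
      (ih fun i hi => hg i (Finset.mem_insert_of_mem hi))

lemma CoverPoly.jetAnalyticOn (hO : IsOpen O) (hg : CoverPoly O g) (φ : Time n → ℂ) :
    JetAnalyticOn O (g φ) := by
  induction hg with
  | jet hf => exact hf
  | phi a => exact .const _
  | add _ _ h1 h2 => exact h1.add h2
  | mul _ _ h1 h2 => exact h1.mul h2
  | congr _ he h1 => exact h1.congr hO (he φ)

lemma CoverPoly.differentiableAt (hg : CoverPoly O g) (φ : Time n → ℂ) (b : Time n) {j : Jet n}
    (hj : j ∈ O) : DifferentiableAt ℂ (fun z => g (Function.update φ b z) j) (φ b) := by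
  induction hg with
  | jet hf => exact differentiableAt_const _
  | phi a =>
    by_cases hab : a = b
    · subst hab; simp
    · simp [Function.update_of_ne hab]
  | add _ _ h1 h2 => exact h1.add h2
  | mul _ _ h1 h2 => exact h1.mul h2
  | congr _ he h1 => simpa only [he _ j hj] using h1

lemma phiD_phi (a b : Time n) (φ : Time n → ℂ) (j : Jet n) :
    phiD b (fun φ _ => φ a) φ j = if b = a then 1 else 0 := by
  unfold phiD
  by_cases hab : b = a
  · subst hab; simp
  · simp [Function.update_of_ne (Ne.symm hab), hab]

lemma phiD_add (hg : CoverPoly O g) (hh : CoverPoly O h) (φ : Time n → ℂ) (b : Time n) {j : Jet n}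
    (hj : j ∈ O) : phiD b (fun φ j => g φ j + h φ j) φ j = phiD b g φ j + phiD b h φ j :=
  deriv_fun_add (hg.differentiableAt φ b hj) (hh.differentiableAt φ b hj)

lemma phiD_mul (hg : CoverPoly O g) (hh : CoverPoly O h) (φ : Time n → ℂ) (b : Time n) {j : Jet n}
    (hj : j ∈ O) : phiD b (fun φ j => g φ j * h φ j) φ j =
      phiD b g φ j * h φ j + g φ j * phiD b h φ j := by
  have := deriv_fun_mul (hg.differentiableAt φ b hj) (hh.differentiableAt φ b hj)
  simpa only [phiD, Function.update_eq_self] using this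

lemma phiD_congr {j : Jet n} (he : ∀ φ, h φ j = g φ j) (φ : Time n → ℂ) (b : Time n) :
    phiD b h φ j = phiD b g φ j := by
  simp only [phiD, he]

lemma CoverPoly.finite_support (hg : CoverPoly O g) (φ : Time n → ℂ) {j : Jet n} (hj : j ∈ O) :
    {b | phiD b g φ j ≠ 0}.Finite := by
  induction hg with
  | jet hf => simp [phiD]
  | phi a =>
    refine (Set.finite_singleton a).subset fun b hb => ?_
    by_contra hne
    exact hb (by rw [phiD_phi]; simp [show b ≠ a from hne])
  | add hg hh h1 h2 =>
    refine (h1.union h2).subset fun b hb => ?_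
    by_contra hne
    simp only [Set.mem_union, Set.mem_ofPred_eq, not_or, not_not] at hne
    exact hb (by rw [phiD_add hg hh φ b hj, hne.1, hne.2, add_zero])
  | mul hg hh h1 h2 =>
    refine (h1.union h2).subset fun b hb => ?_
    by_contra hne
    simp only [Set.mem_union, Set.mem_ofPred_eq, not_or, not_not] at hne
    exact hb (by rw [phiD_mul hg hh φ b hj, hne.1, hne.2, zero_mul, mul_zero, add_zero])
  | congr _ he h1 => simpa only [phiD_congr (fun φ => he φ j hj)] using h1

lemma CoverPoly.finite_support_mul (hg : CoverPoly O g) (φ : Time n → ℂ) {j : Jet n} (hj : j ∈ O)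
    (z : Time n → ℂ) : (Function.support fun b => phiD b g φ j * z b).Finite :=
  (hg.finite_support φ hj).subset fun b hb h0 => hb (by simp [h0])

end Cover

namespace Calibration

variable {n : ℕ} [NeZero n] {X : FrobeniusManifold n} (c : Calibration X)

/-- The derivative `∂/∂t^a` on functions on the tau-cover that do not depend explicitly on the
times. -/
def cD (a : Time n) (g : (Time n → ℂ) → Jet n → ℂ) (φ : Time n → ℂ) (j : Jet n) : ℂ :=
  (∑ᶠ b : Time n, phiD b g φ j * c.Ω a b (j 0)) + c.Dt a (g φ) j

lemma coverD_const (a : Time n) (g : (Time n → ℂ) → Jet n → ℂ) (t : Time n →₀ ℂ)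
    (φ : Time n → ℂ) (j : Jet n) : c.coverD a (fun _ => g) t φ j = c.cD a g φ j := by
  simp [coverD, cD, phiD]

variable {O : Set (Jet n)} {g h : (Time n → ℂ) → Jet n → ℂ}

lemma cD_congr (hO : IsOpen O) (he : ∀ φ, ∀ j ∈ O, h φ j = g φ j) (a : Time n) (φ : Time n → ℂ) :
    ∀ j ∈ O, c.cD a h φ j = c.cD a g φ j := fun j hj => by
  unfold cD
  rw [c.Dt_congr hO (he φ) a j hj]
  congr 1
  exact finsum_congr fun b => by rw [phiD_congr fun φ => he φ j hj]

lemma cD_jet (f : Jet n → ℂ) (a : Time n) (φ : Time n → ℂ) (j : Jet n) :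
    c.cD a (fun _ j => f j) φ j = c.Dt a f j := by
  simp [cD, phiD]

lemma cD_phi (a b : Time n) (φ : Time n → ℂ) (j : Jet n) :
    c.cD a (fun φ _ => φ b) φ j = c.Ω a b (j 0) := by
  unfold cD
  simp only [phiD_phi, ite_mul, one_mul, zero_mul]
  rw [finsum_eq_single _ b fun b' hb => by simp [hb]]
  simp [Dt, evD, jd_const]

lemma cD_add (hO : IsOpen O) (hg : CoverPoly O g) (hh : CoverPoly O h) (a : Time n)
    (φ : Time n → ℂ) : ∀ j ∈ O, c.cD a (fun φ j => g φ j + h φ j) φ j =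
      c.cD a g φ j + c.cD a h φ j := fun j hj => by
  unfold cD
  rw [show c.Dt a (fun j => g φ j + h φ j) j = c.Dt a (g φ) j + c.Dt a (h φ) j from
    vecD_add (hg.jetAnalyticOn hO φ j hj) (hh.jetAnalyticOn hO φ j hj)]
  simp only [phiD_add hg hh φ _ hj, add_mul]
  rw [finsum_add_distrib (hg.finite_support_mul φ hj _) (hh.finite_support_mul φ hj _)]
  ring

lemma cD_mul (hO : IsOpen O) (hg : CoverPoly O g) (hh : CoverPoly O h) (a : Time n)
    (φ : Time n → ℂ) : ∀ j ∈ O, c.cD a (fun φ j => g φ j * h φ j) φ j =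
      c.cD a g φ j * h φ j + g φ j * c.cD a h φ j := fun j hj => by
  unfold cD
  rw [show c.Dt a (fun j => g φ j * h φ j) j = c.Dt a (g φ) j * h φ j + g φ j * c.Dt a (h φ) j from
    vecD_mul (hg.jetAnalyticOn hO φ j hj) (hh.jetAnalyticOn hO φ j hj)]
  simp only [phiD_mul hg hh φ _ hj]
  have h1 : ∀ b, (phiD b g φ j * h φ j + g φ j * phiD b h φ j) * c.Ω a b (j 0) =
      phiD b g φ j * (c.Ω a b (j 0) * h φ j) + g φ j * (phiD b h φ j * c.Ω a b (j 0)) :=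
    fun b => by ring
  simp only [h1]
  rw [finsum_add_distrib (hg.finite_support_mul φ hj _)
    ((hh.finite_support_mul φ hj _).subset fun b hb h0 => hb (by
      rw [show phiD b h φ j * c.Ω a b (j 0) = 0 from h0, mul_zero])),
    ← mul_finsum' _ _ (hh.finite_support_mul φ hj _)]
  simp only [← mul_assoc]
  rw [← finsum_mul' _ _ (hg.finite_support_mul φ hj _)]
  ring

lemma coverPoly_cD (hO : IsOpen O) (hM : ∀ j ∈ O, j 0 ∈ X.M) (hg : CoverPoly O g) (a : Time n) :
    CoverPoly O (c.cD a g) := by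
  induction hg with
  | jet hf => exact .congr (.jet (c.jetAnalyticOn_Dt hM hf a)) fun φ j _ => c.cD_jet _ a φ j
  | phi b => exact .congr (.jet (.comp_base (f := c.Ω a b)
      fun j hj => c.analyticAt_Omega a b (hM j hj))) fun φ j _ => c.cD_phi a b φ j
  | add hg hh h1 h2 => exact .congr (h1.add h2) (c.cD_add hO hg hh a)
  | mul hg hh h1 h2 => exact .congr ((h1.mul hh).add (hg.mul h2)) (c.cD_mul hO hg hh a)
  | congr _ he h1 => exact .congr h1 (c.cD_congr hO he a)

lemma cD_comm (hO : IsOpen O) (hM : ∀ j ∈ O, j 0 ∈ X.M) (hg : CoverPoly O g) (a b : Time n)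
    (φ : Time n → ℂ) : ∀ j ∈ O, c.cD a (c.cD b g) φ j = c.cD b (c.cD a g) φ j := by
  induction hg generalizing φ with
  | jet hf =>
    intro j hj
    rw [c.cD_congr hO (fun φ j _ => c.cD_jet _ b φ j) a φ j hj,
      c.cD_congr hO (fun φ j _ => c.cD_jet _ a φ j) b φ j hj, cD_jet, cD_jet,
      c.Dt_comm hO hM hf a b j hj]
  | phi d =>
    intro j hj
    rw [c.cD_congr hO (fun φ j _ => c.cD_phi b d φ j) a φ j hj,
      c.cD_congr hO (fun φ j _ => c.cD_phi a d φ j) b φ j hj]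
    rw [c.cD_jet (fun j => c.Ω b d (j 0)), c.cD_jet (fun j => c.Ω a d (j 0)),
      c.Dt_Omega a b d (hM j hj)]
  | add hg hh h1 h2 =>
    intro j hj
    have e : ∀ a φ, ∀ j ∈ O, _ := fun a φ => c.cD_add hO hg hh a φ
    rw [c.cD_congr hO (e b) a φ j hj, c.cD_congr hO (e a) b φ j hj,
      c.cD_add hO (c.coverPoly_cD hO hM hg b) (c.coverPoly_cD hO hM hh b) a φ j hj,
      c.cD_add hO (c.coverPoly_cD hO hM hg a) (c.coverPoly_cD hO hM hh a) b φ j hj,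
      h1 φ j hj, h2 φ j hj]
  | mul hg hh h1 h2 =>
    intro j hj
    have e : ∀ a φ, ∀ j ∈ O, _ := fun a φ => c.cD_mul hO hg hh a φ
    have P := fun a => c.coverPoly_cD hO hM hg a
    have Q := fun a => c.coverPoly_cD hO hM hh a
    rw [c.cD_congr hO (e b) a φ j hj, c.cD_congr hO (e a) b φ j hj,
      c.cD_add hO ((P b).mul hh) (hg.mul (Q b)) a φ j hj,
      c.cD_add hO ((P a).mul hh) (hg.mul (Q a)) b φ j hj,
      c.cD_mul hO (P b) hh a φ j hj, c.cD_mul hO hg (Q b) a φ j hj,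
      c.cD_mul hO (P a) hh b φ j hj, c.cD_mul hO hg (Q a) b φ j hj, h1 φ j hj, h2 φ j hj]
    ring
  | congr _ he h1 =>
    intro j hj
    rw [c.cD_congr hO (c.cD_congr hO he b) a φ j hj, c.cD_congr hO (c.cD_congr hO he a) b φ j hj,
      h1 φ j hj]

lemma cD_sum (hO : IsOpen O) {ι : Type*} (s : Finset ι) {g : ι → (Time n → ℂ) → Jet n → ℂ}
    (hg : ∀ i ∈ s, CoverPoly O (g i)) (a : Time n) (φ : Time n → ℂ) :
    ∀ j ∈ O, c.cD a (fun φ j => ∑ i ∈ s, g i φ j) φ j = ∑ i ∈ s, c.cD a (g i) φ j := by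
  classical
  induction s using Finset.induction_on with
  | empty =>
    intro j _
    simp only [Finset.sum_empty]
    rw [c.cD_jet (fun _ => 0)]
    exact vecD_const 0
  | insert i s hi ih =>
    intro j hj
    simp only [Finset.sum_insert hi]
    rw [c.cD_add hO (hg i (Finset.mem_insert_self i s))
      (.sum s fun k hk => hg k (Finset.mem_insert_of_mem hk)) a φ j hj,
      ih (fun k hk => hg k (Finset.mem_insert_of_mem hk)) j hj]

/-! ### Derivatives of the tau-function -/

variable (F : ℕ → Jet n → ℂ)

/-- The `ε^k`-coefficients of `ε^{2|J|} τ⁻¹ ∂_J τ`; they do not depend on the times explicitly. -/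
def tm (J : List (Time n)) (k : ℕ) (φ : Time n → ℂ) (j : Jet n) : ℂ := c.tauMon F J k 0 φ j

/-- The coefficients of `ε² ∂ log τ / ∂t^a`. -/
def logD (a : Time n) (i : ℕ) (φ : Time n → ℂ) (j : Jet n) : ℂ :=
  if i = 0 then φ a else c.Dt a (F i) j

lemma tauMon_eq_tm (J : List (Time n)) (k : ℕ) (t : Time n →₀ ℂ) :
    c.tauMon F J k t = c.tm F J k := by
  induction J generalizing k t with
  | nil => rfl
  | cons a J ih =>
    have h1 : ∀ k, c.tauMon F J k = fun _ => c.tm F J k := fun k => funext fun t => ih k t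
    funext φ j
    change c.tauMon F (a :: J) k t φ j = c.tauMon F (a :: J) k 0 φ j
    simp only [tauMon, h1, coverD_const]

lemma tm_cons (a : Time n) (J : List (Time n)) (k : ℕ) (φ : Time n → ℂ) (j : Jet n) :
    c.tm F (a :: J) k φ j = (if 2 ≤ k then c.cD a (c.tm F J (k - 2)) φ j else 0) +
      ∑ x ∈ antidiagonal k, c.logD F a x.1 φ j * c.tm F J x.2 φ j := by
  have h1 : ∀ k, c.tauMon F J k = fun _ => c.tm F J k := fun k => funext fun t => c.tauMon_eq_tm F J k t
  change c.tauMon F (a :: J) k 0 φ j = _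
  simp only [tauMon, h1, coverD_const]
  rw [Finset.Nat.sum_antidiagonal_eq_sum_range_succ_mk, sum_range_succ', add_assoc,
    add_comm (φ a * _), Finset.range_eq_Ico, Finset.sum_Ico_add' (fun i => c.logD F a i φ j *
      c.tm F J (k - i) φ j) 0 k 1]
  congr 2
  · refine sum_congr (by ext; simp) fun i hi => ?_
    rw [logD, if_neg (by have := Finset.mem_Ico.1 hi; omega)]

variable {F} {K : ℕ}

lemma coverPoly_logD (hM : ∀ j ∈ O, j 0 ∈ X.M) (hF : ∀ i, 0 < i → i ≤ K → JetAnalyticOn O (F i))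
    (a : Time n) {i : ℕ} (hi : i ≤ K) : CoverPoly O (c.logD F a i) := by
  by_cases h0 : i = 0
  · subst h0; exact .congr (.phi a) fun φ j _ => by simp [logD]
  · exact .congr (.jet (c.jetAnalyticOn_Dt hM (hF i (Nat.pos_of_ne_zero h0) hi) a))
      fun φ j _ => by simp [logD, h0]

lemma coverPoly_tm (hO : IsOpen O) (hM : ∀ j ∈ O, j 0 ∈ X.M)
    (hF : ∀ i, 0 < i → i ≤ K → JetAnalyticOn O (F i)) (J : List (Time n)) {k : ℕ} (hk : k ≤ K) :
    CoverPoly O (c.tm F J k) := by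
  induction J generalizing k with
  | nil => exact .jet (.const (if k = 0 then 1 else 0))
  | cons a J ih =>
    refine .congr ?_ fun φ j _ => c.tm_cons F a J k φ j
    refine .add ?_ (.sum _ fun x hx => .mul ?_ ?_)
    · by_cases h2 : 2 ≤ k
      · simp only [h2, if_true]
        exact c.coverPoly_cD hO hM (ih (by omega)) a
      · simp only [h2, if_false]
        exact .jet (.const 0)
    all_goals have := mem_antidiagonal.1 hx
    · exact c.coverPoly_logD hM hF a (by omega)
    · exact ih (by omega)

lemma cD_logD_symm (hO : IsOpen O) (hM : ∀ j ∈ O, j 0 ∈ X.M)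
    (hF : ∀ i, 0 < i → i ≤ K → JetAnalyticOn O (F i)) (a b : Time n) {i : ℕ} (hi : i ≤ K)
    (φ : Time n → ℂ) : ∀ j ∈ O, c.cD a (c.logD F b i) φ j = c.cD b (c.logD F a i) φ j := by
  intro j hj
  by_cases h0 : i = 0
  · subst h0
    rw [show c.logD F b 0 = fun φ _ => φ b from by funext φ j; simp [logD],
      show c.logD F a 0 = fun φ _ => φ a from by funext φ j; simp [logD], cD_phi, cD_phi,
      c.Omega_symm a b (hM j hj)]
  · rw [show c.logD F b i = fun _ j => c.Dt b (F i) j from by funext φ j; simp [logD, h0],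
      show c.logD F a i = fun _ j => c.Dt a (F i) j from by funext φ j; simp [logD, h0], cD_jet,
      cD_jet]
    exact c.Dt_comm hO hM (hF i (Nat.pos_of_ne_zero h0) hi) a b j hj

lemma sum_antidiagonal_two_le (f g : ℕ → ℂ) (k : ℕ) :
    ∑ x ∈ antidiagonal k, f x.1 * (if 2 ≤ x.2 then g (x.2 - 2) else 0) =
      if 2 ≤ k then ∑ x ∈ antidiagonal (k - 2), f x.1 * g x.2 else 0 := by
  by_cases h2 : 2 ≤ k
  · obtain ⟨l, rfl⟩ : ∃ l, k = l + 2 := ⟨k - 2, by omega⟩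
    simp only [h2, if_true, Nat.add_sub_cancel]
    rw [Finset.Nat.sum_antidiagonal_eq_sum_range_succ_mk, Finset.Nat.sum_antidiagonal_eq_sum_range_succ_mk,
      sum_range_succ, sum_range_succ]
    simp only [show ¬ 2 ≤ l + 2 - (l + 1) by omega, Nat.sub_self, show ¬ (2 ≤ 0) by omega,
      if_false, mul_zero, add_zero]
    refine sum_congr rfl fun i hi => ?_
    have := mem_range.1 hi
    rw [if_pos (by omega), show l + 2 - i - 2 = l - i by omega]
  · rw [if_neg h2]
    refine sum_eq_zero fun x hx => ?_
    have := mem_antidiagonal.1 hx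
    rw [if_neg (by omega), mul_zero]

lemma tm_cons_cons (hO : IsOpen O) (hM : ∀ j ∈ O, j 0 ∈ X.M)
    (hF : ∀ i, 0 < i → i ≤ K → JetAnalyticOn O (F i)) (a b : Time n) (J : List (Time n)) {k : ℕ}
    (hk : k ≤ K) (φ : Time n → ℂ) : ∀ j ∈ O, c.tm F (a :: b :: J) k φ j =
      (if 2 ≤ k then ((if 2 ≤ k - 2 then c.cD a (c.cD b (c.tm F J (k - 2 - 2))) φ j else 0) +
        ∑ x ∈ antidiagonal (k - 2), c.cD a (c.logD F b x.1) φ j * c.tm F J x.2 φ j +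
        (∑ x ∈ antidiagonal (k - 2), c.logD F b x.1 φ j * c.cD a (c.tm F J x.2) φ j +
        ∑ x ∈ antidiagonal (k - 2), c.logD F a x.1 φ j * c.cD b (c.tm F J x.2) φ j)) else 0) +
      ∑ x ∈ antidiagonal k, ∑ y ∈ antidiagonal x.2,
        c.logD F a x.1 φ j * c.logD F b y.1 φ j * c.tm F J y.2 φ j := by
  intro j hj
  rw [tm_cons]
  have h1 : ∑ x ∈ antidiagonal k, c.logD F a x.1 φ j * c.tm F (b :: J) x.2 φ j =
      (if 2 ≤ k then ∑ x ∈ antidiagonal (k - 2), c.logD F a x.1 φ j *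
        c.cD b (c.tm F J x.2) φ j else 0) +
      ∑ x ∈ antidiagonal k, ∑ y ∈ antidiagonal x.2,
        c.logD F a x.1 φ j * c.logD F b y.1 φ j * c.tm F J y.2 φ j := by
    simp only [tm_cons, mul_add, sum_add_distrib]
    rw [sum_antidiagonal_two_le (fun i => c.logD F a i φ j)
      (fun i => c.cD b (c.tm F J i) φ j)]
    simp only [mul_sum, mul_assoc]
  rw [h1, ← add_assoc]
  congr 1
  by_cases h2 : 2 ≤ k
  · simp only [h2, if_true]
    have hT : ∀ x ∈ antidiagonal (k - 2), CoverPoly O (c.logD F b x.1) ∧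
        CoverPoly O (c.tm F J x.2) := fun x hx => by
      have := mem_antidiagonal.1 hx
      exact ⟨c.coverPoly_logD hM hF b (by omega), c.coverPoly_tm hO hM hF J (by omega)⟩
    have hA : CoverPoly O fun φ j =>
        (if 2 ≤ k - 2 then c.cD b (c.tm F J (k - 2 - 2)) φ j else 0) := by
      by_cases h4 : 2 ≤ k - 2
      · simp only [h4, if_true]
        exact c.coverPoly_cD hO hM (c.coverPoly_tm hO hM hF J (by omega)) b
      · simp only [h4, if_false]; exact .jet (.const 0)
    rw [c.cD_congr hO (fun φ j _ => c.tm_cons F b J (k - 2) φ j) a φ j hj,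
      c.cD_add hO hA (.sum _ fun x hx => (hT x hx).1.mul (hT x hx).2) a φ j hj,
      c.cD_sum hO _ (fun x hx => (hT x hx).1.mul (hT x hx).2) a φ j hj,
      sum_congr rfl fun x hx => c.cD_mul hO (hT x hx).1 (hT x hx).2 a φ j hj,
      sum_add_distrib]
    have h5 : c.cD a (fun φ j =>
        (if 2 ≤ k - 2 then c.cD b (c.tm F J (k - 2 - 2)) φ j else 0)) φ j =
        if 2 ≤ k - 2 then c.cD a (c.cD b (c.tm F J (k - 2 - 2))) φ j else 0 := by
      split_ifs
      · rfl
      · rw [c.cD_jet (fun _ => 0)]; exact vecD_const 0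
    rw [h5]; ring
  · simp [h2]
lemma tm_swap (hO : IsOpen O) (hM : ∀ j ∈ O, j 0 ∈ X.M)
    (hF : ∀ i, 0 < i → i ≤ K → JetAnalyticOn O (F i)) (a b : Time n) (J : List (Time n)) {k : ℕ}
    (hk : k ≤ K) (φ : Time n → ℂ) :
    ∀ j ∈ O, c.tm F (a :: b :: J) k φ j = c.tm F (b :: a :: J) k φ j := by
  intro j hj
  have h1 := sum_antidiagonal_swap (fun x y z => c.logD F a x φ j * c.logD F b y φ j *
    c.tm F J z φ j) k
  have h2 : ∑ x ∈ antidiagonal k, ∑ y ∈ antidiagonal x.2,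
      c.logD F b x.1 φ j * c.logD F a y.1 φ j * c.tm F J y.2 φ j =
      ∑ x ∈ antidiagonal k, ∑ y ∈ antidiagonal x.2,
        c.logD F a y.1 φ j * c.logD F b x.1 φ j * c.tm F J y.2 φ j :=
    sum_congr rfl fun x _ => sum_congr rfl fun y _ => by ring
  have h3 : ∑ x ∈ antidiagonal (k - 2), c.cD a (c.logD F b x.1) φ j * c.tm F J x.2 φ j =
      ∑ x ∈ antidiagonal (k - 2), c.cD b (c.logD F a x.1) φ j * c.tm F J x.2 φ j := by
    refine sum_congr rfl fun x hx => ?_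
    have := mem_antidiagonal.1 hx
    rw [c.cD_logD_symm hO hM hF a b (by omega) φ j hj]
  have h4 : c.cD a (c.cD b (c.tm F J (k - 2 - 2))) φ j =
      c.cD b (c.cD a (c.tm F J (k - 2 - 2))) φ j :=
    c.cD_comm hO hM (c.coverPoly_tm hO hM hF J (by omega)) a b φ j hj
  rw [c.tm_cons_cons hO hM hF a b J hk φ j hj, c.tm_cons_cons hO hM hF b a J hk φ j hj, h1, h2, h3,
    h4, add_comm (∑ x ∈ antidiagonal (k - 2), c.logD F b x.1 φ j * _)]

lemma tm_perm (hO : IsOpen O) (hM : ∀ j ∈ O, j 0 ∈ X.M)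
    (hF : ∀ i, 0 < i → i ≤ K → JetAnalyticOn O (F i)) {J J' : List (Time n)} (h : J.Perm J')
    {k : ℕ} (hk : k ≤ K) (φ : Time n → ℂ) : ∀ j ∈ O, c.tm F J k φ j = c.tm F J' k φ j := by
  induction h generalizing k φ with
  | nil => exact fun _ _ => rfl
  | cons a _ ih =>
    intro j hj
    rw [tm_cons, tm_cons]
    congr 1
    · split_ifs
      · exact c.cD_congr hO (fun φ => ih (by omega) φ) a φ j hj
      · rfl
    · refine sum_congr rfl fun x hx => ?_
      have := mem_antidiagonal.1 hx
      rw [ih (by omega) φ j hj]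
  | swap a b J => exact c.tm_swap hO hM hF b a J hk φ
  | trans _ _ h1 h2 => exact fun j hj => (h1 hk φ j hj).trans (h2 hk φ j hj)

lemma tm_zero (J : List (Time n)) (φ : Time n → ℂ) (j : Jet n) :
    c.tm F J 0 φ j = (J.map φ).prod := by
  induction J with
  | nil => simp [tm, tauMon]
  | cons a J ih => rw [tm_cons]; simp [ih, logD]

end Calibration

/-! ### Symmetrization -/

/-- Identities between homogeneous polynomials hold for symmetric functions of the factors. -/
lemma sum_symmetric_eq {σ ι κ : Type*} (S : Finset ι) (q : ι → ℂ) (J : ι → List σ)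
    (S' : Finset κ) (q' : κ → ℂ) (J' : κ → List σ)
    (h : ∀ φ : σ → ℂ, ∑ x ∈ S, q x * ((J x).map φ).prod = ∑ x ∈ S', q' x * ((J' x).map φ).prod)
    (m : List σ → ℂ) (hm : ∀ L L' : List σ, L.Perm L' → m L = m L') :
    ∑ x ∈ S, q x * m (J x) = ∑ x ∈ S', q' x * m (J' x) := by
  classical
  let mon : List σ → MvPolynomial σ ℂ := fun L => (L.map MvPolynomial.X).prod
  have hmon : ∀ (L : List σ) (φ : σ → ℂ), MvPolynomial.eval φ (mon L) = (L.map φ).prod := by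
    intro L φ
    simp only [mon]
    rw [map_list_prod, List.map_map]
    congr 2
    funext a; simp
  have hmon' : ∀ L : List σ, mon L =
      MvPolynomial.monomial (Multiset.toFinsupp (L : Multiset σ)) 1 := by
    intro L
    induction L with
    | nil => simp [mon]
    | cons a L ih =>
      simp only [mon, List.map_cons, List.prod_cons] at ih ⊢
      rw [ih, MvPolynomial.X, MvPolynomial.monomial_mul, one_mul, ← Multiset.cons_coe,
        ← Multiset.singleton_add, map_add, Multiset.toFinsupp_singleton]
  have hpoly : ∑ x ∈ S, q x • mon (J x) = ∑ x ∈ S', q' x • mon (J' x) := by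
    refine MvPolynomial.funext fun φ => ?_
    simpa only [map_sum, MvPolynomial.smul_eval, hmon] using h φ
  let T : MvPolynomial σ ℂ →ₗ[ℂ] ℂ := (MvPolynomial.basisMonomials σ ℂ).constr ℂ
    fun s => m (Finsupp.toMultiset s).toList
  have hT : ∀ L, T (mon L) = m L := by
    intro L
    rw [hmon', show MvPolynomial.monomial (Multiset.toFinsupp (L : Multiset σ)) (1 : ℂ) =
      MvPolynomial.basisMonomials σ ℂ (Multiset.toFinsupp (L : Multiset σ)) from
        (congrFun (MvPolynomial.coe_basisMonomials σ ℂ) _).symm]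
    simp only [T]
    rw [Module.Basis.constr_basis, Multiset.toFinsupp_toMultiset]
    exact hm _ _ (Multiset.coe_eq_coe.1 (Multiset.coe_toList _))
  have := congrArg T hpoly
  simpa only [map_sum, map_smul, hT, smul_eq_mul] using this

/-! ### The consequences of the linearization of the Virasoro symmetries -/

/-- The times entering the quadratic part of the Virasoro operators. -/
def lowTimes (n m : ℕ) : Finset (Time n) := Finset.univ ×ˢ Finset.range m

lemma sum_lowTimes {n : ℕ} {A : Type*} [AddCommMonoid A] (m : ℕ) (f : Time n → A) :
    ∑ a ∈ lowTimes n m, f a = ∑ k ∈ Finset.range m, ∑ α, f (α, k) := by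
  rw [lowTimes, Finset.sum_product, sum_comm]

namespace Calibration

variable {n : ℕ} [NeZero n] {X : FrobeniusManifold n} (c : Calibration X) {F : ℕ → Jet n → ℂ}
  {j₀ : Jet n}

lemma exists_nhd (hj₀ : j₀ 0 ∈ X.M) (hF : ∀ k, 0 < k → ∃ N, JetAnalyticAt N (F k) j₀) (K : ℕ) :
    ∃ O : Set (Jet n), IsOpen O ∧ j₀ ∈ O ∧ (∀ j ∈ O, j 0 ∈ X.M) ∧
      ∀ i, 0 < i → i ≤ K → JetAnalyticOn O (F i) := by
  have h1 : ∀ᶠ j : Jet n in 𝓝 j₀, j 0 ∈ X.M :=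
    (continuous_apply 0).continuousAt.eventually (X.isOpen.mem_nhds hj₀)
  have h2 : ∀ᶠ j : Jet n in 𝓝 j₀, ∀ i ∈ Finset.Icc 1 K, ∃ N, JetAnalyticAt N (F i) j := by
    rw [Filter.eventually_all_finset]
    intro i hi
    obtain ⟨N, hN⟩ := hF i (mem_Icc.1 hi).1
    exact hN.eventually.mono fun j hj => ⟨N, hj⟩
  obtain ⟨O, hO, hO', hj⟩ := eventually_nhds_iff.1 (h1.and h2)
  exact ⟨O, hO', hj, fun j hj => (hO j hj).1, fun i h0 hi j hj =>
    (hO j hj).2 i (mem_Icc.2 ⟨h0, hi⟩)⟩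

lemma virF_zero (m : ℕ) (φ : Time n → ℂ) (j : Jet n) : c.virF m 0 φ j =
    ∑ x ∈ lowTimes n m ×ˢ lowTimes n m, c.virA m x.1 x.2 * ([x.1, x.2].map φ).prod := by
  rw [Finset.sum_product, sum_lowTimes]
  simp only [sum_lowTimes, virF, Finsupp.sum_zero_index, add_zero]
  refine sum_congr rfl fun k _ => ?_
  symm
  rw [sum_comm]
  refine sum_congr rfl fun l _ => sum_congr rfl fun α _ =>
    sum_congr rfl fun β _ => ?_
  simp [mul_assoc]

theorem virasoro_reduced (hj₀ : j₀ 0 ∈ X.M) (hF : ∀ k, 0 < k → ∃ N, JetAnalyticAt N (F k) j₀)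
    (hlin : c.LinearizesVirasoro F j₀) (m : ℕ) :
    ∃ (S : Finset (List (Time n))) (q : List (Time n) → ℂ) (κ : ℂ), (∀ J ∈ S, J.length = 1) ∧
      ∀ k : ℕ, 1 ≤ k → ∀ᶠ j in 𝓝 j₀, ∀ φ : Time n → ℂ,
        ∑ x ∈ lowTimes n m ×ˢ lowTimes n m, c.virA m x.1 x.2 * c.tm F [x.1, x.2] k φ j +
          ∑ J ∈ S, q J * c.tm F J (k - 1) φ j + (if k = 2 then κ else 0) =
        c.virTau F m ((k : ℤ) - 2) 0 φ j := by
  classical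
  obtain ⟨ℓ, ⟨N, hN⟩, hfin, heq⟩ := hlin m
  set s := (hfin 0).toFinset with hs
  have hlen : ∀ J ∈ s, J.length < N + 3 := by
    intro J hJ
    have := hN 0 J (by simpa [hs] using hJ)
    simp at this; omega
  let q : List (Time n) → ℂ := ℓ 0
  let A : ℤ → ℕ → (Time n → ℂ) → Jet n → ℂ := fun e L φ j =>
    ∑ J ∈ s with J.length = L,
      q J * (if 0 ≤ e + (L : ℤ) then c.tm F J (e + (L : ℤ)).toNat φ j else 0)
  have red : ∀ e : ℤ, ∀ᶠ j in 𝓝 j₀, ∀ φ : Time n → ℂ,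
      ∑ L ∈ Finset.range (N + 3), A e L φ j = c.virTau F m e 0 φ j := by
    intro e
    filter_upwards [heq e] with j hj φ
    rw [← hj 0 φ]
    rw [finsum_eq_sum_of_support_subset (s := s.image fun J => ((0 : Time n →₀ ℕ), J))]
    · rw [Finset.sum_image fun J _ J' _ h => (Prod.mk.inj h).2]
      rw [← Finset.sum_fiberwise_of_maps_to (g := List.length) (t := Finset.range (N + 3))
        fun J hJ => mem_range.2 (hlen J hJ)]
      refine sum_congr rfl fun L _ => sum_congr rfl fun J hJ => ?_
      have hL := (Finset.mem_filter.1 hJ).2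
      simp [q, hL, tauMon_eq_tm]
    · rintro ⟨I, J⟩ hx
      have hx' := Function.mem_support.1 hx
      have hI : I = 0 := by
        by_contra hI
        obtain ⟨a, ha⟩ := Finsupp.ne_iff.1 hI
        refine hx' ?_
        have : (I.prod fun a p => (0 : Time n →₀ ℂ) a ^ p) = 0 :=
          Finset.prod_eq_zero (Finsupp.mem_support_iff.2 ha) (by simpa using ha)
        simp only [this, mul_zero, zero_mul]
      subst hI
      have hJ : ℓ 0 J ≠ 0 := fun h0 => hx' (by simp [h0])
      simp only [Finset.coe_image, Set.mem_image, Finset.mem_coe]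
      exact ⟨J, by simpa [hs] using hJ, rfl⟩
  have perm : ∀ K, ∃ O : Set (Jet n), IsOpen O ∧ j₀ ∈ O ∧ ∀ j ∈ O, ∀ k ≤ K, ∀ φ,
      ∀ J J' : List (Time n), J.Perm J' → c.tm F J k φ j = c.tm F J' k φ j := by
    intro K
    obtain ⟨O, hO, hj, hM, hFO⟩ := exists_nhd (X := X) hj₀ hF K
    exact ⟨O, hO, hj, fun j hj k hk φ J J' hJ => c.tm_perm hO hM hFO hJ hk φ j hj⟩
  have perm0 : ∀ k φ, ∀ J J' : List (Time n), J.Perm J' → c.tm F J k φ j₀ = c.tm F J' k φ j₀ := by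
    intro k φ
    obtain ⟨O, -, hj, h⟩ := perm k
    exact h j₀ hj k le_rfl φ
  have high : ∀ d L, N + 3 ≤ L + d → 3 ≤ L → ∀ μ : List (Time n) → ℂ,
      (∀ J J' : List (Time n), J.Perm J' → μ J = μ J') →
      ∑ J ∈ s with J.length = L, q J * μ J = 0 := by
    intro d
    induction d with
    | zero =>
      intro L hL _ μ _
      refine sum_eq_zero fun J hJ => ?_
      have h1 := Finset.mem_filter.1 hJ
      have := hlen J h1.1
      omega
    | succ d ih =>
      intro L hL h3 μ hμ
      have := sum_symmetric_eq (s.filter fun J => J.length = L) q id (∅ : Finset ℕ)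
        (fun _ => 0) (fun _ => []) (fun φ => ?_) μ hμ
      · simpa using this
      rw [Finset.sum_empty]
      have h1 := (red (-(L : ℤ))).self_of_nhds φ
      have h2 : c.virTau F m (-(L : ℤ)) 0 φ j₀ = 0 := by
        rw [virTau, if_neg (by omega), if_neg (by omega)]
      rw [h2] at h1
      by_cases hLN : L < N + 3
      · rw [Finset.sum_eq_single L] at h1
        · rw [← h1]
          refine sum_congr rfl fun J _ => ?_
          rw [if_pos (by omega), show (-(L : ℤ) + L).toNat = 0 by simp, tm_zero]
          rfl
        · intro L' _ hne
          rcases lt_or_gt_of_ne hne with hlt | hgt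
          · refine sum_eq_zero fun J _ => ?_
            rw [if_neg (by omega), mul_zero]
          · have : ∀ J, (if 0 ≤ -(L : ℤ) + (L' : ℤ) then
                c.tm F J (-(L : ℤ) + (L' : ℤ)).toNat φ j₀ else 0) =
                c.tm F J (-(L : ℤ) + (L' : ℤ)).toNat φ j₀ := fun J => if_pos (by omega)
            simp only [A, this]
            exact ih L' (by omega) (by omega) _ fun J J' h => perm0 _ φ J J' h
        · intro h; exact absurd (mem_range.2 hLN) h
      · refine sum_eq_zero fun J hJ => ?_
        have h1 := Finset.mem_filter.1 hJ
        have := hlen J h1.1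
        omega
  have split : ∀ f : ℕ → ℂ, (∀ L, 3 ≤ L → f L = 0) →
      ∑ L ∈ Finset.range (N + 3), f L = f 2 + f 1 + f 0 := by
    intro f hf
    rw [sum_range_succ', sum_range_succ', sum_range_succ',
      sum_eq_zero fun i _ => hf _ (by omega), zero_add]
  have two : ∀ μ : List (Time n) → ℂ, (∀ J J' : List (Time n), J.Perm J' → μ J = μ J') →
      ∑ J ∈ s with J.length = 2, q J * μ J =
        ∑ x ∈ lowTimes n m ×ˢ lowTimes n m, c.virA m x.1 x.2 * μ [x.1, x.2] := by
    intro μ hμ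
    refine sum_symmetric_eq (s.filter fun J => J.length = 2) q id
      (lowTimes n m ×ˢ lowTimes n m) (fun x => c.virA m x.1 x.2)
      (fun x => [x.1, x.2]) (fun φ => ?_) μ hμ
    have h1 := (red (-2)).self_of_nhds φ
    rw [split _ fun L hL => by
      have : ∀ J, (if 0 ≤ (-2 : ℤ) + (L : ℤ) then c.tm F J ((-2 : ℤ) + (L : ℤ)).toNat φ j₀ else 0) =
          c.tm F J ((-2 : ℤ) + (L : ℤ)).toNat φ j₀ := fun J => if_pos (by omega)
      simp only [A, this]
      exact high (N + 3) L (by omega) hL _ fun J J' h => perm0 _ φ J J' h] at h1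
    rw [virTau, if_pos rfl, virF_zero] at h1
    rw [← h1]
    simp [A, tm_zero]
  refine ⟨s.filter fun J => J.length = 1, q, ∑ J ∈ s with J.length = 0, q J,
    fun J hJ => (Finset.mem_filter.1 hJ).2, fun k hk => ?_⟩
  obtain ⟨O, hO, hj, hperm⟩ := perm (k + N + 3)
  filter_upwards [red ((k : ℤ) - 2), hO.mem_nhds hj] with j hred hjO φ
  rw [← hred φ, ← Finset.sum_filter_add_sum_filter_not (Finset.range (N + 3)) (fun L => L < 3)]
  have hhigh : ∀ L ∈ (Finset.range (N + 3)).filter (fun L => ¬ L < 3),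
      A ((k : ℤ) - 2) L φ j = 0 := by
    intro L hL
    have hL := Finset.mem_filter.1 hL
    have hL1 := mem_range.1 hL.1
    have : ∀ J, (if 0 ≤ (k : ℤ) - 2 + (L : ℤ) then c.tm F J ((k : ℤ) - 2 + (L : ℤ)).toNat φ j else 0) =
        c.tm F J ((k : ℤ) - 2 + (L : ℤ)).toNat φ j := fun J => if_pos (by omega)
    simp only [A, this]
    exact high (N + 3) L (by omega) (by omega) _ fun J J' h => hperm j hjO _ (by omega) φ J J' h
  rw [sum_eq_zero hhigh, add_zero]
  have hr : (Finset.range (N + 3)).filter (fun L => L < 3) = Finset.range 3 := by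
    ext L; simp; omega
  rw [hr, sum_range_succ, sum_range_succ, Finset.sum_range_one,
    ← two _ fun J J' h => hperm j hjO k (by omega) φ J J' h]
  have a2 : A ((k : ℤ) - 2) 2 φ j = ∑ J ∈ s with J.length = 2, q J * c.tm F J k φ j := by
    refine sum_congr rfl fun J _ => ?_
    rw [if_pos (by push_cast; omega), show ((k : ℤ) - 2 + (2 : ℕ)).toNat = k by push_cast; omega]
  have a1 : A ((k : ℤ) - 2) 1 φ j = ∑ J ∈ s with J.length = 1, q J * c.tm F J (k - 1) φ j := by
    refine sum_congr rfl fun J _ => ?_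
    rw [if_pos (by push_cast; omega), show ((k : ℤ) - 2 + (1 : ℕ)).toNat = k - 1 by push_cast; omega]
  have a0 : A ((k : ℤ) - 2) 0 φ j = if k = 2 then ∑ J ∈ s with J.length = 0, q J else 0 := by
    by_cases h2 : k = 2
    · subst h2
      rw [if_pos rfl]
      refine sum_congr rfl fun J hJ => ?_
      have : J = [] := List.length_eq_zero_iff.1 (Finset.mem_filter.1 hJ).2
      subst this
      simp [tm_zero]
    · rw [if_neg h2]
      refine sum_eq_zero fun J hJ => ?_
      have : J = [] := List.length_eq_zero_iff.1 (Finset.mem_filter.1 hJ).2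
      subst this
      by_cases h0 : 0 ≤ (k : ℤ) - 2 + ((0 : ℕ) : ℤ)
      · rw [if_pos h0]
        simp only [tm, tauMon]
        rw [if_neg (by push_cast at *; omega), mul_zero]
      · rw [if_neg h0, mul_zero]
  rw [a2, a1, a0]; ring

end Calibration

/-! ### The Virasoro symmetries at vanishing times -/

lemma sum_lowTimes_succ {n : ℕ} {A : Type*} [AddCommMonoid A] (m : ℕ) (f : Time n → A) :
    ∑ a ∈ lowTimes n (m + 1), f a =
      (∑ a ∈ lowTimes n m, f (Calibration.up a)) + ∑ α, f (α, 0) := by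
  rw [sum_lowTimes, sum_lowTimes, sum_range_succ']
  rfl

/-- The function `∑ yCoeff r (a, b) ∂_x^a u ∂_x^b u'`. -/
def yFun {n : ℕ} (r : ℕ) (u u' : Jet n → ℂ) (j : Jet n) : ℂ :=
  ∑ ab ∈ antidiagonal r, yCoeff r ab * (Dx^[ab.1] u j * Dx^[ab.2] u' j)

lemma yFun_zero {n : ℕ} (u u' : Jet n → ℂ) (j : Jet n) : yFun 0 u u' j = u j * u' j := by
  simp [yFun, yCoeff]

lemma yFun_succ {n : ℕ} {O : Set (Jet n)} (r : ℕ) {u u' : Jet n → ℂ}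
    (hu : JetAnalyticOn O u) (hu' : JetAnalyticOn O u') : ∀ j ∈ O,
    yFun (r + 1) u u' j = Dx (yFun r u u') j + Dx^[r + 1] u j * u' j := fun j hj => by
  have hA := fun k => hu.iterate_Dx k j hj
  have hB := fun k => hu'.iterate_Dx k j hj
  have h1 : Dx (yFun r u u') j = ∑ ab ∈ antidiagonal r, yCoeff r ab *
      (Dx^[ab.1 + 1] u j * Dx^[ab.2] u' j + Dx^[ab.1] u j * Dx^[ab.2 + 1] u' j) := by
    unfold yFun
    rw [Dx_sum _ fun ab _ => ((JetAnalyticOn.const (yCoeff r ab)).mul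
      ((hu.iterate_Dx ab.1).mul (hu'.iterate_Dx ab.2))) j hj]
    refine sum_congr rfl fun ab _ => ?_
    rw [Dx_const_mul _ (((hu.iterate_Dx ab.1).mul (hu'.iterate_Dx ab.2)) j hj),
      Dx_mul (hA _) (hB _), Function.iterate_succ_apply', Function.iterate_succ_apply']
  rw [h1]
  unfold yFun
  have h2 : ∀ ab ∈ antidiagonal (r + 1), yCoeff (r + 1) ab =
      (if ab.1 = 0 then 0 else yCoeff r (ab.1 - 1, ab.2)) +
      (if ab.2 = 0 then 0 else yCoeff r (ab.1, ab.2 - 1)) + if ab.2 = 0 then 1 else 0 := by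
    rintro ⟨a, b⟩ hab
    have hab := mem_antidiagonal.1 hab
    simp only at hab ⊢
    cases a with
    | zero =>
      obtain rfl : b = r + 1 := by omega
      simp [yCoeff]
    | succ a =>
      cases b with
      | zero =>
        obtain rfl : a = r := by omega
        simp [yCoeff, add_assoc]
      | succ b =>
        simp only [yCoeff, Nat.succ_ne_zero, if_false, Nat.add_sub_cancel, add_zero]
        rw [Nat.choose_succ_succ r a, Nat.choose_succ_succ r (b + 1)]
        push_cast; ring
  rw [sum_congr rfl fun ab hab => by rw [h2 ab hab]]
  simp only [add_mul, sum_add_distrib, mul_add]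
  congr 1
  · congr 1
    · rw [Finset.Nat.sum_antidiagonal_succ]
      simp
    · rw [Finset.Nat.sum_antidiagonal_succ']
      simp
  · rw [Finset.Nat.sum_antidiagonal_succ']
    simp

lemma jetAnalyticOn_yFun {n : ℕ} {O : Set (Jet n)} {r : ℕ} {u u' : Jet n → ℂ} (hu : JetAnalyticOn O u)
    (hu' : JetAnalyticOn O u') : JetAnalyticOn O (yFun r u u') :=
  .sum _ fun _ _ => (JetAnalyticOn.const _).mul ((hu.iterate_Dx _).mul (hu'.iterate_Dx _))

namespace Calibration

variable {n : ℕ} [NeZero n] {X : FrobeniusManifold n} (c : Calibration X)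

lemma virHat_up_up (m : ℕ) (a b : Time n) : c.virHat m (up a) (up b) = 2 * c.virA m a b := by
  simp only [virHat, virA, up]
  have h1 : a.2 + 1 + (b.2 + 1) ≤ m ↔ a.2 + b.2 + 2 ≤ m := by omega
  simp only [h1]
  split_ifs
  · rw [show m - (a.2 + 1) - (b.2 + 1) = m - 2 - a.2 - b.2 by omega,
      show ((b.2 + 1 : ℕ) : ℂ) - 1 / 2 = (b.2 : ℂ) + 1 / 2 by push_cast; ring]
    ring
  · simp

lemma virHat_up_zero (m : ℕ) (a : Time n) (β : Fin n) :
    ∑ ρ, c.virHat m (up a) (ρ, 0) * X.η ρ β = c.virB m a (β, 0) := by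
  simp only [virHat, virB, up, add_zero, zero_add]
  split_ifs
  · simp only [pow_zero, one_mul, Nat.sub_zero, Nat.cast_zero, zero_sub, neg_zero]
    rw [← Matrix.mul_apply, Matrix.mul_assoc, X.inv_mul_eta, Matrix.mul_one,
      show m - (a.2 + 1) = m - 1 - a.2 by omega]
  · simp

lemma virHat_zero_zero (m : ℕ) (β γ : Fin n) :
    ∑ α, ∑ ρ, X.η β α * c.virHat m (α, 0) (ρ, 0) * X.η ρ γ =
      c.virC m (γ, 0) (β, 0) + c.virC m (β, 0) (γ, 0) := by
  have key : ∀ β γ, ∑ α, ∑ ρ, X.η β α * c.virHat m (α, 0) (ρ, 0) * X.η ρ γ =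
      2 * c.virC m (β, 0) (γ, 0) := by
    intro β γ
    simp only [virHat, virC, Nat.zero_le, add_zero, if_true, pow_zero, one_mul, Nat.sub_zero,
      Nat.cast_zero, zero_sub, neg_zero]
    rw [sum_comm]
    simp only [← sum_mul]
    simp only [← Matrix.mul_apply]
    rw [Matrix.mul_assoc, Matrix.mul_assoc, X.inv_mul_eta, Matrix.mul_one]
    ring
  have hs : ∑ α, ∑ ρ, X.η β α * c.virHat m (α, 0) (ρ, 0) * X.η ρ γ =
      ∑ α, ∑ ρ, X.η γ α * c.virHat m (α, 0) (ρ, 0) * X.η ρ β := by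
    rw [sum_comm]
    refine sum_congr rfl fun α _ => sum_congr rfl fun ρ _ => ?_
    rw [c.virHat_symm, ← X.symm.apply β ρ, ← X.symm.apply α γ]; ring
  have h1 := key β γ
  have h2 := key γ β
  rw [← hs] at h2
  linear_combination (1 / 2) * h1 + (1 / 2) * h2

/-- The function `(∇θ_a, e)`. -/
def unitPair (a : Time n) (j : Jet n) : ℂ := ∑ ρ, X.η ρ 0 * thetaWave X c a 0 (j 0) ρ

/-- The function `(∇θ_a, ∂_β)`. -/
def lowered (β : Fin n) (a : Time n) (j : Jet n) : ℂ := ∑ ρ, X.η β ρ * thetaWave X c a 0 (j 0) ρ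

lemma lowered_up (β : Fin n) (a : Time n) {j : Jet n} (hj : j 0 ∈ X.M) :
    c.lowered β (up a) j = c.Ω (β, 0) a (j 0) := by
  rw [c.Omega_symm _ _ hj, c.Omega_zero _ _ hj, Matrix.mul_apply]
  simp only [lowered, thetaWave_up_zero, Matrix.transpose_apply]
  exact sum_congr rfl fun ρ _ => by rw [← X.symm.apply β ρ, mul_comm]

lemma unitPair_eq (a : Time n) (j : Jet n) : c.unitPair a j = c.lowered 0 a j := by
  simp only [unitPair, lowered]
  exact sum_congr rfl fun ρ _ => by rw [← X.symm.apply ρ 0]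

lemma lowered_zero (β α : Fin n) {j : Jet n} (hj : j 0 ∈ X.M) :
    c.lowered β (α, 0) j = X.η β α := by
  simp [lowered, thetaWave, c.zero _ hj, Matrix.one_apply]

/-- The derivative along `x` of the coefficients of the flows in the Virasoro symmetries. -/
def kCoeff (m : ℕ) (a : Time n) (j : Jet n) : ℂ :=
  (∑ b ∈ lowTimes n m, 2 * c.virA m a b * c.Ω (0, 0) b (j 0)) + c.virB m a (0, 0)

lemma kCoeff_eq (m : ℕ) (a : Time n) {j : Jet n} (hj : j 0 ∈ X.M) :
    c.kCoeff m a j = ∑ b ∈ lowTimes n (m + 1), c.virHat m (up a) b * c.unitPair b j := by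
  rw [sum_lowTimes_succ]
  simp only [unitPair_eq, c.lowered_up 0 _ hj, c.lowered_zero 0 _ hj, virHat_up_up]
  unfold kCoeff
  rw [← c.virHat_up_zero m a 0]
  congr 1
  exact sum_congr rfl fun ρ _ => by rw [← X.symm.apply ρ 0]

/-- Functions of the times, affine in `t` and `φ`, restricted to the `x`-axis. -/
def affine (m : ℕ) (f : Time n → Jet n → ℂ) (p : Time n → ℂ) (r : ℂ) (h : Jet n → ℂ) (x : ℂ)
    (φ : Time n → ℂ) (j : Jet n) : ℂ :=
  (∑ a ∈ lowTimes n m, ((∑ b ∈ lowTimes n m, 2 * c.virA m a b * φ b) + x * c.virB m a (0, 0)) *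
    f a j) + (∑ a ∈ lowTimes n m, p a * φ a) + x * r + h j

variable {O : Set (Jet n)}

lemma coverD_affine (hO : IsOpen O) (hM : ∀ j ∈ O, j 0 ∈ X.M) {m : ℕ}
    {G : (Time n →₀ ℂ) → (Time n → ℂ) → Jet n → ℂ} {f : Time n → Jet n → ℂ} {p : Time n → ℂ}
    {r : ℂ} {h : Jet n → ℂ} (hf : ∀ a, JetAnalyticOn O (f a)) (hh : JetAnalyticOn O h)
    (hG : ∀ x φ, ∀ j ∈ O, G (Finsupp.single (0, 0) x) φ j = c.affine m f p r h x φ j)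
    (x : ℂ) (φ : Time n → ℂ) : ∀ j ∈ O, c.coverD (0, 0) G (Finsupp.single (0, 0) x) φ j =
      c.affine m (fun a => Dx (f a)) 0 0 (fun j => (∑ a ∈ lowTimes n m, c.kCoeff m a j * f a j) +
        (∑ a ∈ lowTimes n m, c.Ω (0, 0) a (j 0) * p a) + r + Dx h j) x φ j := by
  intro j hj
  have hsplit : c.coverD (0, 0) G (Finsupp.single (0, 0) x) φ j =
      deriv (fun z => G (Finsupp.single (0, 0) x + Finsupp.single (0, 0) z) φ j) 0 +
        c.cD (0, 0) (G (Finsupp.single (0, 0) x)) φ j := by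
    simp only [coverD, cD, phiD, add_assoc]
  have hd : deriv (fun z => G (Finsupp.single (0, 0) x + Finsupp.single (0, 0) z) φ j) 0 =
      (∑ a ∈ lowTimes n m, c.virB m a (0, 0) * f a j) + r := by
    have h1 : (fun z => G (Finsupp.single (0, 0) x + Finsupp.single (0, 0) z) φ j) = fun z =>
        c.affine m f p r h x φ j + z * ((∑ a ∈ lowTimes n m, c.virB m a (0, 0) * f a j) + r) := by
      funext z
      rw [← Finsupp.single_add, hG _ _ j hj]
      simp only [affine, add_mul, mul_add, sum_add_distrib, mul_sum, mul_assoc]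
      ring
    rw [h1, deriv_const_add]
    simp
  have hlin : ∀ a, CoverPoly O (fun φ _ => (∑ b ∈ lowTimes n m, 2 * c.virA m a b * φ b) +
      x * c.virB m a (0, 0)) := fun a =>
    .add (.sum _ fun b _ => .mul (.jet (.const _)) (.phi b)) (.jet (.const _))
  have hc : ∀ (z : ℂ) a φ, c.cD a (fun _ _ => z) φ j = 0 := fun z a φ => by
    rw [c.cD_jet (fun _ => z)]; exact vecD_const z
  have hcmul : ∀ (z : ℂ) (a b : Time n) φ, c.cD a (fun φ _ => z * φ b) φ j = z * c.Ω a b (j 0) := by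
    intro z a b φ
    rw [c.cD_mul hO (g := fun _ _ => z) (.jet (.const z)) (.phi b) a φ j hj, hc, c.cD_phi]
    ring
  have hlinD : ∀ a, c.cD (0, 0) (fun φ _ => (∑ b ∈ lowTimes n m, 2 * c.virA m a b * φ b) +
      x * c.virB m a (0, 0)) φ j = ∑ b ∈ lowTimes n m, 2 * c.virA m a b * c.Ω (0, 0) b (j 0) := by
    intro a
    rw [c.cD_add hO (.sum _ fun b _ => .mul (.jet (.const (2 * c.virA m a b))) (.phi b))
      (.jet (.const _)) (0, 0) φ j hj, hc, add_zero,
      c.cD_sum hO _ (fun b _ => .mul (.jet (.const (2 * c.virA m a b))) (.phi b)) (0, 0) φ j hj]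
    exact sum_congr rfl fun b _ => hcmul _ _ _ _
  have hcD : c.cD (0, 0) (G (Finsupp.single (0, 0) x)) φ j =
      (∑ a ∈ lowTimes n m, ((∑ b ∈ lowTimes n m, 2 * c.virA m a b * c.Ω (0, 0) b (j 0)) * f a j +
        ((∑ b ∈ lowTimes n m, 2 * c.virA m a b * φ b) + x * c.virB m a (0, 0)) * Dx (f a) j)) +
      (∑ a ∈ lowTimes n m, p a * c.Ω (0, 0) a (j 0)) + Dx h j := by
    have P1 : ∀ a, CoverPoly O (fun φ j => ((∑ b ∈ lowTimes n m, 2 * c.virA m a b * φ b) +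
        x * c.virB m a (0, 0)) * f a j) := fun a => (hlin a).mul (.jet (hf a))
    have P2 : ∀ a, CoverPoly O (fun φ _ => p a * φ a) := fun a => .mul (.jet (.const _)) (.phi a)
    have Q1 := CoverPoly.sum (lowTimes n m) fun a _ => P1 a
    have Q2 := CoverPoly.sum (lowTimes n m) fun a _ => P2 a
    have Q3 : CoverPoly O (fun _ _ => x * r) := .jet (.const _)
    have Q4 : CoverPoly O (fun _ j => h j) := .jet hh
    rw [c.cD_congr hO (fun φ j hj => hG x φ j hj) (0, 0) φ j hj]
    unfold affine
    rw [c.cD_add hO ((Q1.add Q2).add Q3) Q4 _ φ j hj, c.cD_add hO (Q1.add Q2) Q3 _ φ j hj,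
      c.cD_add hO Q1 Q2 _ φ j hj, c.cD_sum hO _ (fun a _ => P1 a) _ φ j hj,
      c.cD_sum hO _ (fun a _ => P2 a) _ φ j hj, hc, c.cD_jet h, c.Dt_zero_eq hO hM hj, add_zero]
    congr 1
    congr 1
    · refine sum_congr rfl fun a _ => ?_
      rw [c.cD_mul hO (hlin a) (.jet (hf a)) _ φ j hj, hlinD, c.cD_jet (f a),
        c.Dt_zero_eq hO hM hj]
    · exact sum_congr rfl fun a _ => hcmul _ _ _ _
  rw [hsplit, hd, hcD]
  simp only [affine, kCoeff, add_mul, sum_add_distrib, Pi.zero_apply, zero_mul,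
    Finset.sum_const_zero, mul_zero, add_zero, mul_comm (c.Ω (0, 0) _ _)]
  ring

lemma virF_add_single (m : ℕ) (x z : ℂ) (β : Fin n) (φ : Time n → ℂ) (j : Jet n) :
    c.virF m (Finsupp.single (0, 0) x + Finsupp.single (β, 0) z) φ j =
      (∑ y ∈ lowTimes n m ×ˢ lowTimes n m, c.virA m y.1 y.2 * ([y.1, y.2].map φ).prod) +
      ((∑ a ∈ lowTimes n m, c.virB m a (0, 0) * x * φ a) +
        ∑ a ∈ lowTimes n m, c.virB m a (β, 0) * z * φ a) +
      (c.virC m (0, 0) (0, 0) * x * x + c.virC m (0, 0) (β, 0) * x * z +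
        (c.virC m (β, 0) (0, 0) * z * x + c.virC m (β, 0) (β, 0) * z * z)) := by
  rw [← c.virF_zero m φ j]
  simp only [virF, Finsupp.sum_zero_index, add_zero]
  have h1 : ∀ g : Time n → ℂ → ℂ, (∀ a, g a 0 = 0) → (∀ a u v, g a (u + v) = g a u + g a v) →
      (Finsupp.single ((0, 0) : Time n) x + Finsupp.single (β, 0) z).sum g =
        g (0, 0) x + g (β, 0) z := by
    intro g hg0 hga
    rw [Finsupp.sum_add_index' hg0 hga, Finsupp.sum_single_index (hg0 _),
      Finsupp.sum_single_index (hg0 _)]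
  rw [h1 _ (by simp) (fun a u v => by simp [mul_add, add_mul, sum_add_distrib]),
    h1 _ (fun a => by simp) (fun a u v => by
      rw [← Finsupp.sum_add]
      exact Finsupp.sum_congr fun b _ => by ring),
    h1 _ (by simp) (fun a u v => by ring), h1 _ (by simp) (fun a u v => by ring)]
  simp only [sum_lowTimes, zero_add]

lemma coverD_virF (hO : IsOpen O) (m : ℕ) (β : Fin n) (x : ℂ)
    (φ : Time n → ℂ) : ∀ j ∈ O,
    c.coverD (β, 0) (c.virF m) (Finsupp.single (0, 0) x) φ j =
      c.affine m (fun a j => c.Ω (β, 0) a (j 0)) (fun a => c.virB m a (β, 0))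
        (c.virC m (0, 0) (β, 0) + c.virC m (β, 0) (0, 0)) (fun _ => 0) x φ j := by
  intro j hj
  have hsplit : c.coverD (β, 0) (c.virF m) (Finsupp.single (0, 0) x) φ j =
      deriv (fun z => c.virF m (Finsupp.single (0, 0) x + Finsupp.single (β, 0) z) φ j) 0 +
        c.cD (β, 0) (c.virF m (Finsupp.single (0, 0) x)) φ j := by
    simp only [coverD, cD, phiD, add_assoc]
  have hd : deriv (fun z => c.virF m (Finsupp.single (0, 0) x + Finsupp.single (β, 0) z) φ j) 0 =
      (∑ a ∈ lowTimes n m, c.virB m a (β, 0) * φ a) +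
        x * (c.virC m (0, 0) (β, 0) + c.virC m (β, 0) (0, 0)) := by
    have h1 : (fun z => c.virF m (Finsupp.single (0, 0) x + Finsupp.single (β, 0) z) φ j) =
        fun z => c.virF m (Finsupp.single (0, 0) x) φ j +
          (z * ((∑ a ∈ lowTimes n m, c.virB m a (β, 0) * φ a) +
            x * (c.virC m (0, 0) (β, 0) + c.virC m (β, 0) (0, 0))) +
            c.virC m (β, 0) (β, 0) * z ^ 2) := by
      funext z
      have h0 := c.virF_add_single m x 0 β φ j
      rw [Finsupp.single_zero, add_zero] at h0
      rw [c.virF_add_single, h0]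
      simp only [mul_zero, zero_mul, Finset.sum_const_zero, add_zero, mul_add, mul_sum]
      rw [sum_congr rfl fun a _ => show c.virB m a (β, 0) * z * φ a =
        z * (c.virB m a (β, 0) * φ a) by ring]
      ring
    rw [h1, deriv_const_add, deriv_fun_add (by fun_prop) (by fun_prop)]
    simp
  have hc : ∀ (z : ℂ) a φ, c.cD a (fun _ _ => z) φ j = 0 := fun z a φ => by
    rw [c.cD_jet (fun _ => z)]; exact vecD_const z
  have hcD : c.cD (β, 0) (c.virF m (Finsupp.single (0, 0) x)) φ j =
      (∑ y ∈ lowTimes n m ×ˢ lowTimes n m, c.virA m y.1 y.2 *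
        (c.Ω (β, 0) y.1 (j 0) * φ y.2 + φ y.1 * c.Ω (β, 0) y.2 (j 0))) +
      ∑ a ∈ lowTimes n m, c.virB m a (0, 0) * x * c.Ω (β, 0) a (j 0) := by
    have P1 : ∀ y : Time n × Time n, CoverPoly O fun φ _ => φ y.1 * φ y.2 :=
      fun y => .mul (.phi y.1) (.phi y.2)
    have P2 : ∀ y : Time n × Time n, CoverPoly O fun φ _ => c.virA m y.1 y.2 * (φ y.1 * φ y.2) :=
      fun y => .mul (.jet (.const (c.virA m y.1 y.2))) (P1 y)
    have P3 : ∀ a, CoverPoly O fun φ _ => c.virB m a (0, 0) * x * φ a :=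
      fun a => .mul (.jet (.const (c.virB m a (0, 0) * x))) (.phi a)
    have Q1 := CoverPoly.sum (lowTimes n m ×ˢ lowTimes n m) fun y _ => P2 y
    have Q2 := CoverPoly.sum (lowTimes n m) fun a _ => P3 a
    have Q3 : CoverPoly O fun _ _ => c.virC m (0, 0) (0, 0) * x * x := .jet (.const _)
    have h0 : ∀ φ, ∀ j ∈ O, c.virF m (Finsupp.single (0, 0) x) φ j =
        (∑ y ∈ lowTimes n m ×ˢ lowTimes n m, c.virA m y.1 y.2 * (φ y.1 * φ y.2)) +
        (∑ a ∈ lowTimes n m, c.virB m a (0, 0) * x * φ a) + c.virC m (0, 0) (0, 0) * x * x := by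
      intro φ j _
      have h0 := c.virF_add_single m x 0 β φ j
      rw [Finsupp.single_zero, add_zero] at h0
      rw [h0]
      simp
    rw [c.cD_congr hO h0 _ φ j hj, c.cD_add hO (Q1.add Q2) Q3 _ φ j hj, c.cD_add hO Q1 Q2 _ φ j hj,
      hc, add_zero, c.cD_sum hO _ (fun y _ => P2 y) _ φ j hj,
      c.cD_sum hO _ (fun a _ => P3 a) _ φ j hj]
    congr 1
    · refine sum_congr rfl fun y _ => ?_
      rw [c.cD_mul hO (g := fun _ _ => c.virA m y.1 y.2) (.jet (.const _)) (P1 y) _ φ j hj, hc,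
        c.cD_mul hO (.phi y.1) (.phi y.2) _ φ j hj, c.cD_phi, c.cD_phi]
      ring
    · refine sum_congr rfl fun a _ => ?_
      rw [c.cD_mul hO (g := fun _ _ => c.virB m a (0, 0) * x) (.jet (.const _)) (.phi a) _ φ j hj,
        hc, c.cD_phi]
      ring
  have hsym : ∀ a b, c.virA m a b = c.virA m b a := fun a b => by
    have := c.virHat_symm m (up a) (up b)
    rw [virHat_up_up, virHat_up_up] at this
    linear_combination (1 / 2) * this
  have hquad : ∑ y ∈ lowTimes n m ×ˢ lowTimes n m, c.virA m y.1 y.2 *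
        (c.Ω (β, 0) y.1 (j 0) * φ y.2 + φ y.1 * c.Ω (β, 0) y.2 (j 0)) =
      ∑ a ∈ lowTimes n m, (∑ b ∈ lowTimes n m, 2 * c.virA m a b * φ b) * c.Ω (β, 0) a (j 0) := by
    rw [Finset.sum_product]
    simp only [mul_add, sum_add_distrib]
    rw [sum_comm (f := fun a b => c.virA m a b * (φ a * c.Ω (β, 0) b (j 0))),
      ← sum_add_distrib]
    refine sum_congr rfl fun a _ => ?_
    rw [← sum_add_distrib, sum_mul]
    refine sum_congr rfl fun b _ => ?_
    rw [hsym b a]; ring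
  rw [hsplit, hd, hcD, hquad]
  simp only [affine, add_mul, sum_add_distrib, add_zero]
  rw [sum_congr rfl fun a _ => show c.virB m a (0, 0) * x * c.Ω (β, 0) a (j 0) =
    x * c.virB m a (0, 0) * c.Ω (β, 0) a (j 0) by ring]
  ring

lemma jetAnalyticOn_Omega (hM : ∀ j ∈ O, j 0 ∈ X.M) (a b : Time n) :
    JetAnalyticOn O fun j => c.Ω a b (j 0) :=
  .comp_base (f := c.Ω a b) fun j hj => c.analyticAt_Omega a b (hM j hj)

lemma jetAnalyticOn_unitPair (hM : ∀ j ∈ O, j 0 ∈ X.M) (a : Time n) :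
    JetAnalyticOn O (c.unitPair a) :=
  .sum _ fun ρ _ => (JetAnalyticOn.const _).mul ((isWave_thetaWave X c a).jetAnalyticOn hM 0 ρ)

/-- The Virasoro symmetry of `∂_x^r v^γ` at vanishing times and vanishing `φ`. -/
def yVir (m : ℕ) (γ : Fin n) (r : ℕ) (j : Jet n) : ℂ :=
  ∑ a ∈ lowTimes n (m + 1), ∑ b ∈ lowTimes n (m + 1), c.virHat m a b *
    yFun r (fun j => thetaWave X c a 0 (j 0) γ) (c.unitPair b) j

lemma iterate_Dx_flow (a : Time n) (γ : Fin n) (r : ℕ) :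
    Dx^[r] (c.flow a γ) = Dx^[r + 1] fun j => thetaWave X c (up a) 0 (j 0) γ := by
  rw [flow_eq_Dx, Function.iterate_succ_apply]

lemma iterate_Dx_thetaWave_zero (hO : IsOpen O) (hM : ∀ j ∈ O, j 0 ∈ X.M) (α γ : Fin n) (r : ℕ) :
    ∀ j ∈ O, Dx^[r + 1] (fun j => thetaWave X c (α, 0) 0 (j 0) γ) j = 0 := fun j hj => by
  rw [iterate_Dx_congr hO (Ψ := fun _ => (1 : Matrix (Fin n) (Fin n) ℂ) γ α)
    (fun j hj => by simp [thetaWave, c.zero _ (hM j hj)]) _ j hj, Function.iterate_succ_apply,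
    Dx_const]
  have : ∀ r, Dx^[r] (fun _ : Jet n => (0 : ℂ)) = fun _ => 0 := fun r => by
    induction r with
    | zero => rfl
    | succ r ih => rw [Function.iterate_succ_apply, Dx_const, ih]
  rw [this]

lemma yVir_succ (hO : IsOpen O) (hM : ∀ j ∈ O, j 0 ∈ X.M) (m : ℕ) (γ : Fin n) (r : ℕ) :
    ∀ j ∈ O, c.yVir m γ (r + 1) j =
      (∑ a ∈ lowTimes n m, c.kCoeff m a j * Dx^[r] (c.flow a γ) j) + Dx (c.yVir m γ r) j := by
  intro j hj
  have hu := fun a => (isWave_thetaWave X c a).jetAnalyticOn hM 0 γ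
  have hu' := fun b => c.jetAnalyticOn_unitPair hM b
  have hy := fun a b => jetAnalyticOn_yFun (r := r) (hu a) (hu' b)
  have h1 : Dx (c.yVir m γ r) j = ∑ a ∈ lowTimes n (m + 1), ∑ b ∈ lowTimes n (m + 1),
      c.virHat m a b * Dx (yFun r (fun j => thetaWave X c a 0 (j 0) γ) (c.unitPair b)) j := by
    unfold yVir
    rw [Dx_sum _ fun a _ => (JetAnalyticOn.sum _ fun b _ =>
      (JetAnalyticOn.const (c.virHat m a b)).mul (hy a b)) j hj]
    refine sum_congr rfl fun a _ => ?_
    rw [Dx_sum _ fun b _ => ((JetAnalyticOn.const (c.virHat m a b)).mul (hy a b)) j hj]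
    exact sum_congr rfl fun b _ => Dx_const_mul _ (hy a b j hj)
  rw [h1]
  unfold yVir
  simp only [yFun_succ r (hu _) (hu' _) j hj, mul_add, sum_add_distrib]
  rw [add_comm]
  congr 1
  rw [sum_lowTimes_succ]
  simp only [c.iterate_Dx_thetaWave_zero hO hM _ γ r j hj, zero_mul, mul_zero,
    Finset.sum_const_zero, add_zero]
  refine sum_congr rfl fun a _ => ?_
  rw [c.kCoeff_eq m a (hM j hj), sum_mul, c.iterate_Dx_flow]
  exact sum_congr rfl fun b _ => by ring

lemma yVir_zero (m : ℕ) (γ : Fin n) {j : Jet n} (hj : j 0 ∈ X.M) :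
    c.yVir m γ 0 j = X.raise (fun β => (∑ a ∈ lowTimes n m, c.kCoeff m a j * c.Ω (β, 0) a (j 0)) +
      (∑ a ∈ lowTimes n m, c.Ω (0, 0) a (j 0) * c.virB m a (β, 0)) +
      (c.virC m (0, 0) (β, 0) + c.virC m (β, 0) (0, 0))) γ := by
  have h1 : ∀ β, (∑ a ∈ lowTimes n m, c.kCoeff m a j * c.Ω (β, 0) a (j 0)) +
      (∑ a ∈ lowTimes n m, c.Ω (0, 0) a (j 0) * c.virB m a (β, 0)) +
      (c.virC m (0, 0) (β, 0) + c.virC m (β, 0) (0, 0)) =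
      ∑ a ∈ lowTimes n (m + 1), ∑ b ∈ lowTimes n (m + 1), c.virHat m a b *
        (c.lowered β a j * c.unitPair b j) := by
    intro β
    rw [sum_lowTimes_succ, add_assoc]
    congr 1
    · refine sum_congr rfl fun a _ => ?_
      rw [c.kCoeff_eq m a hj, sum_mul, c.lowered_up β a hj]
      exact sum_congr rfl fun b _ => by ring
    · simp only [sum_lowTimes_succ, unitPair_eq, c.lowered_up _ _ hj, c.lowered_zero _ _ hj,
        sum_add_distrib]
      congr 1
      · rw [sum_comm]
        refine sum_congr rfl fun a _ => ?_
        rw [← c.virHat_up_zero, mul_sum]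
        refine sum_congr rfl fun ρ _ => ?_
        rw [c.virHat_symm, ← X.symm.apply β ρ]; ring
      · rw [← c.virHat_zero_zero m β 0]
        refine sum_congr rfl fun α _ => sum_congr rfl fun ρ _ => ?_
        rw [← X.symm.apply ρ 0]; ring
  have h2 : ∀ a, X.raise (fun β => c.lowered β a j) γ = thetaWave X c a 0 (j 0) γ := by
    intro a
    have : X.raise (fun β => c.lowered β a j) = X.η⁻¹.mulVec (X.η.mulVec (thetaWave X c a 0 (j 0))) :=
      rfl
    rw [this, Matrix.mulVec_mulVec, X.inv_mul_eta, Matrix.one_mulVec]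
  simp only [h1]
  unfold yVir
  rw [FrobeniusManifold.raise]
  simp only [mul_sum]
  symm
  rw [sum_comm]
  refine sum_congr rfl fun a _ => ?_
  rw [sum_comm]
  refine sum_congr rfl fun b _ => ?_
  rw [yFun_zero, ← h2 a, FrobeniusManifold.raise, sum_mul, mul_sum]
  exact sum_congr rfl fun β _ => by ring

lemma jetAnalyticOn_yVir (hM : ∀ j ∈ O, j 0 ∈ X.M) (m : ℕ) (γ : Fin n) (r : ℕ) :
    JetAnalyticOn O (c.yVir m γ r) :=
  .sum _ fun a _ => .sum _ fun b _ => (JetAnalyticOn.const _).mul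
    (jetAnalyticOn_yFun ((isWave_thetaWave X c a).jetAnalyticOn hM 0 γ)
      (c.jetAnalyticOn_unitPair hM b))

lemma virV_eq (hO : IsOpen O) (hM : ∀ j ∈ O, j 0 ∈ X.M) (m : ℕ) (γ : Fin n) (x : ℂ)
    (φ : Time n → ℂ) : ∀ j ∈ O, c.virV m γ (Finsupp.single (0, 0) x) φ j =
      c.affine m (fun a => c.flow a γ) 0 0 (c.yVir m γ 0) x φ j := by
  intro j hj
  have h1 : ∀ β, c.coverD (0, 0) (c.coverD (β, 0) (c.virF m)) (Finsupp.single (0, 0) x) φ j = _ :=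
    fun β => c.coverD_affine hO hM (fun a => c.jetAnalyticOn_Omega hM (β, 0) a) (.const 0)
      (fun x φ j hj => c.coverD_virF hO m β x φ j hj) x φ j hj
  have h2 : ∀ a, X.raise (fun β => Dx (fun j => c.Ω (β, 0) a (j 0)) j) γ = c.flow a γ j := by
    intro a
    have h3 : ∀ β, Dx (fun j => c.Ω (β, 0) a (j 0)) j = X.η.mulVec (fun γ => c.flow a γ j) β := by
      intro β
      rw [Dx_congr hO (Ψ := fun j => ∑ ρ, X.η β ρ * c.Θ (a.2 + 1) (j 0) ρ a.1) (fun j hj => by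
          rw [← c.lowered_up β a (hM j hj)]; simp only [lowered, thetaWave_up_zero]) j hj,
        Dx_sum _ fun ρ _ => ((JetAnalyticOn.const (X.η β ρ)).mul (.comp_base
          (f := fun v => c.Θ (a.2 + 1) v ρ a.1) fun j hj => c.analytic _ _ _ _ (hM j hj))) j hj]
      simp only [Matrix.mulVec, dotProduct, flow]
      exact sum_congr rfl fun ρ _ => Dx_const_mul _ (JetAnalyticOn.comp_base
          (f := fun v => c.Θ (a.2 + 1) v ρ a.1) (fun j hj => c.analytic _ _ _ _ (hM j hj)) j hj)
    simp only [h3]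
    change (X.η⁻¹.mulVec (X.η.mulVec _)) γ = _
    rw [Matrix.mulVec_mulVec, X.inv_mul_eta, Matrix.one_mulVec]
  unfold virV
  simp only [h1, affine, Dx_const, add_zero, Pi.zero_apply, zero_mul, Finset.sum_const_zero,
    mul_zero]
  rw [c.yVir_zero m γ (hM j hj)]
  simp only [← h2, FrobeniusManifold.raise, mul_add, sum_add_distrib]
  congr 1
  simp only [mul_sum]
  rw [sum_comm]
  exact sum_congr rfl fun a _ => sum_congr rfl fun β _ => by ring

lemma iterate_coverD_virV (hO : IsOpen O) (hM : ∀ j ∈ O, j 0 ∈ X.M) (m : ℕ) (γ : Fin n) (r : ℕ)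
    (x : ℂ) (φ : Time n → ℂ) : ∀ j ∈ O,
    (c.coverD (0, 0))^[r] (c.virV m γ) (Finsupp.single (0, 0) x) φ j =
      c.affine m (fun a => Dx^[r] (c.flow a γ)) 0 0 (c.yVir m γ r) x φ j := by
  induction r generalizing x φ with
  | zero => exact c.virV_eq hO hM m γ x φ
  | succ r ih =>
    intro j hj
    rw [Function.iterate_succ_apply',
      c.coverD_affine hO hM (fun a => (c.jetAnalyticOn_flow hM a γ).iterate_Dx r)
        (c.jetAnalyticOn_yVir hM m γ r) (fun x φ => ih x φ) x φ j hj]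
    simp only [affine, Function.iterate_succ_apply', Pi.zero_apply, mul_zero, zero_mul,
      Finset.sum_const_zero, add_zero]
    rw [c.yVir_succ hO hM m γ r j hj]

lemma iterate_coverD_virV_zero (hO : IsOpen O) (hM : ∀ j ∈ O, j 0 ∈ X.M) (m : ℕ) (γ : Fin n)
    (r : ℕ) : ∀ j ∈ O, (c.coverD (0, 0))^[r] (c.virV m γ) 0 0 j = c.yVir m γ r j := by
  intro j hj
  have := c.iterate_coverD_virV hO hM m γ r 0 0 j hj
  rw [Finsupp.single_zero] at this
  rw [this]
  simp [affine]

end Calibration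

/-! ### The Virasoro constraints as equations between forms -/

section

variable {n : ℕ} [NeZero n] (X : FrobeniusManifold n)

/-- The form of the left hand side of the loop equation. -/
def lhsForm (N : ℕ) (Φ : Jet n → ℂ) : Form n := fun i k σ τ j =>
  ∑ r ∈ Finset.range (N + 1), ∑ γ, jd γ r Φ j * yForm X r γ i k σ τ j

/-- The form of the quadratic part of the loop equation. -/
def quadForm (N : ℕ) (Ψ : Fin n → ℕ → Fin n → ℕ → Jet n → ℂ) : Form n := fun i k σ τ j =>
  ∑ r ∈ Finset.range (N + 1), ∑ s ∈ Finset.range (N + 1), ∑ γ, ∑ ρ,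
    Ψ γ r ρ s j * bForm X (r + 1) (s + 1) γ ρ i k σ τ j

/-- The form of the linear part of the right hand side of the loop equation. -/
def linForm (N : ℕ) (Φ : Jet n → ℂ) : Form n := fun i k σ τ j =>
  ∑ r ∈ Finset.range (N + 1), ∑ γ, jd γ r Φ j * lForm X r γ i k σ τ j

lemma ev_lhsForm (K N : ℕ) (Φ : Jet n → ℂ) (T : Tensor n) (j : Jet n) :
    Form.ev K (lhsForm X N Φ) T j = ∑ r ∈ Finset.range (N + 1), ∑ γ,
      jd γ r Φ j * Form.ev K (yForm X r γ) T j := by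
  unfold lhsForm
  rw [Form.ev_sum_left]
  refine sum_congr rfl fun r _ => ?_
  rw [Form.ev_sum_left]
  exact sum_congr rfl fun γ _ => Form.ev_mul_left K _ _ T j

lemma ev_linForm (K N : ℕ) (Φ : Jet n → ℂ) (T : Tensor n) (j : Jet n) :
    Form.ev K (linForm X N Φ) T j = ∑ r ∈ Finset.range (N + 1), ∑ γ,
      jd γ r Φ j * Form.ev K (lForm X r γ) T j := by
  unfold linForm
  rw [Form.ev_sum_left]
  refine sum_congr rfl fun r _ => ?_
  rw [Form.ev_sum_left]
  exact sum_congr rfl fun γ _ => Form.ev_mul_left K _ _ T j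

lemma ev_quadForm (K N : ℕ) (Ψ : Fin n → ℕ → Fin n → ℕ → Jet n → ℂ) (T : Tensor n) (j : Jet n) :
    Form.ev K (quadForm X N Ψ) T j = ∑ r ∈ Finset.range (N + 1), ∑ s ∈ Finset.range (N + 1),
      ∑ γ, ∑ ρ, Ψ γ r ρ s j * Form.ev K (bForm X (r + 1) (s + 1) γ ρ) T j := by
  unfold quadForm
  rw [Form.ev_sum_left]
  refine sum_congr rfl fun r _ => ?_
  rw [Form.ev_sum_left]
  refine sum_congr rfl fun s _ => ?_
  rw [Form.ev_sum_left]
  refine sum_congr rfl fun γ _ => ?_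
  rw [Form.ev_sum_left]
  exact sum_congr rfl fun ρ _ => Form.ev_mul_left K _ _ T j

end

section

variable {n : ℕ}

/-- The function whose second derivatives enter in order `k`. -/
def prevF (F : ℕ → Jet n → ℂ) (k : ℕ) : Jet n → ℂ := if 3 ≤ k then F (k - 2) else fun _ => 0

/-- The quadratic expression in the derivatives of the `F_i`, in order `k`. -/
def quadCoeff (F : ℕ → Jet n → ℂ) (k : ℕ) (γ : Fin n) (r : ℕ) (ρ : Fin n) (s : ℕ) (j : Jet n) : ℂ :=
  jd γ r (jd ρ s (prevF F k)) j +
    ∑ i ∈ Finset.Icc 1 (k - 1), jd γ r (F i) j * jd ρ s (F (k - i)) j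

end

namespace Calibration

variable {n : ℕ} [NeZero n] {X : FrobeniusManifold n} (c : Calibration X)

lemma virTensor_eq_sum (m : ℕ) (v : Fin n → ℂ) : c.virTensor m v =
    ∑ a ∈ lowTimes n (m + 1), ∑ b ∈ lowTimes n (m + 1),
      c.virHat m a b • pairTensor (thetaWave X c a) (thetaWave X c b) v := by
  funext i k
  ext σ ρ
  simp only [virTensor, Matrix.of_apply, Finset.sum_apply, Matrix.sum_apply, Pi.smul_apply,
    Matrix.smul_apply, smul_eq_mul, pairTensor, sum_lowTimes]
  refine sum_congr rfl fun p _ => ?_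
  rw [sum_comm]

lemma ev_virTensor (K : ℕ) (f : Form n) (m : ℕ) (v : Fin n → ℂ) (j : Jet n) :
    Form.ev K f (c.virTensor m v) j = ∑ a ∈ lowTimes n (m + 1), ∑ b ∈ lowTimes n (m + 1),
      c.virHat m a b * Form.ev K f (pairTensor (thetaWave X c a) (thetaWave X c b) v) j := by
  rw [← Form.evL_apply, virTensor_eq_sum]
  simp only [map_sum, map_smul, smul_eq_mul, Form.evL_apply]

variable {O : Set (Jet n)}

lemma ev_yForm_virTensor (hO : IsOpen O) (hM : ∀ j ∈ O, j 0 ∈ X.M) {K r : ℕ} (hr : r < K) (m : ℕ)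
    (γ : Fin n) : ∀ j ∈ O,
    Form.ev K (yForm X r γ) (c.virTensor m (j 0)) j = c.yVir m γ r j := by
  intro j hj
  rw [ev_virTensor]
  refine sum_congr rfl fun a _ => sum_congr rfl fun b _ => ?_
  rw [ev_yForm (isWave_thetaWave X c a) (isWave_thetaWave X c b) hO hM hM hr γ hj]
  congr 1
  refine sum_congr rfl fun ab _ => ?_
  congr 2
  unfold unitPair
  have hw := fun ρ => (isWave_thetaWave X c b).jetAnalyticOn hM 0 ρ
  rw [iterate_Dx_sum hO _ (fun ρ _ => (JetAnalyticOn.const (X.η ρ 0)).mul (hw ρ)) _ j hj]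
  exact sum_congr rfl fun ρ _ => (iterate_Dx_const_mul hO _ (hw ρ) _ j hj).symm

lemma sum_virA_eq (m : ℕ) (P : Time n → Time n → ℂ) (h0 : ∀ α b, P (α, 0) b = 0)
    (h0' : ∀ a β, P a (β, 0) = 0) :
    ∑ x ∈ lowTimes n m ×ˢ lowTimes n m, c.virA m x.1 x.2 * P (up x.1) (up x.2) =
      (1 / 2) * ∑ a ∈ lowTimes n (m + 1), ∑ b ∈ lowTimes n (m + 1), c.virHat m a b * P a b := by
  rw [Finset.sum_product]
  simp only [sum_lowTimes_succ, h0, h0', mul_zero, Finset.sum_const_zero, add_zero, virHat_up_up,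
    mul_sum]
  exact sum_congr rfl fun a _ => sum_congr rfl fun b _ => by ring

lemma Dt_eq_sum {N : ℕ} {Φ : Jet n → ℂ} {j : Jet n} (h : JetAnalyticAt N Φ j) (a : Time n) :
    c.Dt a Φ j = ∑ r ∈ Finset.range (N + 1), ∑ γ, jd γ r Φ j *
      Dx^[r + 1] (fun j => thetaWave X c (up a) 0 (j 0) γ) j := by
  simp only [← iterate_Dx_flow]
  exact h.vecD_eq _

lemma Dt_Dt_eq_sum (hO : IsOpen O) (hM : ∀ j ∈ O, j 0 ∈ X.M) {N : ℕ} {Φ : Jet n → ℂ}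
    (h : ∀ j ∈ O, JetAnalyticAt N Φ j) (a b : Time n) : ∀ j ∈ O,
    c.Dt a (c.Dt b Φ) j =
      (∑ r ∈ Finset.range (N + 1), ∑ s ∈ Finset.range (N + 1), ∑ γ, ∑ ρ, jd γ r (jd ρ s Φ) j *
        (Dx^[r + 1] (fun j => thetaWave X c (up a) 0 (j 0) γ) j *
          Dx^[s + 1] (fun j => thetaWave X c (up b) 0 (j 0) ρ) j)) +
      ∑ s ∈ Finset.range (N + 1), ∑ ρ, jd ρ s Φ j *
        Dx^[s + 1] (fun y => ((X.mulBy (thetaWave X c (up a) 1 (y 0)) (y 0) *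
          X.mulBy (thetaWave X c (up b) 1 (y 0)) (y 0)).mulVec (y 1)) ρ) j := by
  intro j hj
  have hΦ : JetAnalyticOn O Φ := fun j hj => ⟨N, h j hj⟩
  have hfl := fun s ρ => (c.jetAnalyticOn_flow hM b ρ).iterate_Dx s
  have h1 : ∀ j ∈ O, c.Dt b Φ j = ∑ s ∈ Finset.range (N + 1), ∑ ρ, jd ρ s Φ j *
      Dx^[s] (c.flow b ρ) j := fun j hj => (h j hj).vecD_eq _
  rw [c.Dt_congr hO h1 a j hj]
  have h2 : c.Dt a (fun j => ∑ s ∈ Finset.range (N + 1), ∑ ρ, jd ρ s Φ j *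
      Dx^[s] (c.flow b ρ) j) j = ∑ s ∈ Finset.range (N + 1), ∑ ρ,
      (c.Dt a (jd ρ s Φ) j * Dx^[s] (c.flow b ρ) j +
        jd ρ s Φ j * c.Dt a (Dx^[s] (c.flow b ρ)) j) := by
    refine (vecD_sum _ fun s _ => (JetAnalyticOn.sum _ fun ρ _ =>
      (hΦ.jd ρ s).mul (hfl s ρ)) j hj).trans ?_
    refine sum_congr rfl fun s _ => ?_
    refine (vecD_sum _ fun ρ _ => ((hΦ.jd ρ s).mul (hfl s ρ)) j hj).trans ?_
    exact sum_congr rfl fun ρ _ => vecD_mul (hΦ.jd ρ s j hj) (hfl s ρ j hj)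
  rw [h2]
  simp only [sum_add_distrib]
  congr 1
  · rw [sum_comm (s := Finset.range (N + 1)) (t := Finset.range (N + 1))]
    refine sum_congr rfl fun s _ => ?_
    rw [sum_congr rfl fun ρ _ => by rw [c.Dt_eq_sum ((h j hj).jd ρ s) a]]
    simp only [sum_mul]
    rw [sum_comm]
    refine sum_congr rfl fun r _ => ?_
    rw [sum_comm]
    refine sum_congr rfl fun γ _ => sum_congr rfl fun ρ _ => ?_
    rw [c.iterate_Dx_flow]; ring
  · refine sum_congr rfl fun s _ => sum_congr rfl fun ρ _ => ?_
    rw [c.Dt_iterate_Dx hO hM (c.jetAnalyticOn_flow hM b ρ) a s j hj,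
      iterate_Dx_congr hO (c.Dt_flow hO hM a b ρ) s j hj, ← Function.iterate_succ_apply]
    simp only [thetaWave_up_one]

lemma ev_bForm_virTensor (hO : IsOpen O) (hM : ∀ j ∈ O, j 0 ∈ X.M) {K r s : ℕ} (hr : r + 1 < K)
    (hs : s + 1 < K) (m : ℕ) (γ ρ : Fin n) : ∀ j ∈ O,
    (1 / 2) * Form.ev K (bForm X (r + 1) (s + 1) γ ρ) (c.virTensor m (j 0)) j =
      ∑ x ∈ lowTimes n m ×ˢ lowTimes n m, c.virA m x.1 x.2 *
        (Dx^[r + 1] (fun j => thetaWave X c (up x.1) 0 (j 0) γ) j *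
          Dx^[s + 1] (fun j => thetaWave X c (up x.2) 0 (j 0) ρ) j) := by
  intro j hj
  rw [ev_virTensor, c.sum_virA_eq m fun a b => Dx^[r + 1] (fun j => thetaWave X c a 0 (j 0) γ) j *
    Dx^[s + 1] (fun j => thetaWave X c b 0 (j 0) ρ) j]
  · congr 1
    refine sum_congr rfl fun a _ => sum_congr rfl fun b _ => ?_
    rw [ev_bForm (isWave_thetaWave X c a) (isWave_thetaWave X c b) hO hM hM hr hs γ ρ hj]
  · intro α b; rw [c.iterate_Dx_thetaWave_zero hO hM α γ r j hj, zero_mul]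
  · intro a β; rw [c.iterate_Dx_thetaWave_zero hO hM β ρ s j hj, mul_zero]

lemma ev_lForm_virTensor (hO : IsOpen O) (hM : ∀ j ∈ O, j 0 ∈ X.M) {K s : ℕ} (hs : s + 2 < K)
    (m : ℕ) (ρ : Fin n) : ∀ j ∈ O,
    (1 / 2) * Form.ev K (lForm X s ρ) (c.virTensor m (j 0)) j =
      ∑ x ∈ lowTimes n m ×ˢ lowTimes n m, c.virA m x.1 x.2 *
        Dx^[s + 1] (fun y => ((X.mulBy (thetaWave X c (up x.1) 1 (y 0)) (y 0) *
          X.mulBy (thetaWave X c (up x.2) 1 (y 0)) (y 0)).mulVec (y 1)) ρ) j := by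
  intro j hj
  have h0 : ∀ α v, thetaWave X c (α, 0) 1 v = 0 := fun α v => by funext σ; simp [thetaWave]
  have hz : ∀ v, X.mulBy 0 v = 0 := fun v => by simp [FrobeniusManifold.mulBy]
  have hD : Dx^[s + 1] (fun _ : Jet n => (0 : ℂ)) j = 0 := by
    have := iterate_Dx_const_mul hO (0 : ℂ) (JetAnalyticOn.const (n := n) 0) (s + 1) j hj
    simpa using this
  rw [ev_virTensor, c.sum_virA_eq m fun a b => Dx^[s + 1] (fun y =>
    ((X.mulBy (thetaWave X c a 1 (y 0)) (y 0) *
      X.mulBy (thetaWave X c b 1 (y 0)) (y 0)).mulVec (y 1)) ρ) j]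
  · congr 1
    refine sum_congr rfl fun a _ => sum_congr rfl fun b _ => ?_
    rw [ev_lForm (isWave_thetaWave X c a) (isWave_thetaWave X c b) hO hM hM hs ρ hj]
  · intro α b
    simp only [h0, hz, Matrix.zero_mul, Matrix.zero_mulVec, Pi.zero_apply, hD]
  · intro a β
    simp only [h0, hz, Matrix.mul_zero, Matrix.zero_mulVec, Pi.zero_apply, hD]

variable {F : ℕ → Jet n → ℂ}

lemma tm_singleton (b : Time n) (k : ℕ) : c.tm F [b] k = c.logD F b k := by
  funext φ j
  rw [tm_cons]
  have h1 : (if 2 ≤ k then c.cD b (c.tm F [] (k - 2)) φ j else 0) = 0 := by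
    split_ifs
    · rw [show c.tm F [] (k - 2) = fun _ _ => (if k - 2 = 0 then (1 : ℂ) else 0) from rfl,
        c.cD_jet (fun _ => if k - 2 = 0 then (1 : ℂ) else 0)]
      exact vecD_const _
    · rfl
  rw [h1, zero_add, Finset.sum_eq_single (k, 0)]
  · simp [tm, tauMon]
  · rintro ⟨i, l⟩ hx hne
    have := mem_antidiagonal.1 hx
    have hl : l ≠ 0 := fun h => hne (by simp only at this; subst h; simp [← this])
    simp [tm, tauMon, hl]
  · intro h; exact absurd (mem_antidiagonal.2 (by simp)) h

lemma tm_pair_zero {k : ℕ} (hk : 1 ≤ k) (a b : Time n) (j : Jet n) :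
    c.tm F [a, b] k 0 j = (if k = 2 then c.Ω a b (j 0) else 0) + c.Dt a (c.Dt b (prevF F k)) j +
      ∑ i ∈ Finset.Icc 1 (k - 1), c.Dt a (F i) j * c.Dt b (F (k - i)) j := by
  have hD0 : ∀ a, c.Dt a (fun _ => 0) = fun _ => 0 := fun a => funext fun j => vecD_const 0
  rw [tm_cons]
  congr 1
  · rw [tm_singleton]
    by_cases h2 : k = 2
    · subst h2
      simp only [le_refl, if_true, Nat.sub_self]
      rw [show c.logD F b 0 = fun φ _ => φ b from by funext φ j; simp [logD], cD_phi, prevF,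
        if_neg (by omega), hD0, hD0, add_zero]
    · by_cases h3 : 3 ≤ k
      · rw [if_pos (by omega), if_neg h2, zero_add, prevF, if_pos h3,
          show c.logD F b (k - 2) = fun _ j => c.Dt b (F (k - 2)) j from by
            funext φ j; simp [logD, show k - 2 ≠ 0 by omega], cD_jet]
      · rw [if_neg (by omega), if_neg h2, prevF, if_neg h3, hD0, hD0, zero_add]
  · obtain ⟨l, rfl⟩ : ∃ l, k = l + 1 := ⟨k - 1, by omega⟩
    simp only [tm_singleton]
    rw [Finset.Nat.sum_antidiagonal_eq_sum_range_succ_mk, sum_range_succ']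
    simp only [Nat.sub_zero, Nat.add_sub_cancel]
    rw [sum_range_succ]
    simp only [Nat.sub_self, logD, if_true, Nat.succ_ne_zero, if_false, Pi.zero_apply, mul_zero,
      zero_mul, add_zero]
    rw [Finset.range_eq_Ico, Finset.sum_Ico_add' (fun i => c.Dt a (F i) j *
      (if l + 1 - i = 0 then 0 else c.Dt b (F (l + 1 - i)) j)) 0 l 1]
    refine sum_congr (by ext; simp) fun i hi => ?_
    have := mem_Icc.1 hi
    rw [if_neg (by omega)]

lemma sum_virA_tm (hO : IsOpen O) (hM : ∀ j ∈ O, j 0 ∈ X.M) {N K k : ℕ} (hk : 1 ≤ k)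
    (hN : ∀ i, 0 < i → i ≤ k → ∀ j ∈ O, JetAnalyticAt N (F i) j) (hK : N + 2 < K) (m : ℕ) :
    ∀ j ∈ O, ∑ x ∈ lowTimes n m ×ˢ lowTimes n m, c.virA m x.1 x.2 * c.tm F [x.1, x.2] k 0 j =
      (1 / 2) * Form.ev K (quadForm X N (quadCoeff F k)) (c.virTensor m (j 0)) j +
      (1 / 2) * Form.ev K (linForm X N (prevF F k)) (c.virTensor m (j 0)) j +
      if k = 2 then ∑ x ∈ lowTimes n m ×ˢ lowTimes n m, c.virA m x.1 x.2 * c.Ω x.1 x.2 (j 0)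
        else 0 := by
  intro j hj
  have hprev : ∀ j ∈ O, JetAnalyticAt N (prevF F k) j := by
    intro j hj
    unfold prevF
    split_ifs
    · exact hN _ (by omega) (by omega) j hj
    · exact .const N 0 j
  have h1 : ∀ a b, c.tm F [a, b] k 0 j = (if k = 2 then c.Ω a b (j 0) else 0) +
      ((∑ r ∈ Finset.range (N + 1), ∑ s ∈ Finset.range (N + 1), ∑ γ, ∑ ρ, quadCoeff F k γ r ρ s j *
        (Dx^[r + 1] (fun j => thetaWave X c (up a) 0 (j 0) γ) j *
          Dx^[s + 1] (fun j => thetaWave X c (up b) 0 (j 0) ρ) j)) +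
      ∑ s ∈ Finset.range (N + 1), ∑ ρ, jd ρ s (prevF F k) j *
        Dx^[s + 1] (fun y => ((X.mulBy (thetaWave X c (up a) 1 (y 0)) (y 0) *
          X.mulBy (thetaWave X c (up b) 1 (y 0)) (y 0)).mulVec (y 1)) ρ) j) := by
    intro a b
    rw [c.tm_pair_zero hk, c.Dt_Dt_eq_sum hO hM hprev a b j hj]
    have h2 : ∑ i ∈ Finset.Icc 1 (k - 1), c.Dt a (F i) j * c.Dt b (F (k - i)) j =
        ∑ r ∈ Finset.range (N + 1), ∑ s ∈ Finset.range (N + 1), ∑ γ, ∑ ρ,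
        (∑ i ∈ Finset.Icc 1 (k - 1), jd γ r (F i) j * jd ρ s (F (k - i)) j) *
        (Dx^[r + 1] (fun j => thetaWave X c (up a) 0 (j 0) γ) j *
          Dx^[s + 1] (fun j => thetaWave X c (up b) 0 (j 0) ρ) j) := by
      simp only [sum_mul]
      simp only [sum_comm (t := Finset.Icc 1 (k - 1))]
      refine sum_congr rfl fun i hi => ?_
      have hi := mem_Icc.1 hi
      rw [c.Dt_eq_sum (hN i (by omega) (by omega) j hj), c.Dt_eq_sum (hN (k - i) (by omega)
        (by omega) j hj), Finset.sum_mul_sum]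
      refine sum_congr rfl fun r _ => sum_congr rfl fun s _ => ?_
      rw [Finset.sum_mul_sum]
      exact sum_congr rfl fun γ _ => sum_congr rfl fun ρ _ => by ring
    rw [h2]
    simp only [quadCoeff, add_mul, sum_add_distrib]
    ring
  simp only [h1, mul_add, sum_add_distrib]
  rw [add_comm]
  congr 1
  · rw [ev_quadForm, ev_linForm]
    congr 1
    · simp only [mul_sum]
      simp only [sum_comm (s := lowTimes n m ×ˢ lowTimes n m)]
      refine sum_congr rfl fun r hr => sum_congr rfl fun s hs =>
        sum_congr rfl fun γ _ => sum_congr rfl fun ρ _ => ?_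
      have hr := mem_range.1 hr
      have hs := mem_range.1 hs
      rw [mul_left_comm, c.ev_bForm_virTensor hO hM (by omega) (by omega) m γ ρ j hj,
        mul_sum]
      exact sum_congr rfl fun x _ => by ring
    · simp only [mul_sum]
      simp only [sum_comm (s := lowTimes n m ×ˢ lowTimes n m)]
      refine sum_congr rfl fun s hs => sum_congr rfl fun ρ _ => ?_
      have hs := mem_range.1 hs
      rw [mul_left_comm, c.ev_lForm_virTensor hO hM (by omega) m ρ j hj, mul_sum]
      exact sum_congr rfl fun x _ => by ring
  · split_ifs <;> simp

lemma virTau_zero (hO : IsOpen O) (hM : ∀ j ∈ O, j 0 ∈ X.M) {N K k : ℕ} (hk : 1 ≤ k)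
    (hN : ∀ j ∈ O, JetAnalyticAt N (F k) j) (hK : N < K) (m : ℕ) :
    ∀ j ∈ O, c.virTau F m ((k : ℤ) - 2) 0 0 j =
      Form.ev K (lhsForm X N (F k)) (c.virTensor m (j 0)) j := by
  intro j hj
  rw [virTau, if_neg (by omega), if_pos (by omega), show ((k : ℤ) - 2 + 2).toNat = k by omega,
    (hN j hj).finsum_eq, ev_lhsForm]
  refine sum_congr rfl fun r hr => sum_congr rfl fun γ _ => ?_
  have hr := mem_range.1 hr
  rw [c.iterate_coverD_virV_zero hO hM m γ r j hj, c.ev_yForm_virTensor hO hM (by omega) m γ j hj]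

end Calibration

/-! ### The weights of the forms in the loop equation -/

section

variable {n : ℕ} {O : Set (Jet n)}

/-- The coefficient of the form at `X_{ik}` has weight at most `d - i - k`. -/
def FormFilt (O : Set (Jet n)) (d : ℤ) (f : Form n) : Prop := ∀ i k σ τ,
  JetAnalyticOn O (f i k σ τ) ∧ ∀ l, Filt O l (d - i - k) (f i k σ τ)

namespace FormFilt

variable {d d' : ℤ} {f g : Form n}

lemma mono (h : FormFilt O d f) (hd : d ≤ d') : FormFilt O d' f := fun i k σ τ =>
  ⟨(h i k σ τ).1, fun l => ((h i k σ τ).2 l).mono le_rfl (by omega)⟩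

lemma zero : FormFilt O d fun _ _ _ _ _ => 0 := fun _ _ _ _ => ⟨.const 0, fun _ => .zero⟩

lemma add (hO : IsOpen O) (hf : FormFilt O d f) (hg : FormFilt O d g) :
    FormFilt O d fun i k σ τ j => f i k σ τ j + g i k σ τ j := fun i k σ τ =>
  ⟨(hf i k σ τ).1.add (hg i k σ τ).1, fun l => .add hO (hf i k σ τ).1 (hg i k σ τ).1
    ((hf i k σ τ).2 l) ((hg i k σ τ).2 l)⟩

lemma sum (hO : IsOpen O) {ι : Type*} (s : Finset ι) {f : ι → Form n}
    (h : ∀ x ∈ s, FormFilt O d (f x)) : FormFilt O d fun i k σ τ j => ∑ x ∈ s, f x i k σ τ j :=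
  fun i k σ τ => ⟨.sum _ fun x hx => (h x hx i k σ τ).1, fun l =>
    .sum hO _ (fun x hx => (h x hx i k σ τ).1) fun x hx => (h x hx i k σ τ).2 l⟩

lemma mul (hO : IsOpen O) {Φ : Jet n → ℂ} (hA : JetAnalyticOn O Φ) (hΦ : ∀ l, Filt O l d' Φ)
    (h : FormFilt O d f) : FormFilt O (d' + d) fun i k σ τ j => Φ j * f i k σ τ j :=
  fun i k σ τ => ⟨hA.mul (h i k σ τ).1, fun l =>
    (Filt.mul hO hA (h i k σ τ).1 (hΦ l) ((h i k σ τ).2 l)).mono le_rfl (by omega)⟩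

lemma const_mul (hO : IsOpen O) (a : ℂ) (h : FormFilt O d f) :
    FormFilt O d fun i k σ τ j => a * f i k σ τ j := by
  simpa using mul hO (.const a) (fun l => .const a) h

end FormFilt

end

section

variable {n : ℕ} [NeZero n] {X : FrobeniusManifold n} {O : Set (Jet n)}

lemma filt_mulBy (hO : IsOpen O) (hM : ∀ j ∈ O, j 0 ∈ X.M) (l : ℕ) (τ σ : Fin n) :
    Filt O l 0 fun j => X.mulBy (j 1) (j 0) τ σ := by
  have h : (fun j : Jet n => X.mulBy (j 1) (j 0) τ σ) =
      fun j => ∑ γ, j 1 γ * (fun v => X.C γ v τ σ) (j 0) := by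
    funext j; simp [FrobeniusManifold.mulBy, Matrix.sum_apply]
  have hC : ∀ γ, JetAnalyticOn O fun j => (fun v => X.C γ v τ σ) (j 0) := fun γ =>
    .comp_base fun j hj => X.analyticAt_C (hM j hj) γ τ σ
  rw [h]
  exact .sum hO _ (fun γ _ => (JetAnalyticOn.coord 1 γ).mul (hC γ)) fun γ _ => by
    simpa using Filt.mul hO (.coord 1 γ) (hC γ) (.coord_one γ) (.base (l := l) (fun v => X.C γ v τ σ))

lemma filt_waveCoeff (hO : IsOpen O) (hM : ∀ j ∈ O, j 0 ∈ X.M) (l k i : ℕ) (γ σ : Fin n) :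
    Filt O l ((k : ℤ) - i) (waveCoeff X k i γ σ) := by
  induction k generalizing i γ σ with
  | zero =>
    rcases Nat.eq_zero_or_pos i with rfl | hi
    · simpa [waveCoeff] using Filt.const (O := O) (l := l) (if γ = σ then 1 else 0)
    · rw [waveCoeff_eq_zero X hi]; exact .zero
  | succ k ih =>
    have hD := fun i => ((ih i γ σ).Dx hO (jetAnalyticOn_waveCoeff X hM k i γ σ))
    cases i with
    | zero => exact (hD 0).mono le_rfl (by push_cast; omega)
    | succ i =>
      have hA := fun τ => (jetAnalyticOn_waveCoeff X hM k i γ τ)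
      refine .add hO (jetAnalyticOn_waveCoeff X hM k _ γ σ).Dx
        (.sum _ fun τ _ => (hA τ).mul (jetAnalyticOn_mulBy X hM τ σ))
        ((hD (i + 1)).mono le_rfl (by push_cast; omega)) ?_
      exact .sum hO _ (fun τ _ => (hA τ).mul (jetAnalyticOn_mulBy X hM τ σ)) fun τ _ =>
        ((ih i γ τ).mul hO (hA τ) (jetAnalyticOn_mulBy X hM τ σ) (filt_mulBy hO hM l τ σ)).mono
          le_rfl (by push_cast; omega)

/-- The leading coefficient of `∂_x^k w_0` is the `k`-th power of the multiplication by `v_x`. -/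
lemma waveCoeff_self (k : ℕ) (γ σ : Fin n) (j : Jet n) :
    waveCoeff X k k γ σ j = (X.mulBy (j 1) (j 0) ^ k) γ σ := by
  induction k generalizing σ with
  | zero => simp [waveCoeff, Matrix.one_apply]
  | succ k ih =>
    simp only [waveCoeff, waveCoeff_eq_zero X (Nat.lt_succ_self k), Dx_const, zero_add, ih,
      pow_succ, Matrix.mul_apply]

lemma formFilt_bForm (hO : IsOpen O) (hM : ∀ j ∈ O, j 0 ∈ X.M) (a b : ℕ) (γ ρ : Fin n) : FormFilt O ((a : ℤ) + b) (bForm X a b γ ρ) :=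
  fun i k σ τ => ⟨(jetAnalyticOn_waveCoeff X hM a i γ σ).mul (jetAnalyticOn_waveCoeff X hM b k ρ τ),
    fun l => ((filt_waveCoeff hO hM l a i γ σ).mul hO (jetAnalyticOn_waveCoeff X hM a i γ σ)
      (jetAnalyticOn_waveCoeff X hM b k ρ τ) (filt_waveCoeff hO hM l b k ρ τ)).mono le_rfl
      (by omega)⟩

lemma formFilt_yForm (hO : IsOpen O) (hM : ∀ j ∈ O, j 0 ∈ X.M) (r : ℕ) (γ : Fin n) : FormFilt O r (yForm X r γ) :=
  .sum hO _ fun ab hab => .const_mul hO _ <| .sum hO _ fun ρ _ => .const_mul hO _ <|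
    (formFilt_bForm hO hM ab.1 ab.2 γ ρ).mono (by
      have := mem_antidiagonal.1 hab; omega)

lemma filt_triple (hO : IsOpen O) (hM : ∀ j ∈ O, j 0 ∈ X.M) (l : ℕ) (σ ρ γ : Fin n) : Filt O l 0 (triple X σ ρ γ) := by
  have h : triple X σ ρ γ = fun j => ∑ δ, j 1 δ * (fun v => (X.C σ v * X.C ρ v) γ δ) (j 0) := by
    funext j; simp [triple, Matrix.mulVec, dotProduct, mul_comm]
  have hC : ∀ δ, JetAnalyticOn O fun j => (fun v => (X.C σ v * X.C ρ v) γ δ) (j 0) := fun δ => by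
    simp only [Matrix.mul_apply]
    exact .sum _ fun κ _ => .mul
      (.comp_base (f := fun v => X.C σ v γ κ) fun j hj => X.analyticAt_C (hM j hj) σ γ κ)
      (.comp_base (f := fun v => X.C ρ v κ δ) fun j hj => X.analyticAt_C (hM j hj) ρ κ δ)
  rw [h]
  exact .sum hO _ (fun δ _ => (JetAnalyticOn.coord 1 δ).mul (hC δ)) fun δ _ => by
    simpa using Filt.mul hO (.coord 1 δ) (hC δ) (.coord_one δ)
      (.base (l := l) (fun v => (X.C σ v * X.C ρ v) γ δ))

lemma formFilt_lForm (hO : IsOpen O) (hM : ∀ j ∈ O, j 0 ∈ X.M) (k : ℕ) (γ : Fin n) : FormFilt O ((k : ℤ) + 3) (lForm X k γ) := by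
  have h : FormFilt O ((k : ℤ) + 1) (fun i l σ τ j =>
      ∑ ab ∈ antidiagonal (k + 1), ∑ cd ∈ antidiagonal ab.1,
      ((Nat.choose (k + 1) ab.1 : ℂ) * Nat.choose ab.1 cd.1) * ∑ σ', ∑ ρ',
        Dx^[ab.2] (triple X σ' ρ' γ) j * bForm X cd.1 cd.2 σ' ρ' i l σ τ j) := by
    refine .sum hO _ fun ab hab => .sum hO _ fun cd hcd => .const_mul hO _ <| .sum hO _ fun σ' _ =>
      .sum hO _ fun ρ' _ => ?_
    have hab := mem_antidiagonal.1 hab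
    have hcd := mem_antidiagonal.1 hcd
    exact (FormFilt.mul hO ((jetAnalyticOn_triple hM σ' ρ' γ).iterate_Dx ab.2)
      (fun l => (filt_triple hO hM l σ' ρ' γ).iterate_Dx hO (jetAnalyticOn_triple hM σ' ρ' γ) ab.2)
      (formFilt_bForm hO hM cd.1 cd.2 σ' ρ')).mono (by omega)
  intro i l σ τ
  by_cases hil : i = 0 ∨ l = 0
  · rw [show lForm X k γ i l σ τ = fun _ => 0 from funext fun j => by simp [lForm, hil]]
    exact ⟨.const 0, fun _ => .zero⟩
  · have := h (i - 1) (l - 1) σ τ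
    simp only [mul_comm (Dx^[_] _ _)] at this
    rw [show lForm X k γ i l σ τ = _ from funext fun j => if_neg hil]
    exact ⟨this.1, fun s => (this.2 s).mono le_rfl (by omega)⟩

end

section

variable {n : ℕ} [NeZero n] {X : FrobeniusManifold n} {O : Set (Jet n)}

/-- The quadratic expression in the derivatives of `F_1, …, F_{g-1}` in the loop equation. -/
def genusQuad (G : ℕ → Jet n → ℂ) (g : ℕ) (γ : Fin n) (k : ℕ) (ρ : Fin n) (l : ℕ) (j : Jet n) : ℂ :=
  jd γ k (jd ρ l (G (g - 1))) j + ∑ h ∈ Finset.Icc 1 (g - 1), jd γ k (G h) j * jd ρ l (G (g - h)) j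

/-- The form of the right hand side of the loop equation in genus `g ≥ 2`. -/
def rhsForm (X : FrobeniusManifold n) (N : ℕ) (G : ℕ → Jet n → ℂ) (g : ℕ) : Form n :=
  fun i k σ τ j => (1 / 2) * quadForm X N (genusQuad G g) i k σ τ j +
    (1 / 2) * linForm X N (G (g - 1)) i k σ τ j

lemma formFilt_rhsForm (hO : IsOpen O) (hM : ∀ j ∈ O, j 0 ∈ X.M) {G : ℕ → Jet n → ℂ} {g : ℕ}
    (hg : 2 ≤ g) (hG : ∀ h, 0 < h → h < g → JetAnalyticOn O (G h))
    (hF : ∀ h, 0 < h → h < g → ∀ l, Filt O l (3 * (h : ℤ) - 3) (G h)) (N : ℕ) :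
    FormFilt O (3 * (g : ℤ) - 2) (rhsForm X N G g) := by
  have hd : ∀ h, 0 < h → h < g → ∀ γ (r l : ℕ), Filt O l (3 * (h : ℤ) - 2 - r) (jd γ r (G h)) :=
    fun h h0 h1 γ r l => ((hF h h0 h1 (l + 1)).jd hO (hG h h0 h1) γ r).mono le_rfl (by omega)
  refine .add hO (.const_mul hO _ ?_) (.const_mul hO _ ?_)
  · refine .sum hO _ fun r _ => .sum hO _ fun s _ => .sum hO _ fun γ _ => .sum hO _ fun ρ _ => ?_
    have hp : ∀ h ∈ Finset.Icc 1 (g - 1), JetAnalyticOn O fun j =>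
        jd γ r (G h) j * jd ρ s (G (g - h)) j := fun h hh => by
      have hh := mem_Icc.1 hh
      exact ((hG h (by omega) (by omega)).jd γ r).mul ((hG (g - h) (by omega) (by omega)).jd ρ s)
    have h2 := ((hG (g - 1) (by omega) (by omega)).jd ρ s)
    refine (FormFilt.mul hO (d' := 3 * (g : ℤ) - 4 - r - s) ((h2.jd γ r).add (.sum _ hp)) (fun l => ?_)
      (formFilt_bForm hO hM (r + 1) (s + 1) γ ρ)).mono (by push_cast; omega)
    refine .add hO (h2.jd γ r) (.sum _ hp) ?_ (.sum hO _ hp fun h hh => ?_)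
    · exact ((hd (g - 1) (by omega) (by omega) ρ s (l + 1)).jd hO h2 γ r).mono le_rfl (by omega)
    · have hh := mem_Icc.1 hh
      exact (Filt.mul hO ((hG h (by omega) (by omega)).jd γ r)
        ((hG (g - h) (by omega) (by omega)).jd ρ s) (hd h (by omega) (by omega) γ r l)
        (hd (g - h) (by omega) (by omega) ρ s l)).mono le_rfl (by omega)
  · refine .sum hO _ fun r _ => .sum hO _ fun γ _ => ?_
    exact (FormFilt.mul hO ((hG (g - 1) (by omega) (by omega)).jd γ r)
      (fun l => hd (g - 1) (by omega) (by omega) γ r l) (formFilt_lForm hO hM r γ)).mono (by omega)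

end

/-! ### Poles of the resolvent and the leading terms of the loop equation -/

section

variable {n : ℕ} [NeZero n] {X : FrobeniusManifold n} {v : Fin n → ℂ}

/-- The operator `𝒰` is diagonalizable and generates the algebra of multiplications. -/
structure FrobeniusManifold.RegularAt (X : FrobeniusManifold n) (v : Fin n → ℂ) : Prop where
  mem : v ∈ X.M
  cyclic : ∀ y, ∃ p : Polynomial ℂ, X.mulBy y v = Polynomial.aeval (X.U v) p
  split : ∃ s : Finset ℂ, Polynomial.aeval (X.U v) (Lagrange.nodal s id) = 0

end

section Projectors

variable {n : ℕ}

/-- The spectral projector of a matrix. -/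
def spectralProj (U : Matrix (Fin n) (Fin n) ℂ) (s : Finset ℂ) (u : ℂ) :
    Matrix (Fin n) (Fin n) ℂ := Polynomial.aeval U (Lagrange.basis s id u)

variable {U : Matrix (Fin n) (Fin n) ℂ} {s : Finset ℂ} {u lam : ℂ}

lemma mul_spectralProj (hs : Polynomial.aeval U (Lagrange.nodal s id) = 0) (hu : u ∈ s) :
    U * spectralProj U s u = u • spectralProj U s u := by
  have h : (Polynomial.X - Polynomial.C u) * Lagrange.basis s id u =
      Polynomial.C (Lagrange.nodalWeight s id u) * Lagrange.nodal s id := by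
    rw [Lagrange.basis_eq_prod_sub_inv_mul_nodal_div hu, ← Lagrange.nodal_erase_eq_nodal_div hu,
      Lagrange.nodal_eq_mul_nodal_erase hu]
    simp only [id]
    ring
  have h2 := congrArg (Polynomial.aeval U) h
  rw [map_mul, map_mul, hs, mul_zero, map_sub, Polynomial.aeval_X, Polynomial.aeval_C,
    sub_mul, sub_eq_zero] at h2
  rw [spectralProj, h2, Algebra.algebraMap_eq_smul_one, smul_mul_assoc, one_mul]

lemma aeval_mul_spectralProj (hs : Polynomial.aeval U (Lagrange.nodal s id) = 0) (hu : u ∈ s)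
    (p : Polynomial ℂ) : Polynomial.aeval U p * spectralProj U s u =
      p.eval u • spectralProj U s u := by
  induction p using Polynomial.induction_on' with
  | add p q hp hq => simp [add_mul, add_smul, hp, hq]
  | monomial k a =>
    have hk : ∀ k : ℕ, U ^ k * spectralProj U s u = u ^ k • spectralProj U s u := by
      intro k
      induction k with
      | zero => simp
      | succ k ih => rw [pow_succ, mul_assoc, mul_spectralProj hs hu, mul_smul_comm, ih, smul_smul,
          pow_succ']
    rw [Polynomial.aeval_monomial, Polynomial.eval_monomial, mul_assoc, hk,
      Algebra.algebraMap_eq_smul_one, smul_mul_assoc, one_mul, smul_smul]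

lemma spectralProj_mul_self (hs : Polynomial.aeval U (Lagrange.nodal s id) = 0) (hu : u ∈ s) :
    spectralProj U s u * spectralProj U s u = spectralProj U s u := by
  have h := aeval_mul_spectralProj hs hu (Lagrange.basis s id u)
  rwa [show (Lagrange.basis s id u).eval u = 1 from
    Lagrange.eval_basis_self (Set.injOn_id _) hu, one_smul] at h

lemma sum_spectralProj (hne : s.Nonempty) : ∑ u ∈ s, spectralProj U s u = 1 := by
  unfold spectralProj
  rw [← map_sum, Lagrange.sum_basis (Set.injOn_id _) hne, map_one]

variable [NeZero n]

lemma nonempty_of_nodal (hs : Polynomial.aeval U (Lagrange.nodal s id) = 0) : s.Nonempty := by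
  rw [Finset.nonempty_iff_ne_empty]
  rintro rfl
  simp at hs

lemma resolvent_eq (hs : Polynomial.aeval U (Lagrange.nodal s id) = 0) (hl : lam ∉ s) :
    (lam • 1 - U).det ≠ 0 ∧ (lam • 1 - U)⁻¹ = ∑ u ∈ s, (lam - u)⁻¹ • spectralProj U s u := by
  have key : (lam • 1 - U) * ∑ u ∈ s, (lam - u)⁻¹ • spectralProj U s u = 1 := by
    rw [← sum_spectralProj (U := U) (nonempty_of_nodal hs), mul_sum]
    refine sum_congr rfl fun u hu => ?_
    rw [sum_spectralProj (nonempty_of_nodal hs)]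
    have h : lam - u ≠ 0 := sub_ne_zero.2 fun h => hl (h ▸ hu)
    rw [sub_mul, smul_mul_assoc, one_mul, mul_smul_comm, mul_spectralProj hs hu, smul_comm _ u,
      ← sub_smul, smul_smul, mul_inv_cancel₀ h, one_smul]
  exact ⟨(Matrix.isUnit_det_of_right_inverse key).ne_zero, Matrix.inv_eq_right_inv key⟩

lemma tendsto_resolvent (hs : Polynomial.aeval U (Lagrange.nodal s id) = 0) (hu : u ∈ s) :
    Tendsto (fun lam => (lam - u) • (lam • 1 - U)⁻¹) (𝓝[≠] u) (𝓝 (spectralProj U s u)) := by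
  have hl : Tendsto (fun lam : ℂ => lam) (𝓝[≠] u) (𝓝 u) := tendsto_id.mono_left nhdsWithin_le_nhds
  have h1 : ∀ w ∈ s, Tendsto (fun lam => ((lam - u) * (lam - w)⁻¹) • spectralProj U s w) (𝓝[≠] u)
      (𝓝 (if w = u then spectralProj U s w else 0)) := by
    intro w hw
    by_cases hwu : w = u
    · subst hwu
      rw [if_pos rfl]
      refine tendsto_const_nhds.congr' ?_
      filter_upwards [self_mem_nhdsWithin] with lam hlam
      rw [mul_inv_cancel₀ (sub_ne_zero.2 hlam), one_smul]
    · rw [if_neg hwu]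
      have := (((hl.sub_const u).mul ((hl.sub_const w).inv₀
        (sub_ne_zero.2 (Ne.symm hwu)))).smul_const (spectralProj U s w))
      simpa using this
  have h2 := tendsto_finsetSum s h1
  rw [Finset.sum_ite_eq' s u, if_pos hu] at h2
  refine h2.congr' ?_
  have h3 : ∀ᶠ lam in 𝓝[≠] u, lam ∉ s.erase u := by
    refine nhdsWithin_le_nhds ((s.erase u).finite_toSet.isClosed.isOpen_compl.mem_nhds ?_)
    simp
  filter_upwards [self_mem_nhdsWithin, h3] with lam hlam hlam'
  have : lam ∉ s := fun h => hlam' (Finset.mem_erase.2 ⟨hlam, h⟩)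
  rw [(resolvent_eq hs this).2, smul_sum]
  exact sum_congr rfl fun w _ => (smul_smul _ _ _).symm

lemma tendsto_resTensor {V : Matrix (Fin n) (Fin n) ℂ}
    (hs : Polynomial.aeval U (Lagrange.nodal s id) = 0) (hu : u ∈ s)
    (hV : spectralProj U s u * V * spectralProj U s u = 0) (a k : ℕ) :
    Tendsto (fun lam => (lam - u) ^ (a + 1) • resTensor U V lam a k) (𝓝[≠] u)
      (𝓝 ((∏ l ∈ Finset.range a, ((l : ℂ) + 1 - k - 1 / 2)) • spectralProj U s u)) := by
  induction a with
  | zero => simpa [resTensor] using tendsto_resolvent hs hu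
  | succ a ih =>
    have h := (tendsto_resolvent hs hu).mul
      (ih.const_mul (V + ((a : ℂ) + 1 - k - 1 / 2) • (1 : Matrix (Fin n) (Fin n) ℂ)))
    refine (h.congr fun lam => ?_).trans (le_of_eq ?_)
    · rw [resTensor, pow_succ' _ (a + 1), mul_smul_comm, smul_mul_smul_comm]
    · rw [mul_smul_comm, mul_smul_comm, ← mul_assoc, mul_add, add_mul, hV, zero_add, mul_smul_comm,
        mul_one, smul_mul_assoc, spectralProj_mul_self hs hu, smul_smul, Finset.prod_range_succ]

end Projectors

section

variable {n : ℕ} [NeZero n] {X : FrobeniusManifold n} {v : Fin n → ℂ}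

/-- `(1/2)_a`. -/
def halfPoch (a : ℕ) : ℝ := ∏ l ∈ Finset.range a, ((l : ℝ) + 1 / 2)

lemma halfPoch_pos (a : ℕ) : 0 < halfPoch a := Finset.prod_pos fun l _ => by positivity

lemma sign_mul_prod_eq (i k : ℕ) :
    (-1 : ℂ) ^ k * ∏ l ∈ Finset.range (i + k), ((l : ℂ) + 1 - k - 1 / 2) =
      ((halfPoch i * halfPoch k : ℝ) : ℂ) := by
  rw [add_comm i k, Finset.prod_range_add, ← mul_assoc]
  have h1 : (-1 : ℂ) ^ k * ∏ l ∈ Finset.range k, ((l : ℂ) + 1 - k - 1 / 2) = (halfPoch k : ℂ) := by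
    have h0 : (-1 : ℂ) ^ k = ∏ _l ∈ Finset.range k, (-1 : ℂ) := by simp
    rw [halfPoch, ← Finset.prod_range_reflect, Complex.ofReal_prod, h0, ← Finset.prod_mul_distrib]
    refine Finset.prod_congr rfl fun l hl => ?_
    have hl := mem_range.1 hl
    rw [Nat.sub_sub, Nat.cast_sub (by omega)]
    push_cast; ring
  rw [h1, mul_comm (halfPoch i), Complex.ofReal_mul]
  congr 1
  rw [halfPoch, Complex.ofReal_prod]
  exact Finset.prod_congr rfl fun l _ => by push_cast; ring

/-- The tensor of the resolvent. -/
def resX (X : FrobeniusManifold n) (lam : ℂ) (v : Fin n → ℂ) : Tensor n :=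
  toTensor X (resTensor (X.U v) X.V lam)

namespace FrobeniusManifold.RegularAt

variable (h : X.RegularAt v) {s : Finset ℂ} {u : ℂ}

lemma proj_commute (h : X.RegularAt v) (y : Fin n → ℂ) :
    X.mulBy y v * spectralProj (X.U v) s u = spectralProj (X.U v) s u * X.mulBy y v := by
  obtain ⟨p, hp⟩ := h.cyclic y
  rw [hp, spectralProj, ← map_mul, ← map_mul, mul_comm]

lemma proj_mulVec (h : X.RegularAt v) (hs : Polynomial.aeval (X.U v) (Lagrange.nodal s id) = 0)
    (hu : u ∈ s) (y : Fin n → ℂ) : ∃ a : ℂ, (spectralProj (X.U v) s u).mulVec y =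
      a • (spectralProj (X.U v) s u).mulVec e := by
  obtain ⟨p, hp⟩ := h.cyclic y
  refine ⟨p.eval u, ?_⟩
  rw [← Matrix.smul_mulVec, ← aeval_mul_spectralProj hs hu, ← hp, h.proj_commute,
    ← Matrix.mulVec_mulVec, X.mulBy_mulVec_e h.mem]

lemma adj_proj (h : X.RegularAt v) : X.adj (spectralProj (X.U v) s u) = spectralProj (X.U v) s u := by
  have hp : ∀ p : Polynomial ℂ, X.adj (Polynomial.aeval (X.U v) p) = Polynomial.aeval (X.U v) p := by
    intro p
    induction p using Polynomial.induction_on' with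
    | add p q hp hq => rw [map_add, X.adj_add, hp, hq]
    | monomial k a =>
      have hk : ∀ k : ℕ, X.adj (X.U v ^ k) = X.U v ^ k := by
        intro k
        induction k with
        | zero => simp [X.adj_one]
        | succ k ih => rw [pow_succ, X.adj_mul, ih, X.adj_U h.mem, ← pow_succ, ← pow_succ']
      rw [Polynomial.aeval_monomial, Algebra.algebraMap_eq_smul_one, smul_mul_assoc, one_mul,
        X.adj_smul, hk]
  exact hp _

/-- The projectors have rank one, and `𝒱` is skew symmetric. -/
lemma proj_V_proj (c : Calibration X) (h : X.RegularAt v)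
    (hs : Polynomial.aeval (X.U v) (Lagrange.nodal s id) = 0) (hu : u ∈ s) :
    spectralProj (X.U v) s u * X.V * spectralProj (X.U v) s u = 0 := by
  set P := spectralProj (X.U v) s u with hP
  set f := P.mulVec e with hf
  have hPf : P.mulVec f = f := by rw [hf, Matrix.mulVec_mulVec, spectralProj_mul_self hs hu]
  set B : (Fin n → ℂ) → (Fin n → ℂ) → ℂ := fun x y => dotProduct x (X.η.mulVec y) with hB
  have hBadj : ∀ (A : Matrix (Fin n) (Fin n) ℂ) x y, B (A.mulVec x) y = B x ((X.adj A).mulVec y) := by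
    intro A x y
    simp only [hB]
    rw [Matrix.mulVec_mulVec, FrobeniusManifold.adj, ← Matrix.mul_assoc, ← Matrix.mul_assoc,
      X.eta_mul_inv, Matrix.one_mul, ← Matrix.mulVec_mulVec, dotProduct_comm,
      Matrix.dotProduct_mulVec, dotProduct_comm, Matrix.mulVec_transpose]
  have hBsymm : ∀ x y, B x y = B y x := by
    intro x y
    simp only [hB]
    rw [Matrix.dotProduct_mulVec, dotProduct_comm, ← Matrix.mulVec_transpose, X.symm]
  have hBsmul : ∀ (a : ℂ) x y, B x (a • y) = a * B x y := by
    intro a x y; simp [hB, Matrix.mulVec_smul]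
  have hzero : B f (X.V.mulVec f) = 0 := by
    have h1 := hBadj X.V f f
    have h2 : B f ((-X.V).mulVec f) = -B f (X.V.mulVec f) := by simp [hB, Matrix.neg_mulVec, Matrix.mulVec_neg]
    rw [c.adj_V, h2, hBsymm] at h1
    linear_combination h1 / 2
  have hBf : ∀ y, B f y = B f (P.mulVec y) := by
    intro y
    conv_lhs => rw [← hPf]
    rw [hBadj, h.adj_proj]
  have hPV : P.mulVec (X.V.mulVec f) = 0 := by
    obtain ⟨a, ha⟩ := h.proj_mulVec hs hu (X.V.mulVec f)
    rw [hBf, ha, hBsmul] at hzero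
    rcases mul_eq_zero.1 hzero with h0 | h0
    · rw [ha, h0, zero_smul]
    · have : f = 0 := by
        refine dotProduct_eq_zero f fun y => ?_
        obtain ⟨b, hb⟩ := h.proj_mulVec hs hu ((X.η⁻¹).mulVec y)
        have h1 := hBf ((X.η⁻¹).mulVec y)
        rw [hb, hBsmul, h0, mul_zero] at h1
        simpa only [hB, Matrix.mulVec_mulVec, X.eta_mul_inv, Matrix.one_mulVec] using h1
      rw [this]; simp
  refine Matrix.ext_iff_mulVec.2 fun y => ?_
  obtain ⟨b, hb⟩ := h.proj_mulVec hs hu y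
  rw [← Matrix.mulVec_mulVec, ← Matrix.mulVec_mulVec, hb, Matrix.mulVec_smul, Matrix.mulVec_smul,
    hPV, smul_zero, Matrix.zero_mulVec]

lemma tendsto_resX (c : Calibration X) (h : X.RegularAt v)
    (hs : Polynomial.aeval (X.U v) (Lagrange.nodal s id) = 0) (hu : u ∈ s) (i k : ℕ) :
    Tendsto (fun lam => (lam - u) ^ (i + k + 1) • resX X lam v i k) (𝓝[≠] u)
      (𝓝 (((halfPoch i * halfPoch k : ℝ) : ℂ) • (spectralProj (X.U v) s u * X.η⁻¹))) := by
  have h1 := ((tendsto_resTensor hs hu (h.proj_V_proj c hs hu) (i + k) k).mul_const X.η⁻¹).const_smul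
    ((-1 : ℂ) ^ k)
  rw [smul_mul_assoc, smul_smul, sign_mul_prod_eq] at h1
  refine h1.congr fun lam => ?_
  simp only [resX, toTensor, LinearMap.coe_mk, AddHom.coe_mk, smul_mul_assoc]
  rw [smul_comm]

end FrobeniusManifold.RegularAt

/-- The coefficient of the leading pole of the form `yForm r`. -/
def yLead (r : ℕ) : ℝ := ∑ ab ∈ antidiagonal r,
  ((Nat.choose r ab.1 : ℝ) + Nat.choose r (ab.2 + 1)) * (halfPoch ab.1 * halfPoch ab.2)

lemma yLead_pos (r : ℕ) : 0 < yLead r := by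
  refine Finset.sum_pos (fun ab hab => ?_) ⟨(r, 0), by simp⟩
  have h1 := mem_antidiagonal.1 hab
  have h2 : 0 < Nat.choose r ab.1 := Nat.choose_pos (by omega)
  have h3 : (0 : ℝ) < Nat.choose r ab.1 := by exact_mod_cast h2
  exact mul_pos (by positivity) (mul_pos (halfPoch_pos _) (halfPoch_pos _))

lemma yForm_eq_zero {r i k : ℕ} (hr : r < i + k) (γ σ τ : Fin n) (j : Jet n) :
    yForm X r γ i k σ τ j = 0 := by
  refine sum_eq_zero fun ab hab => ?_
  have h1 := mem_antidiagonal.1 hab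
  rw [sum_eq_zero fun ρ _ => ?_, mul_zero]
  unfold bForm
  rcases lt_or_ge ab.1 i with h2 | h2
  · rw [waveCoeff_eq_zero X h2]; ring
  · rw [waveCoeff_eq_zero X (show ab.2 < k by omega)]; ring

lemma yForm_top (i k : ℕ) (γ σ τ : Fin n) (j : Jet n) : yForm X (i + k) γ i k σ τ j =
    yCoeff (i + k) (i, k) * ((X.mulBy (j 1) (j 0) ^ i) γ σ *
      ∑ ρ, X.η ρ 0 * (X.mulBy (j 1) (j 0) ^ k) ρ τ) := by
  unfold yForm
  rw [Finset.sum_eq_single (i, k)]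
  · simp only [bForm, waveCoeff_self, mul_sum]
    exact sum_congr rfl fun ρ _ => by ring
  · intro ab hab hne
    have h1 := mem_antidiagonal.1 hab
    rw [sum_eq_zero fun ρ _ => ?_, mul_zero]
    unfold bForm
    rcases lt_or_ge ab.1 i with h2 | h2
    · rw [waveCoeff_eq_zero X h2]; ring
    · rw [waveCoeff_eq_zero X (show ab.2 < k by
        rcases Nat.lt_or_ge ab.2 k with h3 | h3
        · exact h3
        · exact absurd (Prod.ext (by simp; omega) (by simp; omega)) hne)]; ring
  · intro h; simp at h

lemma sum_mul_entries (A Q B H : Matrix (Fin n) (Fin n) ℂ) (γ δ : Fin n) :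
    ∑ σ, ∑ τ, (A γ σ * ∑ ρ, H ρ δ * B ρ τ) * Q σ τ = (A * (Q * (B.transpose * H))) γ δ := by
  simp only [Matrix.mul_apply, Matrix.transpose_apply, mul_sum, sum_mul]
  exact sum_congr rfl fun σ _ => sum_congr rfl fun τ _ =>
    sum_congr rfl fun ρ _ => by ring

lemma sum_range_antidiagonal {r K : ℕ} (hr : r < K) (g : ℕ × ℕ → ℂ) :
    ∑ i ∈ Finset.range K, ∑ k ∈ Finset.range K, (if i + k = r then g (i, k) else 0) =
      ∑ ab ∈ antidiagonal r, g ab := by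
  rw [← Finset.sum_product', ← Finset.sum_filter]
  refine sum_congr (Finset.ext fun x => ?_) fun _ _ => rfl
  simp only [Finset.mem_filter, Finset.mem_product, mem_range,
    mem_antidiagonal]
  omega

/-- Only the derivatives of order less than `A` can contribute to an equation between forms whose
poles have order at most `A`. -/
lemma eq_zero_of_poles (c : Calibration X) {j : Jet n} (h : X.RegularAt (j 0))
    (hC : IsUnit (X.mulBy (j 1) (j 0)).det) {K N A : ℕ} (hK : N < K) (z : ℕ → Fin n → ℂ) (f : Form n)
    (hf : ∀ i k, A ≤ i + k → ∀ σ τ, f i k σ τ j =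
      ∑ r ∈ Finset.range (N + 1), ∑ γ, z r γ * yForm X r γ i k σ τ j)
    (R : ℂ → ℂ) (hR : ∀ lam, (lam • 1 - X.U (j 0)).det ≠ 0 → Form.ev K f (resX X lam (j 0)) j = R lam)
    (hRlim : ∀ s : Finset ℂ, Polynomial.aeval (X.U (j 0)) (Lagrange.nodal s id) = 0 → ∀ u ∈ s,
      Tendsto (fun lam => (lam - u) ^ (A + 1) * R lam) (𝓝[≠] u) (𝓝 0)) :
    ∀ r, A ≤ r → r ≤ N → z r = 0 := by
  intro r hr hrN
  induction hd : N - r using Nat.strong_induction_on generalizing r with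
  | _ d ih =>
  have hz : ∀ r', r < r' → r' ≤ N → z r' = 0 := fun r' h1 h2 =>
    ih (N - r') (by omega) r' (by omega) h2 rfl
  obtain ⟨s, hs⟩ := h.split
  set C := X.mulBy (j 1) (j 0) with hCdef
  have hhigh : ∀ i k, r < i + k → ∀ σ τ, f i k σ τ j = 0 := by
    intro i k hik σ τ
    rw [hf i k (by omega)]
    refine sum_eq_zero fun r' hr' => sum_eq_zero fun γ _ => ?_
    have hr' := mem_range.1 hr'
    rcases lt_or_ge r r' with h1 | h1
    · rw [hz r' h1 (by omega)]; simp
    · rw [yForm_eq_zero (by omega), mul_zero]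
  have htop : ∀ i k, i + k = r → ∀ σ τ, f i k σ τ j = ∑ γ, z r γ * yForm X r γ i k σ τ j := by
    intro i k hik σ τ
    rw [hf i k (by omega)]
    refine Finset.sum_eq_single r (fun r' hr' hne => ?_) fun h => ?_
    · refine sum_eq_zero fun γ _ => ?_
      have hr' := mem_range.1 hr'
      rcases lt_or_ge r r' with h1 | h1
      · rw [hz r' h1 (by omega)]; simp
      · rw [yForm_eq_zero (by omega), mul_zero]
    · exact absurd (mem_range.2 (by omega)) h
  have hlim : ∀ u ∈ s, (yLead r : ℂ) * ∑ γ, z r γ * ((C ^ r * spectralProj (X.U (j 0)) s u) γ 0) = 0 := by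
    intro u hu
    set P := spectralProj (X.U (j 0)) s u with hP
    have hl : Tendsto (fun lam : ℂ => lam - u) (𝓝[≠] u) (𝓝 0) := by
      have : Tendsto (fun lam : ℂ => lam) (𝓝[≠] u) (𝓝 u) := tendsto_id.mono_left nhdsWithin_le_nhds
      simpa using this.sub_const u
    have hterm : ∀ i k σ τ, Tendsto (fun lam => f i k σ τ j * ((lam - u) ^ (r + 1) *
        resX X lam (j 0) i k σ τ)) (𝓝[≠] u) (𝓝 (if i + k = r then
          f i k σ τ j * (((halfPoch i * halfPoch k : ℝ) : ℂ) * (P * X.η⁻¹) σ τ) else 0)) := by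
      intro i k σ τ
      have h1 := tendsto_pi_nhds.1 (tendsto_pi_nhds.1 (h.tendsto_resX c hs hu i k) σ) τ
      simp only [Matrix.smul_apply, smul_eq_mul] at h1
      rcases lt_trichotomy (i + k) r with h2 | h2 | h2
      · rw [if_neg (by omega)]
        have h3 := ((hl.pow (r - (i + k))).mul h1).const_mul (f i k σ τ j)
        rw [zero_pow (by omega), zero_mul, mul_zero] at h3
        refine h3.congr fun lam => ?_
        rw [show r + 1 = r - (i + k) + (i + k + 1) by omega, pow_add _ (r - (i + k))]
        ring
      · rw [if_pos h2, ← h2]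
        exact h1.const_mul _
      · rw [if_neg (by omega), hhigh i k h2]
        simp
    have hsum := tendsto_finsetSum (Finset.range K) fun i _ =>
      tendsto_finsetSum (Finset.range K) fun k _ => tendsto_finsetSum Finset.univ fun σ _ =>
      tendsto_finsetSum Finset.univ fun τ _ => hterm i k σ τ
    have hzero : Tendsto (fun lam => (lam - u) ^ (r + 1) * R lam) (𝓝[≠] u) (𝓝 0) := by
      have h1 := (hl.pow (r - A)).mul (hRlim s hs u hu)
      rw [mul_zero] at h1
      refine h1.congr fun lam => ?_
      rw [← mul_assoc, ← pow_add, show r - A + (A + 1) = r + 1 by omega]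
    have hev : ∀ᶠ lam in 𝓝[≠] u, (lam • 1 - X.U (j 0)).det ≠ 0 := by
      have h3 : ∀ᶠ lam in 𝓝[≠] u, lam ∉ s.erase u := by
        refine nhdsWithin_le_nhds ((s.erase u).finite_toSet.isClosed.isOpen_compl.mem_nhds ?_)
        simp
      filter_upwards [self_mem_nhdsWithin, h3] with lam h4 h5
      exact (resolvent_eq hs fun h6 => h5 (Finset.mem_erase.2 ⟨h4, h6⟩)).1
    have heq := tendsto_nhds_unique (hsum.congr' (f₂ := fun lam => (lam - u) ^ (r + 1) * R lam) (by
      filter_upwards [hev] with lam hlam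
      rw [← hR lam hlam]
      simp only [Form.ev, mul_sum]
      exact sum_congr rfl fun i _ => sum_congr rfl fun k _ =>
        sum_congr rfl fun σ _ => sum_congr rfl fun τ _ => by ring)) hzero
    have hcomm : Commute C P := h.proj_commute (j 1)
    have hadj : ∀ k, X.η⁻¹ * (C ^ k).transpose * X.η = C ^ k := by
      intro k
      induction k with
      | zero => simp [X.inv_mul_eta]
      | succ k ih =>
        have := X.adj_mul (C ^ k) C
        rw [X.adj_mulBy h.mem] at this
        rw [pow_succ]
        refine this.trans ?_
        rw [show X.adj (C ^ k) = C ^ k from ih, ← pow_succ, ← pow_succ']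
    have hinner : ∀ i k, i + k = r → (∑ σ, ∑ τ, f i k σ τ j *
        (((halfPoch i * halfPoch k : ℝ) : ℂ) * (P * X.η⁻¹) σ τ)) =
        (((Nat.choose r i : ℝ) + Nat.choose r (k + 1)) * (halfPoch i * halfPoch k) : ℝ) *
          ∑ γ, z r γ * (C ^ r * P) γ 0 := by
      intro i k hik
      have hentry : ∀ γ, ∑ σ, ∑ τ, ((C ^ i) γ σ * ∑ ρ, X.η ρ 0 * (C ^ k) ρ τ) * (P * X.η⁻¹) σ τ =
          (C ^ r * P) γ 0 := by
        intro γ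
        rw [← hik, pow_add, mul_assoc (C ^ i), (hcomm.pow_left k).eq]
        have h2 := hadj k
        rw [Matrix.mul_assoc] at h2
        rw [sum_mul_entries, Matrix.mul_assoc P, h2]
      calc _ = ∑ γ, ∑ σ, ∑ τ, z r γ * (yCoeff r (i, k) * (((halfPoch i * halfPoch k : ℝ) : ℂ) *
            (((C ^ i) γ σ * ∑ ρ, X.η ρ 0 * (C ^ k) ρ τ) * (P * X.η⁻¹) σ τ))) := by
            rw [sum_comm]
            conv_rhs => enter [2, γ]; rw [sum_comm]
            rw [sum_comm (s := Finset.univ) (t := Finset.univ) (f := fun γ τ => ∑ σ, _)]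
            refine sum_congr rfl fun τ _ => ?_
            rw [sum_comm]
            refine sum_congr rfl fun σ _ => ?_
            rw [htop i k hik, sum_mul]
            refine sum_congr rfl fun γ _ => ?_
            subst hik
            rw [yForm_top]
            ring
        _ = _ := by
            simp only [← mul_sum, hentry]
            rw [mul_sum]
            refine sum_congr rfl fun γ _ => ?_
            simp only [yCoeff]; push_cast; ring
    rw [← heq, yLead, Complex.ofReal_sum, sum_mul,
      ← sum_range_antidiagonal (show r < K by omega)]
    refine sum_congr rfl fun i _ => sum_congr rfl fun k _ => ?_
    by_cases hik : i + k = r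
    · simp only [if_pos hik]; exact (hinner i k hik).symm
    · simp [if_neg hik]
  have hcyc : ∀ y, dotProduct (z r) ((C ^ r).mulVec y) = 0 := by
    intro y
    have h1 : y = ∑ u ∈ s, (spectralProj (X.U (j 0)) s u).mulVec y := by
      rw [← Matrix.sum_mulVec, sum_spectralProj (nonempty_of_nodal hs), Matrix.one_mulVec]
    rw [h1, Matrix.mulVec_sum, dotProduct_sum]
    refine sum_eq_zero fun u hu => ?_
    obtain ⟨a, ha⟩ := h.proj_mulVec hs hu y
    have h2 := (mul_eq_zero.1 (hlim u hu)).resolve_left (by exact_mod_cast (yLead_pos r).ne')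
    rw [ha, Matrix.mulVec_smul, dotProduct_smul, Matrix.mulVec_mulVec]
    simp only [dotProduct, FrobeniusManifold.e, Matrix.mulVec_single_one, Matrix.col_apply, h2,
      smul_zero]
  refine dotProduct_eq_zero _ fun y => ?_
  have h1 := hcyc (((C ^ r)⁻¹).mulVec y)
  rwa [Matrix.mulVec_mulVec, Matrix.mul_nonsing_inv _ (by rw [Matrix.det_pow]; exact hC.pow r),
    Matrix.one_mulVec] at h1

end

/-! ### Density of the regular points -/

section

variable {n : ℕ}

lemma isOpen_linearIndependent_matrix (m : ℕ) :
    IsOpen {f : Fin m → Matrix (Fin n) (Fin n) ℂ | LinearIndependent ℂ f} :=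
  isOpen_setOfPred_linearIndependent (𝕜 := ℂ) (E := Fin n → Fin n → ℂ) (ι := Fin m)

/-- The powers of a matrix up to the degree of its minimal polynomial span the algebra it
generates. -/
lemma aeval_mem_span_pow {A : Matrix (Fin n) (Fin n) ℂ} {m : ℕ}
    (hm : (minpoly ℂ A).natDegree ≤ m) (p : Polynomial ℂ) :
    Polynomial.aeval A p ∈ Submodule.span ℂ (Set.range fun i : Fin m => A ^ (i : ℕ)) := by
  have hA : IsIntegral ℂ A := Algebra.IsIntegral.isIntegral A
  have hmon := minpoly.monic hA
  rcases subsingleton_or_nontrivial (Matrix (Fin n) (Fin n) ℂ) with hsub | hnon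
  · rw [Subsingleton.elim (Polynomial.aeval A p) 0]; exact zero_mem _
  have hpos := minpoly.natDegree_pos hA
  have h1 : Polynomial.aeval A p = Polynomial.aeval A (p %ₘ minpoly ℂ A) := by
    rw [Polynomial.modByMonic_eq_sub_mul_div, map_sub, map_mul, minpoly.aeval, zero_mul,
      sub_zero]
  have h2 : (p %ₘ minpoly ℂ A).natDegree < m :=
    lt_of_lt_of_le (Polynomial.natDegree_modByMonic_lt p hmon (fun h => by simp [h] at hpos)) hm
  rw [h1, Polynomial.aeval_eq_sum_range' h2]
  exact Submodule.sum_mem _ fun i hi => Submodule.smul_mem _ _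
    (Submodule.subset_span ⟨⟨i, mem_range.1 hi⟩, rfl⟩)

lemma minpoly_dvd_nodal_pow (A : Matrix (Fin n) (Fin n) ℂ) :
    ∃ k, minpoly ℂ A ∣ Lagrange.nodal (minpoly ℂ A).roots.toFinset id ^ k := by
  refine ⟨Multiset.card (minpoly ℂ A).roots, ?_⟩
  have h := (IsAlgClosed.splits (minpoly ℂ A)).eq_prod_roots
  rw [(minpoly.monic (Algebra.IsIntegral.isIntegral A)).leadingCoeff, Polynomial.C_1, one_mul] at h
  conv_lhs => rw [h]
  have h2 := Multiset.prod_dvd_prod_of_dvd (S := (minpoly ℂ A).roots)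
    (fun x => Polynomial.X - Polynomial.C x)
    (fun _ => Lagrange.nodal (minpoly ℂ A).roots.toFinset id) fun x hx =>
      Lagrange.X_sub_C_dvd_nodal id (Multiset.mem_toFinset.2 hx)
  simpa using h2

end

section

variable {n : ℕ} [NeZero n] {X : FrobeniusManifold n} {v : Fin n → ℂ}

namespace FrobeniusManifold

/-- The algebra of the operators of multiplication. -/
def mulAlgebra (X : FrobeniusManifold n) (hv : v ∈ X.M) : Subalgebra ℂ (Matrix (Fin n) (Fin n) ℂ) where
  carrier := Set.range fun y => X.mulBy y v
  mul_mem' := by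
    rintro _ _ ⟨x, rfl⟩ ⟨y, rfl⟩
    exact ⟨_, (X.mulBy_mul_mulBy hv x y).symm⟩
  add_mem' := by
    rintro _ _ ⟨x, rfl⟩ ⟨y, rfl⟩
    exact ⟨_, X.mulBy_add x y v⟩
  algebraMap_mem' a := ⟨a • e, by
    simp only [X.mulBy_smul, X.mulBy_e hv, Algebra.algebraMap_eq_smul_one]⟩

lemma C_mem (hv : v ∈ X.M) (γ : Fin n) : X.C γ v ∈ X.mulAlgebra hv :=
  ⟨Pi.single γ 1, X.mulBy_single γ v⟩

lemma U_mem (hv : v ∈ X.M) : X.U v ∈ X.mulAlgebra hv := ⟨_, rfl⟩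

lemma aeval_mem (hv : v ∈ X.M) {A : Matrix (Fin n) (Fin n) ℂ} (hA : A ∈ X.mulAlgebra hv)
    (p : Polynomial ℂ) : Polynomial.aeval A p ∈ X.mulAlgebra hv :=
  Algebra.adjoin_le (Set.singleton_subset_iff.2 hA) (Polynomial.aeval_mem_adjoin_singleton ℂ A)

lemma mem_comm (hv : v ∈ X.M) {A B : Matrix (Fin n) (Fin n) ℂ} (hA : A ∈ X.mulAlgebra hv)
    (hB : B ∈ X.mulAlgebra hv) : A * B = B * A := by
  obtain ⟨x, rfl⟩ := hA
  obtain ⟨y, rfl⟩ := hB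
  exact X.mulBy_comm hv x y

lemma SemisimpleAt.eq_zero (hs : X.SemisimpleAt v) (hv : v ∈ X.M) {A : Matrix (Fin n) (Fin n) ℂ}
    (hA : A ∈ X.mulAlgebra hv) (hN : IsNilpotent A) : A = 0 := by
  obtain ⟨x, rfl⟩ := hA
  rw [hs x hN]
  simp [mulBy]

lemma SemisimpleAt.nodal (hs : X.SemisimpleAt v) (hv : v ∈ X.M) {A : Matrix (Fin n) (Fin n) ℂ}
    (hA : A ∈ X.mulAlgebra hv) :
    Polynomial.aeval A (Lagrange.nodal (minpoly ℂ A).roots.toFinset id) = 0 := by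
  obtain ⟨k, hk⟩ := minpoly_dvd_nodal_pow A
  refine hs.eq_zero hv (X.aeval_mem hv hA _) ⟨k, ?_⟩
  obtain ⟨r, hr⟩ := hk
  rw [← map_pow, hr, map_mul, minpoly.aeval, zero_mul]

/-- The trace form of a semisimple algebra is nondegenerate. -/
lemma SemisimpleAt.eq_zero_of_trace (hs : X.SemisimpleAt v) (hv : v ∈ X.M)
    {A : Matrix (Fin n) (Fin n) ℂ} (hA : A ∈ X.mulAlgebra hv)
    (ht : ∀ B ∈ X.mulAlgebra hv, (B * A).trace = 0) : A = 0 := by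
  have hnod := hs.nodal hv hA
  set s := (minpoly ℂ A).roots.toFinset
  rw [← mul_one A, ← sum_spectralProj (U := A) (nonempty_of_nodal hnod), mul_sum]
  refine sum_eq_zero fun u hu => ?_
  have h1 := ht _ (X.aeval_mem hv hA (Lagrange.basis s id u))
  rw [X.mem_comm hv (X.aeval_mem hv hA _) hA] at h1
  have h2 := mul_spectralProj hnod hu
  rw [show A * Polynomial.aeval A (Lagrange.basis s id u) = _ from h2, Matrix.trace_smul,
    smul_eq_mul] at h1
  rw [h2]
  rcases mul_eq_zero.1 h1 with h3 | h3
  · rw [h3, zero_smul]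
  · have h4 : IsIdempotentElem (Matrix.toLin' (spectralProj A s u)) := by
      unfold IsIdempotentElem
      rw [Module.End.mul_eq_comp, ← Matrix.toLin'_mul, spectralProj_mul_self hnod hu]
    have h5 := LinearMap.IsIdempotentElem.eq_zero_of_trace_eq_zero h4
      (by rw [Matrix.trace_toLin'_eq, h3])
    rw [(LinearEquiv.map_eq_zero_iff _).1 h5, smul_zero]

/-- The partial derivative of `p(𝒰)`. -/
def pdAeval (X : FrobeniusManifold n) (γ : Fin n) (v : Fin n → ℂ) (p : Polynomial ℂ) :
    Matrix (Fin n) (Fin n) ℂ :=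
  Matrix.of fun α β => pd γ (fun u => Polynomial.aeval (X.U u) p α β) v

lemma analyticAt_aeval_U (hv : v ∈ X.M) (p : Polynomial ℂ) (α β : Fin n) :
    AnalyticAt ℂ (fun u => Polynomial.aeval (X.U u) p α β) v := by
  induction p using Polynomial.induction_on generalizing α β with
  | C a => simp only [Polynomial.aeval_C]; exact analyticAt_const
  | add p q hp hq => simp only [map_add, Matrix.add_apply]; exact (hp α β).add (hq α β)
  | monomial k a ih =>
    simp only [pow_succ, ← mul_assoc (Polynomial.C a), map_mul (_ : _ →ₐ[ℂ] _) (_ * _), Polynomial.aeval_X,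
      Matrix.mul_apply]
    exact analyticAt_fun_sum _ fun σ _ => (ih α σ).mul (X.analyticAt_U hv σ β)

lemma trace_mul_pdAeval (c : Calibration X) (hv : v ∈ X.M) (γ : Fin n) (p : Polynomial ℂ)
    {B : Matrix (Fin n) (Fin n) ℂ} (hB : B ∈ X.mulAlgebra hv) :
    (B * X.pdAeval γ v p).trace =
      (B * (Polynomial.aeval (X.U v) (Polynomial.derivative p) * X.C γ v)).trace := by
  induction p using Polynomial.induction_on generalizing B with
  | C a =>
    have : X.pdAeval γ v (Polynomial.C a) = 0 := by
      ext α β; simp [pdAeval, Polynomial.aeval_C, pd_const]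
    simp [this]
  | add p q hp hq =>
    have : X.pdAeval γ v (p + q) = X.pdAeval γ v p + X.pdAeval γ v q := by
      ext α β
      simp only [pdAeval, Matrix.of_apply, map_add, Matrix.add_apply]
      exact pd_add (analyticAt_aeval_U hv p α β) (analyticAt_aeval_U hv q α β) γ
    rw [this, mul_add, Matrix.trace_add, hp hB, hq hB, Polynomial.derivative_add, map_add, add_mul,
      mul_add, Matrix.trace_add]
  | monomial k a ih =>
    set p := Polynomial.C a * Polynomial.X ^ k with hp
    have hstep : Polynomial.C a * Polynomial.X ^ (k + 1) = p * Polynomial.X := by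
      rw [hp, pow_succ, mul_assoc]
    clear_value p
    have h1 : X.pdAeval γ v (p * Polynomial.X) = X.pdAeval γ v p * X.U v +
        Polynomial.aeval (X.U v) p * (X.C γ v + (X.C γ v * X.V - X.V * X.C γ v)) := by
      ext α β
      simp only [pdAeval, Matrix.of_apply, map_mul, Polynomial.aeval_X, Matrix.mul_apply,
        Matrix.add_apply]
      rw [← sum_add_distrib]
      refine (pd_sum _ (fun σ _ => (analyticAt_aeval_U hv p α σ).mul (X.analyticAt_U hv σ β)) γ).trans ?_
      refine sum_congr rfl fun σ _ => ?_
      refine (pd_mul (analyticAt_aeval_U hv p α σ) (X.analyticAt_U hv σ β) γ).trans ?_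
      rw [c.pd_U hv]
      simp only [Matrix.add_apply]
    have hU := X.U_mem hv
    have hC := X.C_mem hv γ
    have hpU := X.aeval_mem hv hU p
    have h2 : (B * (X.pdAeval γ v p * X.U v)).trace = (X.U v * B * X.pdAeval γ v p).trace := by
      rw [← mul_assoc, Matrix.trace_mul_comm, mul_assoc]
    have h3 : (B * (Polynomial.aeval (X.U v) p * (X.C γ v * X.V - X.V * X.C γ v))).trace = 0 := by
      have hBp := mul_mem hB hpU
      rw [← mul_assoc, mul_sub, Matrix.trace_sub, ← mul_assoc, ← mul_assoc,
        Matrix.trace_mul_comm (B * Polynomial.aeval (X.U v) p * X.V), ← mul_assoc,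
        X.mem_comm hv hC hBp, sub_self]
    rw [hstep, h1, mul_add, Matrix.trace_add, h2, ih (mul_mem hU hB), mul_add, mul_add,
      Matrix.trace_add, h3, add_zero, Polynomial.derivative_mul (f := p), Polynomial.derivative_X, mul_one, map_add,
      map_mul, Polynomial.aeval_X, add_mul, mul_add, Matrix.trace_add,
      X.mem_comm hv hU hB, X.mem_comm hv (X.aeval_mem hv hU _) hU]
    simp only [mul_assoc]

lemma exists_regularAt (hX : X.Semisimple) (c : Calibration X) {D : Set (Fin n → ℂ)} (hD : IsOpen D)
    (hDM : D ⊆ X.M) (hne : D.Nonempty) : ∃ v ∈ D, X.RegularAt v := by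
  set S : Set ℕ := (fun v => (minpoly ℂ (X.U v)).natDegree) '' D
  have hbdd : BddAbove S := by
    refine ⟨n, ?_⟩
    rintro _ ⟨v, _, rfl⟩
    have := Polynomial.natDegree_le_of_dvd (Matrix.minpoly_dvd_charpoly (X.U v))
      (Matrix.charpoly_monic _).ne_zero
    rwa [Matrix.charpoly_natDegree_eq_dim, Fintype.card_fin] at this
  obtain ⟨v₁, hv₁, hm⟩ := Nat.sSup_mem (hne.image _ : S.Nonempty) hbdd
  set m := sSup S with hmdef
  have hmax : ∀ v ∈ D, (minpoly ℂ (X.U v)).natDegree ≤ m := fun v hv =>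
    le_csSup hbdd ⟨v, hv, rfl⟩
  have hpow : ∀ v ∈ D, ContinuousAt (fun u => fun i : Fin m => X.U u ^ (i : ℕ)) v := by
    intro v hv
    refine continuousAt_pi.2 fun i => ?_
    have : ContinuousAt (fun u => X.U u) v :=
      continuousAt_pi.2 fun α => continuousAt_pi.2 fun β => (X.analyticAt_U (hDM hv) α β).continuousAt
    exact this.pow _
  have hev : ∀ᶠ v in 𝓝 v₁, LinearIndependent ℂ (fun i : Fin m => X.U v ^ (i : ℕ)) := by
    refine (hpow v₁ hv₁).eventually ((isOpen_linearIndependent_matrix m).mem_nhds ?_)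
    have := linearIndependent_pow (K := ℂ) (X.U v₁)
    simp only at hm
    rw [hm] at this
    exact this
  obtain ⟨v, ⟨hli, hvD⟩, hvM, hss⟩ :=
    mem_closure_iff_nhds.1 (hX (hDM hv₁)) _ (Filter.inter_mem hev (hD.mem_nhds hv₁))
  refine ⟨v, hvD, hvM, ?_, ⟨_, hss.nodal hvM (X.U_mem hvM)⟩⟩
  set q := minpoly ℂ (X.U v) with hq
  have hW : ∀ γ, X.pdAeval γ v q ∈ Submodule.span ℂ (Set.range fun i : Fin m => X.U v ^ (i : ℕ)) := by
    intro γ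
    by_contra hnot
    have hlim : LinearIndependent ℂ (Fin.snoc (fun i : Fin m => X.U v ^ (i : ℕ)) (X.pdAeval γ v q) :
        Fin (m + 1) → Matrix (Fin n) (Fin n) ℂ) := linearIndependent_finSnoc.2 ⟨hli, hnot⟩
    set ℓ : ℂ → Fin n → ℂ := fun t => v + t • Pi.single γ 1 with hℓ
    have hℓc : Tendsto ℓ (𝓝[≠] 0) (𝓝 v) := by
      have : ContinuousAt ℓ 0 := by fun_prop
      have h := this.tendsto
      simp only [hℓ, zero_smul, add_zero] at h
      exact h.mono_left nhdsWithin_le_nhds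
    have hQ : Tendsto (fun t => t⁻¹ • Polynomial.aeval (X.U (ℓ t)) q) (𝓝[≠] 0)
        (𝓝 (X.pdAeval γ v q)) := by
      refine tendsto_pi_nhds.2 fun α => tendsto_pi_nhds.2 fun β => ?_
      have hd := (X.analyticAt_aeval_U hvM q α β).differentiableAt.hasFDerivAt
      have hl : HasDerivAt ℓ (Pi.single γ 1) 0 := by
        have := ((hasDerivAt_id (0 : ℂ)).smul_const (Pi.single γ 1 : Fin n → ℂ)).const_add v
        simpa [hℓ] using this
      have hv0 : ℓ 0 = v := by simp [hℓ]
      rw [← hv0] at hd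
      have := (hd.comp_hasDerivAt (0 : ℂ) hl).tendsto_slope_zero
      rw [hv0] at this
      simpa [hv0, hq, minpoly.aeval, pdAeval, pd] using this
    have htend : Tendsto (fun t => (Fin.snoc (fun i : Fin m => X.U (ℓ t) ^ (i : ℕ))
        (t⁻¹ • Polynomial.aeval (X.U (ℓ t)) q) : Fin (m + 1) → Matrix (Fin n) (Fin n) ℂ)) (𝓝[≠] 0)
        (𝓝 (Fin.snoc (fun i : Fin m => X.U v ^ (i : ℕ)) (X.pdAeval γ v q))) := by
      refine tendsto_pi_nhds.2 fun i => ?_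
      refine Fin.lastCases ?_ (fun i => ?_) i
      · simpa only [Fin.snoc_last] using hQ
      · simp only [Fin.snoc_castSucc]
        exact tendsto_pi_nhds.1 ((hpow v hvD).tendsto.comp hℓc) i
    have h1 := htend.eventually ((isOpen_linearIndependent_matrix (m + 1)).mem_nhds hlim)
    obtain ⟨t, ht1, ht2⟩ := (h1.and (hℓc.eventually (hD.mem_nhds hvD))).exists
    exact (linearIndependent_finSnoc.1 ht1).2
      (Submodule.smul_mem _ _ (aeval_mem_span_pow (hmax _ ht2) q))
  have hsep : q.Separable := by
    refine Polynomial.Separable.of_dvd ?_ (minpoly.dvd ℂ _ (hss.nodal hvM (X.U_mem hvM)))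
    rw [Lagrange.nodal_eq]
    exact Polynomial.separable_prod_X_sub_C_iff'.2 (Function.Injective.injOn fun _ _ h => h)
  obtain ⟨a, b, hab⟩ := hsep
  have hU := X.U_mem hvM
  have hbq : Polynomial.aeval (X.U v) b * Polynomial.aeval (X.U v) (Polynomial.derivative q) = 1 := by
    have := congrArg (Polynomial.aeval (X.U v)) hab
    rwa [map_add, map_mul, hq, minpoly.aeval, mul_zero, zero_add, map_mul, map_one] at this
  have hCp : ∀ γ, ∃ p : Polynomial ℂ, X.C γ v = Polynomial.aeval (X.U v) p := by
    intro γ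
    have h1 : ∃ p : Polynomial ℂ, X.pdAeval γ v q = Polynomial.aeval (X.U v) p := by
      refine Submodule.span_induction (p := fun A _ => ∃ p : Polynomial ℂ, A = Polynomial.aeval (X.U v) p)
        ?_ ⟨0, by simp⟩ ?_ ?_ (hW γ)
      · rintro _ ⟨i, rfl⟩; exact ⟨Polynomial.X ^ (i : ℕ), by simp⟩
      · rintro _ _ _ _ ⟨p, rfl⟩ ⟨p', rfl⟩; exact ⟨p + p', by simp⟩
      · rintro a _ _ ⟨p, rfl⟩; exact ⟨a • p, by simp⟩
    obtain ⟨p, hp⟩ := h1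
    have hC := X.C_mem hvM γ
    have h2 : Polynomial.aeval (X.U v) p -
        Polynomial.aeval (X.U v) (Polynomial.derivative q) * X.C γ v = 0 := by
      refine hss.eq_zero_of_trace hvM (sub_mem (X.aeval_mem hvM hU p)
        (mul_mem (X.aeval_mem hvM hU _) hC)) fun B hB => ?_
      rw [mul_sub, Matrix.trace_sub, ← X.trace_mul_pdAeval c hvM γ q hB, hp, sub_self]
    refine ⟨b * p, ?_⟩
    rw [map_mul, sub_eq_zero.1 h2, ← mul_assoc, hbq, one_mul]
  choose p hp using hCp
  intro y
  refine ⟨∑ γ, Polynomial.C (y γ) * p γ, ?_⟩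
  simp only [mulBy, hp, map_sum, map_mul, Polynomial.aeval_C, Algebra.algebraMap_eq_smul_one,
    smul_mul_assoc, one_mul]

end FrobeniusManifold

variable {O : Set (Jet n)}

/-- The jets at which the leading poles of the loop equation can be compared. -/
def IsRegularJet (X : FrobeniusManifold n) (j : Jet n) : Prop :=
  X.RegularAt (j 0) ∧ IsUnit (X.mulBy (j 1) (j 0)).det

lemma exists_isRegularJet (hX : X.Semisimple) (c : Calibration X) (hO : IsOpen O)
    (hM : ∀ j ∈ O, j 0 ∈ X.M) (hne : O.Nonempty) : ∃ j ∈ O, IsRegularJet X j := by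
  obtain ⟨j, hj⟩ := hne
  obtain ⟨v, hv, hreg⟩ := X.exists_regularAt hX c (D := (fun v => Function.update j 0 v) ⁻¹' O)
    (hO.preimage (by fun_prop)) (fun v hv => by simpa using hM _ hv) ⟨j 0, by simpa using hj⟩
  set j' := Function.update j 0 v with hj'
  have hj'0 : j' 0 = v := by simp [hj']
  set A := X.mulBy (j' 1) v with hA
  have hcont : Continuous fun t : ℂ => Function.update j' 1 (j' 1 + t • FrobeniusManifold.e) := by
    fun_prop
  have hnhd : (fun t : ℂ => Function.update j' 1 (j' 1 + t • FrobeniusManifold.e)) ⁻¹' O ∈ 𝓝 0 :=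
    (hO.preimage hcont).mem_nhds (by simpa using hv)
  obtain ⟨t, ht, htr⟩ := (infinite_of_mem_nhds 0 hnhd).exists_notMem_finset
    ((-A).charpoly.roots.toFinset)
  refine ⟨Function.update j' 1 (j' 1 + t • FrobeniusManifold.e), ht, ?_⟩
  have h0 : Function.update j' 1 (j' 1 + t • FrobeniusManifold.e) 0 = v := by simp [hj'0]
  refine ⟨by rw [h0]; exact hreg, ?_⟩
  rw [h0, Function.update_self, X.mulBy_add, X.mulBy_smul, X.mulBy_e hreg.mem]
  rw [Multiset.mem_toFinset, Polynomial.mem_roots (Matrix.charpoly_monic _).ne_zero,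
    Polynomial.IsRoot.def, Matrix.eval_charpoly] at htr
  refine isUnit_iff_ne_zero.2 ?_
  convert htr using 2
  rw [sub_neg_eq_add, add_comm, Matrix.smul_one_eq_diagonal]
  rfl

lemma eq_zero_of_isRegularJet (hX : X.Semisimple) (c : Calibration X) (hO : IsOpen O)
    (hM : ∀ j ∈ O, j 0 ∈ X.M) {Φ : Jet n → ℂ} (hΦ : JetAnalyticOn O Φ)
    (h : ∀ j ∈ O, IsRegularJet X j → Φ j = 0) : ∀ j ∈ O, Φ j = 0 := by
  intro j hj
  by_contra hne
  have hcont : ContinuousAt Φ j := by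
    obtain ⟨N, G, hG, hev⟩ := hΦ j hj
    refine ContinuousAt.congr ?_ (hev.mono fun _ h => h.symm)
    have hc : Continuous fun (j : Jet n) (i : Fin (N + 1)) => j i :=
      continuous_pi fun i => continuous_apply (i : ℕ)
    exact ContinuousAt.comp (f := fun (j : Jet n) (i : Fin (N + 1)) => j i) hG.continuousAt
      hc.continuousAt
  obtain ⟨O', hO'sub, hO', hjO'⟩ := mem_nhds_iff.1
    (Filter.inter_mem (hcont.eventually_ne hne) (hO.mem_nhds hj))
  obtain ⟨j', hj', hreg⟩ := exists_isRegularJet hX c hO' (fun j hj => hM j (hO'sub hj).2) ⟨j, hjO'⟩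
  exact (hO'sub hj').1 (h j' (hO'sub hj').2 hreg)

end

/-! ### The Virasoro constraints at the resolvent -/

section

variable {n : ℕ} [NeZero n] {X : FrobeniusManifold n} {O : Set (Jet n)}

lemma transfer_resX (c : Calibration X) {v : Fin n → ℂ} (hv : v ∈ X.M) {K : ℕ}
    (Λ : Tensor n →ₗ[ℂ] ℂ) (hΛ : ∀ T : Tensor n, (∀ i k, i + k < K → T i k = 0) → Λ T = 0)
    (h : ∀ m < n * K, Λ (c.virTensor m v) = 0) {lam : ℂ}
    (hlam : (lam • 1 - X.U v).det ≠ 0) : Λ (resX X lam v) = 0 := by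
  refine transfer (X.U v) X.V (Λ.comp (toTensor X)) K (fun T hT => ?_) (fun m hm => ?_) lam hlam
  · exact hΛ _ fun i k hik => by simp [toTensor, hT (i + k) hik]
  · rw [LinearMap.comp_apply, ← c.virTensor_eq hv]
    exact h m hm

/-- An equation between forms that holds at the tensors of the Virasoro symmetries holds at the
resolvent. -/
lemma ev_resX_eq_zero (c : Calibration X) {j : Jet n} (hj : j 0 ∈ X.M) {K : ℕ} (f : Form n)
    (h : ∀ m < n * (2 * K), Form.ev K f (c.virTensor m (j 0)) j = 0) {lam : ℂ}
    (hlam : (lam • 1 - X.U (j 0)).det ≠ 0) : Form.ev K f (resX X lam (j 0)) j = 0 := by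
  exact transfer_resX c hj (Form.evL K f j) (K := 2 * K) (fun T hT => Form.ev_eq_zero f j
    fun i hi k hk => hT i k (by omega)) h hlam

/-- The homogeneous equation has only constant solutions. -/
lemma jd_eq_zero_of_lhsForm (hX : X.Semisimple) (c : Calibration X) (hO : IsOpen O)
    (hM : ∀ j ∈ O, j 0 ∈ X.M) {Φ : Jet n → ℂ} {N K : ℕ} (hN : ∀ j ∈ O, JetAnalyticAt N Φ j)
    (hK : N < K) (h : ∀ j ∈ O, ∀ lam, (lam • 1 - X.U (j 0)).det ≠ 0 →
      Form.ev K (lhsForm X N Φ) (resX X lam (j 0)) j = 0) :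
    ∀ j ∈ O, ∀ γ r, jd γ r Φ j = 0 := by
  intro j hj γ r
  rcases lt_or_ge N r with hr | hr
  · exact (hN j hj).jd_eq_zero γ hr
  · refine eq_zero_of_isRegularJet hX c hO hM (JetAnalyticOn.jd (fun j hj => ⟨N, hN j hj⟩) γ r)
      (fun j hj hreg => ?_) j hj
    exact congrFun (eq_zero_of_poles c hreg.1 hreg.2 (A := 0) hK (fun r γ => jd γ r Φ j) _
      (fun i k _ σ τ => rfl) (fun _ => 0) (h j hj) (fun s _ u _ => by simp) r (Nat.zero_le r) hr) γ

end

namespace Calibration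

variable {n : ℕ} [NeZero n] {X : FrobeniusManifold n} (c : Calibration X) {F : ℕ → Jet n → ℂ}
  {j₀ : Jet n}

lemma exists_nhd_order (hj₀ : j₀ 0 ∈ X.M) (hF : ∀ k, 0 < k → ∃ N, JetAnalyticAt N (F k) j₀) (k : ℕ) :
    ∃ N, ∀ᶠ j in 𝓝 j₀, j 0 ∈ X.M ∧ ∀ i, 0 < i → i ≤ k → JetAnalyticAt N (F i) j := by
  choose! N hN using hF
  refine ⟨(Finset.Icc 1 k).sup N, ?_⟩
  have h1 : ∀ᶠ j : Jet n in 𝓝 j₀, j 0 ∈ X.M :=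
    (continuous_apply 0).continuousAt.eventually (X.isOpen.mem_nhds hj₀)
  have h2 : ∀ᶠ j : Jet n in 𝓝 j₀, ∀ i ∈ Finset.Icc 1 k, JetAnalyticAt (N i) (F i) j := by
    rw [Filter.eventually_all_finset]
    intro i hi
    exact (hN i (mem_Icc.1 hi).1).eventually
  filter_upwards [h1, h2] with j h1 h2
  refine ⟨h1, fun i h0 hi => ?_⟩
  have := mem_Icc.2 ⟨h0, hi⟩
  exact (h2 i this).mono (Finset.le_sup this)

lemma sum_virA_tm_of_odd (hO : IsOpen O) (hM : ∀ j ∈ O, j 0 ∈ X.M) {N K k : ℕ} (hk : Odd k)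
    (hN : ∀ i, 0 < i → i ≤ k → ∀ j ∈ O, JetAnalyticAt N (F i) j) (hK : N + 2 < K)
    (hodd : ∀ i, Odd i → i < k → ∀ j ∈ O, ∀ γ r, jd γ r (F i) j = 0) (m : ℕ) :
    ∀ j ∈ O, ∑ x ∈ lowTimes n m ×ˢ lowTimes n m, c.virA m x.1 x.2 * c.tm F [x.1, x.2] k 0 j = 0 := by
  intro j hj
  have hprev : ∀ j ∈ O, ∀ γ r, jd γ r (prevF F k) j = 0 := by
    intro j hj γ r
    unfold prevF
    split_ifs with h
    · exact hodd (k - 2) (by obtain ⟨t, rfl⟩ := hk; exact ⟨t - 1, by omega⟩) (by omega) j hj γ r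
    · exact jd_const 0 γ r
  rw [c.sum_virA_tm hO hM hk.pos hN hK m j hj, if_neg (by rintro rfl; exact absurd hk (by decide)),
    ev_quadForm, ev_linForm]
  have h2 : ∀ γ r ρ s, quadCoeff F k γ r ρ s j = 0 := by
    intro γ r ρ s
    rw [quadCoeff, jd_congr hO (fun j hj => hprev j hj ρ s) γ r j hj, jd_const, zero_add]
    refine sum_eq_zero fun i hi => ?_
    have hi := mem_Icc.1 hi
    rcases Nat.even_or_odd i with he | ho
    · rw [hodd (k - i) (Nat.Odd.sub_even (by omega) hk he) (by omega) j hj, mul_zero]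
    · rw [hodd i ho (by omega) j hj, zero_mul]
  simp [h2, hprev j hj]

/-- If `F_i` is constant for odd `i < k`, and the Virasoro constraints hold in the odd order `k`,
then `F_k` is constant. -/
lemma eventually_jd_eq_zero_of_odd (hX : X.Semisimple) (hj₀ : j₀ 0 ∈ X.M)
    (hF : ∀ k, 0 < k → ∃ N, JetAnalyticAt N (F k) j₀) {k : ℕ} (hk : Odd k)
    (hodd : ∀ i, Odd i → i < k → ∀ᶠ j in 𝓝 j₀, ∀ γ r, jd γ r (F i) j = 0)
    (h : ∀ m, ∀ᶠ j in 𝓝 j₀, ∑ x ∈ lowTimes n m ×ˢ lowTimes n m,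
      c.virA m x.1 x.2 * c.tm F [x.1, x.2] k 0 j = c.virTau F m ((k : ℤ) - 2) 0 0 j) :
    ∀ᶠ j in 𝓝 j₀, ∀ γ r, jd γ r (F k) j = 0 := by
  obtain ⟨N, hN⟩ := exists_nhd_order hj₀ hF k
  have h1 : ∀ᶠ j in 𝓝 j₀, ∀ i ∈ Finset.range k, Odd i → ∀ γ r, jd γ r (F i) j = 0 := by
    rw [Filter.eventually_all_finset]
    intro i hi
    by_cases ho : Odd i
    · filter_upwards [hodd i ho (mem_range.1 hi)] with j hj _ using hj
    · simp [ho]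
  have h2 : ∀ᶠ j in 𝓝 j₀, ∀ m ∈ Finset.range (n * (2 * (N + 3))),
      ∑ x ∈ lowTimes n m ×ˢ lowTimes n m, c.virA m x.1 x.2 * c.tm F [x.1, x.2] k 0 j =
        c.virTau F m ((k : ℤ) - 2) 0 0 j := by
    rw [Filter.eventually_all_finset]
    exact fun m _ => h m
  obtain ⟨O, hOsub, hO, hj⟩ := eventually_nhds_iff.1 (hN.and (h1.and h2))
  have hM : ∀ j ∈ O, j 0 ∈ X.M := fun j hj => (hOsub j hj).1.1
  have hA : ∀ i, 0 < i → i ≤ k → ∀ j ∈ O, JetAnalyticAt N (F i) j := fun i h0 hi j hj =>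
    (hOsub j hj).1.2 i h0 hi
  refine eventually_of_isOpen hO hj (jd_eq_zero_of_lhsForm hX c hO hM (hA k hk.pos le_rfl)
    (K := N + 3) (by omega) fun j hj lam hlam => ev_resX_eq_zero c (hM j hj) _ (fun m hm => ?_) hlam)
  rw [← c.virTau_zero hO hM hk.pos (hA k hk.pos le_rfl) (by omega) m j hj,
    ← (hOsub j hj).2.2 m (mem_range.2 hm)]
  exact c.sum_virA_tm_of_odd hO hM hk hA (K := N + 3) (by omega)
    (fun i ho hi j hj => (hOsub j hj).2.1 i (mem_range.2 hi) ho) m j hj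

lemma Dt_eq_zero {Φ : Jet n → ℂ} {j : Jet n} (h : ∀ γ r, jd γ r Φ j = 0) (a : Time n) :
    c.Dt a Φ j = 0 := by
  simp [Dt, evD, h]

lemma eventually_jd_one (hX : X.Semisimple) (hj₀ : j₀ 0 ∈ X.M)
    (hF : ∀ k, 0 < k → ∃ N, JetAnalyticAt N (F k) j₀) (hlin : c.LinearizesVirasoro F j₀) :
    ∀ᶠ j in 𝓝 j₀, ∀ γ r, jd γ r (F 1) j = 0 := by
  refine c.eventually_jd_eq_zero_of_odd hX hj₀ hF odd_one (fun i hi h => ?_) fun m => ?_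
  · obtain rfl : i = 0 := by omega
    exact absurd hi (by decide)
  · obtain ⟨S, q, κ, hS, h⟩ := c.virasoro_reduced hj₀ hF hlin m
    filter_upwards [h 1 le_rfl] with j hj
    have h1 := hj 0
    rw [if_neg (by omega), add_zero, sum_eq_zero (s := S) fun J hJ => ?_, add_zero] at h1
    · exact h1
    · obtain ⟨b, rfl⟩ := List.length_eq_one_iff.1 (hS J hJ)
      rw [tm_singleton]
      simp [logD]

/-- The Virasoro operators have no terms of first order with constant coefficients. -/
theorem virasoro_constraints (hX : X.Semisimple) (hj₀ : j₀ 0 ∈ X.M)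
    (hF : ∀ k, 0 < k → ∃ N, JetAnalyticAt N (F k) j₀) (hlin : c.LinearizesVirasoro F j₀) (m : ℕ) :
    ∃ κ : ℂ, ∀ k : ℕ, 1 ≤ k → ∀ᶠ j in 𝓝 j₀,
      ∑ x ∈ lowTimes n m ×ˢ lowTimes n m, c.virA m x.1 x.2 * c.tm F [x.1, x.2] k 0 j +
        (if k = 2 then κ else 0) = c.virTau F m ((k : ℤ) - 2) 0 0 j := by
  obtain ⟨S, q, κ, hS, h⟩ := c.virasoro_reduced hj₀ hF hlin m
  have hlinear : ∀ φ : Time n → ℂ, ∑ J ∈ S, q J * (J.map φ).prod = 0 := by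
    intro φ
    obtain ⟨j, hj, hj1⟩ := ((h 1 le_rfl).and (c.eventually_jd_one hX hj₀ hF hlin)).exists
    have h1 := hj φ
    rw [if_neg (by omega), add_zero, virTau, if_neg (by omega), if_pos (by omega),
      show (((1 : ℕ) : ℤ) - 2 + 2).toNat = 1 by omega] at h1
    simp only [hj1, zero_mul, Finset.sum_const_zero, finsum_zero] at h1
    rw [sum_eq_zero (s := lowTimes n m ×ˢ lowTimes n m), zero_add] at h1
    · rw [← h1]
      exact sum_congr rfl fun J _ => by rw [Nat.sub_self, tm_zero]
    · intro x _
      rw [tm_cons, if_neg (by omega), zero_add]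
      simp only [tm_singleton, Finset.Nat.antidiagonal_succ, Finset.Nat.antidiagonal_zero]
      simp [logD, c.Dt_eq_zero hj1]
  refine ⟨κ, fun k hk => ?_⟩
  filter_upwards [h k hk] with j hj
  suffices hz : ∑ J ∈ S, q J * c.tm F J (k - 1) 0 j = 0 by rw [← hj 0, hz, add_zero]
  rcases Nat.eq_or_lt_of_le hk with rfl | hk
  · refine sum_eq_zero fun J hJ => ?_
    obtain ⟨b, rfl⟩ := List.length_eq_one_iff.1 (hS J hJ)
    rw [tm_singleton]
    simp [logD]
  · rw [← hlinear fun b => c.Dt b (F (k - 1)) j]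
    refine sum_congr rfl fun J hJ => ?_
    obtain ⟨b, rfl⟩ := List.length_eq_one_iff.1 (hS J hJ)
    rw [tm_singleton, logD, if_neg (by omega)]
    simp

lemma eventually_jd_odd (hX : X.Semisimple) (hj₀ : j₀ 0 ∈ X.M)
    (hF : ∀ k, 0 < k → ∃ N, JetAnalyticAt N (F k) j₀) (hlin : c.LinearizesVirasoro F j₀) {k : ℕ}
    (hk : Odd k) : ∀ᶠ j in 𝓝 j₀, ∀ γ r, jd γ r (F k) j = 0 := by
  induction k using Nat.strong_induction_on with
  | _ k ih =>
    refine c.eventually_jd_eq_zero_of_odd hX hj₀ hF hk (fun i ho hi => ih i hi ho) fun m => ?_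
    obtain ⟨κ, h⟩ := c.virasoro_constraints hX hj₀ hF hlin m
    filter_upwards [h k hk.pos] with j hj
    rwa [if_neg (by rintro rfl; exact absurd hk (by decide)), add_zero] at hj

lemma quadCoeff_two_mul {g : ℕ} (hg : 2 ≤ g) {j : Jet n}
    (hodd : ∀ i, Odd i → i < 2 * g → ∀ γ r, jd γ r (F i) j = 0) (γ : Fin n) (r : ℕ) (ρ : Fin n) (s : ℕ) :
    quadCoeff F (2 * g) γ r ρ s j = genusQuad (fun g => F (2 * g)) g γ r ρ s j := by
  unfold quadCoeff genusQuad prevF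
  rw [if_pos (by omega), show 2 * g - 2 = 2 * (g - 1) by omega]
  congr 1
  symm
  refine Finset.sum_of_injOn (fun h => 2 * h) (fun a _ b _ h => by simpa using h) ?_ ?_ ?_
  · intro h hh
    have := mem_Icc.1 (Finset.mem_coe.1 hh)
    exact Finset.mem_coe.2 (mem_Icc.2 (by constructor <;> simp only <;> omega))
  · intro i hi hni
    have hi := mem_Icc.1 hi
    rcases Nat.even_or_odd i with he | ho
    · obtain ⟨h, rfl⟩ := he
      exact absurd ⟨h, Finset.mem_coe.2 (mem_Icc.2 (by constructor <;> omega)), by simp only; omega⟩ hni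
    · rw [hodd i ho (by omega), zero_mul]
  · intro h _
    simp only [Nat.mul_sub]

/-- The loop equation in genus `g ≥ 2`, at the resolvent. -/
theorem eventually_genus_eq (hX : X.Semisimple) (hj₀ : j₀ 0 ∈ X.M)
    (hF : ∀ k, 0 < k → ∃ N, JetAnalyticAt N (F k) j₀) (hlin : c.LinearizesVirasoro F j₀) {g : ℕ}
    (hg : 2 ≤ g) : ∃ N, (∀ᶠ j in 𝓝 j₀, ∀ h, 0 < h → h ≤ g → JetAnalyticAt N (F (2 * h)) j) ∧
      ∀ᶠ j in 𝓝 j₀, ∀ lam, (lam • 1 - X.U (j 0)).det ≠ 0 →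
        Form.ev (N + 3) (lhsForm X N (F (2 * g))) (resX X lam (j 0)) j =
          Form.ev (N + 3) (rhsForm X N (fun g => F (2 * g)) g) (resX X lam (j 0)) j := by
  obtain ⟨N, hN⟩ := exists_nhd_order hj₀ hF (2 * g)
  refine ⟨N, hN.mono fun j hj h h0 hh => hj.2 (2 * h) (by omega) (by omega), ?_⟩
  have h1 : ∀ᶠ j in 𝓝 j₀, ∀ i ∈ Finset.range (2 * g), Odd i → ∀ γ r, jd γ r (F i) j = 0 := by
    rw [Filter.eventually_all_finset]
    intro i hi
    by_cases ho : Odd i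
    · filter_upwards [c.eventually_jd_odd hX hj₀ hF hlin ho] with j hj _ using hj
    · simp [ho]
  have h2 : ∀ᶠ j in 𝓝 j₀, ∀ m ∈ Finset.range (n * (2 * (N + 3))),
      ∑ x ∈ lowTimes n m ×ˢ lowTimes n m, c.virA m x.1 x.2 * c.tm F [x.1, x.2] (2 * g) 0 j =
        c.virTau F m (((2 * g : ℕ) : ℤ) - 2) 0 0 j := by
    rw [Filter.eventually_all_finset]
    intro m _
    obtain ⟨κ, h⟩ := c.virasoro_constraints hX hj₀ hF hlin m
    filter_upwards [h (2 * g) (by omega)] with j hj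
    rwa [if_neg (by omega), add_zero] at hj
  obtain ⟨O, hOsub, hO, hj⟩ := eventually_nhds_iff.1 (hN.and (h1.and h2))
  have hM : ∀ j ∈ O, j 0 ∈ X.M := fun j hj => (hOsub j hj).1.1
  have hA : ∀ i, 0 < i → i ≤ 2 * g → ∀ j ∈ O, JetAnalyticAt N (F i) j := fun i h0 hi j hj =>
    (hOsub j hj).1.2 i h0 hi
  refine eventually_of_isOpen hO hj fun j hj lam hlam => ?_
  have hrhs : ∀ T, Form.ev (N + 3) (rhsForm X N (fun g => F (2 * g)) g) T j =
      (1 / 2) * Form.ev (N + 3) (quadForm X N (quadCoeff F (2 * g))) T j +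
        (1 / 2) * Form.ev (N + 3) (linForm X N (prevF F (2 * g))) T j := by
    intro T
    unfold rhsForm
    rw [Form.ev_add_left, Form.ev_mul_left _ (fun _ => 1 / 2), Form.ev_mul_left _ (fun _ => 1 / 2)]
    have e1 : prevF F (2 * g) = F (2 * (g - 1)) := by
      unfold prevF
      rw [if_pos (by omega), show 2 * g - 2 = 2 * (g - 1) by omega]
    rw [e1, ev_quadForm, ev_quadForm]
    simp only [quadCoeff_two_mul hg fun i ho hi => (hOsub j hj).2.1 i (mem_range.2 hi) ho]
  have key := ev_resX_eq_zero c (hM j hj) (K := N + 3) (fun i k σ τ j =>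
    lhsForm X N (F (2 * g)) i k σ τ j + (-1) * rhsForm X N (fun g => F (2 * g)) g i k σ τ j)
    (fun m hm => ?_) hlam
  · rw [Form.ev_add_left, Form.ev_mul_left _ (fun _ => -1)] at key
    linear_combination key
  · rw [Form.ev_add_left, Form.ev_mul_left _ (fun _ => -1), hrhs,
      ← c.virTau_zero hO hM (by omega) (hA _ (by omega) le_rfl) (by omega) m j hj,
      ← (hOsub j hj).2.2 m (mem_range.2 hm),
      c.sum_virA_tm hO hM (by omega) hA (K := N + 3) (by omega) m j hj,
      if_neg (by omega)]
    ring

end Calibration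

/-! ### Calculus of matrix valued functions, derivatives of the resolvent -/

section

variable {n : ℕ} {A B : (Fin n → ℂ) → Matrix (Fin n) (Fin n) ℂ} {v : Fin n → ℂ}

/-- A matrix valued function is analytic at a point. -/
def MatAnalyticAt (A : (Fin n → ℂ) → Matrix (Fin n) (Fin n) ℂ) (v : Fin n → ℂ) : Prop :=
  ∀ α β, AnalyticAt ℂ (fun u => A u α β) v

/-- The partial derivative of a matrix valued function. -/
def pdM (γ : Fin n) (A : (Fin n → ℂ) → Matrix (Fin n) (Fin n) ℂ) (v : Fin n → ℂ) :
    Matrix (Fin n) (Fin n) ℂ := Matrix.of fun α β => pd γ (fun u => A u α β) v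

namespace MatAnalyticAt

lemma const (M : Matrix (Fin n) (Fin n) ℂ) : MatAnalyticAt (fun _ => M) v :=
  fun _ _ => analyticAt_const

lemma sub (hA : MatAnalyticAt A v) (hB : MatAnalyticAt B v) : MatAnalyticAt (fun u => A u - B u) v :=
  fun α β => (hA α β).sub (hB α β)

lemma mul (hA : MatAnalyticAt A v) (hB : MatAnalyticAt B v) :
    MatAnalyticAt (fun u => A u * B u) v := fun α β => by
  simp only [Matrix.mul_apply]
  exact analyticAt_fun_sum _ fun σ _ => (hA α σ).mul (hB σ β)

lemma smul (a : ℂ) (hA : MatAnalyticAt A v) : MatAnalyticAt (fun u => a • A u) v :=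
  fun α β => analyticAt_const.mul (hA α β)

lemma trace (hA : MatAnalyticAt A v) : AnalyticAt ℂ (fun u => (A u).trace) v :=
  analyticAt_fun_sum _ fun α _ => hA α α

lemma det (hA : MatAnalyticAt A v) : AnalyticAt ℂ (fun u => (A u).det) v := by
  simp only [Matrix.det_apply']
  exact analyticAt_fun_sum _ fun p _ => analyticAt_const.mul
    (Finset.analyticAt_fun_prod _ fun i _ => hA _ _)

lemma inv (hA : MatAnalyticAt A v) (h : (A v).det ≠ 0) : MatAnalyticAt (fun u => (A u)⁻¹) v := by
  intro α β
  simp only [Matrix.inv_def, Ring.inverse_eq_inv', Matrix.smul_apply, smul_eq_mul,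
    Matrix.adjugate_apply]
  refine (hA.det.inv h).mul (MatAnalyticAt.det fun i k => ?_)
  by_cases hi : i = β
  · subst hi; simp only [Matrix.updateRow_self]; exact analyticAt_const
  · simp only [Matrix.updateRow_ne hi]; exact hA i k

end MatAnalyticAt

lemma pdM_mul (hA : MatAnalyticAt A v) (hB : MatAnalyticAt B v) (γ : Fin n) :
    pdM γ (fun u => A u * B u) v = pdM γ A v * B v + A v * pdM γ B v := by
  ext α β
  simp only [pdM, Matrix.of_apply, Matrix.mul_apply, Matrix.add_apply]
  rw [← sum_add_distrib]
  refine (pd_sum _ (fun σ _ => (hA α σ).mul (hB σ β)) γ).trans ?_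
  exact sum_congr rfl fun σ _ => pd_mul (hA α σ) (hB σ β) γ

lemma pdM_add (hA : MatAnalyticAt A v) (hB : MatAnalyticAt B v) (γ : Fin n) :
    pdM γ (fun u => A u + B u) v = pdM γ A v + pdM γ B v := by
  ext α β
  exact pd_add (hA α β) (hB α β) γ

lemma pdM_const (M : Matrix (Fin n) (Fin n) ℂ) (γ : Fin n) : pdM γ (fun _ => M) v = 0 := by
  ext α β
  exact pd_const _ _ _

lemma pdM_smul (a : ℂ) (hA : MatAnalyticAt A v) (γ : Fin n) :
    pdM γ (fun u => a • A u) v = a • pdM γ A v := by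
  ext α β
  exact pd_const_mul a (hA α β) γ

lemma pdM_congr (h : ∀ᶠ u in 𝓝 v, A u = B u) (γ : Fin n) : pdM γ A v = pdM γ B v := by
  ext α β
  exact pd_congr_nhds (h.mono fun u hu => by rw [hu]) γ

lemma pd_trace (hA : MatAnalyticAt A v) (γ : Fin n) :
    pd γ (fun u => (A u).trace) v = (pdM γ A v).trace :=
  pd_sum _ (fun α _ => hA α α) γ

lemma pdM_inv (hA : MatAnalyticAt A v) (h : (A v).det ≠ 0) (γ : Fin n) :
    pdM γ (fun u => (A u)⁻¹) v = -((A v)⁻¹ * pdM γ A v * (A v)⁻¹) := by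
  have hev : ∀ᶠ u in 𝓝 v, (A u)⁻¹ * A u = 1 :=
    (hA.det.continuousAt.eventually_ne h).mono fun u hu =>
      Matrix.nonsing_inv_mul _ (isUnit_iff_ne_zero.2 hu)
  have h1 := pdM_congr hev γ
  rw [pdM_const, pdM_mul (hA.inv h) hA] at h1
  have h2 := congrArg (· * (A v)⁻¹) (eq_neg_of_add_eq_zero_left h1)
  simp only [mul_assoc, neg_mul] at h2
  rw [Matrix.mul_nonsing_inv _ (isUnit_iff_ne_zero.2 h), mul_one] at h2
  rw [h2, mul_assoc]

end

section

variable {n : ℕ} [NeZero n] {X : FrobeniusManifold n} {v : Fin n → ℂ} {lam : ℂ}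

lemma matAnalyticAt_U (hv : v ∈ X.M) : MatAnalyticAt X.U v := X.analyticAt_U hv

lemma Calibration.pdM_U (c : Calibration X) (hv : v ∈ X.M) (γ : Fin n) :
    pdM γ X.U v = X.C γ v + (X.C γ v * X.V - X.V * X.C γ v) := by
  ext α β
  exact c.pd_U hv γ α β

lemma matAnalyticAt_res (hv : v ∈ X.M) (hlam : (lam • 1 - X.U v).det ≠ 0) :
    MatAnalyticAt (fun u => (lam • 1 - X.U u)⁻¹) v :=
  ((MatAnalyticAt.const _).sub (matAnalyticAt_U hv)).inv hlam

lemma matAnalyticAt_resTensor (hv : v ∈ X.M) (hlam : (lam • 1 - X.U v).det ≠ 0) (a k : ℕ) :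
    MatAnalyticAt (fun u => resTensor (X.U u) X.V lam a k) v := by
  induction a with
  | zero => exact matAnalyticAt_res hv hlam
  | succ a ih => exact (matAnalyticAt_res hv hlam).mul ((MatAnalyticAt.const _).mul ih)

lemma matAnalyticAt_resX (hv : v ∈ X.M) (hlam : (lam • 1 - X.U v).det ≠ 0) (i k : ℕ) :
    MatAnalyticAt (fun u => resX X lam u i k) v :=
  ((matAnalyticAt_resTensor hv hlam (i + k) k).mul (.const _)).smul _

lemma Calibration.pdM_res (c : Calibration X) (hv : v ∈ X.M) (hlam : (lam • 1 - X.U v).det ≠ 0)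
    (γ : Fin n) : pdM γ (fun u => (lam • 1 - X.U u)⁻¹) v = (lam • 1 - X.U v)⁻¹ *
      (X.C γ v + (X.C γ v * X.V - X.V * X.C γ v)) * (lam • 1 - X.U v)⁻¹ := by
  have h1 : (fun u => lam • 1 - X.U u) = fun u => lam • 1 + (-1 : ℂ) • X.U u := by
    funext u; rw [neg_one_smul, sub_eq_add_neg]
  have h2 : MatAnalyticAt (fun u => lam • 1 - X.U u) v := (MatAnalyticAt.const _).sub (matAnalyticAt_U hv)
  rw [pdM_inv h2 hlam, h1, pdM_add (.const _) ((matAnalyticAt_U hv).smul _), pdM_const,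
    pdM_smul _ (matAnalyticAt_U hv), c.pdM_U hv, zero_add, neg_one_smul, mul_neg, neg_mul, neg_neg]

lemma Calibration.pdM_zero_res (c : Calibration X) (hv : v ∈ X.M)
    (hlam : (lam • 1 - X.U v).det ≠ 0) : pdM 0 (fun u => (lam • 1 - X.U u)⁻¹) v =
      (lam • 1 - X.U v)⁻¹ * (lam • 1 - X.U v)⁻¹ := by
  rw [c.pdM_res hv hlam, X.C_zero hv, one_mul, mul_one, sub_self, add_zero, mul_one]

lemma Calibration.pdM_zero_resTensor (c : Calibration X) (hv : v ∈ X.M)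
    (hlam : (lam • 1 - X.U v).det ≠ 0) (a k : ℕ) :
    pdM 0 (fun u => resTensor (X.U u) X.V lam a k) v =
      resTensor (X.U v) X.V lam (a + 1) k - resTensor (X.U v) X.V lam (a + 1) (k + 1) := by
  induction a with
  | zero =>
    simp only [resTensor]
    rw [c.pdM_zero_res hv hlam, ← mul_sub, ← sub_mul, add_sub_add_left_eq_sub, ← sub_smul]
    push_cast
    rw [show ((0 : ℂ) + 1 - k - 1 / 2 - (0 + 1 - (k + 1) - 1 / 2)) = 1 by ring, one_smul, one_mul]
  | succ a ih =>
    have hr := matAnalyticAt_resTensor hv hlam a k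
    rw [show (fun u => resTensor (X.U u) X.V lam (a + 1) k) = fun u => (lam • 1 - X.U u)⁻¹ *
      ((X.V + ((a : ℂ) + 1 - k - 1 / 2) • 1) * resTensor (X.U u) X.V lam a k) from rfl,
      pdM_mul (matAnalyticAt_res hv hlam) ((MatAnalyticAt.const _).mul hr), c.pdM_zero_res hv hlam,
      pdM_mul (.const _) hr, pdM_const, zero_mul, zero_add, ih]
    set S := (lam • 1 - X.U v)⁻¹ with hS
    have e1 : resTensor (X.U v) X.V lam (a + 1 + 1) k = S * ((X.V + ((a : ℂ) + 1 - k - 1 / 2) • 1) *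
        resTensor (X.U v) X.V lam (a + 1) k) + S * resTensor (X.U v) X.V lam (a + 1) k := by
      rw [resTensor, ← hS, ← mul_add]
      congr 1
      rw [← add_one_mul, show (((a + 1 : ℕ) : ℂ) + 1 - k - 1 / 2) = ((a : ℂ) + 1 - k - 1 / 2) + 1 by
        push_cast; ring, add_smul, one_smul, add_assoc]
    have e2 : resTensor (X.U v) X.V lam (a + 1 + 1) (k + 1) =
        S * ((X.V + ((a : ℂ) + 1 - k - 1 / 2) • 1) * resTensor (X.U v) X.V lam (a + 1) (k + 1)) := by
      rw [resTensor, ← hS]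
      congr 4
      push_cast; ring
    have e3 : S * S * ((X.V + ((a : ℂ) + 1 - k - 1 / 2) • 1) * resTensor (X.U v) X.V lam a k) =
        S * resTensor (X.U v) X.V lam (a + 1) k := by
      rw [mul_assoc, resTensor]
    rw [e1, e2, e3, mul_sub, mul_sub]
    abel

lemma Calibration.pdM_zero_resX (c : Calibration X) (hv : v ∈ X.M)
    (hlam : (lam • 1 - X.U v).det ≠ 0) (i k : ℕ) :
    pdM 0 (fun u => resX X lam u i k) v = resX X lam v (i + 1) k + resX X lam v i (k + 1) := by
  have h1 := matAnalyticAt_resTensor hv hlam (i + k) k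
  rw [show (fun u => resX X lam u i k) = fun u => (-1 : ℂ) ^ k •
    (resTensor (X.U u) X.V lam (i + k) k * X.η⁻¹) from rfl, pdM_smul _ (h1.mul (.const _)),
    pdM_mul h1 (.const _), pdM_const, mul_zero, add_zero, c.pdM_zero_resTensor hv hlam, sub_mul,
    smul_sub]
  simp only [resX, toTensor, LinearMap.coe_mk, AddHom.coe_mk]
  rw [pow_succ, mul_neg_one, neg_smul, sub_eq_add_neg, show i + 1 + k = i + k + 1 by ring,
    show i + (k + 1) = i + k + 1 by ring]

lemma inv_neg_matrix (A : Matrix (Fin n) (Fin n) ℂ) : (-A)⁻¹ = -A⁻¹ := by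
  by_cases h : IsUnit A.det
  · exact Matrix.inv_eq_right_inv (by rw [neg_mul_neg, Matrix.mul_nonsing_inv _ h])
  · rw [Matrix.nonsing_inv_apply_not_isUnit _ h, Matrix.nonsing_inv_apply_not_isUnit, neg_zero]
    rw [Matrix.det_neg]
    exact fun h' => h ((IsUnit.mul_iff.1 h').2)

lemma loopConst_eq (lam : ℂ) (v : Fin n → ℂ) : loopConst X lam v =
    (1 / 4) * ((lam • 1 - X.U v)⁻¹ * X.V * ((lam • 1 - X.U v)⁻¹ * X.V)).trace -
      (1 / 16) * ((lam • 1 - X.U v)⁻¹ * (lam • 1 - X.U v)⁻¹).trace := by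
  have h : (X.U v - lam • (1 : Matrix (Fin n) (Fin n) ℂ))⁻¹ = -(lam • 1 - X.U v)⁻¹ := by
    rw [← neg_sub, inv_neg_matrix]
  rw [loopConst, h, pow_two, pow_two, neg_mul, neg_mul_neg, neg_mul_neg]

lemma analyticAt_loopConst (hv : v ∈ X.M) (hlam : (lam • 1 - X.U v).det ≠ 0) :
    AnalyticAt ℂ (loopConst X lam) v := by
  have hS := matAnalyticAt_res hv hlam
  have hSV := hS.mul (.const X.V)
  rw [show loopConst X lam = _ from funext (loopConst_eq lam)]
  exact (analyticAt_const.mul (hSV.mul hSV).trace).sub (analyticAt_const.mul (hS.mul hS).trace)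

lemma sum_eta_mul (A : Matrix (Fin n) (Fin n) ℂ) :
    ∑ σ, ∑ τ, X.η σ τ * (A * X.η⁻¹) σ τ = A.trace := by
  have h : A.trace = (A * X.η⁻¹ * X.η).trace := by rw [mul_assoc, X.inv_mul_eta, mul_one]
  rw [h, Matrix.trace]
  refine sum_congr rfl fun σ _ => ?_
  rw [Matrix.diag_apply, Matrix.mul_apply]
  refine sum_congr rfl fun τ _ => ?_
  rw [mul_comm, X.symm.apply σ τ]

lemma Calibration.pd_zero_loopConst (c : Calibration X) (hv : v ∈ X.M)
    (hlam : (lam • 1 - X.U v).det ≠ 0) : pd 0 (loopConst X lam) v =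
      -((1 / 2) * ∑ σ, ∑ τ, X.η σ τ * resX X lam v 1 1 σ τ) := by
  have hS := matAnalyticAt_res hv hlam
  have hSV := hS.mul (.const X.V)
  rw [show loopConst X lam = fun u =>
    (1 / 4) * ((lam • 1 - X.U u)⁻¹ * X.V * ((lam • 1 - X.U u)⁻¹ * X.V)).trace +
      (-(1 / 16)) * ((lam • 1 - X.U u)⁻¹ * (lam • 1 - X.U u)⁻¹).trace from
    funext fun u => by rw [loopConst_eq]; ring]
  refine (pd_add (analyticAt_const.mul (hSV.mul hSV).trace)
    (analyticAt_const.mul (hS.mul hS).trace) 0).trans ?_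
  refine (congrArg₂ (· + ·) (pd_const_mul _ (hSV.mul hSV).trace 0)
    (pd_const_mul _ (hS.mul hS).trace 0)).trans ?_
  rw [pd_trace (hSV.mul hSV),
    pd_trace (hS.mul hS), pdM_mul hSV hSV, pdM_mul hS (.const X.V), pdM_mul hS hS, pdM_const,
    mul_zero, add_zero, c.pdM_zero_res hv hlam]
  have hX11 : resX X lam v 1 1 = -(resTensor (X.U v) X.V lam 2 1 * X.η⁻¹) := by
    simp [resX, toTensor]
  simp only [hX11, Matrix.neg_apply, mul_neg, sum_neg_distrib, sum_eta_mul]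
  simp only [resTensor]
  set S := (lam • 1 - X.U v)⁻¹
  set V := X.V
  rw [show (((1 : ℕ) : ℂ) + 1 - (1 : ℕ) - 1 / 2) = 1 / 2 by push_cast; ring,
    show (((0 : ℕ) : ℂ) + 1 - (1 : ℕ) - 1 / 2) = -(1 / 2) by push_cast; ring]
  have t1 : (S * V * (S * S * V)).trace = (S * S * V * (S * V)).trace := Matrix.trace_mul_comm _ _
  have t2 : (S * (V * (S * (V * S)))).trace = (S * S * V * (S * V)).trace := by
    rw [← mul_assoc, ← mul_assoc, ← mul_assoc, Matrix.trace_mul_comm]; simp only [mul_assoc]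
  have t3 : (S * (V * (S * S))).trace = (S * (S * (V * S))).trace := by
    rw [Matrix.trace_mul_comm S (V * (S * S)), ← mul_assoc S S (V * S),
      Matrix.trace_mul_comm (S * S)]
    simp only [mul_assoc]
  simp only [add_mul, mul_add, smul_mul_assoc, mul_smul_comm, one_mul, Matrix.trace_add,
    Matrix.trace_smul, smul_eq_mul, t1, t2, t3, mul_assoc S S S]
  ring

end

/-! ### Rational functions of the spectral parameter -/

section

open Polynomial

/-- The function is rational, vanishes at infinity, and its poles are zeros of `χ`. -/
def RatAt (χ : ℂ[X]) (f : ℂ → ℂ) : Prop :=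
  (∃ (K : ℕ) (P : ℂ[X]), ∀ z, χ.eval z ≠ 0 → f z * χ.eval z ^ K = P.eval z) ∧
    Tendsto (fun x : ℝ => f x) atTop (𝓝 0)

namespace RatAt

variable {χ : ℂ[X]} {f g : ℂ → ℂ}

lemma zero : RatAt χ fun _ => 0 := ⟨⟨0, 0, by simp⟩, by simp⟩

lemma add (hf : RatAt χ f) (hg : RatAt χ g) : RatAt χ fun z => f z + g z := by
  obtain ⟨⟨K, P, hP⟩, hf'⟩ := hf
  obtain ⟨⟨L, Q, hQ⟩, hg'⟩ := hg
  refine ⟨⟨K + L, P * χ ^ L + Q * χ ^ K, fun z hz => ?_⟩, by simpa using hf'.add hg'⟩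
  simp only [eval_add, eval_mul, eval_pow, ← hP z hz, ← hQ z hz, pow_add]
  ring

lemma mul (hf : RatAt χ f) (hg : RatAt χ g) : RatAt χ fun z => f z * g z := by
  obtain ⟨⟨K, P, hP⟩, hf'⟩ := hf
  obtain ⟨⟨L, Q, hQ⟩, hg'⟩ := hg
  refine ⟨⟨K + L, P * Q, fun z hz => ?_⟩, by simpa using hf'.mul hg'⟩
  simp only [eval_mul, ← hP z hz, ← hQ z hz, pow_add]
  ring

lemma const_mul (a : ℂ) (hf : RatAt χ f) : RatAt χ fun z => a * f z := by
  obtain ⟨⟨K, P, hP⟩, hf'⟩ := hf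
  refine ⟨⟨K, C a * P, fun z hz => ?_⟩, by simpa using hf'.const_mul a⟩
  simp only [eval_mul, eval_C, ← hP z hz, mul_assoc]

lemma sum {ι : Type*} (s : Finset ι) {f : ι → ℂ → ℂ} (h : ∀ i ∈ s, RatAt χ (f i)) :
    RatAt χ fun z => ∑ i ∈ s, f i z := by
  classical
  induction s using Finset.induction_on with
  | empty => simpa using zero
  | insert a s ha ih =>
    simp only [Finset.sum_insert ha]
    exact (h a (Finset.mem_insert_self a s)).add (ih fun i hi => h i (Finset.mem_insert_of_mem hi))

/-- A rational function without poles that vanishes at infinity is zero. -/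
lemma eq_zero {χ' : ℂ[X]} (hcop : IsCoprime χ χ') (hχ : χ ≠ 0) (hf : RatAt χ f) (hg : RatAt χ' g)
    (hinf : {z | χ.eval z ≠ 0 ∧ χ'.eval z ≠ 0 ∧ f z = g z}.Infinite) :
    ∀ z, χ.eval z ≠ 0 → f z = 0 := by
  obtain ⟨⟨K, P, hP⟩, hf'⟩ := hf
  obtain ⟨⟨L, Q, hQ⟩, -⟩ := hg
  have heq : P * χ' ^ L = χ ^ K * Q := by
    refine eq_of_infinite_eval_eq _ _ (hinf.mono fun z hz => ?_)
    rw [Set.mem_ofPred_eq, eval_mul, eval_mul, eval_pow, eval_pow, ← hP z hz.1, ← hQ z hz.2.1,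
      hz.2.2]
    ring
  obtain ⟨R, hR⟩ : χ ^ K ∣ P := (hcop.pow (m := K) (n := L)).dvd_of_dvd_mul_right ⟨Q, heq⟩
  have hfR : ∀ z, χ.eval z ≠ 0 → f z = R.eval z := by
    intro z hz
    have := hP z hz
    rw [hR, eval_mul, eval_pow, mul_comm] at this
    exact mul_left_cancel₀ (pow_ne_zero K hz) this
  have hev : ∀ᶠ x : ℝ in atTop, χ.eval (x : ℂ) ≠ 0 := by
    have hfin : {x : ℝ | χ.eval (x : ℂ) = 0}.Finite := by
      refine Set.Finite.of_injOn (f := fun x : ℝ => (x : ℂ)) (t := (χ.roots.toFinset : Set ℂ))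
        (fun x hx => ?_) (Complex.ofReal_injective.injOn) (Finset.finite_toSet _)
      simpa [hχ] using hx
    obtain ⟨B, hB⟩ := hfin.bddAbove
    filter_upwards [eventually_gt_atTop B] with x hx h0
    exact absurd (hB h0) (not_le.2 hx)
  have hlim : Tendsto (fun x : ℝ => R.eval (x : ℂ)) atTop (𝓝 0) :=
    hf'.congr' (hev.mono fun x hx => hfR x hx)
  have hR0 : R = 0 := by
    rcases le_or_gt R.degree 0 with hd | hd
    · rw [eq_C_of_degree_le_zero hd] at hlim ⊢
      simp only [eval_C] at hlim
      rw [tendsto_nhds_unique tendsto_const_nhds hlim, C_0]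
    · have h1 : Tendsto (fun x : ℝ => ‖(x : ℂ)‖) atTop atTop := by
        simpa using tendsto_abs_atTop_atTop
      exact absurd hlim.norm (not_tendsto_nhds_of_tendsto_atTop (R.tendsto_norm_atTop hd h1) _)
  intro z hz
  rw [hfR z hz, hR0, eval_zero]

end RatAt

end

section

variable {n : ℕ}

lemma ratAt_resolvent (U : Matrix (Fin n) (Fin n) ℂ) (α β : Fin n) :
    RatAt U.charpoly fun z => (z • 1 - U)⁻¹ α β := by
  have hsm : ∀ z : ℂ, z • (1 : Matrix (Fin n) (Fin n) ℂ) - U = Matrix.scalar (Fin n) z - U := by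
    intro z; rw [Matrix.smul_one_eq_diagonal]; rfl
  refine ⟨⟨1, U.charmatrix.adjugate α β, fun z hz => ?_⟩, ?_⟩
  · have h1 : (z • 1 - U).adjugate α β = (U.charmatrix.adjugate α β).eval z := by
      have h2 := RingHom.map_adjugate (Polynomial.evalRingHom z) U.charmatrix
      have h3 : (Polynomial.evalRingHom z).mapMatrix U.charmatrix = z • 1 - U := by
        ext i l
        by_cases hil : i = l
        · subst hil; simp [Matrix.charmatrix_apply_eq]
        · simp [hil]
      rw [h3] at h2
      rw [← h2]; rfl
    rw [Matrix.eval_charpoly, ← hsm] at hz ⊢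
    change (z • 1 - U)⁻¹ α β * _ = _
    rw [pow_one, Matrix.inv_def, Ring.inverse_eq_inv', Matrix.smul_apply, smul_eq_mul, h1]
    field_simp
  · have hc : ContinuousAt (fun t : ℂ => ((1 : Matrix (Fin n) (Fin n) ℂ) - t • U)⁻¹ α β) 0 := by
      simp only [Matrix.inv_def, Ring.inverse_eq_inv', Matrix.smul_apply, smul_eq_mul]
      have h1 : Continuous fun t : ℂ => (1 : Matrix (Fin n) (Fin n) ℂ) - t • U := by fun_prop
      refine ContinuousAt.mul (ContinuousAt.inv₀ h1.matrix_det.continuousAt (by simp)) ?_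
      exact (h1.matrix_adjugate.matrix_elem α β).continuousAt
    have ht : Tendsto (fun x : ℝ => ((x : ℂ))⁻¹) atTop (𝓝 0) := by
      have := (Complex.continuous_ofReal.tendsto 0).comp tendsto_inv_atTop_zero
      refine this.congr fun x => ?_
      simp
    have h2 := ht.mul (hc.tendsto.comp ht)
    rw [zero_mul] at h2
    refine h2.congr' ?_
    have hdet : ∀ᶠ x : ℝ in atTop, ((1 : Matrix (Fin n) (Fin n) ℂ) - (x : ℂ)⁻¹ • U).det ≠ 0 := by
      have h1 : Continuous fun t : ℂ => ((1 : Matrix (Fin n) (Fin n) ℂ) - t • U).det := by fun_prop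
      exact ht.eventually (h1.continuousAt.eventually_ne (by simp))
    filter_upwards [eventually_gt_atTop (0 : ℝ), hdet] with x hx hd
    have hx0 : (x : ℂ) ≠ 0 := by exact_mod_cast hx.ne'
    have e : (x : ℂ) • (1 : Matrix (Fin n) (Fin n) ℂ) - U = (x : ℂ) • (1 - (x : ℂ)⁻¹ • U) := by
      rw [smul_sub, smul_smul, mul_inv_cancel₀ hx0, one_smul]
    have e2 : ((x : ℂ) • (1 : Matrix (Fin n) (Fin n) ℂ) - U)⁻¹ =
        (x : ℂ)⁻¹ • ((1 : Matrix (Fin n) (Fin n) ℂ) - (x : ℂ)⁻¹ • U)⁻¹ := by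
      refine Matrix.inv_eq_right_inv ?_
      rw [e, Matrix.smul_mul, Matrix.mul_smul, smul_smul, mul_inv_cancel₀ hx0, one_smul,
        Matrix.mul_nonsing_inv _ (isUnit_iff_ne_zero.2 hd)]
    rw [e2]
    rfl

lemma ratAt_resTensor (U V : Matrix (Fin n) (Fin n) ℂ) (a k : ℕ) (α β : Fin n) :
    RatAt U.charpoly fun z => resTensor U V z a k α β := by
  induction a generalizing α β with
  | zero => exact ratAt_resolvent U α β
  | succ a ih =>
    simp only [resTensor, Matrix.mul_apply]
    exact .sum _ fun σ _ => (ratAt_resolvent U α σ).mul (.sum _ fun ρ _ => .const_mul _ (ih ρ β))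

variable [NeZero n] (X : FrobeniusManifold n) (v : Fin n → ℂ)

lemma ratAt_resX (i k : ℕ) (α β : Fin n) :
    RatAt (X.U v).charpoly fun z => resX X z v i k α β := by
  simp only [resX, toTensor, LinearMap.coe_mk, AddHom.coe_mk, Matrix.smul_apply, smul_eq_mul,
    Matrix.mul_apply]
  refine .const_mul _ (.sum _ fun σ _ => ?_)
  simp only [mul_comm _ (X.η⁻¹ σ β)]
  exact .const_mul _ (ratAt_resTensor _ _ _ _ _ _)

lemma ratAt_loopConst : RatAt (X.U v).charpoly fun z => loopConst X z v := by
  simp only [loopConst_eq, sub_eq_add_neg, ← neg_mul]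
  have hS := ratAt_resolvent (X.U v)
  have hSV : ∀ α β, RatAt (X.U v).charpoly fun z => ((z • 1 - X.U v)⁻¹ * X.V) α β := by
    intro α β
    simp only [Matrix.mul_apply, mul_comm _ (X.V _ β)]
    exact .sum _ fun σ _ => .const_mul _ (hS α σ)
  have hmul : ∀ {A B : ℂ → Matrix (Fin n) (Fin n) ℂ}, (∀ α β, RatAt (X.U v).charpoly fun z => A z α β) →
      (∀ α β, RatAt (X.U v).charpoly fun z => B z α β) →
      RatAt (X.U v).charpoly fun z => (A z * B z).trace := by
    intro A B hA hB
    simp only [Matrix.trace, Matrix.diag_apply, Matrix.mul_apply]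
    exact .sum _ fun α _ => .sum _ fun σ _ => (hA α σ).mul (hB σ α)
  simp only [← sub_eq_add_neg]
  exact (hmul hSV hSV).const_mul _ |>.add ((hmul hS hS).const_mul _)

end

/-! ### The loop equation in genus one -/

section

variable {n : ℕ}

lemma is_const_of_jd_eq_zero {Φ : Jet n → ℂ} {j : Jet n} {r : ℕ} {γ : Fin n} {ε : ℝ}
    (hA : ∀ z ∈ Metric.ball (j r γ) ε, ∃ N, JetAnalyticAt N Φ (jetUpdate j r γ z))
    (h : ∀ z ∈ Metric.ball (j r γ) ε, jd γ r Φ (jetUpdate j r γ z) = 0) :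
    ∀ z ∈ Metric.ball (j r γ) ε, Φ (jetUpdate j r γ z) = Φ j := by
  intro z hz
  have hup : ∀ z w, jetUpdate (jetUpdate j r γ z) r γ w = jetUpdate j r γ w := by
    intro z w; simp [jetUpdate]
  have hcoord : ∀ z, jetUpdate j r γ z r γ = z := by intro z; simp [jetUpdate]
  have hd : ∀ z ∈ Metric.ball (j r γ) ε, DifferentiableAt ℂ (fun z => Φ (jetUpdate j r γ z)) z := by
    intro z hz
    obtain ⟨N, hN⟩ := hA z hz
    have := hN.differentiableAt γ r
    simpa only [hup, hcoord] using this
  have h0 : Set.EqOn (deriv fun z => Φ (jetUpdate j r γ z)) 0 (Metric.ball (j r γ) ε) := by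
    intro z hz
    have := h z hz
    change deriv (fun w => Φ (jetUpdate (jetUpdate j r γ z) r γ w)) (jetUpdate j r γ z r γ) = 0 at this
    simpa only [hup, hcoord, Pi.zero_apply] using this
  have hε : 0 < ε := by
    by_contra hε
    rw [Metric.ball_eq_empty.2 (not_lt.1 hε)] at hz
    exact hz
  have := Metric.isOpen_ball.is_const_of_deriv_eq_zero (Metric.isPreconnected_ball)
    (fun z hz => (hd z hz).differentiableWithinAt) h0 hz (Metric.mem_ball_self hε)
  simpa only [jetUpdate_self] using this

/-- The effect of the unit field on the tensors of pairs of waves. -/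
def unitShift : Tensor n →ₗ[ℂ] Tensor n where
  toFun T i k := T (i + 1) k + T i (k + 1)
  map_add' T T' := by funext i k; simp only [Pi.add_apply]; abel
  map_smul' r T := by funext i k; simp [smul_add]

lemma jd_ev [NeZero n] {O : Set (Jet n)} (hO : IsOpen O) {f : Form n} {T : (Fin n → ℂ) → Tensor n}
    (hf : ∀ i k σ τ, JetAnalyticOn O (f i k σ τ))
    (hT : ∀ j ∈ O, ∀ i k, MatAnalyticAt (fun u => T u i k) (j 0))
    (hd : ∀ j ∈ O, ∀ i k, pdM 0 (fun u => T u i k) (j 0) = unitShift (T (j 0)) i k) (K : ℕ) :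
    ∀ j ∈ O, jd 0 0 (fun j => Form.ev K f (T (j 0)) j) j =
      Form.ev K (fun i k σ τ => jd 0 0 (f i k σ τ)) (T (j 0)) j +
        Form.ev K f (unitShift (T (j 0))) j := by
  intro j hj
  have hTO : ∀ i k σ τ, JetAnalyticOn O fun j => T (j 0) i k σ τ := fun i k σ τ =>
    .comp_base (f := fun u => T u i k σ τ) fun j hj => hT j hj i k σ τ
  have hm : ∀ i k σ τ, JetAnalyticOn O fun j => f i k σ τ j * T (j 0) i k σ τ :=
    fun i k σ τ => (hf i k σ τ).mul (hTO i k σ τ)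
  simp only [Form.ev, ← sum_add_distrib]
  refine (jdL_sum hO [(0, 0)] _ (fun i _ => .sum _ fun k _ => .sum _ fun σ _ => .sum _ fun τ _ =>
    hm i k σ τ) j hj).trans (sum_congr rfl fun i _ => ?_)
  refine (jdL_sum hO [(0, 0)] _ (fun k _ => .sum _ fun σ _ => .sum _ fun τ _ =>
    hm i k σ τ) j hj).trans (sum_congr rfl fun k _ => ?_)
  refine (jdL_sum hO [(0, 0)] _ (fun σ _ => .sum _ fun τ _ =>
    hm i k σ τ) j hj).trans (sum_congr rfl fun σ _ => ?_)
  refine (jdL_sum hO [(0, 0)] _ (fun τ _ => hm i k σ τ) j hj).trans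
    (sum_congr rfl fun τ _ => ?_)
  refine (jd_mul (hf i k σ τ j hj) (hTO i k σ τ j hj) 0 0).trans ?_
  rw [jd_comp_base (fun u => T u i k σ τ) (hT j hj i k σ τ).differentiableAt, ← hd j hj i k]
  rfl

end

section

variable {n : ℕ} [NeZero n] {X : FrobeniusManifold n} {O : Set (Jet n)}

lemma jetAnalyticOn_lhsForm (hO : IsOpen O) (hM : ∀ j ∈ O, j 0 ∈ X.M) {Φ : Jet n → ℂ}
    (hΦ : JetAnalyticOn O Φ) (N : ℕ) (i k : ℕ) (σ τ : Fin n) :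
    JetAnalyticOn O (lhsForm X N Φ i k σ τ) :=
  .sum _ fun r _ => .sum _ fun γ _ => (hΦ.jd γ r).mul (formFilt_yForm hO hM r γ i k σ τ).1

lemma isOpen_resolventSet (hO : IsOpen O) (hM : ∀ j ∈ O, j 0 ∈ X.M) (lam : ℂ) :
    IsOpen {j ∈ O | (lam • 1 - X.U (j 0)).det ≠ 0} := by
  refine isOpen_iff_mem_nhds.2 fun j hj => ?_
  have h1 : ContinuousAt (fun j : Jet n => (lam • 1 - X.U (j 0)).det) j :=
    (((MatAnalyticAt.const (lam • 1)).sub (matAnalyticAt_U (hM j hj.1))).det.continuousAt).comp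
      (f := fun j : Jet n => j 0) (continuous_apply 0).continuousAt
  exact Filter.inter_mem (hO.mem_nhds hj.1) (h1.eventually_ne hj.2)

lemma ratAt_ev (K : ℕ) (f : Form n) (j : Jet n) (v : Fin n → ℂ) :
    RatAt (X.U v).charpoly fun z => Form.ev K f (resX X z v) j :=
  .sum _ fun _ _ => .sum _ fun _ _ => .sum _ fun _ _ => .sum _ fun _ _ =>
    .const_mul _ (ratAt_resX X v _ _ _ _)

namespace Calibration

variable (c : Calibration X)

lemma matAnalyticAt_virTensor {v : Fin n → ℂ} (hv : v ∈ X.M) (m i k : ℕ) :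
    MatAnalyticAt (fun u => c.virTensor m u i k) v := fun σ τ => by
  simp only [virTensor, Matrix.of_apply]
  exact analyticAt_fun_sum _ fun p _ => analyticAt_fun_sum _ fun q _ =>
    analyticAt_fun_sum _ fun α _ => analyticAt_fun_sum _ fun β _ =>
      analyticAt_const.mul (((isWave_thetaWave X c _).analytic i σ v hv).mul
        ((isWave_thetaWave X c _).analytic k τ v hv))

lemma pdM_zero_virTensor {v : Fin n → ℂ} (hv : v ∈ X.M) (m i k : ℕ) :
    pdM 0 (fun u => c.virTensor m u i k) v = unitShift (c.virTensor m v) i k := by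
  ext σ τ
  have hw : ∀ a i σ, AnalyticAt ℂ (fun u => thetaWave X c a i u σ) v := fun a i σ =>
    (isWave_thetaWave X c a).analytic i σ v hv
  have hd : ∀ a i σ, pd 0 (fun u => thetaWave X c a i u σ) v = thetaWave X c a (i + 1) v σ := by
    intro a i σ
    rw [(isWave_thetaWave X c a).deriv i 0 σ v hv, X.C_zero hv, Matrix.one_mulVec]
  have hm : ∀ a b, AnalyticAt ℂ (fun u => c.virHat m a b *
      (thetaWave X c a i u σ * thetaWave X c b k u τ)) v := fun a b =>
    analyticAt_const.mul ((hw a i σ).mul (hw b k τ))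
  simp only [pdM, unitShift, virTensor, Matrix.of_apply, LinearMap.coe_mk, AddHom.coe_mk,
    Matrix.add_apply, ← sum_add_distrib]
  refine (pd_sum _ (fun p _ => analyticAt_fun_sum _ fun q _ =>
    analyticAt_fun_sum _ fun α _ => analyticAt_fun_sum _ fun β _ => hm _ _) 0).trans
    (sum_congr rfl fun p _ => ?_)
  refine (pd_sum _ (fun q _ => analyticAt_fun_sum _ fun α _ =>
    analyticAt_fun_sum _ fun β _ => hm _ _) 0).trans (sum_congr rfl fun q _ => ?_)
  refine (pd_sum _ (fun α _ => analyticAt_fun_sum _ fun β _ => hm _ _) 0).trans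
    (sum_congr rfl fun α _ => ?_)
  refine (pd_sum _ (fun β _ => hm _ _) 0).trans (sum_congr rfl fun β _ => ?_)
  refine (pd_const_mul _ ((hw _ i σ).fun_mul (hw _ k τ)) 0).trans ?_
  rw [show pd 0 _ v = _ from pd_mul (hw (α, p) i σ) (hw (β, q) k τ) 0, hd, hd]
  ring

lemma analyticAt_sum_virA_Omega {v : Fin n → ℂ} (hv : v ∈ X.M) (m : ℕ) :
    AnalyticAt ℂ (fun u => ∑ x ∈ lowTimes n m ×ˢ lowTimes n m, c.virA m x.1 x.2 * c.Ω x.1 x.2 u) v :=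
  analyticAt_fun_sum _ fun _ _ => analyticAt_const.mul (c.analyticAt_Omega _ _ hv)

lemma pd_zero_sum_virA_Omega {v : Fin n → ℂ} (hv : v ∈ X.M) (m : ℕ) :
    pd 0 (fun u => ∑ x ∈ lowTimes n m ×ˢ lowTimes n m, c.virA m x.1 x.2 * c.Ω x.1 x.2 u) v =
      (1 / 2) * ∑ σ, ∑ τ, X.η σ τ * c.virTensor m v 1 1 σ τ := by
  have h0 : ∀ α : Fin n, thetaWave X c (α, 0) 1 v = 0 := by
    intro α; funext σ; simp [thetaWave]
  rw [pd_sum _ (fun x _ => analyticAt_const.fun_mul (c.analyticAt_Omega _ _ hv)) 0]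
  have h1 := c.sum_virA_eq m (fun a b => ∑ σ, ∑ τ, X.η σ τ *
    (thetaWave X c a 1 v σ * thetaWave X c b 1 v τ)) (by simp [h0]) (by simp [h0])
  have h2 : ∑ σ, ∑ τ, X.η σ τ * c.virTensor m v 1 1 σ τ =
      ∑ a ∈ lowTimes n (m + 1), ∑ b ∈ lowTimes n (m + 1), c.virHat m a b * ∑ σ, ∑ τ, X.η σ τ *
        (thetaWave X c a 1 v σ * thetaWave X c b 1 v τ) := by
    rw [virTensor_eq_sum]
    simp only [Finset.sum_apply, Matrix.sum_apply, Pi.smul_apply, Matrix.smul_apply, smul_eq_mul,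
      pairTensor, Matrix.of_apply, mul_sum]
    rw [sum_congr rfl fun σ _ => sum_comm, sum_comm]
    refine sum_congr rfl fun a _ => ?_
    rw [sum_congr rfl fun σ _ => sum_comm, sum_comm]
    refine sum_congr rfl fun b _ => sum_congr rfl fun σ _ =>
      sum_congr rfl fun τ _ => by ring
  rw [h2, ← h1]
  refine sum_congr rfl fun x _ => ?_
  refine (pd_const_mul _ (c.analyticAt_Omega _ _ hv) 0).trans ?_
  rw [c.pd_Omega _ _ _ hv, X.C_zero hv, Matrix.mul_one, thetaWave_up_one, thetaWave_up_one]
  simp only [Matrix.mul_apply, Matrix.transpose_apply, col, sum_mul]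
  rw [sum_comm]
  congr 1
  exact sum_congr rfl fun σ _ => sum_congr rfl fun τ _ => by ring

/-- The functions of genus one satisfy the loop equation up to a function of `lam` that is
preserved by the unit field. -/
lemma jd_genus_one (hO : IsOpen O) (hM : ∀ j ∈ O, j 0 ∈ X.M) {Φ : Jet n → ℂ}
    (hΦ : JetAnalyticOn O Φ) {N K : ℕ} (hK : 2 ≤ K) (κ : ℕ → ℂ)
    (h : ∀ m < n * (2 * K + 1), ∀ j ∈ O, Form.ev K (lhsForm X N Φ) (c.virTensor m (j 0)) j =
      ∑ x ∈ lowTimes n m ×ˢ lowTimes n m, c.virA m x.1 x.2 * c.Ω x.1 x.2 (j 0) + κ m)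
    {lam : ℂ} (hlam : ∀ j ∈ O, (lam • 1 - X.U (j 0)).det ≠ 0) :
    ∀ j ∈ O, jd 0 0 (fun j => Form.ev K (lhsForm X N Φ) (resX X lam (j 0)) j +
      loopConst X lam (j 0)) j = 0 := by
  intro j hj
  have hf := jetAnalyticOn_lhsForm hO hM hΦ N
  set f := lhsForm X N Φ
  set Λ : Tensor n →ₗ[ℂ] ℂ := Form.evL K (fun i k σ τ => jd 0 0 (f i k σ τ)) j +
    (Form.evL K f j).comp unitShift - (1 / 2 : ℂ) • (Form.evL 2 (fun i k σ τ _ =>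
      if i = 1 ∧ k = 1 then X.η σ τ else 0) j) with hΛdef
  have hΛ : ∀ T, Λ T = Form.ev K (fun i k σ τ => jd 0 0 (f i k σ τ)) T j +
      Form.ev K f (unitShift T) j - (1 / 2) * ∑ σ, ∑ τ, X.η σ τ * T 1 1 σ τ := by
    intro T
    have : Form.ev 2 (fun i k σ τ _ => if i = 1 ∧ k = 1 then X.η σ τ else 0) T j =
        ∑ σ, ∑ τ, X.η σ τ * T 1 1 σ τ := by
      simp [Form.ev, sum_range_succ]
    simp only [hΛdef, LinearMap.sub_apply, LinearMap.add_apply, LinearMap.smul_apply,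
      LinearMap.comp_apply, Form.evL_apply, smul_eq_mul, this]
  have hz := transfer_resX c (hM j hj) (K := 2 * K + 1) Λ (fun T hT => ?_) (fun m hm => ?_)
    (hlam j hj)
  · rw [hΛ] at hz
    have hC : JetAnalyticOn O fun j => loopConst X lam (j 0) :=
      .comp_base fun j hj => analyticAt_loopConst (hM j hj) (hlam j hj)
    have hev : JetAnalyticOn O fun j => Form.ev K f (resX X lam (j 0)) j :=
      .sum _ fun i _ => .sum _ fun k _ => .sum _ fun σ _ => .sum _ fun τ _ => (hf i k σ τ).mul
        (.comp_base (f := fun u => resX X lam u i k σ τ)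
          fun j hj => matAnalyticAt_resX (hM j hj) (hlam j hj) i k σ τ)
    rw [jd_add (hev j hj) (hC j hj), jd_ev hO hf
      (fun j hj => matAnalyticAt_resX (hM j hj) (hlam j hj))
      (fun j hj => c.pdM_zero_resX (hM j hj) (hlam j hj)) K j hj,
      jd_comp_base _ (analyticAt_loopConst (hM j hj) (hlam j hj)).differentiableAt,
      c.pd_zero_loopConst (hM j hj) (hlam j hj)]
    linear_combination hz
  · rw [hΛ, hT 1 1 (by omega)]
    have h1 : ∀ g : Form n, Form.ev K g T j = 0 := fun g =>
      Form.ev_eq_zero g j fun i hi k hk => hT i k (by omega)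
    have h2 : ∀ g : Form n, Form.ev K g (unitShift T) j = 0 := fun g =>
      Form.ev_eq_zero g j fun i hi k hk => by
        simp [unitShift, hT (i + 1) k (by omega), hT i (k + 1) (by omega)]
    simp [h1, h2]
  · have hΩ : JetAnalyticOn O fun j => ∑ x ∈ lowTimes n m ×ˢ lowTimes n m,
        c.virA m x.1 x.2 * c.Ω x.1 x.2 (j 0) :=
      .comp_base fun j hj => c.analyticAt_sum_virA_Omega (hM j hj) m
    have h1 := jd_congr hO (h m hm) 0 0 j hj
    rw [jd_add (hΩ j hj) ⟨0, .const 0 _ j⟩, jd_const, add_zero, jd_ev hO hf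
      (fun j hj => c.matAnalyticAt_virTensor (hM j hj) m)
      (fun j hj => c.pdM_zero_virTensor (hM j hj) m) K j hj,
      jd_comp_base _ (c.analyticAt_sum_virA_Omega (hM j hj) m).differentiableAt,
      c.pd_zero_sum_virA_Omega (hM j hj)] at h1
    rw [hΛ, h1, sub_self]

/-- Along the unit field, `𝒰` changes by a multiple of the identity. -/
lemma U_jetUpdate (c : Calibration X) (hM : ∀ j ∈ O, j 0 ∈ X.M) {j : Jet n} {ε : ℝ}
    (hε : ∀ z ∈ Metric.ball (j 0 0) ε, jetUpdate j 0 0 z ∈ O) :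
    ∀ z ∈ Metric.ball (j 0 0) ε, X.U (jetUpdate j 0 0 z 0) = X.U (j 0) + (z - j 0 0) • 1 := by
  intro z hz
  ext α β
  have hA : JetAnalyticOn O fun j => X.U (j 0) α β := .comp_base (f := fun u => X.U u α β)
    fun j hj => X.analyticAt_U (hM j hj) α β
  have hB : JetAnalyticOn O fun j : Jet n => j 0 0 * (-(1 : Matrix (Fin n) (Fin n) ℂ) α β) :=
    (JetAnalyticOn.coord 0 0).mul (.const _)
  have h := is_const_of_jd_eq_zero (Φ := fun j : Jet n => X.U (j 0) α β +
      j 0 0 * (-(1 : Matrix (Fin n) (Fin n) ℂ) α β)) (j := j) (r := 0) (γ := 0) (ε := ε)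
    (fun z hz => (hA.add hB) _ (hε z hz)) (fun z hz => ?_) z hz
  · have h0 : jetUpdate j 0 0 z 0 0 = z := by simp [jetUpdate]
    simp only [h0] at h
    simp only [Matrix.add_apply, Matrix.smul_apply, smul_eq_mul]
    linear_combination h
  · have hv := hM _ (hε z hz)
    rw [jd_add (hA _ (hε z hz)) (hB _ (hε z hz)),
      jd_mul ((JetAnalyticOn.coord 0 0) _ (hε z hz)) ((JetAnalyticOn.const _) _ (hε z hz)),
      jd_const, jd_coord, jd_comp_base (fun u => X.U u α β) (X.analyticAt_U hv α β).differentiableAt,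
      c.pd_U hv, X.C_zero hv]
    simp

/-- The loop equation in genus one, on an open set. -/
lemma genus_one_on (hO : IsOpen O) (hM : ∀ j ∈ O, j 0 ∈ X.M) {Φ : Jet n → ℂ}
    (hΦ : JetAnalyticOn O Φ) {N K : ℕ} (hK : 2 ≤ K) (κ : ℕ → ℂ)
    (h : ∀ m < n * (2 * K + 1), ∀ j ∈ O, Form.ev K (lhsForm X N Φ) (c.virTensor m (j 0)) j =
      ∑ x ∈ lowTimes n m ×ˢ lowTimes n m, c.virA m x.1 x.2 * c.Ω x.1 x.2 (j 0) + κ m) :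
    ∀ j ∈ O, ∀ lam, (lam • 1 - X.U (j 0)).det ≠ 0 →
      Form.ev K (lhsForm X N Φ) (resX X lam (j 0)) j = -loopConst X lam (j 0) := by
  intro j hj lam hlam
  have hsm : ∀ (A : Matrix (Fin n) (Fin n) ℂ) (z : ℂ), A.charpoly.eval z = (z • 1 - A).det := by
    intro A z; rw [Matrix.eval_charpoly, Matrix.smul_one_eq_diagonal]; rfl
  obtain ⟨ε, hε, hball⟩ : ∃ ε > 0, ∀ z ∈ Metric.ball (j 0 0) ε, jetUpdate j 0 0 z ∈ O :=
    Metric.eventually_nhds_iff_ball.1 ((tendsto_jetUpdate j 0 0).eventually (hO.mem_nhds hj))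
  have hU := c.U_jetUpdate hM hball
  set χ := (X.U (j 0)).charpoly with hχ
  have hχ0 : χ ≠ 0 := (Matrix.charpoly_monic _).ne_zero
  have hshift : ∀ z ∈ Metric.ball (j 0 0) ε, ∀ x,
      (x • 1 - X.U (jetUpdate j 0 0 z 0)).det = χ.eval (x - (z - j 0 0)) := by
    intro z hz x
    rw [hU z hz, hχ, hsm]
    congr 1
    module
  obtain ⟨t, ht, hts⟩ : ∃ t ∈ Metric.ball (j 0 0) ε, ∀ x ∈ χ.roots.toFinset, ∀ y ∈ χ.roots.toFinset,
      x - y ≠ t - j 0 0 := by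
    have hinf : (Metric.ball (j 0 0) ε).Infinite :=
      infinite_of_mem_nhds (j 0 0) (Metric.ball_mem_nhds _ hε)
    obtain ⟨t, ht, htn⟩ := hinf.exists_notMem_finset
      ((χ.roots.toFinset ×ˢ χ.roots.toFinset).image fun x => x.1 - x.2 + j 0 0)
    refine ⟨t, ht, fun x hx y hy hxy => htn (Finset.mem_image.2 ⟨(x, y), Finset.mem_product.2 ⟨hx, hy⟩, ?_⟩)⟩
    simp only [hxy]; ring
  have hcop : IsCoprime χ (X.U (jetUpdate j 0 0 t 0)).charpoly := by
    rw [Polynomial.isCoprime_iff_aeval_ne_zero_of_isAlgClosed ℂ ℂ]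
    intro x
    by_contra! hx
    rw [Polynomial.coe_aeval_eq_eval, hsm (X.U (jetUpdate j 0 0 t 0)), hshift t ht] at hx
    refine hts x (by simpa [hχ0] using hx.1) (x - (t - j 0 0)) (by simpa [hχ0] using hx.2) (by ring)
  obtain ⟨B, hB⟩ : ∃ B : ℝ, ∀ x ∈ χ.roots.toFinset, ‖x‖ ≤ B := by
    obtain ⟨B, hB⟩ := (χ.roots.toFinset.image fun x => ‖x‖).bddAbove
    exact ⟨B, fun x hx => hB (by simpa using ⟨x, by simpa using hx, rfl⟩)⟩
  have hfar : ∀ x : ℂ, B + ε < ‖x‖ → ∀ z ∈ Metric.ball (j 0 0) ε,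
      (x • 1 - X.U (jetUpdate j 0 0 z 0)).det ≠ 0 := by
    intro x hx z hz h0
    rw [hshift z hz] at h0
    have h1 := hB (x - (z - j 0 0)) (by simpa [hχ0] using h0)
    have h2 := norm_sub_norm_le x (z - j 0 0)
    rw [Metric.mem_ball, dist_eq_norm] at hz
    linarith
  have hself : j 0 0 ∈ Metric.ball (j 0 0) ε := Metric.mem_ball_self hε
  have hkey := RatAt.eq_zero hcop hχ0
    ((ratAt_ev K (lhsForm X N Φ) j (j 0)).add (ratAt_loopConst X (j 0)))
    ((ratAt_ev K (lhsForm X N Φ) (jetUpdate j 0 0 t) (jetUpdate j 0 0 t 0)).add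
      (ratAt_loopConst X (jetUpdate j 0 0 t 0))) ?_ lam (by rwa [hχ, hsm])
  · linear_combination hkey
  · refine Set.Infinite.mono (s := {x : ℂ | B + ε < ‖x‖}) (fun x hx => ?_) ?_
    · have hx0 := hfar x hx
      have e := hx0 _ hself
      rw [jetUpdate_self] at e
      refine ⟨by rwa [hχ, hsm], by rw [hsm]; exact hx0 t ht, ?_⟩
      set O' := {j ∈ O | (x • 1 - X.U (j 0)).det ≠ 0} with hO'
      have hO'o : IsOpen O' := isOpen_resolventSet hO hM x
      have hM' : ∀ j ∈ O', j 0 ∈ X.M := fun j hj => hM j hj.1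
      have hΦ' : JetAnalyticOn O' Φ := fun j hj => hΦ j hj.1
      have hf := jetAnalyticOn_lhsForm hO'o hM' hΦ' N
      have hE : JetAnalyticOn O' fun j => Form.ev K (lhsForm X N Φ) (resX X x (j 0)) j +
          loopConst X x (j 0) :=
        .add (.sum _ fun i _ => .sum _ fun k _ => .sum _ fun σ _ => .sum _ fun τ _ =>
          (hf i k σ τ).mul (.comp_base (f := fun u => resX X x u i k σ τ)
            fun j hj => matAnalyticAt_resX (hM' j hj) hj.2 i k σ τ))
          (.comp_base fun j hj => analyticAt_loopConst (hM' j hj) hj.2)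
      exact (is_const_of_jd_eq_zero (Φ := fun j => Form.ev K (lhsForm X N Φ) (resX X x (j 0)) j +
          loopConst X x (j 0)) (fun z hz => hE _ ⟨hball z hz, hx0 z hz⟩)
        (fun z hz => c.jd_genus_one hO'o hM' hΦ' hK κ (fun m hm j hj => h m hm j hj.1)
          (fun j hj => hj.2) _ ⟨hball z hz, hx0 z hz⟩) t ht).symm
    · refine Set.infinite_of_not_bddAbove (α := ℝ) (s := (fun x : ℂ => ‖x‖) '' _) ?_ |>.of_image
      rintro ⟨b, hb⟩
      have h1 := le_max_left b (B + ε)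
      have h2 := le_max_right b (B + ε)
      have h3 : ‖((|max b (B + ε)| + 1 : ℝ) : ℂ)‖ = |max b (B + ε)| + 1 := by
        rw [Complex.norm_real, Real.norm_eq_abs, abs_of_nonneg (by positivity)]
      have h4 := le_abs_self (max b (B + ε))
      have := hb ⟨((|max b (B + ε)| + 1 : ℝ) : ℂ), by rw [Set.mem_ofPred_eq, h3]; linarith, rfl⟩
      simp only [h3] at this
      linarith

/-- The loop equation in genus one, at the resolvent. -/
theorem eventually_genus_one {F : ℕ → Jet n → ℂ} {j₀ : Jet n} (hX : X.Semisimple) (hj₀ : j₀ 0 ∈ X.M)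
    (hF : ∀ k, 0 < k → ∃ N, JetAnalyticAt N (F k) j₀) (hlin : c.LinearizesVirasoro F j₀) :
    ∃ N, (∀ᶠ j in 𝓝 j₀, JetAnalyticAt N (F 2) j) ∧
      ∀ᶠ j in 𝓝 j₀, ∀ lam, (lam • 1 - X.U (j 0)).det ≠ 0 →
        Form.ev (N + 3) (lhsForm X N (F 2)) (resX X lam (j 0)) j = -loopConst X lam (j 0) := by
  obtain ⟨N, hN⟩ := exists_nhd_order hj₀ hF 2
  refine ⟨N, hN.mono fun j hj => hj.2 2 (by omega) (by omega), ?_⟩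
  choose κ hκ using c.virasoro_constraints hX hj₀ hF hlin
  have h2 : ∀ᶠ j in 𝓝 j₀, ∀ m ∈ Finset.range (n * (2 * (N + 3) + 1)),
      ∑ x ∈ lowTimes n m ×ˢ lowTimes n m, c.virA m x.1 x.2 * c.tm F [x.1, x.2] 2 0 j + κ m =
        c.virTau F m (((2 : ℕ) : ℤ) - 2) 0 0 j := by
    rw [Filter.eventually_all_finset]
    intro m _
    simpa using hκ m 2 (by omega)
  obtain ⟨O, hOsub, hO, hj⟩ := eventually_nhds_iff.1
    (hN.and ((c.eventually_jd_one hX hj₀ hF hlin).and h2))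
  have hM : ∀ j ∈ O, j 0 ∈ X.M := fun j hj => (hOsub j hj).1.1
  have hA : ∀ i, 0 < i → i ≤ 2 → ∀ j ∈ O, JetAnalyticAt N (F i) j := fun i h0 hi j hj =>
    (hOsub j hj).1.2 i h0 hi
  refine eventually_of_isOpen hO hj (c.genus_one_on hO hM (fun j hj => ⟨N, hA 2 (by omega) le_rfl j hj⟩)
    (by omega) κ fun m hm j hj => ?_)
  rw [← c.virTau_zero hO hM (by omega) (hA 2 (by omega) le_rfl) (by omega) m j hj,
    ← (hOsub j hj).2.2 m (mem_range.2 hm),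
    c.sum_virA_tm hO hM (by omega) hA (K := N + 3) (by omega) m j hj, if_pos rfl, ev_quadForm,
    ev_linForm]
  have h0 : prevF F 2 = fun _ => 0 := by simp [prevF]
  have h1 : ∀ ρ s, jd ρ s (fun _ : Jet n => (0 : ℂ)) = fun _ => 0 := fun ρ s =>
    funext fun j => jd_const 0 ρ s
  simp [quadCoeff, h0, h1, (hOsub j hj).2.1]

end Calibration
end

/-! ### The order of the functions of genus `g` -/

section

variable {n : ℕ}

lemma JetRep.eventually_fderiv_eq_zero {N : ℕ} {Φ : Jet n → ℂ} {G} {j₀ : Jet n}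
    (hG : JetRep N Φ G j₀) {S : ℕ → Prop}
    (h : ∀ᶠ j in 𝓝 j₀, ∀ γ r, S r → LoopEq.jd γ r Φ j = 0) :
    ∀ᶠ x in 𝓝 (jetTrunc N j₀), AnalyticAt ℂ G x ∧
      ∀ γ r, S r → fderiv ℂ G x (truncBasis N γ r) = 0 := by
  set x₀ := jetTrunc N j₀ with hx₀
  set ext : (Fin (N + 1) → Fin n → ℂ) → Jet n := fun x r => if h : r < N + 1 then x ⟨r, h⟩ else j₀ r
  have hext : Continuous ext := by
    refine continuous_pi fun r => ?_
    by_cases hr : r < N + 1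
    · simp only [ext, hr, dif_pos]; exact continuous_apply _
    · simp only [ext, hr, dif_neg, not_false_iff]; exact continuous_const
  have hext₀ : ext x₀ = j₀ := by
    funext r; simp [ext, hx₀, jetTrunc]
  have htr : ∀ x, jetTrunc N (ext x) = x := by
    intro x; funext i; exact dif_pos i.2
  have h1 : Tendsto ext (𝓝 x₀) (𝓝 j₀) := by rw [← hext₀]; exact hext.tendsto x₀
  filter_upwards [h1.eventually (hG.eventually.and h)] with x hx
  have h2 := hx.1.1
  rw [htr] at h2
  refine ⟨h2, fun γ r hr => ?_⟩
  rw [← hx.2 γ r hr, hx.1.jd_eq, htr]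

/-- A function with vanishing derivatives is constant. -/
lemma JetAnalyticAt.eventually_const {N : ℕ} {Φ : Jet n → ℂ} {j₀ : Jet n}
    (hΦ : JetAnalyticAt N Φ j₀) (h : ∀ᶠ j in 𝓝 j₀, ∀ γ r, LoopEq.jd γ r Φ j = 0) :
    ∃ a, ∀ᶠ j in 𝓝 j₀, Φ j = a := by
  obtain ⟨G, hG⟩ := hΦ
  change JetRep N Φ G j₀ at hG
  obtain ⟨ε, hε, hball⟩ := Metric.eventually_nhds_iff_ball.1
    (hG.eventually_fderiv_eq_zero (S := fun _ => True) (h.mono fun j hj γ r _ => hj γ r))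
  refine ⟨G (jetTrunc N j₀), ?_⟩
  filter_upwards [hG.2, ((continuous_jetTrunc N).tendsto j₀).eventually (Metric.ball_mem_nhds _ hε)]
    with j h1 h2
  rw [h1]
  refine Metric.isOpen_ball.is_const_of_fderiv_eq_zero (𝕜 := ℂ) Metric.isPreconnected_ball
    (fun x hx => (hball x hx).1.differentiableAt.differentiableWithinAt) (fun x hx => ?_) h2
    (Metric.mem_ball_self hε)
  refine ContinuousLinearMap.ext fun w => ?_
  have hw : w = ∑ r : Fin (N + 1), ∑ γ, w r γ • truncBasis N γ r := by
    funext i δ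
    simp [Finset.sum_apply, truncBasis, Fin.val_inj, ite_apply, Pi.single_apply]
  rw [hw]
  simp [(hball x hx).2]

lemma JetAnalyticAt.of_jd_eq_zero {N : ℕ} {Φ : Jet n → ℂ} {j₀ : Jet n}
    (hΦ : JetAnalyticAt (N + 1) Φ j₀) (h : ∀ᶠ j in 𝓝 j₀, ∀ γ, LoopEq.jd γ (N + 1) Φ j = 0) :
    JetAnalyticAt N Φ j₀ := by
  obtain ⟨G, hG⟩ := hΦ
  change JetRep (N + 1) Φ G j₀ at hG
  have hev := hG.eventually_fderiv_eq_zero (S := fun r => r = N + 1)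
    (h.mono fun j hj γ r hr => hr ▸ hj γ)
  set x₀ := jetTrunc (N + 1) j₀ with hx₀
  obtain ⟨ε, hε, hball⟩ := Metric.eventually_nhds_iff_ball.1 hev
  set last : Fin (N + 2) := Fin.last (N + 1)
  have hconst : ∀ x ∈ Metric.ball x₀ ε, G x = G (Function.update x last (x₀ last)) := by
    intro x hx
    have hmem : ∀ y ∈ Metric.ball (x₀ last) ε, Function.update x last y ∈ Metric.ball x₀ ε := by
      intro y hy
      rw [Metric.mem_ball, dist_pi_lt_iff hε] at hx ⊢
      intro i
      by_cases hi : i = last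
      · subst hi; simpa using hy
      · simpa [hi] using hx i
    have hd : ∀ y ∈ Metric.ball (x₀ last) ε,
        HasFDerivAt (fun y => G (Function.update x last y)) (0 : (Fin n → ℂ) →L[ℂ] ℂ) y := by
      intro y hy
      obtain ⟨h1, h2⟩ := hball _ (hmem y hy)
      set D : (Fin n → ℂ) →L[ℂ] (Fin (N + 2) → Fin n → ℂ) :=
        .pi (Pi.single last (.id ℂ (Fin n → ℂ)))
      have hD : HasFDerivAt (fun y => Function.update x last y) D y := hasFDerivAt_update x y
      have h3 := h1.differentiableAt.hasFDerivAt.comp y hD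
      suffices hz : (fderiv ℂ G (Function.update x last y)).comp D = 0 by rwa [hz] at h3
      refine ContinuousLinearMap.ext fun w => ?_
      have hw : D w = ∑ γ, w γ • truncBasis (N + 1) γ (N + 1) := by
        funext i δ
        by_cases hi : i = last
        · subst hi
          simp [D, truncBasis, last, Finset.sum_apply, Pi.single_apply]
        · have : (i : ℕ) ≠ N + 1 := fun h => hi (Fin.ext h)
          simp [D, truncBasis, this, hi, Finset.sum_apply]
      rw [ContinuousLinearMap.comp_apply, hw]
      simp [h2]
    have := Metric.isOpen_ball.is_const_of_fderiv_eq_zero (𝕜 := ℂ) Metric.isPreconnected_ball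
      (fun y hy => (hd y hy).differentiableAt.differentiableWithinAt)
      (fun y hy => (hd y hy).fderiv) (x := x last) (y := x₀ last)
      (by rw [Metric.mem_ball, dist_pi_lt_iff hε] at hx; exact hx last) (Metric.mem_ball_self hε)
    simpa using this
  refine ⟨fun x => G fun i => if h : (i : ℕ) < N + 1 then x ⟨i, h⟩ else x₀ i, ?_, ?_⟩
  · have h1 : (fun i : Fin (N + 2) => if h : (i : ℕ) < N + 1 then
        (fun i : Fin (N + 1) => j₀ i) ⟨i, h⟩ else x₀ i) = x₀ := by
      funext i; by_cases hi : (i : ℕ) < N + 1 <;> simp [hi, hx₀, jetTrunc]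
    refine AnalyticAt.fun_comp (g := G) (f := fun (x : Fin (N + 1) → Fin n → ℂ) (i : Fin (N + 2)) =>
      if h : (i : ℕ) < N + 1 then x (⟨i, h⟩ : Fin (N + 1)) else x₀ i) (by rw [h1]; exact hG.1) ?_
    refine AnalyticAt.pi fun i => ?_
    by_cases hi : (i : ℕ) < N + 1
    · simp only [hi, dif_pos]
      exact (ContinuousLinearMap.proj (R := ℂ) (φ := fun _ : Fin (N + 1) => Fin n → ℂ) ⟨i, hi⟩).analyticAt _
    · simp only [hi, dif_neg, not_false_iff]; exact analyticAt_const
  · filter_upwards [hG.2, ((continuous_jetTrunc (N + 1)).tendsto j₀).eventually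
      (Metric.ball_mem_nhds _ hε)] with j h1 h2
    rw [h1, hconst _ h2]
    congr 1
    funext i
    by_cases hi : i = last
    · subst hi; simp [last]
    · have : (i : ℕ) < N + 1 := by
        have := i.2
        have : (i : ℕ) ≠ N + 1 := fun h => hi (Fin.ext h)
        omega
      simp [hi, this, jetTrunc]

lemma JetAnalyticAt.of_jd_eq_zero_of_lt {N M : ℕ} {Φ : Jet n → ℂ} {j₀ : Jet n}
    (hΦ : JetAnalyticAt N Φ j₀) (h : ∀ᶠ j in 𝓝 j₀, ∀ γ r, M < r → LoopEq.jd γ r Φ j = 0) :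
    JetAnalyticAt M Φ j₀ := by
  induction N with
  | zero => exact hΦ.mono (Nat.zero_le M)
  | succ N ih =>
    rcases le_or_gt (N + 1) M with hN | hN
    · exact hΦ.mono hN
    · exact ih (hΦ.of_jd_eq_zero (h.mono fun j hj γ => hj γ (N + 1) hN))

lemma Filt.mono_set {O O' : Set (Jet n)} {l : ℕ} {d : ℤ} {Φ : Jet n → ℂ} (h : Filt O l d Φ)
    (hO : O' ⊆ O) : Filt O' l d Φ := fun L hL hl hw j hj => h L hL hl hw j (hO hj)

end

section

variable {n : ℕ} [NeZero n] {X : FrobeniusManifold n} {O : Set (Jet n)}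

/-- An equation of weight `d` bounds the weight of its solution. -/
lemma filt_of_lhsForm (hX : X.Semisimple) (c : Calibration X) (hO : IsOpen O)
    (hM : ∀ j ∈ O, j 0 ∈ X.M) {Φ : Jet n → ℂ} {N K d : ℕ} (hN : ∀ j ∈ O, JetAnalyticAt N Φ j)
    (hK : N < K) (hd : 1 ≤ d) {B : Form n} (hB : FormFilt O d B) (R : ℂ → (Fin n → ℂ) → ℂ)
    (hRlim : ∀ v, ∀ s : Finset ℂ, Polynomial.aeval (X.U v) (Lagrange.nodal s id) = 0 → ∀ u ∈ s,
      Tendsto (fun lam => (lam - u) ^ (d + 2) * R lam v) (𝓝[≠] u) (𝓝 0))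
    (h : ∀ j ∈ O, ∀ lam, (lam • 1 - X.U (j 0)).det ≠ 0 →
      Form.ev K (lhsForm X N Φ) (resX X lam (j 0)) j =
        Form.ev K B (resX X lam (j 0)) j + R lam (j 0)) (l : ℕ) : Filt O l ((d : ℤ) - 1) Φ := by
  have hΦ : JetAnalyticOn O Φ := fun j hj => ⟨N, hN j hj⟩
  have key : ∀ l γ (r : ℕ), Filt O l ((d : ℤ) - r) (jd γ r Φ) := by
    intro l
    induction l with
    | zero => exact fun γ r => filt_zero _
    | succ l ih =>
      intro γ r L hL hlen hw
      rcases lt_or_ge N r with hr | hr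
      · intro j hj
        rw [jdL_congr hO L (fun j hj => (hN j hj).jd_eq_zero γ hr) j hj, jdL_zero]
      refine eq_zero_of_isRegularJet hX c hO hM ((hΦ.jd γ r).jdL L) fun j hj hreg => ?_
      have hA : ∀ i k σ τ, JetAnalyticOn O fun j => lhsForm X N Φ i k σ τ j + -1 * B i k σ τ j :=
        fun i k σ τ => (jetAnalyticOn_lhsForm hO hM hΦ N i k σ τ).add
          ((JetAnalyticOn.const _).mul (hB i k σ τ).1)
      refine congrFun (eq_zero_of_poles c hreg.1 hreg.2 (A := ((d : ℤ) + 1 - jetWeight L).toNat) hK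
        (fun r γ => jdL L (jd γ r Φ) j)
        (fun i k σ τ => jdL L fun j => lhsForm X N Φ i k σ τ j + -1 * B i k σ τ j) ?_
        (fun lam => if L = [] then R lam (j 0) else 0) ?_ ?_ r (by omega) hr) γ
      · intro i k hik σ τ
        have hY := fun r γ => formFilt_yForm (X := X) hO hM r γ i k σ τ
        rw [jdL_add hO L (jetAnalyticOn_lhsForm hO hM hΦ N i k σ τ)
          ((JetAnalyticOn.const _).mul (hB i k σ τ).1) j hj]
        have h2 : jdL L (fun j => -1 * B i k σ τ j) j = 0 :=
          (Filt.const_mul hO (hB i k σ τ).1 (-1) ((hB i k σ τ).2 (L.length + 1))) L hL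
            (Nat.lt_succ_self _) (by omega) j hj
        rw [h2, add_zero]
        refine (jdL_sum hO L _ (fun r _ => .sum _ fun γ _ => (hΦ.jd γ r).mul (hY r γ).1) j hj).trans
          (sum_congr rfl fun r _ => ?_)
        refine (jdL_sum hO L _ (fun γ _ => (hΦ.jd γ r).mul (hY r γ).1) j hj).trans
          (sum_congr rfl fun γ _ => ?_)
        exact Filt.jdL_mul_eq hO L hL (hΦ.jd γ r) (hY r γ).1 ((ih γ r).mono (by omega) le_rfl)
          (hY r γ).2 (by omega) j hj
      · intro lam hlam
        have hO' := isOpen_resolventSet hO hM lam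
        set O' := {j ∈ O | (lam • 1 - X.U (j 0)).det ≠ 0} with hO'def
        have hj' : j ∈ O' := ⟨hj, hlam⟩
        have hres : ∀ i k σ τ, ∀ j ∈ O', AnalyticAt ℂ (fun u => resX X lam u i k σ τ) (j 0) :=
          fun i k σ τ j hj => matAnalyticAt_resX (hM j hj.1) hj.2 i k σ τ
        have hA' : ∀ i k σ τ, JetAnalyticOn O' fun j =>
            lhsForm X N Φ i k σ τ j + -1 * B i k σ τ j := fun i k σ τ j hj => hA i k σ τ j hj.1
        have hm : ∀ i k σ τ, JetAnalyticOn O' fun j =>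
            (lhsForm X N Φ i k σ τ j + -1 * B i k σ τ j) * resX X lam (j 0) i k σ τ :=
          fun i k σ τ => (hA' i k σ τ).mul
            (.comp_base (f := fun u => resX X lam u i k σ τ) (hres i k σ τ))
        have h1 : jdL L (fun j => Form.ev K (fun i k σ τ j =>
            lhsForm X N Φ i k σ τ j + -1 * B i k σ τ j) (resX X lam (j 0)) j) j =
            if L = [] then R lam (j 0) else 0 := by
          rw [jdL_congr hO' L (Ψ := fun j => R lam (j 0)) (fun j hj => ?_) j hj']
          · split_ifs with hL0
            · subst hL0; rfl
            · rw [jdL_base L hL hL0]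
          · rw [Form.ev_add_left, Form.ev_mul_left _ (fun _ => -1), h j hj.1 lam hj.2]
            ring
        rw [← h1]
        symm
        refine (jdL_sum hO' L _ (fun i _ => .sum _ fun k _ => .sum _ fun σ _ => .sum _ fun τ _ =>
          hm i k σ τ) j hj').trans (sum_congr rfl fun i _ => ?_)
        refine (jdL_sum hO' L _ (fun k _ => .sum _ fun σ _ => .sum _ fun τ _ =>
          hm i k σ τ) j hj').trans (sum_congr rfl fun k _ => ?_)
        refine (jdL_sum hO' L _ (fun σ _ => .sum _ fun τ _ =>
          hm i k σ τ) j hj').trans (sum_congr rfl fun σ _ => ?_)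
        refine (jdL_sum hO' L _ (fun τ _ => hm i k σ τ) j hj').trans
          (sum_congr rfl fun τ _ => ?_)
        exact jdL_mul_base hO' L hL (hA' i k σ τ) (hres i k σ τ) j hj'
      · intro s hs u hu
        by_cases hL0 : L = []
        · subst hL0
          simpa [jetWeight, show ((d : ℤ) + 1).toNat = d + 1 by omega] using hRlim (j 0) s hs u hu
        · simp [hL0]
  refine (filt_succ.2 ⟨fun h0 => absurd h0 (by omega), fun γ k hk =>
    (key l γ k).mono le_rfl (by omega)⟩ : Filt O (l + 1) ((d : ℤ) - 1) Φ).mono (by omega) le_rfl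

lemma tendsto_loopConst {v : Fin n → ℂ} {s : Finset ℂ}
    (hs : Polynomial.aeval (X.U v) (Lagrange.nodal s id) = 0) {u : ℂ} (hu : u ∈ s) :
    Tendsto (fun lam => (lam - u) ^ 3 * loopConst X lam v) (𝓝[≠] u) (𝓝 0) := by
  have hS := tendsto_resolvent hs hu
  set P := spectralProj (X.U v) s u
  have hl : Tendsto (fun lam : ℂ => lam - u) (𝓝[≠] u) (𝓝 0) := by
    have : Tendsto (fun lam : ℂ => lam - u) (𝓝 u) (𝓝 (u - u)) :=
      (continuous_id.sub continuous_const).tendsto u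
    rw [sub_self] at this
    exact this.mono_left nhdsWithin_le_nhds
  have hc : Continuous fun A : Matrix (Fin n) (Fin n) ℂ =>
      (1 / 4) * (A * X.V * (A * X.V)).trace - (1 / 16) * (A * A).trace := by fun_prop
  have h := hl.mul ((hc.tendsto P).comp hS)
  rw [zero_mul] at h
  refine h.congr fun lam => ?_
  rw [loopConst_eq]
  simp only [Function.comp, Matrix.smul_mul, Matrix.mul_smul, Matrix.trace_smul, smul_eq_mul]
  ring

namespace Calibration

variable (c : Calibration X)

theorem exists_filt {F : ℕ → Jet n → ℂ} {j₀ : Jet n} (hX : X.Semisimple) (hj₀ : j₀ 0 ∈ X.M)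
    (hF : ∀ k, 0 < k → ∃ N, JetAnalyticAt N (F k) j₀) (hlin : c.LinearizesVirasoro F j₀) (g : ℕ) :
    ∃ O : Set (Jet n), IsOpen O ∧ j₀ ∈ O ∧ (∀ j ∈ O, j 0 ∈ X.M) ∧ ∀ h, 0 < h → h ≤ g →
      JetAnalyticOn O (F (2 * h)) ∧ ∀ l, Filt O l (3 * (h : ℤ) - 3) (F (2 * h)) := by
  induction g with
  | zero => exact ⟨(fun j : Jet n => j 0) ⁻¹' X.M, X.isOpen.preimage (continuous_apply 0), hj₀,
      fun j hj => hj, fun h h0 hh => absurd hh (by omega)⟩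
  | succ g ih =>
    obtain ⟨O, hO, hjO, hM, hFO⟩ := ih
    rcases Nat.eq_zero_or_pos g with rfl | hg
    · obtain ⟨N, hN, heq⟩ := c.eventually_genus_one hX hj₀ hF hlin
      obtain ⟨O₁, hsub, hO₁, hj₁⟩ := eventually_nhds_iff.1 (hN.and heq)
      have hM' : ∀ j ∈ O ∩ O₁, j 0 ∈ X.M := fun j hj => hM j hj.1
      refine ⟨O ∩ O₁, hO.inter hO₁, ⟨hjO, hj₁⟩, hM', fun h h0 hh => ?_⟩
      obtain rfl : h = 1 := by omega
      refine ⟨fun j hj => ⟨N, (hsub j hj.2).1⟩, fun l => ?_⟩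
      exact filt_of_lhsForm hX c (hO.inter hO₁) hM' (fun j hj => (hsub j hj.2).1) (K := N + 3)
        (d := 1) (by omega) le_rfl (B := fun _ _ _ _ _ => 0) .zero
        (fun lam v => -1 * loopConst X lam v)
        (fun v s hs u hu => by
          simpa [mul_left_comm] using (tendsto_loopConst hs hu).const_mul (-1))
        (fun j hj lam hlam => by rw [(hsub j hj.2).2 lam hlam]; simp [Form.ev]) l
    · obtain ⟨N, hN, heq⟩ := c.eventually_genus_eq hX hj₀ hF hlin (g := g + 1) (by omega)
      obtain ⟨O₁, hsub, hO₁, hj₁⟩ := eventually_nhds_iff.1 (hN.and heq)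
      have hO' := hO.inter hO₁
      have hM' : ∀ j ∈ O ∩ O₁, j 0 ∈ X.M := fun j hj => hM j hj.1
      have hlow : ∀ h, 0 < h → h ≤ g → JetAnalyticOn (O ∩ O₁) (F (2 * h)) ∧
          ∀ l, Filt (O ∩ O₁) l (3 * (h : ℤ) - 3) (F (2 * h)) := fun h h0 hh =>
        ⟨fun j hj => (hFO h h0 hh).1 j hj.1, fun l => ((hFO h h0 hh).2 l).mono_set fun j hj => hj.1⟩
      refine ⟨O ∩ O₁, hO', ⟨hjO, hj₁⟩, hM', fun h h0 hh => ?_⟩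
      rcases Nat.lt_or_ge g h with hgh | hgh
      · obtain rfl : h = g + 1 := by omega
        refine ⟨fun j hj => ⟨N, (hsub j hj.2).1 _ h0 le_rfl⟩, fun l => ?_⟩
        have hB := formFilt_rhsForm (X := X) hO' hM' (G := fun g => F (2 * g)) (g := g + 1) (by omega)
          (fun h h0 hh => (hlow h h0 (by omega)).1) (fun h h0 hh => (hlow h h0 (by omega)).2) N
        refine (filt_of_lhsForm hX c hO' hM' (fun j hj => (hsub j hj.2).1 _ h0 le_rfl) (K := N + 3)
          (d := 3 * g + 1) (by omega) (by omega) (hB.mono (by push_cast; omega)) (fun _ _ => 0)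
          (fun v s hs u hu => by simp)
          (fun j hj lam hlam => by rw [(hsub j hj.2).2 lam hlam, add_zero]) l).mono le_rfl
          (by push_cast; omega)
      · exact hlow h h0 hgh

/-- The function of genus `g` depends on the derivatives of order at most `3 g - 2`. -/
theorem jetAnalyticAt_genus {F : ℕ → Jet n → ℂ} {j₀ : Jet n} (hX : X.Semisimple) (hj₀ : j₀ 0 ∈ X.M)
    (hF : ∀ k, 0 < k → ∃ N, JetAnalyticAt N (F k) j₀) (hlin : c.LinearizesVirasoro F j₀) {g : ℕ}
    (hg : 0 < g) : JetAnalyticAt (3 * g - 2) (F (2 * g)) j₀ := by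
  obtain ⟨N, hN⟩ := hF (2 * g) (by omega)
  obtain ⟨O, hO, hj, hM, h⟩ := c.exists_filt hX hj₀ hF hlin g
  refine hN.of_jd_eq_zero_of_lt (eventually_of_isOpen hO hj fun j hj γ r hr => ?_)
  exact (h g hg le_rfl).2 2 [(γ, r)] (by simp; omega) (by simp) (by simp [jetWeight]; omega) j hj

end Calibration
end

/-! ### Periods -/

section

variable {n : ℕ} [NeZero n] {X : FrobeniusManifold n}

variable (X) in
/-- The functions `p_α(·; lam)` are flat coordinates of the metric inverse to `g - lam η⁻¹` on the
domain `D`. -/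
structure IsPeriodDomain (p : Fin n → (Fin n → ℂ) → ℂ → ℂ) (lam : ℂ) (D : Set (Fin n → ℂ)) :
    Prop where
  isOpen : IsOpen D
  preconnected : IsPreconnected D
  mem : ∀ v ∈ D, v ∈ X.M
  regular : ∀ v ∈ D, (lam • 1 - X.U v).det ≠ 0
  analytic : ∀ v ∈ D, ∀ α, AnalyticAt ℂ (fun u => p α u lam) v
  flat : ∀ v ∈ D, ∀ α β γ,
    ∑ ε, ((X.g v β ε - lam * X.η⁻¹ β ε) * pd ε (pd γ (fun u => p α u lam)) v +
      X.Γ γ v β ε * pd ε (fun u => p α u lam) v) = 0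
  normalized : ∀ v ∈ D, ∀ α, deriv (fun l => p α v l) lam = -pd 0 (fun u => p α u lam) v
  independent : ∀ v ∈ D, (periodJac p v lam).det ≠ 0

lemma IsPeriodSystem.exists_domain {p : Fin n → (Fin n → ℂ) → ℂ → ℂ} {v₀ : Fin n → ℂ} {lam₀ : ℂ}
    (h : IsPeriodSystem X p v₀ lam₀) (hv₀ : v₀ ∈ X.M) :
    ∃ ε > 0, ∀ lam ∈ Metric.ball lam₀ ε, IsPeriodDomain X p lam (Metric.ball v₀ ε) := by
  have hfst : Tendsto (fun x : (Fin n → ℂ) × ℂ => x.1) (𝓝 (v₀, lam₀)) (𝓝 v₀) :=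
    continuous_fst.tendsto (v₀, lam₀)
  have hA : ∀ᶠ x : (Fin n → ℂ) × ℂ in 𝓝 (v₀, lam₀), ∀ α,
      AnalyticAt ℂ (fun x : (Fin n → ℂ) × ℂ => p α x.1 x.2) x :=
    Filter.eventually_all.2 fun α => (h.analytic α).eventually_analyticAt
  have hsec : ∀ x : (Fin n → ℂ) × ℂ, AnalyticAt ℂ (fun u : Fin n → ℂ => (u, x.2)) x.1 :=
    fun x => analyticAt_id.prod analyticAt_const
  have hpd : ∀ x : (Fin n → ℂ) × ℂ, ∀ α,
      AnalyticAt ℂ (fun x : (Fin n → ℂ) × ℂ => p α x.1 x.2) x → ∀ σ,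
      pd σ (fun u => p α u x.2) x.1 =
        fderiv ℂ (fun x : (Fin n → ℂ) × ℂ => p α x.1 x.2) x (Pi.single σ 1, 0) := by
    intro x α hx σ
    have h1 : HasFDerivAt (fun u : Fin n → ℂ => (u, x.2))
        (ContinuousLinearMap.inl ℂ (Fin n → ℂ) ℂ) x.1 := hasFDerivAt_prodMk_left x.1 x.2
    have h2 := HasFDerivAt.comp x.1 (g := fun x : (Fin n → ℂ) × ℂ => p α x.1 x.2)
      (f := fun u : Fin n → ℂ => (u, x.2)) hx.differentiableAt.hasFDerivAt h1
    have h3 : HasFDerivAt (fun u => p α u x.2) _ x.1 := h2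
    rw [pd, h3.fderiv]
    rfl
  have hdet : ∀ᶠ x : (Fin n → ℂ) × ℂ in 𝓝 (v₀, lam₀), (periodJac p x.1 x.2).det ≠ 0 := by
    have hc : ContinuousAt (fun x : (Fin n → ℂ) × ℂ => (Matrix.of fun α σ =>
        fderiv ℂ (fun x : (Fin n → ℂ) × ℂ => p α x.1 x.2) x (Pi.single σ 1, 0)).det)
        (v₀, lam₀) := by
      simp only [Matrix.det_apply', Matrix.of_apply]
      refine tendsto_finsetSum _ fun s _ => tendsto_const_nhds.mul (tendsto_finsetProd _ fun i _ => ?_)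
      exact ((h.analytic _).fderiv.continuousAt).clm_apply continuousAt_const
    have he : ∀ᶠ x : (Fin n → ℂ) × ℂ in 𝓝 (v₀, lam₀), (periodJac p x.1 x.2).det =
        (Matrix.of fun α σ => fderiv ℂ (fun x : (Fin n → ℂ) × ℂ => p α x.1 x.2) x
          (Pi.single σ 1, 0)).det := by
      filter_upwards [hA] with x hx
      congr 1
      ext α σ
      exact hpd x α (hx α) σ
    filter_upwards [he, hc.eventually_ne (by rw [← he.self_of_nhds]; exact h.independent)] with x h1 h2
    rwa [h1]
  have hres : ∀ᶠ x : (Fin n → ℂ) × ℂ in 𝓝 (v₀, lam₀), (x.2 • 1 - X.U x.1).det ≠ 0 := by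
    have hc : ContinuousAt (fun x : (Fin n → ℂ) × ℂ => (x.2 • 1 - X.U x.1).det) (v₀, lam₀) := by
      simp only [Matrix.det_apply', Matrix.sub_apply, Matrix.smul_apply]
      refine tendsto_finsetSum _ fun s _ => tendsto_const_nhds.mul (tendsto_finsetProd _ fun i _ => ?_)
      refine Tendsto.sub ?_ ?_
      · exact (continuous_snd.smul continuous_const).tendsto (v₀, lam₀)
      · exact (X.analyticAt_U hv₀ _ _).continuousAt.tendsto.comp hfst
    refine hc.eventually_ne ?_
    have := h.regular
    rw [← neg_sub, Matrix.det_neg] at this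
    exact right_ne_zero_of_mul this
  have hall := hA.and (hdet.and (hres.and (h.flat.and (h.normalized.and
    (hfst.eventually (X.isOpen.mem_nhds hv₀))))))
  obtain ⟨ε, hε, hball⟩ := Metric.eventually_nhds_iff_ball.1 hall
  refine ⟨ε, hε, fun lam hlam => ?_⟩
  have hin : ∀ v ∈ Metric.ball v₀ ε, (v, lam) ∈ Metric.ball (v₀, lam₀) ε := by
    intro v hv
    rw [Metric.mem_ball, Prod.dist_eq, max_lt_iff]
    exact ⟨hv, hlam⟩
  exact ⟨Metric.isOpen_ball, Metric.isPreconnected_ball, fun v hv => (hball _ (hin v hv)).2.2.2.2.2,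
    fun v hv => (hball _ (hin v hv)).2.2.1, fun v hv α =>
      AnalyticAt.fun_comp (g := fun x : (Fin n → ℂ) × ℂ => p α x.1 x.2)
        (f := fun u : Fin n → ℂ => (u, lam)) ((hball _ (hin v hv)).1 α) (hsec (v, lam)),
    fun v hv => (hball _ (hin v hv)).2.2.2.1, fun v hv => (hball _ (hin v hv)).2.2.2.2.1,
    fun v hv => (hball _ (hin v hv)).2.1⟩

variable (X) in
/-- The matrices with columns `∇p_α` and its successors in the sequence of waves. -/
def periodMat (p : Fin n → (Fin n → ℂ) → ℂ → ℂ) (lam : ℂ) :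
    ℕ → (Fin n → ℂ) → Matrix (Fin n) (Fin n) ℂ
  | 0, v => X.η⁻¹ * (periodJac p v lam).transpose
  | i + 1, v => (lam • 1 - X.U v)⁻¹ * ((X.V + ((i : ℂ) + 1 / 2) • 1) * periodMat p lam i v)

lemma periodMat_succ (p : Fin n → (Fin n → ℂ) → ℂ → ℂ) (lam : ℂ) (i : ℕ) (v : Fin n → ℂ) :
    periodMat X p lam (i + 1) v =
      (lam • 1 - X.U v)⁻¹ * ((X.V + ((i : ℂ) + 1 / 2) • 1) * periodMat X p lam i v) := rfl

lemma resTensor_succ_succ (U V : Matrix (Fin n) (Fin n) ℂ) (lam : ℂ) (a k : ℕ) :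
    resTensor U V lam (a + 1) (k + 1) =
      resTensor U V lam a k * ((V - ((k : ℂ) + 1 / 2) • 1) * (lam • 1 - U)⁻¹) := by
  induction a with
  | zero =>
    simp only [resTensor]
    congr 2
    push_cast
    module
  | succ a ih =>
    rw [resTensor, ih]
    conv_rhs => rw [resTensor]
    have : (((a + 1 : ℕ) : ℂ) + 1 - (k + 1 : ℕ) - 1 / 2) = (a : ℂ) + 1 - k - 1 / 2 := by
      push_cast; ring
    rw [this]
    simp only [Matrix.mul_assoc]

namespace IsPeriodDomain

variable {p : Fin n → (Fin n → ℂ) → ℂ → ℂ} {lam : ℂ} {D : Set (Fin n → ℂ)}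

lemma matAnalyticAt (h : IsPeriodDomain X p lam D) {v : Fin n → ℂ} (hv : v ∈ D) (i : ℕ) :
    MatAnalyticAt (periodMat X p lam i) v := by
  induction i with
  | zero => exact (MatAnalyticAt.const _).mul fun σ α => analyticAt_pd (h.analytic v hv α) σ
  | succ i ih =>
    exact (matAnalyticAt_res (h.mem v hv) (h.regular v hv)).mul ((MatAnalyticAt.const _).mul ih)

lemma res_comm_C (h : IsPeriodDomain X p lam D) {v : Fin n → ℂ} (hv : v ∈ D) (γ : Fin n) :
    (lam • 1 - X.U v)⁻¹ * X.C γ v = X.C γ v * (lam • 1 - X.U v)⁻¹ := by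
  have hu := isUnit_iff_ne_zero.2 (h.regular v hv)
  have h1 : X.C γ v * (lam • 1 - X.U v) = (lam • 1 - X.U v) * X.C γ v := by
    rw [Matrix.mul_sub, Matrix.sub_mul, X.U_comm_C (h.mem v hv)]
    simp
  calc (lam • 1 - X.U v)⁻¹ * X.C γ v =
      (lam • 1 - X.U v)⁻¹ * (X.C γ v * (lam • 1 - X.U v)) * (lam • 1 - X.U v)⁻¹ := by
        rw [Matrix.mul_assoc, Matrix.mul_assoc, Matrix.mul_nonsing_inv _ hu, Matrix.mul_one]
    _ = _ := by rw [h1, ← Matrix.mul_assoc, Matrix.nonsing_inv_mul _ hu, Matrix.one_mul]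

lemma pdM_zero (c : Calibration X) (h : IsPeriodDomain X p lam D) {v : Fin n → ℂ} (hv : v ∈ D)
    (γ : Fin n) : pdM γ (periodMat X p lam 0) v = X.C γ v * periodMat X p lam 1 v := by
  have hu := isUnit_iff_ne_zero.2 (h.regular v hv)
  set J := (periodJac p v lam).transpose with hJ
  set H := pdM γ (fun u => (periodJac p u lam).transpose) v with hH
  have hpd : pdM γ (periodMat X p lam 0) v = X.η⁻¹ * H := by
    rw [show periodMat X p lam 0 = fun u => X.η⁻¹ * (periodJac p u lam).transpose from rfl,
      pdM_mul (B := fun u => (periodJac p u lam).transpose) (.const _)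
        (fun σ α => analyticAt_pd (h.analytic v hv α) σ), pdM_const,
      Matrix.zero_mul, zero_add]
  have hflat : (X.U v - lam • 1) * (X.η⁻¹ * H) + X.C γ v * ((X.V + (1 / 2 : ℂ) • 1) * (X.η⁻¹ * J)) = 0 := by
    have h1 : (X.g v - lam • X.η⁻¹) * H + X.Γ γ v * J = 0 := by
      ext β α
      rw [Matrix.add_apply, Matrix.mul_apply, Matrix.mul_apply, ← sum_add_distrib]
      rw [Matrix.zero_apply, ← h.flat v hv α β γ]
      refine sum_congr rfl fun ε _ => ?_
      rw [pd_comm (h.analytic v hv α)]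
      rfl
    have h2 : X.η⁻¹ * ((1 / 2 : ℂ) • (1 : Matrix (Fin n) (Fin n) ℂ) - X.V).transpose =
        (X.V + (1 / 2 : ℂ) • 1) * X.η⁻¹ := by
      rw [X.transpose_eq, X.adj_sub, X.adj_smul, X.adj_one, c.adj_V, ← Matrix.mul_assoc,
        ← Matrix.mul_assoc, X.inv_mul_eta, Matrix.one_mul, sub_neg_eq_add, add_comm]
    rw [← h1, FrobeniusManifold.g, FrobeniusManifold.Γ, Matrix.mul_assoc (X.C γ v), h2,
      Matrix.sub_mul, Matrix.sub_mul]
    simp only [Matrix.mul_assoc, Matrix.smul_mul, Matrix.one_mul]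
  have h3 : (lam • 1 - X.U v) * (X.η⁻¹ * H) =
      X.C γ v * ((X.V + (1 / 2 : ℂ) • 1) * (X.η⁻¹ * J)) := by
    rw [← sub_eq_zero, ← neg_eq_zero, ← hflat, ← neg_sub (X.U v), Matrix.neg_mul]
    abel
  rw [hpd, periodMat, ← Matrix.mul_assoc, ← h.res_comm_C hv, Matrix.mul_assoc]
  simp only [periodMat, Nat.cast_zero, zero_add]
  rw [← h3, ← Matrix.mul_assoc, Matrix.nonsing_inv_mul _ hu, Matrix.one_mul]

lemma pdM_periodMat (c : Calibration X) (h : IsPeriodDomain X p lam D) (i : ℕ) (γ : Fin n) :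
    ∀ v ∈ D, pdM γ (periodMat X p lam i) v = X.C γ v * periodMat X p lam (i + 1) v := by
  induction i with
  | zero => exact fun v hv => h.pdM_zero c hv γ
  | succ i ih =>
    intro v hv
    have hS := matAnalyticAt_res (h.mem v hv) (h.regular v hv)
    have hP := h.matAnalyticAt hv i
    rw [show periodMat X p lam (i + 1) = fun u => (lam • 1 - X.U u)⁻¹ *
      ((X.V + ((i : ℂ) + 1 / 2) • 1) * periodMat X p lam i u) from rfl,
      pdM_mul hS ((MatAnalyticAt.const _).mul hP), pdM_mul (.const _) hP, pdM_const, Matrix.zero_mul,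
      zero_add, ih v hv, c.pdM_res (h.mem v hv) (h.regular v hv), periodMat_succ p lam (i + 1),
      ← Matrix.mul_assoc (X.C γ v) (lam • 1 - X.U v)⁻¹ (_ * periodMat X p lam (i + 1) v),
      ← h.res_comm_C hv, periodMat_succ]
    set S := (lam • 1 - X.U v)⁻¹
    set P := periodMat X p lam i v
    have e : ((i + 1 : ℕ) : ℂ) + 1 / 2 = ((i : ℂ) + 1 / 2) + 1 := by push_cast; ring
    rw [e]
    generalize (i : ℂ) + 1 / 2 = a
    simp only [Matrix.mul_assoc, Matrix.mul_add, Matrix.add_mul, Matrix.mul_sub, Matrix.sub_mul,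
      Matrix.smul_mul, Matrix.mul_smul, Matrix.one_mul, add_smul, one_smul, smul_add]
    module

lemma isWave (c : Calibration X) (h : IsPeriodDomain X p lam D) (α : Fin n) :
    IsWave X D fun i v σ => periodMat X p lam i v σ α where
  analytic i σ v hv := h.matAnalyticAt hv i σ α
  deriv i γ σ v hv := by
    have := congrFun (congrFun (h.pdM_periodMat c i γ v hv) σ) α
    rw [Matrix.mul_apply] at this
    exact this

lemma jac_eq (v : Fin n → ℂ) : (periodJac p v lam).transpose = X.η * periodMat X p lam 0 v := by
  rw [periodMat, X.eta_mul_inv_assoc]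

lemma jac_eq' (v : Fin n → ℂ) : periodJac p v lam = (periodMat X p lam 0 v).transpose * X.η := by
  rw [← Matrix.transpose_transpose (periodJac p v lam), jac_eq (X := X), Matrix.transpose_mul, X.symm.eq]

lemma gram_eq (v : Fin n → ℂ) : gram X p v lam =
    ((periodMat X p lam 0 v).transpose * (X.η * ((X.U v - lam • 1) * periodMat X p lam 0 v)))⁻¹ := by
  rw [gram, jac_eq (X := X), jac_eq' (X := X), FrobeniusManifold.g]
  congr 1
  rw [show X.U v * X.η⁻¹ - lam • X.η⁻¹ = (X.U v - lam • 1) * X.η⁻¹ by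
    rw [Matrix.sub_mul, Matrix.smul_mul, Matrix.one_mul]]
  simp only [Matrix.mul_assoc, X.inv_mul_eta_assoc]

/-- The Gram matrix is constant. -/
lemma gram_const (c : Calibration X) (h : IsPeriodDomain X p lam D) {v v' : Fin n → ℂ} (hv : v ∈ D)
    (hv' : v' ∈ D) : gram X p v lam = gram X p v' lam := by
  rw [gram_eq, gram_eq]
  congr 1
  set Q : (Fin n → ℂ) → Matrix (Fin n) (Fin n) ℂ := fun u => (periodMat X p lam 0 u).transpose *
    (X.η * ((X.U u - lam • 1) * periodMat X p lam 0 u)) with hQ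
  have hA : ∀ v ∈ D, MatAnalyticAt Q v := fun v hv =>
    MatAnalyticAt.mul (fun α σ => h.matAnalyticAt hv 0 σ α) ((MatAnalyticAt.const _).mul
      (((matAnalyticAt_U (h.mem v hv)).sub (.const _)).mul (h.matAnalyticAt hv 0)))
  have hz : ∀ v ∈ D, ∀ γ, pdM γ Q v = 0 := by
    intro v hv γ
    have hP := h.matAnalyticAt hv 0
    have hU := matAnalyticAt_U (h.mem v hv)
    have hUl := hU.sub (MatAnalyticAt.const (lam • (1 : Matrix (Fin n) (Fin n) ℂ)))
    have hu := isUnit_iff_ne_zero.2 (h.regular v hv)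
    have hT : pdM γ (fun u => (periodMat X p lam 0 u).transpose) v =
        (pdM γ (periodMat X p lam 0) v).transpose := rfl
    have hUd : pdM γ (fun u => X.U u - lam • 1) v = X.C γ v + (X.C γ v * X.V - X.V * X.C γ v) := by
      simp only [sub_eq_add_neg (X.U _)]
      rw [pdM_add hU (.const _), pdM_const, add_zero, c.pdM_U (h.mem v hv)]
    rw [hQ, pdM_mul (A := fun u => (periodMat X p lam 0 u).transpose) (fun α σ => hP σ α) ((MatAnalyticAt.const _).mul (hUl.mul hP)),
      pdM_mul (.const _) (hUl.mul hP), pdM_const, Matrix.zero_mul, zero_add, pdM_mul hUl hP, hT, hUd,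
      h.pdM_periodMat c 0 γ v hv]
    have h1 : (X.U v - lam • 1) * (X.C γ v * periodMat X p lam 1 v) =
        -(X.C γ v * ((X.V + (1 / 2 : ℂ) • 1) * periodMat X p lam 0 v)) := by
      rw [← neg_sub (lam • 1) (X.U v), Matrix.neg_mul, periodMat_succ, ← Matrix.mul_assoc (X.C γ v) (lam • 1 - X.U v)⁻¹,
        ← h.res_comm_C hv, Matrix.mul_assoc, ← Matrix.mul_assoc (lam • 1 - X.U v),
        Matrix.mul_nonsing_inv _ hu, Matrix.one_mul, Nat.cast_zero, zero_add]
    have h2 : (X.C γ v * periodMat X p lam 1 v).transpose * (X.η * ((X.U v - lam • 1) *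
        periodMat X p lam 0 v)) = -((periodMat X p lam 0 v).transpose * (X.η * (((1 / 2 : ℂ) • 1 - X.V) *
          (X.C γ v * periodMat X p lam 0 v)))) := by
      have h3 : ((X.U v - lam • 1) * (X.C γ v * periodMat X p lam 1 v)).transpose =
          (X.C γ v * periodMat X p lam 1 v).transpose * (X.η * (X.U v - lam • 1) * X.η⁻¹) := by
        rw [Matrix.transpose_mul, X.transpose_eq (X.U v - lam • 1), X.adj_sub, X.adj_U (h.mem v hv),
          X.adj_smul, X.adj_one]
      have h4 : (X.C γ v * periodMat X p lam 1 v).transpose * (X.η * ((X.U v - lam • 1) *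
        periodMat X p lam 0 v)) = (X.C γ v * periodMat X p lam 1 v).transpose *
          (X.η * (X.U v - lam • 1) * X.η⁻¹) * (X.η * periodMat X p lam 0 v) := by
        simp only [Matrix.mul_assoc, X.inv_mul_eta_assoc]
      rw [h4, ← h3, h1, Matrix.transpose_neg, Matrix.transpose_mul, Matrix.transpose_mul,
        X.transpose_eq (X.C γ v), X.adj_C (h.mem v hv), X.transpose_eq (X.V + _), X.adj_add, c.adj_V,
        X.adj_smul, X.adj_one]
      simp only [Matrix.mul_assoc, X.inv_mul_eta_assoc, Matrix.neg_mul]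
      rw [neg_add_eq_sub]
    rw [h1, h2]
    set P := periodMat X p lam 0 v
    simp only [Matrix.mul_assoc, Matrix.mul_add, Matrix.add_mul, Matrix.mul_sub, Matrix.sub_mul,
      Matrix.smul_mul, Matrix.mul_smul, Matrix.one_mul, Matrix.mul_neg]
    module
  ext α β
  refine h.isOpen.is_const_of_fderiv_eq_zero (𝕜 := ℂ) h.preconnected (f := fun u => Q u α β)
    (fun v hv => (hA v hv α β).differentiableAt.differentiableWithinAt) (fun v hv => ?_) hv hv'
  refine ContinuousLinearMap.coe_injective (LinearMap.pi_ext' fun γ => LinearMap.ext_ring ?_)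
  exact congrFun (congrFun (hz v hv γ) α) β

lemma gram_symm (h : IsPeriodDomain X p lam D) {v : Fin n → ℂ} (hv : v ∈ D) :
    (gram X p v lam).transpose = gram X p v lam := by
  rw [gram_eq, Matrix.transpose_nonsing_inv]
  congr 1
  rw [Matrix.transpose_mul, Matrix.transpose_mul, Matrix.transpose_mul, Matrix.transpose_transpose,
    X.symm.eq, X.transpose_eq (X.U v - lam • 1), X.adj_sub, X.adj_U (h.mem v hv), X.adj_smul,
    X.adj_one]
  simp only [Matrix.mul_assoc, X.inv_mul_eta, Matrix.mul_one]

lemma mul_gram_mul (h : IsPeriodDomain X p lam D) {v : Fin n → ℂ} (hv : v ∈ D) :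
    periodMat X p lam 0 v * gram X p v lam * (periodMat X p lam 0 v).transpose =
      -((lam • 1 - X.U v)⁻¹ * X.η⁻¹) := by
  have hu := isUnit_iff_ne_zero.2 (h.regular v hv)
  have hP : IsUnit (periodMat X p lam 0 v).det := by
    rw [periodMat, Matrix.det_mul, Matrix.det_transpose]
    exact (Matrix.isUnit_nonsing_inv_det _ X.nondeg).mul (isUnit_iff_ne_zero.2 (h.independent v hv))
  have hPt : IsUnit (periodMat X p lam 0 v).transpose.det := by rwa [Matrix.det_transpose]
  rw [gram_eq]
  set P := periodMat X p lam 0 v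
  rw [Matrix.mul_inv_rev, Matrix.mul_inv_rev, Matrix.mul_inv_rev, ← neg_sub (lam • 1), inv_neg_matrix]
  simp only [Matrix.mul_assoc, Matrix.nonsing_inv_mul _ hPt, Matrix.mul_one]
  rw [← Matrix.mul_assoc P, Matrix.mul_nonsing_inv _ hP, Matrix.one_mul, Matrix.neg_mul]

lemma mul_gram_mul_eq_resX (c : Calibration X) (h : IsPeriodDomain X p lam D) {v : Fin n → ℂ}
    (hv : v ∈ D) (i k : ℕ) : periodMat X p lam i v * gram X p v lam *
      (periodMat X p lam k v).transpose = -resX X lam v i k := by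
  induction k with
  | zero =>
    induction i with
    | zero =>
      rw [h.mul_gram_mul hv]
      simp [resX, toTensor, resTensor]
    | succ i ih =>
      rw [periodMat_succ, Matrix.mul_assoc, Matrix.mul_assoc, Matrix.mul_assoc,
        ← Matrix.mul_assoc (periodMat X p lam i v), ih]
      simp only [resX, toTensor, LinearMap.coe_mk, AddHom.coe_mk, pow_zero, one_smul, add_zero,
        resTensor, Matrix.mul_neg, Matrix.mul_assoc]
      rw [show ((i : ℂ) + 1 - (0 : ℕ) - 1 / 2) = (i : ℂ) + 1 / 2 by push_cast; ring]
  | succ k ih =>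
    have hS : X.adj (lam • 1 - X.U v)⁻¹ = (lam • 1 - X.U v)⁻¹ := by
      have e : X.adj (lam • 1 - X.U v) = lam • 1 - X.U v := by
        rw [X.adj_sub, X.adj_U (h.mem v hv), X.adj_smul, X.adj_one]
      symm
      refine Matrix.inv_eq_left_inv ?_
      nth_rw 2 [← e]
      rw [← X.adj_mul, Matrix.mul_nonsing_inv _ (isUnit_iff_ne_zero.2 (h.regular v hv)), X.adj_one]
    rw [periodMat, Matrix.transpose_mul, Matrix.transpose_mul, ← Matrix.mul_assoc, ← Matrix.mul_assoc,
      ih, X.transpose_eq (X.V + _), X.transpose_eq (lam • 1 - X.U v)⁻¹, hS, X.adj_add, c.adj_V,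
      X.adj_smul, X.adj_one]
    simp only [resX, toTensor, LinearMap.coe_mk, AddHom.coe_mk, ← add_assoc, resTensor_succ_succ,
      pow_succ, Matrix.neg_mul, Matrix.smul_mul, Matrix.mul_assoc, X.inv_mul_eta_assoc]
    rw [show (-X.V + ((k : ℂ) + 1 / 2) • 1) = -(X.V - ((k : ℂ) + 1 / 2) • 1) by module]
    simp only [Matrix.neg_mul, Matrix.mul_neg]
    module

end IsPeriodDomain
end

/-! ### The loop equation -/

section

variable {n : ℕ} [NeZero n] {X : FrobeniusManifold n} {O : Set (Jet n)}

namespace IsPeriodDomain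

variable {p : Fin n → (Fin n → ℂ) → ℂ → ℂ} {lam : ℂ} {D : Set (Fin n → ℂ)}

variable (X p lam) in
/-- The wave of the period `p_α`. -/
def wave (α : Fin n) (i : ℕ) (v : Fin n → ℂ) (σ : Fin n) : ℂ := periodMat X p lam i v σ α

lemma sum_gram_wave (c : Calibration X) (h : IsPeriodDomain X p lam D) {v : Fin n → ℂ} (hv : v ∈ D)
    (i k : ℕ) (σ τ : Fin n) : ∑ α, ∑ β, gram X p v lam α β *
      (wave X p lam α i v σ * wave X p lam β k v τ) = -resX X lam v i k σ τ := by
  have := congrFun (congrFun (h.mul_gram_mul_eq_resX c hv i k) σ) τ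
  rw [Matrix.neg_apply] at this
  rw [← this, sum_comm, Matrix.mul_apply]
  refine sum_congr rfl fun β _ => ?_
  rw [Matrix.mul_apply, sum_mul]
  refine sum_congr rfl fun α _ => ?_
  rw [Matrix.transpose_apply, wave, wave]
  ring

lemma ev_resX (c : Calibration X) (h : IsPeriodDomain X p lam D) {j : Jet n} (hj : j 0 ∈ D) (K : ℕ)
    (f : Form n) : -Form.ev K f (resX X lam (j 0)) j = ∑ α, ∑ β, gram X p (j 0) lam α β *
      Form.ev K f (pairTensor (wave X p lam α) (wave X p lam β) (j 0)) j := by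
  have h1 : -resX X lam (j 0) = ∑ α, ∑ β, gram X p (j 0) lam α β •
      pairTensor (wave X p lam α) (wave X p lam β) (j 0) := by
    funext i k
    ext σ τ
    rw [Pi.neg_apply, Pi.neg_apply, Matrix.neg_apply, ← h.sum_gram_wave c hj]
    simp only [Finset.sum_apply, Matrix.sum_apply, Pi.smul_apply, Matrix.smul_apply, smul_eq_mul,
      pairTensor, Matrix.of_apply]
  rw [← Form.evL_apply, ← map_neg, h1]
  simp only [map_sum, map_smul, smul_eq_mul, Form.evL_apply]

lemma pd_zero_eq (α : Fin n) (v : Fin n → ℂ) :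
    pd 0 (fun u => p α u lam) v = ∑ ρ, X.η ρ 0 * wave X p lam α 0 v ρ := by
  have := congrFun (congrFun (jac_eq (X := X) (p := p) (lam := lam) v) 0) α
  rw [Matrix.mul_apply] at this
  refine this.trans (sum_congr rfl fun ρ _ => ?_)
  rw [X.symm.apply ρ 0, wave]

lemma iterate_Dx_pd_zero (c : Calibration X) (h : IsPeriodDomain X p lam D) (hO : IsOpen O)
    (hD : ∀ j ∈ O, j 0 ∈ D) (α : Fin n) (b : ℕ) : ∀ j ∈ O,
    Dx^[b] (fun y => pd 0 (fun u => p α u lam) (y 0)) j =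
      ∑ ρ, X.η ρ 0 * Dx^[b] (fun y => wave X p lam α 0 (y 0) ρ) j := by
  intro j hj
  have hw := fun ρ => (h.isWave c α).jetAnalyticOn hD 0 ρ
  simp only [pd_zero_eq (X := X)]
  refine (iterate_Dx_sum hO _ (fun ρ _ => (JetAnalyticOn.const _).mul (hw ρ)) b j hj).trans
    (sum_congr rfl fun ρ _ => ?_)
  exact iterate_Dx_const_mul hO _ (hw ρ) b j hj

lemma iterate_Dx_res (c : Calibration X) (h : IsPeriodDomain X p lam D) (hO : IsOpen O)
    (hD : ∀ j ∈ O, j 0 ∈ D) (γ : Fin n) (r : ℕ) : ∀ j ∈ O,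
    Dx^[r] (fun y => (X.U (y 0) - lam • (1 : Matrix (Fin n) (Fin n) ℂ))⁻¹ γ 0) j =
      ∑ α, ∑ β, gram X p (j 0) lam α β * ∑ ab ∈ antidiagonal r,
        (Nat.choose r ab.1 : ℂ) * (Dx^[ab.1] (fun y => wave X p lam α 0 (y 0) γ) j *
          Dx^[ab.2] (fun y => pd 0 (fun u => p β u lam) (y 0)) j) := by
  intro j hj
  have hw : ∀ α, JetAnalyticOn O fun y : Jet n => wave X p lam α 0 (y 0) γ := fun α =>
    (h.isWave c α).jetAnalyticOn hD 0 γ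
  have hp : ∀ β, JetAnalyticOn O fun y : Jet n => pd 0 (fun u => p β u lam) (y 0) := fun β =>
    .comp_base fun j hj => analyticAt_pd (h.analytic _ (hD j hj) β) 0
  have hm : ∀ α β, JetAnalyticOn O fun y : Jet n => wave X p lam α 0 (y 0) γ *
      pd 0 (fun u => p β u lam) (y 0) := fun α β => (hw α).mul (hp β)
  have h1 : ∀ y ∈ O, (X.U (y 0) - lam • (1 : Matrix (Fin n) (Fin n) ℂ))⁻¹ γ 0 =
      ∑ α, ∑ β, gram X p (j 0) lam α β * (wave X p lam α 0 (y 0) γ *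
        pd 0 (fun u => p β u lam) (y 0)) := by
    intro y hy
    rw [h.gram_const c (hD j hj) (hD y hy)]
    have h2 : ∑ ρ, X.η ρ 0 * -resX X lam (y 0) 0 0 γ ρ =
        (X.U (y 0) - lam • (1 : Matrix (Fin n) (Fin n) ℂ))⁻¹ γ 0 := by
      have h3 : (lam • 1 - X.U (y 0))⁻¹ γ 0 = (resX X lam (y 0) 0 0 * X.η) γ 0 := by
        simp [resX, toTensor, resTensor, Matrix.mul_assoc, X.inv_mul_eta]
      rw [← neg_sub, inv_neg_matrix, Matrix.neg_apply, h3, Matrix.mul_apply,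
        ← sum_neg_distrib]
      exact sum_congr rfl fun ρ _ => by ring
    rw [← h2]
    simp only [← h.sum_gram_wave c (hD y hy), pd_zero_eq (X := X), mul_sum]
    rw [sum_comm]
    refine sum_congr rfl fun α _ => ?_
    rw [sum_comm]
    exact sum_congr rfl fun β _ => sum_congr rfl fun ρ _ => by ring
  rw [iterate_Dx_congr hO h1 r j hj]
  refine (iterate_Dx_sum hO _ (fun α _ => .sum _ fun β _ => (JetAnalyticOn.const _).mul (hm α β))
    r j hj).trans (sum_congr rfl fun α _ => ?_)
  refine (iterate_Dx_sum hO _ (fun β _ => (JetAnalyticOn.const _).mul (hm α β))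
    r j hj).trans (sum_congr rfl fun β _ => ?_)
  exact (iterate_Dx_const_mul hO _ (hm α β) r j hj).trans
    (congrArg _ (iterate_Dx_mul hO (hw α) (hp β) r j hj))

lemma sum_yCoeff (r : ℕ) (f g : ℕ → ℂ) :
    ∑ ab ∈ antidiagonal r, (Nat.choose r (ab.2 + 1) : ℂ) * (f ab.1 * g ab.2) =
      ∑ k ∈ Finset.Icc 1 r, (Nat.choose r k : ℂ) * (f (r - k + 1) * g (k - 1)) := by
  symm
  refine Finset.sum_of_injOn (fun k => (r - k + 1, k - 1)) (fun a ha b hb hab => ?_) (fun k hk => ?_)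
    (fun ab hab hn => ?_) (fun k hk => ?_)
  · have ha := mem_Icc.1 (Finset.mem_coe.1 ha)
    have hb := mem_Icc.1 (Finset.mem_coe.1 hb)
    have := congrArg Prod.snd hab
    simp only at this
    omega
  · have hk := mem_Icc.1 (Finset.mem_coe.1 hk)
    exact Finset.mem_coe.2 (mem_antidiagonal.2 (by simp only; omega))
  · have hab := mem_antidiagonal.1 hab
    have : ab.2 = r := by
      by_contra hne
      refine hn ⟨ab.2 + 1, Finset.mem_coe.2 (mem_Icc.2 (by omega)), Prod.ext ?_ ?_⟩ <;>
        simp only <;> omega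
    rw [this, Nat.choose_succ_self]
    simp
  · have hk := mem_Icc.1 hk
    simp only [Nat.sub_add_cancel hk.1]

lemma ev_yForm_resX (c : Calibration X) (h : IsPeriodDomain X p lam D) (hO : IsOpen O)
    (hD : ∀ j ∈ O, j 0 ∈ D) {r K : ℕ} (hr : r < K) (γ : Fin n) : ∀ j ∈ O,
    Dx^[r] (fun y => (X.U (y 0) - lam • (1 : Matrix (Fin n) (Fin n) ℂ))⁻¹ γ 0) j +
      ∑ k ∈ Finset.Icc 1 r, (Nat.choose r k : ℂ) * ∑ α, ∑ β,
        Dx^[k - 1] (fun y => pd 0 (fun u => p α u lam) (y 0)) j * gram X p (j 0) lam α β *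
          Dx^[r - k + 1] (gradP X p lam β γ) j =
      -Form.ev K (yForm X r γ) (resX X lam (j 0)) j := by
  intro j hj
  have hM : ∀ j ∈ O, j 0 ∈ X.M := fun j hj => h.mem _ (hD j hj)
  rw [h.ev_resX c (hD j hj), h.iterate_Dx_res c hO hD γ r j hj]
  have hgs : ∀ α β, gram X p (j 0) lam β α = gram X p (j 0) lam α β := fun α β =>
    congrFun (congrFun (h.gram_symm (hD j hj)) α) β
  have hswap : ∑ k ∈ Finset.Icc 1 r, (Nat.choose r k : ℂ) * ∑ α, ∑ β,
        Dx^[k - 1] (fun y => pd 0 (fun u => p α u lam) (y 0)) j * gram X p (j 0) lam α β *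
          Dx^[r - k + 1] (gradP X p lam β γ) j =
      ∑ α, ∑ β, gram X p (j 0) lam α β * ∑ k ∈ Finset.Icc 1 r, (Nat.choose r k : ℂ) *
        (Dx^[r - k + 1] (fun y => wave X p lam α 0 (y 0) γ) j *
          Dx^[k - 1] (fun y => pd 0 (fun u => p β u lam) (y 0)) j) := by
    simp only [mul_sum]
    rw [sum_comm]
    rw [sum_congr rfl fun α _ => sum_comm, sum_comm]
    refine sum_congr rfl fun β _ => sum_congr rfl fun α _ =>
      sum_congr rfl fun k _ => ?_
    rw [hgs α β]
    change _ * (_ * Dx^[r - k + 1] (fun y => wave X p lam β 0 (y 0) γ) j) = _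
    ring
  rw [hswap, ← sum_add_distrib]
  refine sum_congr rfl fun α _ => ?_
  rw [← sum_add_distrib]
  refine sum_congr rfl fun β _ => ?_
  have hev := ev_yForm (h.isWave c α) (h.isWave c β) hO hM hD hr γ hj
  refine Eq.trans ?_ (congrArg (gram X p (j 0) lam α β * ·) hev).symm
  rw [← mul_add, ← sum_yCoeff r (fun a => Dx^[a] (fun y => wave X p lam α 0 (y 0) γ) j)
    (fun b => Dx^[b] (fun y => pd 0 (fun u => p β u lam) (y 0)) j), ← sum_add_distrib]
  refine congrArg _ (sum_congr rfl fun ab _ => ?_)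
  rw [h.iterate_Dx_pd_zero c hO hD β ab.2 j hj, yCoeff, add_mul]
  rfl

lemma loopLHS_eq (c : Calibration X) (h : IsPeriodDomain X p lam D) (hO : IsOpen O)
    (hD : ∀ j ∈ O, j 0 ∈ D) {N K : ℕ} (hK : N < K) {Φ : Jet n → ℂ} {j : Jet n} (hj : j ∈ O)
    (hΦ : JetAnalyticAt N Φ j) :
    loopLHS X p lam Φ j = -Form.ev K (lhsForm X N Φ) (resX X lam (j 0)) j := by
  rw [loopLHS, hΦ.finsum_eq, ev_lhsForm, ← sum_neg_distrib]
  refine sum_congr rfl fun r hr => ?_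
  rw [← sum_neg_distrib]
  refine sum_congr rfl fun γ _ => ?_
  have := mem_range.1 hr
  rw [h.ev_yForm_resX c hO hD (K := K) (by omega) γ j hj, mul_neg]

lemma loopQuad_eq (c : Calibration X) (h : IsPeriodDomain X p lam D) (hO : IsOpen O)
    (hD : ∀ j ∈ O, j 0 ∈ D) {N K : ℕ} (hK : N + 1 < K) {Ψ : Fin n → ℕ → Fin n → ℕ → Jet n → ℂ}
    {j : Jet n} (hj : j ∈ O) (hΨ : ∀ γ k ρ l, N < k ∨ N < l → Ψ γ k ρ l j = 0) :
    loopQuad X p lam (fun γ k ρ l => Ψ γ k ρ l j) j =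
      -Form.ev K (quadForm X N Ψ) (resX X lam (j 0)) j := by
  have hM : ∀ j ∈ O, j 0 ∈ X.M := fun j hj => h.mem _ (hD j hj)
  rw [loopQuad, finsum_eq_sum_of_support_subset (s := Finset.range (N + 1) ×ˢ Finset.range (N + 1)),
    Finset.sum_product, ev_quadForm, ← sum_neg_distrib]
  · refine sum_congr rfl fun r hr => ?_
    rw [← sum_neg_distrib]
    refine sum_congr rfl fun s hs => ?_
    rw [← sum_neg_distrib]
    refine sum_congr rfl fun γ _ => ?_
    rw [← sum_neg_distrib]
    refine sum_congr rfl fun ρ _ => ?_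
    have hr := mem_range.1 hr
    have hs := mem_range.1 hs
    rw [← mul_neg, h.ev_resX c (hD j hj)]
    refine congrArg _ (sum_congr rfl fun α _ => sum_congr rfl fun β _ => ?_)
    have := ev_bForm (h.isWave c α) (h.isWave c β) hO hM hD (K := K) (a := r + 1) (b := s + 1)
      (by omega) (by omega) γ ρ hj
    refine Eq.trans ?_ (congrArg (gram X p (j 0) lam α β * ·) this).symm
    change _ = gram X p (j 0) lam α β *
      (Dx^[r + 1] (gradP X p lam α γ) j * Dx^[s + 1] (gradP X p lam β ρ) j)
    ring
  · intro x hx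
    by_contra hn
    refine hx (sum_eq_zero fun γ _ => sum_eq_zero fun ρ _ => ?_)
    rw [hΨ γ x.1 ρ x.2, zero_mul]
    simp only [Finset.coe_product, Finset.coe_range, Set.mem_prod, Set.mem_Iio] at hn
    omega

lemma gradDP_eq (c : Calibration X) (h : IsPeriodDomain X p lam D) {v : Fin n → ℂ} (hv : v ∈ D)
    (α : Fin n) : gradDP X p lam α v = -wave X p lam α 1 v := by
  funext γ
  have hpd : ∀ ε, pd ε (fun u => deriv (fun l => p α u l) lam) v =
      -pd 0 (pd ε fun u => p α u lam) v := by
    intro ε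
    have hA := analyticAt_pd (h.analytic v hv α) 0
    rw [pd_congr_nhds (g := fun u => -1 * pd 0 (fun u => p α u lam) u)
      (eventually_of_isOpen h.isOpen hv fun u hu => by rw [h.normalized u hu α]; ring) ε,
      pd_const_mul _ hA, pd_comm (h.analytic v hv α)]
    ring
  have h1 := congrFun (congrFun (h.pdM_periodMat c 0 0 v hv) γ) α
  rw [X.C_zero (h.mem v hv), Matrix.one_mul] at h1
  rw [Pi.neg_apply, wave, ← h1, gradDP, FrobeniusManifold.raise]
  simp only [hpd, mul_neg, sum_neg_distrib]
  congr 1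
  have hA := fun ε => analyticAt_pd (h.analytic v hv α) ε
  have e : pdM 0 (periodMat X p lam 0) v γ α = _ :=
    pd_sum (f := fun ε u => X.η⁻¹ γ ε * pd ε (fun u => p α u lam) u) Finset.univ
      (fun ε _ => analyticAt_const.fun_mul (hA ε)) 0
  rw [e]
  exact sum_congr rfl fun ε _ => (pd_const_mul _ (hA ε) 0).symm

lemma loopLin_eq (c : Calibration X) (h : IsPeriodDomain X p lam D) (hO : IsOpen O)
    (hD : ∀ j ∈ O, j 0 ∈ D) {N K : ℕ} (hK : N + 2 < K) {Φ : Jet n → ℂ} {j : Jet n} (hj : j ∈ O)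
    (hΦ : JetAnalyticAt N Φ j) :
    loopLin X p lam Φ j = -Form.ev K (linForm X N Φ) (resX X lam (j 0)) j := by
  have hM : ∀ j ∈ O, j 0 ∈ X.M := fun j hj => h.mem _ (hD j hj)
  have hneg : ∀ (x v : Fin n → ℂ), X.mulBy (-x) v = -X.mulBy x v := by
    intro x v; simp [FrobeniusManifold.mulBy]
  rw [loopLin, hΦ.finsum_eq, ev_linForm, ← sum_neg_distrib]
  refine sum_congr rfl fun r hr => ?_
  rw [← sum_neg_distrib]
  refine sum_congr rfl fun γ _ => ?_
  have hr := mem_range.1 hr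
  rw [← mul_neg, h.ev_resX c (hD j hj)]
  refine congrArg _ (sum_congr rfl fun α _ => sum_congr rfl fun β _ => ?_)
  have := ev_lForm (h.isWave c α) (h.isWave c β) hO hM hD (K := K) (k := r) (by omega) γ hj
  refine Eq.trans ?_ (congrArg (gram X p (j 0) lam α β * ·) this).symm
  rw [mul_comm]
  refine congrArg _ (iterate_Dx_congr hO (fun y hy => ?_) (r + 1) j hj)
  rw [h.gradDP_eq c (hD y hy), h.gradDP_eq c (hD y hy), hneg, hneg, neg_mul_neg]
  rfl

/-- The loop equation in terms of the resolvent. -/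
lemma loopEquation_iff (c : Calibration X) (h : IsPeriodDomain X p lam D) (hO : IsOpen O)
    (hD : ∀ j ∈ O, j 0 ∈ D) {F : ℕ → Jet n → ℂ} {g N : ℕ} (hg : 0 < g)
    (hN : ∀ j ∈ O, ∀ h, 0 < h → h ≤ g → JetAnalyticAt N (F h) j) {j : Jet n} (hj : j ∈ O) :
    (loopLHS X p lam (F g) j = (if g = 1 then loopConst X lam (j 0)
      else (1 / 2) * loopQuad X p lam (fun γ k ρ l => jd γ k (jd ρ l (F (g - 1))) j +
          ∑ h ∈ Finset.Icc 1 (g - 1), jd γ k (F h) j * jd ρ l (F (g - h)) j) j +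
        (1 / 2) * loopLin X p lam (F (g - 1)) j)) ↔
    Form.ev (N + 3) (lhsForm X N (F g)) (resX X lam (j 0)) j =
      if g = 1 then -loopConst X lam (j 0)
      else Form.ev (N + 3) (rhsForm X N F g) (resX X lam (j 0)) j := by
  rw [h.loopLHS_eq c hO hD (K := N + 3) (by omega) hj (hN j hj g hg le_rfl)]
  split_ifs with h1
  · exact neg_eq_iff_eq_neg
  · have hq : loopQuad X p lam (fun γ k ρ l => jd γ k (jd ρ l (F (g - 1))) j +
        ∑ h ∈ Finset.Icc 1 (g - 1), jd γ k (F h) j * jd ρ l (F (g - h)) j) j =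
        -Form.ev (N + 3) (quadForm X N (genusQuad F g)) (resX X lam (j 0)) j := by
      refine h.loopQuad_eq c hO hD (Ψ := genusQuad F g) (by omega) hj fun γ k ρ l hkl => ?_
      unfold genusQuad
      rcases hkl with hk | hl
      · rw [((hN j hj (g - 1) (by omega) (by omega)).jd ρ l).jd_eq_zero γ hk, zero_add]
        refine sum_eq_zero fun i hi => ?_
        have hi := mem_Icc.1 hi
        rw [(hN j hj i (by omega) (by omega)).jd_eq_zero γ hk, zero_mul]
      · rw [jd_congr hO (fun j hj => (hN j hj (g - 1) (by omega) (by omega)).jd_eq_zero ρ hl) γ k j hj,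
          jd_const, zero_add]
        refine sum_eq_zero fun i hi => ?_
        have hi := mem_Icc.1 hi
        rw [(hN j hj (g - i) (by omega) (by omega)).jd_eq_zero ρ hl, mul_zero]
    rw [hq, h.loopLin_eq c hO hD (K := N + 3) (by omega) hj (hN j hj (g - 1) (by omega) (by omega))]
    unfold rhsForm
    rw [Form.ev_add_left, Form.ev_mul_left _ (fun _ => 1 / 2), Form.ev_mul_left _ (fun _ => 1 / 2)]
    constructor <;> intro h2 <;> linear_combination -h2

end IsPeriodDomain
end

/-! ### Existence and uniqueness of the solution of the loop equation -/

section

variable {n : ℕ}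

lemma RatAt.eq_zero_of_infinite {χ : Polynomial ℂ} {f : ℂ → ℂ} (hf : RatAt χ f)
    (h : {z | χ.eval z ≠ 0 ∧ f z = 0}.Infinite) : ∀ z, χ.eval z ≠ 0 → f z = 0 := by
  obtain ⟨⟨K, P, hP⟩, -⟩ := hf
  have hP0 : P = 0 := Polynomial.eq_zero_of_infinite_isRoot P (h.mono fun z hz => by
    rw [Set.mem_ofPred_eq, Polynomial.IsRoot, ← hP z hz.1, hz.2, zero_mul])
  intro z hz
  have := hP z hz
  rw [hP0, Polynomial.eval_zero] at this
  exact (mul_eq_zero.1 this).resolve_right (pow_ne_zero K hz)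

/-- A transformation of brackets depends only on the germs of the series. -/
lemma Transforms.congr {W W' : ℕ → Fin n → Jet n → ℂ} {B A : Bracket n} {j₀ : Jet n}
    (hT : Transforms W B A j₀) (h : ∀ k γ, ∀ᶠ j in 𝓝 j₀, W k γ j = W' k γ j) :
    Transforms W' B A j₀ := by
  intro m i i' N f hf
  have h1 : ∀ᶠ j in 𝓝 j₀, ∀ k ∈ Finset.range (m + 1), ∀ γ, W k γ j = W' k γ j := by
    rw [Filter.eventually_all_finset]
    exact fun k _ => Filter.eventually_all.2 (h k)
  obtain ⟨O, hsub, hO, hj⟩ := eventually_nhds_iff.1 h1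
  have hW : ∀ k, k ≤ m → ∀ γ, ∀ j ∈ O, W k γ j = W' k γ j := fun k hk γ j hj =>
    hsub j hj k (mem_range.2 (by omega)) γ
  filter_upwards [hT m i i' N f hf, hO.mem_nhds hj] with j hTj hjO
  have hL : ∀ ab ∈ antidiagonal m,
      (∑ᶠ s : ℕ, ∑ k, ∑ l, jd k s (W' ab.1 i) j *
        Dx^[s] (op B 0 k l (fun y => ∑ᶠ t : ℕ,
          (-1 : ℂ) ^ t * Dx^[t] (fun z => jd l t (W' ab.2 i') z * f z) y)) j) =
      ∑ᶠ s : ℕ, ∑ k, ∑ l, jd k s (W ab.1 i) j *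
        Dx^[s] (op B 0 k l (fun y => ∑ᶠ t : ℕ,
          (-1 : ℂ) ^ t * Dx^[t] (fun z => jd l t (W ab.2 i') z * f z) y)) j := by
    intro ab hab
    have hab := mem_antidiagonal.1 hab
    refine finsum_congr fun s => sum_congr rfl fun k _ => sum_congr rfl fun l _ => ?_
    rw [jd_congr hO (hW ab.1 (by omega) i) k s j hjO]
    refine congrArg _ (iterate_Dx_congr hO (fun y hy => sum_congr rfl fun q _ => ?_) s j hjO)
    refine congrArg _ (iterate_Dx_congr hO (fun y hy => finsum_congr fun t => ?_) _ y hy)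
    refine congrArg _ (iterate_Dx_congr hO (fun z hz => ?_) t y hy)
    rw [jd_congr hO (hW ab.2 (by omega) i') l t z hz]
  have hR : ∀ ab ∈ antidiagonal m, ∀ Φ,
      compCoeff W' Φ ab.2 j = compCoeff W Φ ab.2 j := by
    intro ab hab Φ
    have hab := mem_antidiagonal.1 hab
    unfold compCoeff
    have e : (fun ε : ℂ => Φ fun r γ => ∑ k ∈ Finset.range (ab.2 + 1), ε ^ k * Dx^[r] (W' k γ) j) =
        fun ε : ℂ => Φ fun r γ => ∑ k ∈ Finset.range (ab.2 + 1), ε ^ k * Dx^[r] (W k γ) j := by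
      funext ε
      refine congrArg Φ (funext fun r => funext fun γ => sum_congr rfl fun k hk => ?_)
      have := mem_range.1 hk
      rw [iterate_Dx_congr hO (hW k (by omega) γ) r j hjO]
    rw [e]
  rw [sum_congr rfl hL, hTj]
  exact sum_congr rfl fun ab hab => sum_congr rfl fun s _ => by rw [hR ab hab]

end

section

variable {n : ℕ} [NeZero n] {X : FrobeniusManifold n} {j₀ : Jet n}

namespace Calibration

variable (c : Calibration X)

lemma eventually_loop_resX {F : ℕ → Jet n → ℂ} (hX : X.Semisimple) (hj₀ : j₀ 0 ∈ X.M)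
    (hF : ∀ k, 0 < k → ∃ N, JetAnalyticAt N (F k) j₀) (hlin : c.LinearizesVirasoro F j₀) {g : ℕ}
    (hg : 0 < g) : ∃ N, (∀ᶠ j in 𝓝 j₀, ∀ h, 0 < h → h ≤ g → JetAnalyticAt N (F (2 * h)) j) ∧
      ∀ᶠ j in 𝓝 j₀, ∀ lam, (lam • 1 - X.U (j 0)).det ≠ 0 →
        Form.ev (N + 3) (lhsForm X N (F (2 * g))) (resX X lam (j 0)) j =
          if g = 1 then -loopConst X lam (j 0)
          else Form.ev (N + 3) (rhsForm X N (fun g => F (2 * g)) g) (resX X lam (j 0)) j := by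
  rcases Nat.eq_or_lt_of_le hg with rfl | hg
  · obtain ⟨N, hN, heq⟩ := c.eventually_genus_one hX hj₀ hF hlin
    refine ⟨N, hN.mono fun j hj h h0 h1 => ?_, by simpa using heq⟩
    obtain rfl : h = 1 := by omega
    exact hj
  · obtain ⟨N, hN, heq⟩ := c.eventually_genus_eq hX hj₀ hF hlin (g := g) (by omega)
    exact ⟨N, hN, by simpa only [if_neg (show g ≠ 1 by omega)] using heq⟩

/-- The functions of a quasitriviality that linearizes the Virasoro symmetries satisfy the loop
equation. -/
theorem loopEquation {F : ℕ → Jet n → ℂ} (hX : X.Semisimple) (hj₀ : j₀ 0 ∈ X.M)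
    (hF : ∀ k, 0 < k → ∃ N, JetAnalyticAt N (F k) j₀) (hlin : c.LinearizesVirasoro F j₀)
    {p : Fin n → (Fin n → ℂ) → ℂ → ℂ} {lam₀ : ℂ} (hp : IsPeriodSystem X p (j₀ 0) lam₀) :
    LoopEquation X p lam₀ j₀ fun g => F (2 * g) := by
  intro g hg
  obtain ⟨ε, hε, hdom⟩ := hp.exists_domain hj₀
  obtain ⟨N, hN, heq⟩ := c.eventually_loop_resX hX hj₀ hF hlin hg
  have hball : ∀ᶠ j : Jet n in 𝓝 j₀, j 0 ∈ Metric.ball (j₀ 0) ε :=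
    (continuous_apply 0).continuousAt.eventually (Metric.ball_mem_nhds _ hε)
  obtain ⟨O, hsub, hO, hj⟩ := eventually_nhds_iff.1 (hN.and (heq.and hball))
  filter_upwards [prod_mem_nhds (hO.mem_nhds hj) (Metric.ball_mem_nhds lam₀ hε)] with x hx
  have hD := hdom x.2 hx.2
  have hOD : ∀ j ∈ O, j 0 ∈ Metric.ball (j₀ 0) ε := fun j hj => (hsub j hj).2.2
  exact (hD.loopEquation_iff c hO hOD hg (F := fun g => F (2 * g))
    (fun j hj => (hsub j hj).1) hx.1).2
    ((hsub x.1 hx.1).2.1 x.2 (hD.regular _ (hOD x.1 hx.1)))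

/-- Two solutions of the loop equation have the same derivatives. -/
lemma eventually_jd_eq_of_loopEquation (c : Calibration X) {F F' : ℕ → Jet n → ℂ} (hX : X.Semisimple) (hj₀ : j₀ 0 ∈ X.M)
    (hF : ∀ k, 0 < k → ∃ N, JetAnalyticAt N (F k) j₀)
    (hF' : ∀ k, 0 < k → ∃ N, JetAnalyticAt N (F' k) j₀)
    {p : Fin n → (Fin n → ℂ) → ℂ → ℂ} {lam₀ : ℂ} (hp : IsPeriodSystem X p (j₀ 0) lam₀)
    (hL : LoopEquation X p lam₀ j₀ F) (hL' : LoopEquation X p lam₀ j₀ F') (g : ℕ) (hg : 0 < g) :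
    ∀ᶠ j in 𝓝 j₀, ∀ γ r, jd γ r (fun j => F' g j + -1 * F g j) j = 0 := by
  induction g using Nat.strong_induction_on with
  | _ g ih =>
  obtain ⟨ε, hε, hdom⟩ := hp.exists_domain hj₀
  obtain ⟨N₁, hN₁⟩ := exists_nhd_order hj₀ hF g
  obtain ⟨N₂, hN₂⟩ := exists_nhd_order hj₀ hF' g
  set N := max N₁ N₂
  have hball : ∀ᶠ j : Jet n in 𝓝 j₀, j 0 ∈ Metric.ball (j₀ 0) ε :=
    (continuous_apply 0).continuousAt.eventually (Metric.ball_mem_nhds _ hε)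
  have hlow : ∀ᶠ j in 𝓝 j₀, ∀ h ∈ Finset.range g, 0 < h →
      ∀ γ r, jd γ r (fun j => F' h j + -1 * F h j) j = 0 := by
    rw [Filter.eventually_all_finset]
    intro h hh
    rcases Nat.eq_zero_or_pos h with rfl | h0
    · simp
    · exact (ih h (mem_range.1 hh) h0).mono fun j hj _ => hj
  obtain ⟨u, hu, w, hw, huw⟩ := mem_nhds_prod_iff.1 ((hL g hg).and (hL' g hg))
  obtain ⟨O, hsub, hO, hj⟩ := eventually_nhds_iff.1 (hN₁.and (hN₂.and (hball.and
    (hlow.and (show ∀ᶠ j in 𝓝 j₀, j ∈ u from hu)))))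
  have hM : ∀ j ∈ O, j 0 ∈ X.M := fun j hj => (hsub j hj).1.1
  have hA : ∀ j ∈ O, ∀ h, 0 < h → h ≤ g → JetAnalyticAt N (F h) j := fun j hj h h0 hh =>
    ((hsub j hj).1.2 h h0 hh).mono (le_max_left _ _)
  have hA' : ∀ j ∈ O, ∀ h, 0 < h → h ≤ g → JetAnalyticAt N (F' h) j := fun j hj h h0 hh =>
    ((hsub j hj).2.1.2 h h0 hh).mono (le_max_right _ _)
  have hOD : ∀ j ∈ O, j 0 ∈ Metric.ball (j₀ 0) ε := fun j hj => (hsub j hj).2.2.1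
  have hjd : ∀ j ∈ O, ∀ h, 0 < h → h ≤ g → ∀ γ r, jd γ r (fun j => F' h j + -1 * F h j) j =
      jd γ r (F' h) j + -1 * jd γ r (F h) j := by
    intro j hj h h0 hh γ r
    rw [jd_add ⟨N, hA' j hj h h0 hh⟩ ⟨N, (JetAnalyticAt.const N (-1) j).mul (hA j hj h h0 hh)⟩,
      jd_mul ⟨N, .const N (-1) j⟩ ⟨N, hA j hj h h0 hh⟩, jd_const]
    ring
  have heq : ∀ j ∈ O, ∀ h, 0 < h → h < g → ∀ γ r, jd γ r (F' h) j = jd γ r (F h) j := by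
    intro j hj h h0 hh γ r
    have h1 := hjd j hj h h0 hh.le γ r
    rw [(hsub j hj).2.2.2.1 h (mem_range.2 hh) h0 γ r] at h1
    linear_combination -h1
  have hrhs : ∀ j ∈ O, g ≠ 1 → ∀ T, Form.ev (N + 3) (rhsForm X N F' g) T j =
      Form.ev (N + 3) (rhsForm X N F g) T j := by
    intro j hj hg1 T
    unfold rhsForm
    rw [Form.ev_add_left, Form.ev_mul_left _ (fun _ => 1 / 2), Form.ev_mul_left _ (fun _ => 1 / 2),
      Form.ev_add_left, Form.ev_mul_left _ (fun _ => 1 / 2), Form.ev_mul_left _ (fun _ => 1 / 2),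
      ev_quadForm, ev_quadForm, ev_linForm, ev_linForm]
    have hq : ∀ γ k ρ l, genusQuad F' g γ k ρ l j = genusQuad F g γ k ρ l j := by
      intro γ k ρ l
      unfold genusQuad
      rw [jd_congr hO (fun j hj => heq j hj (g - 1) (by omega) (by omega) ρ l) γ k j hj]
      refine congrArg _ (sum_congr rfl fun h hh => ?_)
      have hh := mem_Icc.1 hh
      rw [heq j hj h (by omega) (by omega), heq j hj (g - h) (by omega) (by omega)]
    simp only [hq, heq j hj (g - 1) (by omega) (by omega)]
  refine eventually_of_isOpen hO hj (jd_eq_zero_of_lhsForm hX c hO hM (N := N) (K := N + 3)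
    (fun j hj => (hA' j hj g hg le_rfl).add
      ((JetAnalyticAt.const N (-1) j).mul (hA j hj g hg le_rfl))) (by omega) fun j hj lam hlam => ?_)
  have hsm : ∀ z : ℂ, (X.U (j 0)).charpoly.eval z = (z • 1 - X.U (j 0)).det := by
    intro z; rw [Matrix.eval_charpoly, Matrix.smul_one_eq_diagonal]; rfl
  refine RatAt.eq_zero_of_infinite (ratAt_ev (X := X) (N + 3) _ j (j 0)) ?_ lam (by rwa [hsm])
  refine (infinite_of_mem_nhds lam₀ (Filter.inter_mem hw (Metric.ball_mem_nhds lam₀ hε))).mono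
    fun z hz => ?_
  have hD := hdom z hz.2
  refine ⟨by rw [hsm]; exact hD.regular _ (hOD j hj), ?_⟩
  obtain ⟨e, e'⟩ := huw (Set.mk_mem_prod (hsub j hj).2.2.2.2 hz.1)
  have e := (hD.loopEquation_iff c hO hOD hg hA hj).1 e
  have e' := (hD.loopEquation_iff c hO hOD hg hA' hj).1 e'
  have hsplit : Form.ev (N + 3) (lhsForm X N fun j => F' g j + -1 * F g j) (resX X z (j 0)) j =
      Form.ev (N + 3) (lhsForm X N (F' g)) (resX X z (j 0)) j -
        Form.ev (N + 3) (lhsForm X N (F g)) (resX X z (j 0)) j := by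
    simp only [ev_lhsForm, hjd j hj g hg le_rfl, ← Finset.sum_sub_distrib]
    exact sum_congr rfl fun r _ => sum_congr rfl fun γ _ => by ring
  rw [hsplit, e, e']
  split_ifs with h1
  · ring
  · rw [hrhs j hj h1, sub_self]

theorem loopEquation_unique (c : Calibration X) {F F' : ℕ → Jet n → ℂ} (hX : X.Semisimple) (hj₀ : j₀ 0 ∈ X.M)
    (hF : ∀ k, 0 < k → ∃ N, JetAnalyticAt N (F k) j₀)
    (hF' : ∀ k, 0 < k → ∃ N, JetAnalyticAt N (F' k) j₀)
    {p : Fin n → (Fin n → ℂ) → ℂ → ℂ} {lam₀ : ℂ} (hp : IsPeriodSystem X p (j₀ 0) lam₀)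
    (hL : LoopEquation X p lam₀ j₀ F) (hL' : LoopEquation X p lam₀ j₀ F') (g : ℕ) (hg : 0 < g) :
    ∃ a : ℂ, ∀ᶠ j in 𝓝 j₀, F' g j = F g j + a := by
  obtain ⟨N₁, h₁⟩ := hF g hg
  obtain ⟨N₂, h₂⟩ := hF' g hg
  have hA : JetAnalyticAt (max N₁ N₂) (fun j => F' g j + -1 * F g j) j₀ :=
    (h₂.mono (le_max_right _ _)).add ((JetAnalyticAt.const _ (-1) j₀).mul (h₁.mono (le_max_left _ _)))
  obtain ⟨a, ha⟩ := hA.eventually_const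
    (c.eventually_jd_eq_of_loopEquation hX hj₀ hF hF' hp hL hL' g hg)
  exact ⟨a, ha.mono fun j hj => by linear_combination hj⟩

/-- The quasitriviality has a genus expansion. -/
lemma eventually_eq_genusExpansion {F : ℕ → Jet n → ℂ} {W : ℕ → Fin n → Jet n → ℂ}
    (hX : X.Semisimple) (hj₀ : j₀ 0 ∈ X.M)
    (hF : ∀ k, 0 < k → ∃ N, JetAnalyticAt N (F k) j₀) (hlin : c.LinearizesVirasoro F j₀)
    (hW₀ : ∀ γ, ∀ᶠ j in 𝓝 j₀, W 0 γ j = j 0 γ)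
    (hW : ∀ k γ, 0 < k → ∀ᶠ j in 𝓝 j₀,
      W k γ j = X.raise (fun β => Dx (c.Dt (β, 0) (F k)) j) γ) (k : ℕ) (γ : Fin n) :
    ∀ᶠ j in 𝓝 j₀, W k γ j = c.genusExpansion (fun g => F (2 * g)) k γ j := by
  rcases Nat.eq_zero_or_pos k with rfl | hk
  · filter_upwards [hW₀ γ] with j hj
    rw [hj, genusExpansion, if_pos rfl]
  · rcases Nat.even_or_odd k with he | ho
    · filter_upwards [hW k γ hk] with j hj
      rw [hj, genusExpansion, if_neg hk.ne', if_pos he, Nat.mul_div_cancel' he.two_dvd]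
    · obtain ⟨O, hsub, hO, hjO⟩ := eventually_nhds_iff.1 (c.eventually_jd_odd hX hj₀ hF hlin ho)
      filter_upwards [hW k γ hk, hO.mem_nhds hjO] with j hj hmem
      rw [hj, genusExpansion, if_neg hk.ne', if_neg (Nat.not_even_iff_odd.2 ho)]
      have h0 : ∀ β, Dx (c.Dt (β, 0) (F k)) j = 0 := by
        intro β
        rw [Dx_congr hO (Ψ := fun _ => 0) (fun j hj => c.Dt_eq_zero (hsub j hj) (β, 0)) j hmem]
        simp [Dx, jd_const]
      simp [FrobeniusManifold.raise, h0]

end Calibration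
end

end LoopEq

end

theorem mainTheorem1 {n : ℕ} [NeZero n] (X : FrobeniusManifold n) (hX : X.Semisimple)
    (c : Calibration X) (A₁ A₂ : Bracket n) (hA : IsPoissonPencil X.M A₁ A₂)
    (hlead : HasLeadingTerm X A₁ A₂)
    (h : Fin n → ℕ → ℕ → Jet n → ℂ) (htau : IsTauStructure X A₁ A₂ h) (hnormal : IsNormal X h)
    (j₀ : Jet n) (hj₀ : j₀ 0 ∈ X.M)
    (W : ℕ → Fin n → Jet n → ℂ) (hW : IsQuasiMiura X.M W j₀)
    (hW₁ : Transforms W (bracket₁ X) A₁ j₀) (hW₂ : Transforms W (bracket₂ X) A₂ j₀)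
    (hlin : c.LinearizationAxiom W j₀) :
    ∃ F : ℕ → Jet n → ℂ,
      (∀ g, 0 < g → JetAnalyticAt (3 * g - 2) (F g) j₀) ∧
      (∀ k γ, ∀ᶠ j in nhds j₀, W k γ j = c.genusExpansion F k γ j) ∧
      Transforms (c.genusExpansion F) (bracket₁ X) A₁ j₀ ∧
      Transforms (c.genusExpansion F) (bracket₂ X) A₂ j₀ ∧
      ∀ (lam₀ : ℂ) (p : Fin n → (Fin n → ℂ) → ℂ → ℂ), IsPeriodSystem X p (j₀ 0) lam₀ →
        LoopEquation X p lam₀ j₀ F ∧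
        ∀ F' : ℕ → Jet n → ℂ, (∀ g, 0 < g → ∃ N, JetAnalyticAt N (F' g) j₀) →
          LoopEquation X p lam₀ j₀ F' →
          ∀ g, 0 < g → ∃ a : ℂ, ∀ᶠ j in nhds j₀, F' g j = F g j + a := by
  obtain ⟨F, hF, hWF, hlin⟩ := hlin
  have hW' := c.eventually_eq_genusExpansion hX hj₀ hF hlin hW.zero hWF
  refine ⟨fun g => F (2 * g), fun g hg => c.jetAnalyticAt_genus hX hj₀ hF hlin hg, hW',
    hW₁.congr hW', hW₂.congr hW', fun lam₀ p hp => ?_⟩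
  have hL := c.loopEquation hX hj₀ hF hlin hp
  exact ⟨hL, fun F' hF' hL' => c.loopEquation_unique hX hj₀ (fun g hg => hF (2 * g) (by omega)) hF' hp
    hL hL'⟩
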